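/- Let $G$ be a connected Lie group with Lie algebra $\mathfrak g$, and let $\pi\colon P\to X$ be a smooth principal bundle with structure group $G$ (right action $P\times G\to P$), where $P$ and $X$ are smooth manifolds (finite-dimensional, Hausdorff, second countable). **$\mathbf{Loc}_\infty(X)$.** For a $\mathbb Z$-graded real vector bundle $E=\bigoplus_k E^k$ of finite rank on $X$, grade $\Omega^\bullet(X,E)=\Gamma(\Lambda^\bullet T^*X\otimes E)$ by total degree. A *superconnection* on $E$ is a linear operator $D$ of degree $1$ on $\Omega^\bullet(X,E)$ with $D(\sigma\wedge\eta)=d\sigma\wedge\eta+(-1)^k\sigma\wedge D\eta$ for $\sigma\in\Omega^k(X)$; it is *flat* if $D^2=0$. Objects of $\mathbf{Loc}_\infty(X)$ are pairs $(E,D)$ with $D$ a flat superconnection. The morphism complex from $(E,D)$ to $(E',D')$ is the graded space $\Omega^\bullet(X,\operatorname{Hom}(E,E'))$ with differential $\partial_{D,D'}\omega=D'\wedge\omega-(-1)^k\omega\wedge D$ for $\omega$ of degree $k$, i.e. $(\partial_{D,D'}\omega)\wedge\eta=D'(\omega\wedge\eta)-(-1)^k\omega\wedge D\eta$ for all $\eta\in\Omega^\bullet(X,E)$.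 Composition is the wedge product combined with composition of homomorphisms, with the Koszul sign rule. **$[\mathbf{Loc}_\infty(P)]_{\rm bas}$.** Let $E$ be a graded $G$-equivariant vector bundle on $P$ (a smooth right action of $G$ on $E$ covering the action on $P$, linear on fibres and preserving the grading). Let $G$ act on $\Omega^\bullet(P,E)$ by $(g\cdot\varphi)_p(v_1,\dots,v_r)=\varphi_{p\cdot g}(d\sigma_g v_1,\dots,d\sigma_g v_r)\cdot g^{-1}$, where $\sigma_g(p)=p\cdot g$. For $x\in\mathfrak g$ let $L_x^E$ be the corresponding infinitesimal action and $i_x^E$ the contraction with the fundamental vector field of $x$. A form $\varphi$ is *basic* if $i_x^E\varphi=0$ and $L_x^E\varphi=0$ for all $x\in\mathfrak g$. A superconnection $D$ on $E$ is *basic* if it is $G$-equivariant and $[D,i_x^E]=L_x^E$ for all $x\in\mathfrak g$. Objects of $[\mathbf{Loc}_\infty(P)]_{\rm bas}$ are pairs $(E,D)$ of a graded $G$-equivariant vector bundle with a flat basic superconnection. Morphisms from $(E,D)$ to $(E',D')$ are the basic forms $\Omega^\bullet_{\rm bas}(P,\operatorname{Hom}(E,E'))$, with the differential $\partial_{D,D'}$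 and composition as above. **Proposition.** $\mathbf{Loc}_\infty(X)$ and $[\mathbf{Loc}_\infty(P)]_{\rm bas}$ are well-defined DG categories. For every $(\bar E,\bar D)$ in $\mathbf{Loc}_\infty(X)$ there is a unique superconnection $\pi^*\bar D$ on $\pi^*\bar E$ with $(\pi^*\bar D)(\pi^*\eta)=\pi^*(\bar D\eta)$ for all $\eta\in\Omega^\bullet(X,\bar E)$; it is flat and basic for the canonical action of $G$ on $\pi^*\bar E$. Pullback of bundles, superconnections and $\operatorname{Hom}$-valued forms is a DG functor $$\pi^*\colon \mathbf{Loc}_\infty(X)\longrightarrow[\mathbf{Loc}_\infty(P)]_{\rm bas},$$ and this functor is a quasi-equivalence: it induces isomorphisms on the cohomology of all morphism complexes, and it is essentially surjective on homotopy categories. In fact, it is an isomorphism on morphism complexes, and every object of $[\mathbf{Loc}_\infty(P)]_{\rm bas}$ is isomorphic, by a closed isomorphism of degree $0$, to some $\pi^*(\bar E,\bar D)$. -/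

import Mathlib

open Bundle
open scoped Manifold ContDiff

universe v u w u' w'

noncomputable section

namespace ChernWeil

set_option linter.unusedSectionVars false
set_option linter.checkUnivs false

/-! ## Multilinear algebra on a finite-dimensional space -/

section Multilinear

variable {V : Type*} [AddCommGroup V] [Module ℝ V] [TopologicalSpace V] [IsTopologicalAddGroup V]
  [ContinuousSMul ℝ V] [T2Space V] [FiniteDimensional ℝ V]
  {N : Type*} [AddCommGroup N] [Module ℝ N] [TopologicalSpace N] [IsTopologicalAddGroup N]
  [ContinuousSMul ℝ N]
  {N₁ : Type*} [AddCommGroup N₁] [Module ℝ N₁] [TopologicalSpace N₁]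
  {N₂ : Type*} [AddCommGroup N₂] [Module ℝ N₂] [TopologicalSpace N₂]

/-- Multilinear maps out of a finite-dimensional space are continuous. -/
theorem continuous_multilinear {n : ℕ} (f : MultilinearMap ℝ (fun _ : Fin n => V) N) :
    Continuous f := by
  let b := Module.finBasis ℝ V
  have h : (f : (Fin n → V) → N) = fun v =>
      ∑ r : Fin n → Fin (Module.finrank ℝ V),
        (∏ i, b.coord (r i) (v i)) • f (fun i => b (r i)) := by
    funext v
    conv_lhs => rw [show v = fun i => ∑ j, b.coord j (v i) • b j from
      funext fun i => by simp [b.sum_repr]]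
    rw [f.map_sum]
    exact Finset.sum_congr rfl fun r _ => f.map_smul_univ _ _
  rw [h]
  refine continuous_finsetSum _ fun r _ => Continuous.smul ?_ continuous_const
  refine continuous_finsetProd _ fun i _ => ?_
  exact (LinearMap.continuous_of_finiteDimensional (b.coord (r i))).comp (continuous_apply i)

/-- An alternating map on a finite-dimensional space, as a continuous alternating map. -/
def toContAlt {n : ℕ} (f : V [⋀^Fin n]→ₗ[ℝ] N) : V [⋀^Fin n]→L[ℝ] N :=
  { f with cont := continuous_multilinear f.toMultilinearMap }

/-- The wedge product of alternating maps with values in `N₁` and `N₂`, where the values are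
multiplied with a bilinear map `B`. It is the sum over all shuffles, so for `p = 0` or `r = 0` it is
the plain product, and `(α ∧ β)(v, w) = B (α v) (β w) - B (α w) (β v)` for `p = r = 1`. -/
def wedge (B : N₁ →ₗ[ℝ] N₂ →ₗ[ℝ] N) {p r n : ℕ} (h : p + r = n)
    (a : V [⋀^Fin p]→L[ℝ] N₁) (b : V [⋀^Fin r]→L[ℝ] N₂) : V [⋀^Fin n]→L[ℝ] N :=
  toContAlt (((TensorProduct.lift B).compAlternatingMap
    (a.toAlternatingMap.domCoprod b.toAlternatingMap)).domDomCongr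
      (finSumFinEquiv.trans (finCongr h)))

/-- Contraction `(ι_u a)(v₁, …, v_p) = a(u, v₁, …, v_p)`. -/
def contract {p : ℕ} (u : V) (a : V [⋀^Fin (p + 1)]→L[ℝ] N) : V [⋀^Fin p]→L[ℝ] N :=
  toContAlt (a.toAlternatingMap.curryLeft u)

end Multilinear

/-! ## Vector bundles and differential forms -/

/-- A smooth real vector bundle of finite rank over a manifold `X` modelled on `EX`. -/
structure VBundle (EX : Type*) [NormedAddCommGroup EX] [NormedSpace ℝ EX]
    (X : Type*) [TopologicalSpace X] [ChartedSpace EX X] where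
  /-- the typical fibre -/
  F : Type v
  [normedF : NormedAddCommGroup F]
  [spaceF : NormedSpace ℝ F]
  [finiteF : FiniteDimensional ℝ F]
  /-- the fibre over a point -/
  fib : X → Type v
  [addFib : ∀ x, AddCommGroup (fib x)]
  [moduleFib : ∀ x, Module ℝ (fib x)]
  [topFib : ∀ x, TopologicalSpace (fib x)]
  [topAddFib : ∀ x, IsTopologicalAddGroup (fib x)]
  [topSMulFib : ∀ x, ContinuousSMul ℝ (fib x)]
  [topTotal : TopologicalSpace (TotalSpace F fib)]
  [fiberBundle : FiberBundle F fib]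
  [vectorBundle : VectorBundle ℝ F fib]
  [smooth : ContMDiffVectorBundle ∞ F fib 𝓘(ℝ, EX)]

attribute [instance] VBundle.normedF VBundle.spaceF VBundle.finiteF VBundle.addFib
  VBundle.moduleFib VBundle.topFib VBundle.topAddFib VBundle.topSMulFib VBundle.topTotal
  VBundle.fiberBundle VBundle.vectorBundle VBundle.smooth

section Forms

variable {EX : Type*} [NormedAddCommGroup EX] [NormedSpace ℝ EX] [FiniteDimensional ℝ EX]
  {X : Type*} [TopologicalSpace X] [ChartedSpace EX X]

instance (x : X) : FiniteDimensional ℝ (TangentSpace 𝓘(ℝ, EX) x) :=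
  inferInstanceAs (FiniteDimensional ℝ EX)

instance (x : X) : T2Space (TangentSpace 𝓘(ℝ, EX) x) :=
  inferInstanceAs (T2Space EX)

/-- The identification of the fibres over equal points. -/
def VBundle.congrFib (A : VBundle.{v} EX X) {x y : X} (h : x = y) : A.fib x ≃L[ℝ] A.fib y :=
  h ▸ ContinuousLinearEquiv.refl ℝ (A.fib x)

/-- The bundle `Hom(A, B)`. -/
def VBundle.hom (A B : VBundle.{v} EX X) : VBundle.{v} EX X where
  F := A.F →L[ℝ] B.F
  fib x := A.fib x →L[ℝ] B.fib x

/-- The trivial line bundle. -/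
def VBundle.line (EX : Type*) [NormedAddCommGroup EX] [NormedSpace ℝ EX] (X : Type*)
    [TopologicalSpace X] [ChartedSpace EX X] : VBundle EX X where
  F := ℝ
  fib := Bundle.Trivial X ℝ


/-- A `ℤ`-graded vector bundle `E = ⨁ₖ Eᵏ` of finite total rank. -/
structure GradedBundle (EX : Type*) [NormedAddCommGroup EX] [NormedSpace ℝ EX]
    (X : Type*) [TopologicalSpace X] [ChartedSpace EX X] where
  /-- the degree `k` part -/
  part : ℤ → VBundle.{v} EX X
  finite_support : {k | Nontrivial (part k).F}.Finite

/-- The finitely many degrees in which `E` may be nonzero. -/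
def GradedBundle.support (E : GradedBundle.{v} EX X) : Finset ℤ := E.finite_support.toFinset

/-- The graded bundle `Hom(E, E')`, as the family of its summands `Hom(E^q, E'^q')`. -/
def GradedBundle.hom (E E' : GradedBundle.{v} EX X) (i : ℤ × ℤ) : VBundle.{v} EX X :=
  (E.part i.1).hom (E'.part i.2)

/-- The degree of the summand `Hom(E^q, E'^q')` of `Hom(E, E')`. -/
def homDeg (i : ℤ × ℤ) : ℤ := i.2 - i.1

/-- Differential `p`-forms with values in a vector bundle, without any regularity. -/
abbrev RawForm (A : VBundle.{v} EX X) (p : ℕ) : Type _ :=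
  ∀ x : X, TangentSpace 𝓘(ℝ, EX) x [⋀^Fin p]→L[ℝ] A.fib x

/-- Inhomogeneous forms with values in the sum `⨁ᵢ Vᵢ` of a family of bundles, without any
regularity: the component `α p i` is the part of partial degree `p` with values in `Vᵢ`. Only
finitely many components can be nonzero when almost all of the bundles `Vᵢ` are zero. -/
abbrev RawForms {ι : Type} (V : ι → VBundle.{v} EX X) : Type _ :=
  ∀ (p : ℕ) (i : ι), RawForm (V i) p

/-- `α` has total degree `n`: the component in `Ωᵖ(X, Vᵢ)` vanishes unless `p + deg i = n`. -/
def IsHomogeneous {ι : Type} {V : ι → VBundle.{v} EX X} (deg : ι → ℤ) (n : ℤ)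
    (α : RawForms V) : Prop :=
  ∀ (p : ℕ) (i : ι), (p : ℤ) + deg i ≠ n → α p i = 0

/-- The wedge product `σ ∧ α` of a scalar `k`-form `σ` with a bundle-valued form. -/
def scalarWedge {ι : Type} {V : ι → VBundle.{v} EX X} {k : ℕ} (σ : RawForm (VBundle.line EX X) k)
    (α : RawForms V) : RawForms V :=
  fun n i x => if h : k ≤ n then
    wedge (N₁ := ℝ) (LinearMap.lsmul ℝ ((V i).fib x)) (Nat.add_sub_cancel' h)
      (σ x) (α (n - k) i x) else 0

/-- The multiplication `α ∧ η` of an `E`-valued form by a `Hom(E, E')`-valued form, with the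
Koszul sign `(σ ⊗ f) ∧ (τ ⊗ e) = (-1)^{|f||τ|} (σ ∧ τ) ⊗ f(e)`. -/
def homWedge {E E' : GradedBundle.{v} EX X} (α : RawForms (E.hom E')) (η : RawForms E.part) :
    RawForms E'.part :=
  fun n q' x => ∑ p : Fin (n + 1), ∑ q ∈ E.support,
    ((-1 : ℝ) ^ (homDeg (q, q') * ((n - p : ℕ) : ℤ))) •
      wedge (ContinuousLinearMap.coeLM ℝ) (Nat.add_sub_cancel' (Nat.lt_succ_iff.mp p.2))
        (show _ [⋀^Fin p]→L[ℝ] ((E.part q).fib x →L[ℝ] (E'.part q').fib x) from α p (q, q') x)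
        (η (n - p) q x)

/-- The composition `ψ ∧ α` of `Hom`-valued forms, with the Koszul sign
`(σ ⊗ f) ∧ (τ ⊗ g) = (-1)^{|f||τ|} (σ ∧ τ) ⊗ (f ∘ g)`. -/
def homComp {E E' E'' : GradedBundle.{v} EX X} (ψ : RawForms (E'.hom E''))
    (α : RawForms (E.hom E')) : RawForms (E.hom E'') :=
  fun n i x => ∑ p : Fin (n + 1), ∑ q ∈ E'.support,
    ((-1 : ℝ) ^ (homDeg (q, i.2) * ((n - p : ℕ) : ℤ))) •
      (show _ [⋀^Fin n]→L[ℝ] ((E.part i.1).fib x →L[ℝ] (E''.part i.2).fib x) from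
        wedge (LinearMap.mk₂ ℝ (fun f g => f.comp g) (fun _ _ _ => ContinuousLinearMap.add_comp ..)
            (fun _ _ _ => ContinuousLinearMap.smul_comp ..)
            (fun _ _ _ => ContinuousLinearMap.comp_add ..)
            (fun _ _ _ => ContinuousLinearMap.comp_smul ..))
          (Nat.add_sub_cancel' (Nat.lt_succ_iff.mp p.2))
          (show _ [⋀^Fin p]→L[ℝ] ((E'.part q).fib x →L[ℝ] (E''.part i.2).fib x) from
            ψ p (q, i.2) x)
          (show _ [⋀^Fin (n - p)]→L[ℝ] ((E.part i.1).fib x →L[ℝ] (E'.part q).fib x) from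
            α (n - p) (i.1, q) x))

/-- The identity endomorphism of `E`, as a `Hom(E, E)`-valued form of partial degree `0`. -/
def homOne (E : GradedBundle.{v} EX X) : RawForms (E.hom E)
  | 0, (q, q'), x => ContinuousAlternatingMap.constOfIsEmpty ℝ _ _
      (show (E.part q).fib x →L[ℝ] (E.part q').fib x from
        if h : q = q' then h ▸ ContinuousLinearMap.id ℝ ((E.part q).fib x) else 0)
  | _ + 1, _, _ => 0

/-- The exterior derivative of a scalar form, computed at `x` in the preferred chart `φ` at `x`:
`(dσ)ₓ = (φ* d ((φ⁻¹)* σ))ₓ`. -/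
def extD {k : ℕ} (σ : RawForm (VBundle.line EX X) k) : RawForm (VBundle.line EX X) (k + 1) :=
  fun x => (extDeriv (F := ℝ) (fun y : EX =>
      (σ ((chartAt EX x).symm y)).compContinuousLinearMap
        (mfderiv 𝓘(ℝ, EX) 𝓘(ℝ, EX) (chartAt EX x).symm y)) (chartAt EX x x)).compContinuousLinearMap
    (mfderiv 𝓘(ℝ, EX) 𝓘(ℝ, EX) (chartAt EX x) x)

variable [IsManifold 𝓘(ℝ, EX) ∞ X]

/-- Smoothness of a form as a section of the bundle `Λᵖ T*X ⊗ A` of alternating maps. -/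
def SmoothForm {A : VBundle.{v} EX X} {p : ℕ} (α : RawForm A p) : Prop :=
  ContMDiff 𝓘(ℝ, EX) (𝓘(ℝ, EX).prod 𝓘(ℝ, EX [⋀^Fin p]→L[ℝ] A.F)) ∞
    (fun x => TotalSpace.mk' (EX [⋀^Fin p]→L[ℝ] A.F)
      (E := fun x : X => TangentSpace 𝓘(ℝ, EX) x [⋀^Fin p]→L[ℝ] A.fib x) x (α x))


theorem smoothForm_iff {A : VBundle.{v} EX X} {p : ℕ} (α : RawForm A p) :
    SmoothForm α ↔ ∀ x₀ : X, ContMDiffAt 𝓘(ℝ, EX) 𝓘(ℝ, EX [⋀^Fin p]→L[ℝ] A.F) ∞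
      (fun x => ContinuousAlternatingMap.inCoordinates EX
        (E₁ := fun x : X => TangentSpace 𝓘(ℝ, EX) x) A.F (E₂ := A.fib) x₀ x x₀ x (α x)) x₀ :=
  forall_congr' fun _ => contMDiffAt_section _

/-- The smooth forms `Ω(X, ⨁ᵢ Vᵢ)`. -/
def Omega {ι : Type} (V : ι → VBundle.{v} EX X) : Submodule ℝ (RawForms V) where
  carrier := {α | ∀ p i, SmoothForm (α p i)}
  zero_mem' p i := (smoothForm_iff _).2 fun x₀ => by
    have h : (fun x : X => ContinuousAlternatingMap.inCoordinates EX
        (E₁ := fun x : X => TangentSpace 𝓘(ℝ, EX) x) (V i).F (E₂ := (V i).fib) x₀ x x₀ x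
        ((0 : RawForms V) p i x)) = fun _ => 0 := by
      funext x; ext w; simp [ContinuousAlternatingMap.inCoordinates]
    rw [h]
    exact contMDiffAt_const
  add_mem' {α β} hα hβ p i := (smoothForm_iff _).2 fun x₀ => by
    have h : (fun x : X => ContinuousAlternatingMap.inCoordinates EX
        (E₁ := fun x : X => TangentSpace 𝓘(ℝ, EX) x) (V i).F (E₂ := (V i).fib) x₀ x x₀ x
        ((α + β) p i x)) = fun x => ContinuousAlternatingMap.inCoordinates EX
        (E₁ := fun x : X => TangentSpace 𝓘(ℝ, EX) x) (V i).F (E₂ := (V i).fib) x₀ x x₀ x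
        (α p i x) + ContinuousAlternatingMap.inCoordinates EX
        (E₁ := fun x : X => TangentSpace 𝓘(ℝ, EX) x) (V i).F (E₂ := (V i).fib) x₀ x x₀ x
        (β p i x) := by
      funext x; ext w; simp [ContinuousAlternatingMap.inCoordinates]
    rw [h]
    exact ((smoothForm_iff _).1 (hα p i) x₀).add ((smoothForm_iff _).1 (hβ p i) x₀)
  smul_mem' c α hα p i := (smoothForm_iff _).2 fun x₀ => by
    have h : (fun x : X => ContinuousAlternatingMap.inCoordinates EX
        (E₁ := fun x : X => TangentSpace 𝓘(ℝ, EX) x) (V i).F (E₂ := (V i).fib) x₀ x x₀ x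
        ((c • α) p i x)) = fun x => c • ContinuousAlternatingMap.inCoordinates EX
        (E₁ := fun x : X => TangentSpace 𝓘(ℝ, EX) x) (V i).F (E₂ := (V i).fib) x₀ x x₀ x
        (α p i x) := by
      funext x; ext w; simp [ContinuousAlternatingMap.inCoordinates]
    rw [h]
    exact (c • ContinuousLinearMap.id ℝ (EX [⋀^Fin p]→L[ℝ] (V i).F)).contMDiff.contMDiffAt.comp x₀
      ((smoothForm_iff _).1 (hα p i) x₀)

/-- `HasValue D η ζ`: the form `η` is smooth and the operator `D` sends it to `ζ`. -/
def HasValue {E E' : GradedBundle.{v} EX X} (D : Omega E.part →ₗ[ℝ] Omega E'.part)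
    (η : RawForms E.part) (ζ : RawForms E'.part) : Prop :=
  ∃ h : η ∈ Omega E.part, (D ⟨η, h⟩ : RawForms E'.part) = ζ

/-- A superconnection on `E`: an operator of degree `1` on `Ω(X, E)` (for the total degree) with
`D (σ ∧ η) = dσ ∧ η + (-1)ᵏ σ ∧ D η` for all smooth scalar `k`-forms `σ`. -/
structure IsSuperconnection (E : GradedBundle.{v} EX X)
    (D : Omega E.part →ₗ[ℝ] Omega E.part) : Prop where
  degree : ∀ (n : ℤ) (η : Omega E.part), IsHomogeneous id n (η : RawForms E.part) →
    IsHomogeneous id (n + 1) (D η : RawForms E.part)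
  leibniz : ∀ (k : ℕ) (σ : RawForm (VBundle.line EX X) k), SmoothForm σ → ∀ η : Omega E.part,
    HasValue D (scalarWedge σ (η : RawForms E.part))
      (scalarWedge (extD σ) (η : RawForms E.part) +
        (-1 : ℝ) ^ k • scalarWedge σ (D η : RawForms E.part))

/-- A superconnection is flat if `D² = 0`. -/
def IsFlat {E : GradedBundle.{v} EX X} (D : Omega E.part →ₗ[ℝ] Omega E.part) : Prop :=
  ∀ η, D (D η) = 0

/-- An `∞`-local system on `X`: a graded vector bundle with a flat superconnection. -/
structure LocalSystem (EX : Type*) [NormedAddCommGroup EX] [NormedSpace ℝ EX]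
    [FiniteDimensional ℝ EX] (X : Type*) [TopologicalSpace X] [ChartedSpace EX X]
    [IsManifold 𝓘(ℝ, EX) ∞ X] where
  E : GradedBundle.{v} EX X
  D : Omega E.part →ₗ[ℝ] Omega E.part
  superconnection : IsSuperconnection E D
  flat : IsFlat D

/-- The morphisms of degree `n` from `E` to `E'`: the space `Ω(X, Hom(E, E'))ⁿ`. -/
def homForms (E E' : GradedBundle.{v} EX X) (n : ℤ) : Set (RawForms (E.hom E')) :=
  {α | α ∈ Omega (E.hom E') ∧ IsHomogeneous homDeg n α}

/-- `β = D' ∧ α - (-1)ᵏ α ∧ D`, as operators on `Ω(X, E)`: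
`β ∧ η = D' (α ∧ η) - (-1)ᵏ α ∧ D η` for all `η`. -/
def IsDifferential {E E' : GradedBundle.{v} EX X} (D : Omega E.part →ₗ[ℝ] Omega E.part)
    (D' : Omega E'.part →ₗ[ℝ] Omega E'.part) (k : ℤ) (α β : RawForms (E.hom E')) : Prop :=
  ∀ η : Omega E.part, HasValue D' (homWedge α (η : RawForms E.part))
    (homWedge β (η : RawForms E.part) + (-1 : ℝ) ^ k • homWedge α (D η : RawForms E.part))

end Forms

/-! ## DG categories

The graded vector space `Hom(A, B) = ⨁ₙ Homⁿ(A, B)` is given by subspaces `Homⁿ(A, B)` of an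
ambient vector space. The differential and the composition only matter on these subspaces; this way
the axioms need no identification of `Hom^{(l + m) + n}` with `Hom^{l + (m + n)}`. -/

/-- The data of a DG category over `ℝ`. -/
structure DGData where
  Obj : Type u
  /-- the ambient vector space of `Hom(A, B)` -/
  Amb : Obj → Obj → Type w
  [addAmb : ∀ A B, AddCommGroup (Amb A B)]
  [moduleAmb : ∀ A B, Module ℝ (Amb A B)]
  /-- the morphisms of degree `n` -/
  Hom : ∀ A B : Obj, ℤ → Set (Amb A B)
  /-- the differential on the morphisms of degree `n` -/
  d : ∀ {A B : Obj}, ℤ → Amb A B → Amb A B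
  comp : ∀ {A B C : Obj}, Amb B C → Amb A B → Amb A C
  one : ∀ A : Obj, Amb A A

attribute [instance] DGData.addAmb DGData.moduleAmb

/-- The axioms of a DG category. -/
structure DGData.IsDGCategory (C : DGData.{u, w}) : Prop where
  zero_mem : ∀ (A B : C.Obj) (n : ℤ), 0 ∈ C.Hom A B n
  add_mem : ∀ (A B : C.Obj) (n : ℤ), ∀ f ∈ C.Hom A B n, ∀ g ∈ C.Hom A B n, f + g ∈ C.Hom A B n
  smul_mem : ∀ (A B : C.Obj) (n : ℤ) (c : ℝ), ∀ f ∈ C.Hom A B n, c • f ∈ C.Hom A B n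
  independent : ∀ (A B : C.Obj) (s : Finset ℤ) (f : ℤ → C.Amb A B),
    (∀ n ∈ s, f n ∈ C.Hom A B n) → ∑ n ∈ s, f n = 0 → ∀ n ∈ s, f n = 0
  d_mem : ∀ (A B : C.Obj) (n : ℤ), ∀ f ∈ C.Hom A B n, C.d n f ∈ C.Hom A B (n + 1)
  d_add : ∀ (A B : C.Obj) (n : ℤ), ∀ f ∈ C.Hom A B n, ∀ g ∈ C.Hom A B n,
    C.d n (f + g) = C.d n f + C.d n g
  d_smul : ∀ (A B : C.Obj) (n : ℤ) (c : ℝ), ∀ f ∈ C.Hom A B n, C.d n (c • f) = c • C.d n f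
  d_d : ∀ (A B : C.Obj) (n : ℤ), ∀ f ∈ C.Hom A B n, C.d (n + 1) (C.d n f) = 0
  comp_mem : ∀ (A₁ A₂ A₃ : C.Obj) (m n : ℤ), ∀ f ∈ C.Hom A₂ A₃ m, ∀ g ∈ C.Hom A₁ A₂ n,
    C.comp f g ∈ C.Hom A₁ A₃ (m + n)
  add_comp : ∀ (A₁ A₂ A₃ : C.Obj) (m n : ℤ), ∀ f ∈ C.Hom A₂ A₃ m, ∀ f' ∈ C.Hom A₂ A₃ m,
    ∀ g ∈ C.Hom A₁ A₂ n, C.comp (f + f') g = C.comp f g + C.comp f' g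
  comp_add : ∀ (A₁ A₂ A₃ : C.Obj) (m n : ℤ), ∀ f ∈ C.Hom A₂ A₃ m, ∀ g ∈ C.Hom A₁ A₂ n,
    ∀ g' ∈ C.Hom A₁ A₂ n, C.comp f (g + g') = C.comp f g + C.comp f g'
  smul_comp : ∀ (A₁ A₂ A₃ : C.Obj) (m n : ℤ) (c : ℝ), ∀ f ∈ C.Hom A₂ A₃ m,
    ∀ g ∈ C.Hom A₁ A₂ n, C.comp (c • f) g = c • C.comp f g
  comp_smul : ∀ (A₁ A₂ A₃ : C.Obj) (m n : ℤ) (c : ℝ), ∀ f ∈ C.Hom A₂ A₃ m,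
    ∀ g ∈ C.Hom A₁ A₂ n, C.comp f (c • g) = c • C.comp f g
  assoc : ∀ (A₁ A₂ A₃ A₄ : C.Obj) (l m n : ℤ), ∀ f ∈ C.Hom A₃ A₄ l, ∀ g ∈ C.Hom A₂ A₃ m,
    ∀ h ∈ C.Hom A₁ A₂ n, C.comp (C.comp f g) h = C.comp f (C.comp g h)
  one_mem : ∀ A : C.Obj, C.one A ∈ C.Hom A A 0
  one_comp : ∀ (A B : C.Obj) (n : ℤ), ∀ f ∈ C.Hom A B n, C.comp (C.one B) f = f
  comp_one : ∀ (A B : C.Obj) (n : ℤ), ∀ f ∈ C.Hom A B n, C.comp f (C.one A) = f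
  leibniz : ∀ (A₁ A₂ A₃ : C.Obj) (m n : ℤ), ∀ f ∈ C.Hom A₂ A₃ m, ∀ g ∈ C.Hom A₁ A₂ n,
    C.d (m + n) (C.comp f g) = C.comp (C.d m f) g + (-1 : ℝ) ^ m • C.comp f (C.d n g)

/-- Closed morphisms of degree `n`, the cocycles of the complex `Hom(A, B)`. -/
def DGData.Closed (C : DGData.{u, w}) (A B : C.Obj) (n : ℤ) : Set (C.Amb A B) :=
  {f | f ∈ C.Hom A B n ∧ C.d n f = 0}

/-- `f` and `g` (cocycles of degree `n`) have the same class in `Hⁿ(Hom(A, B))`. -/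
def DGData.Cohomologous (C : DGData.{u, w}) {A B : C.Obj} (n : ℤ) (f g : C.Amb A B) : Prop :=
  ∃ h ∈ C.Hom A B (n - 1), f - g = C.d (n - 1) h

/-- `A` and `B` are isomorphic by a closed isomorphism of degree `0`. -/
def DGData.Iso (C : DGData.{u, w}) (A B : C.Obj) : Prop :=
  ∃ f ∈ C.Closed A B 0, ∃ g ∈ C.Closed B A 0, C.comp g f = C.one A ∧ C.comp f g = C.one B

/-- `A` and `B` are isomorphic in the homotopy category. -/
def DGData.HomotopyIso (C : DGData.{u, w}) (A B : C.Obj) : Prop :=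
  ∃ f ∈ C.Closed A B 0, ∃ g ∈ C.Closed B A 0,
    C.Cohomologous 0 (C.comp g f) (C.one A) ∧ C.Cohomologous 0 (C.comp f g) (C.one B)

/-- The data of a DG functor. -/
structure DGFunctorData (C : DGData.{u, w}) (D : DGData.{u', w'}) where
  obj : C.Obj → D.Obj
  map : ∀ {A B : C.Obj}, C.Amb A B → D.Amb (obj A) (obj B)

section Functors

variable {C : DGData.{u, w}} {D : DGData.{u', w'}}

/-- The axioms of a DG functor. -/
structure DGFunctorData.IsDGFunctor (F : DGFunctorData C D) : Prop where
  map_mem : ∀ (A B : C.Obj) (n : ℤ), ∀ f ∈ C.Hom A B n, F.map f ∈ D.Hom (F.obj A) (F.obj B) n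
  map_add : ∀ (A B : C.Obj) (n : ℤ), ∀ f ∈ C.Hom A B n, ∀ g ∈ C.Hom A B n,
    F.map (f + g) = F.map f + F.map g
  map_smul : ∀ (A B : C.Obj) (n : ℤ) (c : ℝ), ∀ f ∈ C.Hom A B n, F.map (c • f) = c • F.map f
  map_d : ∀ (A B : C.Obj) (n : ℤ), ∀ f ∈ C.Hom A B n, F.map (C.d n f) = D.d n (F.map f)
  map_one : ∀ A : C.Obj, F.map (C.one A) = D.one (F.obj A)
  map_comp : ∀ (A₁ A₂ A₃ : C.Obj) (m n : ℤ), ∀ f ∈ C.Hom A₂ A₃ m, ∀ g ∈ C.Hom A₁ A₂ n,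
    F.map (C.comp f g) = D.comp (F.map f) (F.map g)

/-- `F` is quasi fully faithful: for all `A`, `B` the map `Hⁿ(Hom(A, B)) → Hⁿ(Hom(F A, F B))` is
injective and surjective for all `n`. -/
def DGFunctorData.QuasiFullyFaithful (F : DGFunctorData C D) : Prop :=
  ∀ (A B : C.Obj) (n : ℤ),
    (∀ f ∈ C.Closed A B n, ∀ g ∈ C.Closed A B n,
      D.Cohomologous n (F.map f) (F.map g) → C.Cohomologous n f g) ∧
    ∀ g ∈ D.Closed (F.obj A) (F.obj B) n, ∃ f ∈ C.Closed A B n, D.Cohomologous n (F.map f) g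

/-- `F` is quasi essentially surjective: it is essentially surjective on homotopy categories. -/
def DGFunctorData.QuasiEssSurj (F : DGFunctorData C D) : Prop :=
  ∀ B : D.Obj, ∃ A : C.Obj, D.HomotopyIso (F.obj A) B

/-- Quasi-equivalences of DG categories. -/
def DGFunctorData.IsQuasiEquivalence (F : DGFunctorData C D) : Prop :=
  F.QuasiFullyFaithful ∧ F.QuasiEssSurj

end Functors

/-! ## The DG category of local systems -/

section Loc

variable {EX : Type*} [NormedAddCommGroup EX] [NormedSpace ℝ EX] [FiniteDimensional ℝ EX]
  {X : Type*} [TopologicalSpace X] [ChartedSpace EX X] [IsManifold 𝓘(ℝ, EX) ∞ X]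
  {O : Type*} (S : O → LocalSystem.{v} EX X)
  (H : ∀ A B : O, ℤ → Set (RawForms ((S A).E.hom (S B).E)))

/-- For objects `O` with underlying local systems and spaces of morphisms `Hⁿ(A, B)` inside
`Ω(X, Hom(E, E'))`, this says that `∂α = D' ∧ α - (-1)ᵏ α ∧ D` is a well defined element of
`Hᵏ⁺¹(A, B)` for each `α` in `Hᵏ(A, B)`. -/
def HasDifferentials : Prop :=
  ∀ (A B : O) (k : ℤ), ∀ α ∈ H A B k, ∃! β, β ∈ H A B (k + 1) ∧ IsDifferential (S A).D (S B).D k α β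

open Classical in
/-- The DG category with objects `O`, morphisms `Hⁿ(A, B)`, the differential `∂` and the
composition `∧`. -/
def dgOf (h : HasDifferentials S H) : DGData where
  Obj := O
  Amb A B := RawForms ((S A).E.hom (S B).E)
  Hom := H
  d {A B} k α := if hα : α ∈ H A B k then (h A B k α hα).choose else 0
  comp ψ α := homComp ψ α
  one A := homOne (S A).E

end Loc

section LocX

variable (EX : Type*) [NormedAddCommGroup EX] [NormedSpace ℝ EX] [FiniteDimensional ℝ EX]
  (X : Type*) [TopologicalSpace X] [ChartedSpace EX X] [IsManifold 𝓘(ℝ, EX) ∞ X]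

/-- The differential of `Loc_∞(X)` is well defined. -/
def LocHasDifferentials : Prop :=
  HasDifferentials (fun A : LocalSystem.{v} EX X => A) fun A B => homForms A.E B.E

/-- The DG category `Loc_∞(X)`. -/
def Loc (h : LocHasDifferentials.{v} EX X) : DGData := dgOf _ _ h

end LocX

/-! ## Principal bundles and basic local systems -/

section Principal

variable (EG : Type*) [NormedAddCommGroup EG] [NormedSpace ℝ EG] [FiniteDimensional ℝ EG]
  (G : Type*) [TopologicalSpace G] [ChartedSpace EG G] [Group G]
  (EP : Type*) [NormedAddCommGroup EP] [NormedSpace ℝ EP] [FiniteDimensional ℝ EP]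
  (P : Type*) [TopologicalSpace P] [ChartedSpace EP P]
  (EX : Type*) [NormedAddCommGroup EX] [NormedSpace ℝ EX] [FiniteDimensional ℝ EX]
  (X : Type*) [TopologicalSpace X] [ChartedSpace EX X]

/-- A smooth principal bundle `π : P → X` with structure group `G`: a smooth right action of `G` on
`P` over `X` which is locally isomorphic to `U × G` with right translations. -/
structure PrincipalBundle where
  proj : ContMDiffMap 𝓘(ℝ, EP) 𝓘(ℝ, EX) P X ∞
  /-- the right action `p · g` -/
  act : P → G → P
  act_one : ∀ p, act p 1 = p
  act_mul : ∀ p g h, act p (g * h) = act (act p g) h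
  smooth_act : ContMDiff (𝓘(ℝ, EP).prod 𝓘(ℝ, EG)) 𝓘(ℝ, EP) ∞ (fun q : P × G => act q.1 q.2)
  proj_act : ∀ p g, proj (act p g) = proj p
  locally_trivial : ∀ x : X, ∃ (U : Set X) (e : OpenPartialHomeomorph P (X × G)),
    IsOpen U ∧ x ∈ U ∧ e.source = proj ⁻¹' U ∧ e.target = U ×ˢ Set.univ ∧
    ContMDiffOn 𝓘(ℝ, EP) (𝓘(ℝ, EX).prod 𝓘(ℝ, EG)) ∞ e e.source ∧
    ContMDiffOn (𝓘(ℝ, EX).prod 𝓘(ℝ, EG)) 𝓘(ℝ, EP) ∞ e.symm e.target ∧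
    ∀ p ∈ e.source, (e p).1 = proj p ∧ ∀ g, (e (act p g)).2 = (e p).2 * g

variable {EG G EP P EX X} (Q : PrincipalBundle EG G EP P EX X)

/-- The fundamental vector field of `x` in the Lie algebra of `G`, at the point `p`: the derivative
of `g ↦ p · g` at `1` in the direction `x`. -/
def PrincipalBundle.fundamental (x : GroupLieAlgebra 𝓘(ℝ, EG) G) (p : P) :
    TangentSpace 𝓘(ℝ, EP) p :=
  (mfderiv 𝓘(ℝ, EG) 𝓘(ℝ, EP) (fun g => Q.act p g) 1 x : EP)

/-- A family of linear isomorphisms `v ↦ v · g` from `A_p` to `A_{p · g}`. -/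
abbrev PrincipalBundle.FibreAction (A : VBundle.{v} EP P) : Type _ :=
  ∀ (g : G) (p : P), A.fib p ≃L[ℝ] A.fib (Q.act p g)

/-- The family `v ↦ v · g` is a smooth right action of `G` on the total space of `A`. -/
structure PrincipalBundle.IsAction {A : VBundle.{v} EP P} (ρ : Q.FibreAction A) : Prop where
  one : ∀ (p : P) (a : A.fib p),
    (⟨Q.act p 1, ρ 1 p a⟩ : TotalSpace A.F A.fib) = ⟨p, a⟩
  mul : ∀ (g h : G) (p : P) (a : A.fib p),
    (⟨Q.act p (g * h), ρ (g * h) p a⟩ : TotalSpace A.F A.fib) =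
      ⟨Q.act (Q.act p g) h, ρ h (Q.act p g) (ρ g p a)⟩
  smooth : ContMDiff ((𝓘(ℝ, EP).prod 𝓘(ℝ, A.F)).prod 𝓘(ℝ, EG)) (𝓘(ℝ, EP).prod 𝓘(ℝ, A.F)) ∞
    (fun q : TotalSpace A.F A.fib × G =>
      (⟨Q.act q.1.1 q.2, ρ q.2 q.1.1 q.1.2⟩ : TotalSpace A.F A.fib))

/-- The induced action on `Hom(A, B)`, `f · g = (v ↦ f(v · g⁻¹) · g)`. -/
def PrincipalBundle.homAction {E E' : GradedBundle.{v} EP P} (ρ : ∀ k, Q.FibreAction (E.part k))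
    (ρ' : ∀ k, Q.FibreAction (E'.part k)) (i : ℤ × ℤ) : Q.FibreAction (E.hom E' i) :=
  fun g p => (ρ i.1 g p).arrowCongr (ρ' i.2 g p)

section Forms

variable {ι : Type} {V : ι → VBundle.{v} EP P} (ρ : ∀ i, Q.FibreAction (V i))

/-- The left action on forms,
`(g · φ)_p (v₁, …, v_r) = φ_{p · g} ((dσ_g) v₁, …, (dσ_g) v_r) · g⁻¹`. -/
def PrincipalBundle.actForms (g : G) (φ : RawForms V) : RawForms V :=
  fun r i p => ((ρ i g p).symm : (V i).fib (Q.act p g) →L[ℝ] (V i).fib p).compContinuousAlternatingMap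
    ((φ r i (Q.act p g)).compContinuousLinearMap
      (mfderiv 𝓘(ℝ, EP) 𝓘(ℝ, EP) (fun q => Q.act q g) p))

/-- The contraction `i_x` with the fundamental vector field of `x`. -/
def PrincipalBundle.contraction (x : GroupLieAlgebra 𝓘(ℝ, EG) G) (φ : RawForms V) : RawForms V :=
  fun r i p => contract (Q.fundamental x p) (φ (r + 1) i p)

/-- The infinitesimal action `L_x`: at each point `p`, the derivative of `g ↦ (g · φ)_p` at `1` in
the direction `x`. The values lie in the vector space `Λʳ T_p*P ⊗ V_p`, which is identified with
`Λʳ EP* ⊗ F` by a linear isomorphism `V_p ≃ F` to make it a normed space; the result does not depend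
on this. -/
def PrincipalBundle.lieDerivative (x : GroupLieAlgebra 𝓘(ℝ, EG) G) (φ : RawForms V) : RawForms V :=
  fun r i p =>
    let e : (V i).fib p ≃L[ℝ] (V i).F :=
      (trivializationAt (V i).F (V i).fib p).continuousLinearEquivAt ℝ p
        (mem_baseSet_trivializationAt (V i).F (V i).fib p)
    let f : G → EP [⋀^Fin r]→L[ℝ] (V i).F := fun g =>
      (e : (V i).fib p →L[ℝ] (V i).F).compContinuousAlternatingMap (Q.actForms ρ g φ r i p)
    (e.symm : (V i).F →L[ℝ] (V i).fib p).compContinuousAlternatingMap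
      (show EP [⋀^Fin r]→L[ℝ] (V i).F from
        mfderiv 𝓘(ℝ, EG) 𝓘(ℝ, EP [⋀^Fin r]→L[ℝ] (V i).F) f 1 x)

/-- Basic forms: `i_x φ = 0` and `L_x φ = 0` for all `x` in the Lie algebra. -/
def PrincipalBundle.IsBasicForm (φ : RawForms V) : Prop :=
  ∀ x : GroupLieAlgebra 𝓘(ℝ, EG) G, Q.contraction x φ = 0 ∧ Q.lieDerivative ρ x φ = 0

end Forms

variable [IsManifold 𝓘(ℝ, EP) ∞ P] [IsManifold 𝓘(ℝ, EX) ∞ X]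

/-- A superconnection is basic if it is `G`-equivariant and `[D, i_x] = D i_x + i_x D = L_x`. -/
structure PrincipalBundle.IsBasicSuperconnection {E : GradedBundle.{v} EP P}
    (ρ : ∀ k, Q.FibreAction (E.part k)) (D : Omega E.part →ₗ[ℝ] Omega E.part) : Prop where
  equivariant : ∀ (g : G) (η : Omega E.part),
    HasValue D (Q.actForms ρ g (η : RawForms E.part)) (Q.actForms ρ g (D η : RawForms E.part))
  cartan : ∀ (x : GroupLieAlgebra 𝓘(ℝ, EG) G) (η : Omega E.part),
    HasValue D (Q.contraction x (η : RawForms E.part))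
      (Q.lieDerivative ρ x (η : RawForms E.part) - Q.contraction x (D η : RawForms E.part))

/-- A basic `∞`-local system on `P`: a graded `G`-equivariant vector bundle with a flat basic
superconnection. -/
structure BasicLocalSystem extends LocalSystem.{v} EP P where
  act : ∀ k, Q.FibreAction (E.part k)
  isAction : ∀ k, Q.IsAction (act k)
  basic : Q.IsBasicSuperconnection act D

/-- The morphisms of degree `n` between basic local systems, `Ω_bas(P, Hom(E, E'))ⁿ`. -/
def basicForms (A B : BasicLocalSystem.{v} Q) (n : ℤ) : Set (RawForms (A.E.hom B.E)) :=
  {α | α ∈ homForms A.E B.E n ∧ Q.IsBasicForm (Q.homAction A.act B.act) α}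

/-- The differential of `[Loc_∞(P)]_bas` is well defined. -/
def BasHasDifferentials : Prop :=
  HasDifferentials (fun A : BasicLocalSystem.{v} Q => A.toLocalSystem) (basicForms Q)

/-- The DG category `[Loc_∞(P)]_bas`. -/
def LocBas (h : BasHasDifferentials.{v} Q) : DGData := dgOf _ _ h

/-! ## The pullback functor -/

/-- The pullback bundle `π* A`. -/
def VBundle.pullback (A : VBundle.{v} EX X) : VBundle.{v} EP P where
  F := A.F
  fib p := A.fib (Q.proj p)
  topTotal := inferInstanceAs (TopologicalSpace (TotalSpace A.F (Q.proj *ᵖ A.fib)))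
  fiberBundle := inferInstanceAs (FiberBundle A.F (Q.proj *ᵖ A.fib))
  vectorBundle := inferInstanceAs (VectorBundle ℝ A.F (Q.proj *ᵖ A.fib))
  smooth := inferInstanceAs (ContMDiffVectorBundle ∞ A.F (Q.proj *ᵖ A.fib) 𝓘(ℝ, EP))

/-- The graded pullback bundle `π* E`. -/
def GradedBundle.pullback (E : GradedBundle.{v} EX X) : GradedBundle.{v} EP P where
  part k := (E.part k).pullback Q
  finite_support := E.finite_support

/-- The action of `G` on `π* A`, the identity of the fibres `(π* A)_{p · g} = A_{π p} = (π* A)_p`. -/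
def pullbackAction (A : VBundle.{v} EX X) : Q.FibreAction (A.pullback Q) :=
  fun g p => A.congrFib (Q.proj_act p g).symm

/-- The pullback of forms with values in `E`. -/
def pullbackForms {E : GradedBundle.{v} EX X} (η : RawForms E.part) :
    RawForms (E.pullback Q).part :=
  fun n i p => (η n i (Q.proj p)).compContinuousLinearMap
    (mfderiv 𝓘(ℝ, EP) 𝓘(ℝ, EX) Q.proj p)

/-- The pullback of forms with values in `Hom(E, E')`. -/
def pullbackHom {E E' : GradedBundle.{v} EX X} (α : RawForms (E.hom E')) :
    RawForms ((E.pullback Q).hom (E'.pullback Q)) :=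
  fun n i p => (α n i (Q.proj p)).compContinuousLinearMap
    (mfderiv 𝓘(ℝ, EP) 𝓘(ℝ, EX) Q.proj p)

/-- `D'` is the pullback superconnection `π* D`: the superconnection on `π* E` with
`D' (π* η) = π* (D η)` for all `η`. -/
structure IsPullbackSuperconnection (A : LocalSystem.{v} EX X)
    (D' : Omega (A.E.pullback Q).part →ₗ[ℝ] Omega (A.E.pullback Q).part) : Prop where
  superconnection : IsSuperconnection (A.E.pullback Q) D'
  pullback : ∀ η : Omega A.E.part, HasValue D' (pullbackForms Q (η : RawForms A.E.part))
    (pullbackForms Q (A.D η : RawForms A.E.part))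

/-- Pullbacks of `∞`-local systems on `X` are well defined basic `∞`-local systems on `P`. -/
structure HasPullbacks : Prop where
  isAction : ∀ A : VBundle.{v} EX X, Q.IsAction (pullbackAction Q A)
  existsUnique : ∀ A : LocalSystem.{v} EX X, ∃! D', IsPullbackSuperconnection Q A D'
  flat : ∀ (A : LocalSystem.{v} EX X) D', IsPullbackSuperconnection Q A D' → IsFlat D'
  basic : ∀ (A : LocalSystem.{v} EX X) D', IsPullbackSuperconnection Q A D' →
    Q.IsBasicSuperconnection (fun k => pullbackAction Q (A.E.part k)) D'

/-- The basic `∞`-local system `π* (E, D)`. -/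
def pullbackSystem (h : HasPullbacks.{v} Q) (A : LocalSystem.{v} EX X) :
    BasicLocalSystem.{v} Q where
  E := A.E.pullback Q
  D := (h.existsUnique A).choose
  superconnection := (h.existsUnique A).choose_spec.1.superconnection
  flat := h.flat A _ (h.existsUnique A).choose_spec.1
  act k := pullbackAction Q (A.E.part k)
  isAction k := h.isAction (A.E.part k)
  basic := h.basic A _ (h.existsUnique A).choose_spec.1

/-- The pullback functor `π* : Loc_∞(X) → [Loc_∞(P)]_bas`. -/
def pullbackFunctor (hX : LocHasDifferentials.{v} EX X) (hP : BasHasDifferentials.{v} Q)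
    (h : HasPullbacks.{v} Q) : DGFunctorData (Loc EX X hX) (LocBas Q hP) where
  obj A := pullbackSystem Q h A
  map α := pullbackHom Q α

end Principal
end ChernWeil

end

open Bundle
open scoped Manifold ContDiff

noncomputable section

namespace ChernWeil

set_option linter.unusedSectionVars false
set_option linter.checkUnivs false

/-! ## Shortcut instances for forms -/

section Instances

variable {EX : Type*} [NormedAddCommGroup EX] [NormedSpace ℝ EX] [FiniteDimensional ℝ EX]
  {X : Type*} [TopologicalSpace X] [ChartedSpace EX X] [IsManifold 𝓘(ℝ, EX) ∞ X]
  {ι : Type} (V : ι → VBundle.{v} EX X)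

abbrev rawModule : Module ℝ (RawForms V) := inferInstance

abbrev rawSMul : SMul ℝ (RawForms V) := inferInstance

abbrev omegaAddCommGroup : AddCommGroup (Omega V) := (Omega V).addCommGroup

abbrev omegaAddMonoid : AddMonoid (Omega V) := (Omega V).addCommGroup.toAddMonoid

abbrev omegaModule : Module ℝ (Omega V) := (Omega V).module

abbrev omegaSMul : SMul ℝ (Omega V) := (Omega V).module.toSMul

abbrev omegaDistribSMul : DistribSMul ℝ (Omega V) :=
  (Omega V).module.toDistribMulAction.toDistribSMul

abbrev omegaSMulZeroClass : SMulZeroClass ℝ (Omega V) := (omegaDistribSMul V).toSMulZeroClass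

abbrev omegaCoeFun : CoeFun (Omega V) fun _ => RawForms V := ⟨Subtype.val⟩

end Instances

attribute [local instance] rawModule rawSMul omegaAddCommGroup omegaAddMonoid omegaModule
  omegaSMul omegaDistribSMul omegaSMulZeroClass omegaCoeFun

/-! ## Algebra of the wedge product -/

section Algebra

variable {V : Type*} [AddCommGroup V] [Module ℝ V] [TopologicalSpace V] [IsTopologicalAddGroup V]
  [ContinuousSMul ℝ V] [T2Space V] [FiniteDimensional ℝ V]
  {V' : Type*} [AddCommGroup V'] [Module ℝ V'] [TopologicalSpace V'] [IsTopologicalAddGroup V']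
  [ContinuousSMul ℝ V'] [T2Space V'] [FiniteDimensional ℝ V']
  {N : Type*} [AddCommGroup N] [Module ℝ N] [TopologicalSpace N] [IsTopologicalAddGroup N]
  [ContinuousSMul ℝ N]
  {N₁ : Type*} [AddCommGroup N₁] [Module ℝ N₁] [TopologicalSpace N₁] [IsTopologicalAddGroup N₁]
  [ContinuousSMul ℝ N₁]
  {N₂ : Type*} [AddCommGroup N₂] [Module ℝ N₂] [TopologicalSpace N₂] [IsTopologicalAddGroup N₂]
  [ContinuousSMul ℝ N₂]
  {N₃ : Type*} [AddCommGroup N₃] [Module ℝ N₃] [TopologicalSpace N₃] [IsTopologicalAddGroup N₃]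
  [ContinuousSMul ℝ N₃]
  {N₁₂ : Type*} [AddCommGroup N₁₂] [Module ℝ N₁₂] [TopologicalSpace N₁₂]
  [IsTopologicalAddGroup N₁₂] [ContinuousSMul ℝ N₁₂]
  {N₂₃ : Type*} [AddCommGroup N₂₃] [Module ℝ N₂₃] [TopologicalSpace N₂₃]
  [IsTopologicalAddGroup N₂₃] [ContinuousSMul ℝ N₂₃]

theorem contract_apply {p : ℕ} (u : V) (a : V [⋀^Fin (p + 1)]→L[ℝ] N) (v : Fin p → V) :
    contract u a v = a (Matrix.vecCons u v) := rfl

theorem map_insertNth_real {p : ℕ} (a : V [⋀^Fin (p + 1)]→L[ℝ] N) (j : Fin (p + 1)) (u : V)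
    (v : Fin p → V) : a (j.insertNth u v) = (-1 : ℝ) ^ (j : ℕ) • a (Matrix.vecCons u v) := by
  refine (a.toAlternatingMap.map_insertNth j u v).trans ?_
  rcases neg_one_pow_eq_or ℤ (j : ℕ) with h | h <;>
    rcases Nat.even_or_odd (j : ℕ) with h' | h' <;> simp [h'.neg_one_pow]

/-- The permutations of `Fin (m + 1)`, sorted by the preimage of `0`. -/
theorem sum_perm_cons {m : ℕ} (f : (Fin (m + 1) → V) → N) (u : V) (v : Fin m → V) :
    ∑ σ : Equiv.Perm (Fin (m + 1)), ((Equiv.Perm.sign σ : ℤ) : ℝ) • f (Matrix.vecCons u v ∘ σ) =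
      ∑ j : Fin (m + 1), ∑ τ : Equiv.Perm (Fin m),
        ((-1 : ℝ) ^ (j : ℕ) * ((Equiv.Perm.sign τ : ℤ) : ℝ)) • f (j.insertNth u (v ∘ τ)) := by
  rw [← Finset.sum_product']
  symm
  let F : Fin (m + 1) × Equiv.Perm (Fin m) → Equiv.Perm (Fin (m + 1)) :=
    fun x => Equiv.Perm.decomposeFin.symm (0, x.2) * x.1.cycleRange
  have hF : Function.Bijective F := by
    rw [Fintype.bijective_iff_injective_and_card]
    constructor
    · rintro ⟨i, s⟩ ⟨j, t⟩ h
      have hi : F (i, s) i = 0 := by simp [F]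
      have hj : F (j, t) j = 0 := by simp [F]
      have hij : i = j := by
        rw [h] at hi
        exact (F (j, t)).injective (hi.trans hj.symm)
      subst hij
      have h' : Equiv.Perm.decomposeFin.symm ((0 : Fin (m + 1)), s) =
          Equiv.Perm.decomposeFin.symm (0, t) := mul_right_cancel h
      simpa using h'
    · simp [Fintype.card_perm, Nat.factorial_succ]
  refine Fintype.sum_bijective F hF _ _ fun x => ?_
  obtain ⟨j, τ⟩ := x
  have h1 : (((Equiv.Perm.sign (F (j, τ))) : ℤ) : ℝ) =
      (-1 : ℝ) ^ (j : ℕ) * ((Equiv.Perm.sign τ : ℤ) : ℝ) := by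
    simp [F, Equiv.Perm.decomposeFin.symm_sign, mul_comm]
  rw [h1]
  congr 2
  funext i
  simp only [F, Function.comp_apply, Equiv.Perm.coe_mul]
  rw [← Fin.cons_apply_cycleRange]
  refine Fin.cases ?_ (fun k => ?_) (j.cycleRange i)
  · simp
  · simp

theorem factorial_smul_wedge (B : N₁ →ₗ[ℝ] N₂ →ₗ[ℝ] N) {p r n : ℕ} (h : p + r = n)
    (a : V [⋀^Fin p]→L[ℝ] N₁) (b : V [⋀^Fin r]→L[ℝ] N₂) (v : Fin n → V) :
    ((p.factorial * r.factorial : ℕ) : ℝ) • wedge B h a b v =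
      ∑ σ : Equiv.Perm (Fin n), ((Equiv.Perm.sign σ : ℤ) : ℝ) •
        B (a fun i => v (σ (Fin.cast h (Fin.castAdd r i))))
          (b fun j => v (σ (Fin.cast h (Fin.natAdd p j)))) := by
  let e : Fin p ⊕ Fin r ≃ Fin n := finSumFinEquiv.trans (finCongr h)
  have h0 := MultilinearMap.domCoprod_alternization_eq a.toAlternatingMap b.toAlternatingMap
  have h1 := congrArg (fun f => TensorProduct.lift B (f (v ∘ e))) h0
  simp only [MultilinearMap.alternatization_apply, AlternatingMap.smul_apply, map_sum,
    Fintype.card_fin] at h1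
  rw [Nat.cast_smul_eq_nsmul]
  refine Eq.trans ?_ (h1.symm.trans ?_)
  · rw [map_nsmul]; rfl
  · refine Fintype.sum_equiv e.permCongr _ _ fun σ => ?_
    have : ∀ (s : ℤˣ) (x : N), ((s : ℤ) : ℝ) • x = s • x := fun s x => by
      rw [Int.cast_smul_eq_zsmul]; rfl
    rw [this, Equiv.Perm.sign_permCongr]
    simp only [MultilinearMap.domDomCongr_apply, MultilinearMap.domCoprod_apply, Units.smul_def,
      _root_.map_zsmul, TensorProduct.lift.tmul]
    have e1 : ∀ i, (e.permCongr σ) (Fin.cast h (Fin.castAdd r i)) = e (σ (Sum.inl i)) := fun i => by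
      have : Fin.cast h (Fin.castAdd r i) = e (Sum.inl i) := rfl
      rw [this, Equiv.permCongr_apply, Equiv.symm_apply_apply]
    have e2 : ∀ i, (e.permCongr σ) (Fin.cast h (Fin.natAdd p i)) = e (σ (Sum.inr i)) := fun i => by
      have : Fin.cast h (Fin.natAdd p i) = e (Sum.inr i) := rfl
      rw [this, Equiv.permCongr_apply, Equiv.symm_apply_apply]
    simp only [e1, e2]
    rfl

/-- The contraction `ι_u`, which is zero on forms of degree `0`. -/
def iota (u : V) : ∀ {p : ℕ}, V [⋀^Fin p]→L[ℝ] N → V [⋀^Fin (p - 1)]→L[ℝ] N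
  | 0, _ => 0
  | _ + 1, a => contract u a

/-- The wedge product, extended by zero to all degrees. -/
def tw (B : N₁ →ₗ[ℝ] N₂ →ₗ[ℝ] N) (p r n : ℕ) (a : V [⋀^Fin p]→L[ℝ] N₁)
    (b : V [⋀^Fin r]→L[ℝ] N₂) : V [⋀^Fin n]→L[ℝ] N :=
  if h : p + r = n then wedge B h a b else 0

theorem tw_of_eq (B : N₁ →ₗ[ℝ] N₂ →ₗ[ℝ] N) {p r n : ℕ} (h : p + r = n) (a : V [⋀^Fin p]→L[ℝ] N₁)
    (b : V [⋀^Fin r]→L[ℝ] N₂) : tw B p r n a b = wedge B h a b := dif_pos h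

theorem tw_of_ne (B : N₁ →ₗ[ℝ] N₂ →ₗ[ℝ] N) {p r n : ℕ} (h : p + r ≠ n) (a : V [⋀^Fin p]→L[ℝ] N₁)
    (b : V [⋀^Fin r]→L[ℝ] N₂) : tw B p r n a b = 0 := dif_neg h

theorem factorial_smul_tw (B : N₁ →ₗ[ℝ] N₂ →ₗ[ℝ] N) {p r n : ℕ} (h : p + r = n)
    (a : V [⋀^Fin p]→L[ℝ] N₁) (b : V [⋀^Fin r]→L[ℝ] N₂) (v : Fin n → V) :
    ((p.factorial * r.factorial : ℕ) : ℝ) • tw B p r n a b v =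
      ∑ σ : Equiv.Perm (Fin n), ((Equiv.Perm.sign σ : ℤ) : ℝ) •
        B (a fun i => v (σ (Fin.cast h (Fin.castAdd r i))))
          (b fun j => v (σ (Fin.cast h (Fin.natAdd p j)))) := by
  rw [tw_of_eq B h, factorial_smul_wedge]

theorem factorial_cancel {p r : ℕ} {x y : N}
    (h : ((p.factorial * r.factorial : ℕ) : ℝ) • x = ((p.factorial * r.factorial : ℕ) : ℝ) • y) :
    x = y := by
  refine (smul_right_injective N ?_) h
  exact_mod_cast (Nat.mul_pos p.factorial_pos r.factorial_pos).ne'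

theorem tw_add_left (B : N₁ →ₗ[ℝ] N₂ →ₗ[ℝ] N) {p r n : ℕ} (a a' : V [⋀^Fin p]→L[ℝ] N₁)
    (b : V [⋀^Fin r]→L[ℝ] N₂) : tw B p r n (a + a') b = tw B p r n a b + tw B p r n a' b := by
  by_cases h : p + r = n
  · ext v
    refine factorial_cancel (p := p) (r := r) ?_
    rw [ContinuousAlternatingMap.add_apply, smul_add]
    simp only [factorial_smul_tw B h, ← Finset.sum_add_distrib, ContinuousAlternatingMap.add_apply,
      map_add, LinearMap.add_apply, smul_add]
  · simp [tw_of_ne B h]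

theorem tw_add_right (B : N₁ →ₗ[ℝ] N₂ →ₗ[ℝ] N) {p r n : ℕ} (a : V [⋀^Fin p]→L[ℝ] N₁)
    (b b' : V [⋀^Fin r]→L[ℝ] N₂) : tw B p r n a (b + b') = tw B p r n a b + tw B p r n a b' := by
  by_cases h : p + r = n
  · ext v
    refine factorial_cancel (p := p) (r := r) ?_
    rw [ContinuousAlternatingMap.add_apply, smul_add]
    simp only [factorial_smul_tw B h, ← Finset.sum_add_distrib, ContinuousAlternatingMap.add_apply,
      map_add, smul_add]
  · simp [tw_of_ne B h]

theorem tw_smul_left (B : N₁ →ₗ[ℝ] N₂ →ₗ[ℝ] N) {p r n : ℕ} (c : ℝ) (a : V [⋀^Fin p]→L[ℝ] N₁)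
    (b : V [⋀^Fin r]→L[ℝ] N₂) : tw B p r n (c • a) b = c • tw B p r n a b := by
  by_cases h : p + r = n
  · ext v
    refine factorial_cancel (p := p) (r := r) ?_
    rw [ContinuousAlternatingMap.smul_apply, smul_comm]
    simp only [factorial_smul_tw B h, Finset.smul_sum, ContinuousAlternatingMap.smul_apply,
      map_smul, LinearMap.smul_apply]
    exact Finset.sum_congr rfl fun _ _ => smul_comm _ _ _
  · simp [tw_of_ne B h]

theorem tw_smul_right (B : N₁ →ₗ[ℝ] N₂ →ₗ[ℝ] N) {p r n : ℕ} (c : ℝ) (a : V [⋀^Fin p]→L[ℝ] N₁)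
    (b : V [⋀^Fin r]→L[ℝ] N₂) : tw B p r n a (c • b) = c • tw B p r n a b := by
  by_cases h : p + r = n
  · ext v
    refine factorial_cancel (p := p) (r := r) ?_
    rw [ContinuousAlternatingMap.smul_apply, smul_comm]
    simp only [factorial_smul_tw B h, Finset.smul_sum, ContinuousAlternatingMap.smul_apply,
      map_smul]
    exact Finset.sum_congr rfl fun _ _ => smul_comm _ _ _
  · simp [tw_of_ne B h]

/-- The wedge product as a bilinear map. -/
def twL (B : N₁ →ₗ[ℝ] N₂ →ₗ[ℝ] N) (p r n : ℕ) :
    (V [⋀^Fin p]→L[ℝ] N₁) →ₗ[ℝ] (V [⋀^Fin r]→L[ℝ] N₂) →ₗ[ℝ] V [⋀^Fin n]→L[ℝ] N :=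
  LinearMap.mk₂ ℝ (tw B p r n) (fun _ _ _ => tw_add_left ..) (fun _ _ _ => tw_smul_left ..)
    (fun _ _ _ => tw_add_right ..) (fun _ _ _ => tw_smul_right ..)

theorem twL_apply (B : N₁ →ₗ[ℝ] N₂ →ₗ[ℝ] N) (p r n : ℕ) (a : V [⋀^Fin p]→L[ℝ] N₁)
    (b : V [⋀^Fin r]→L[ℝ] N₂) : twL B p r n a b = tw B p r n a b := rfl

theorem tw_zero_left (B : N₁ →ₗ[ℝ] N₂ →ₗ[ℝ] N) {p r n : ℕ} (b : V [⋀^Fin r]→L[ℝ] N₂) :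
    tw B p r n 0 b = 0 := by rw [← twL_apply, map_zero, LinearMap.zero_apply]

theorem tw_zero_right (B : N₁ →ₗ[ℝ] N₂ →ₗ[ℝ] N) {p r n : ℕ} (a : V [⋀^Fin p]→L[ℝ] N₁) :
    tw B p r n a 0 = 0 := by rw [← twL_apply, map_zero]

theorem tw_sub_left (B : N₁ →ₗ[ℝ] N₂ →ₗ[ℝ] N) {p r n : ℕ} (a a' : V [⋀^Fin p]→L[ℝ] N₁)
    (b : V [⋀^Fin r]→L[ℝ] N₂) : tw B p r n (a - a') b = tw B p r n a b - tw B p r n a' b := by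
  simp only [← twL_apply, map_sub, LinearMap.sub_apply]

theorem tw_sum_left {ι : Type*} (B : N₁ →ₗ[ℝ] N₂ →ₗ[ℝ] N) {p r n : ℕ} (s : Finset ι)
    (a : ι → V [⋀^Fin p]→L[ℝ] N₁) (b : V [⋀^Fin r]→L[ℝ] N₂) :
    tw B p r n (∑ i ∈ s, a i) b = ∑ i ∈ s, tw B p r n (a i) b := by
  simp only [← twL_apply, map_sum, LinearMap.sum_apply]

theorem tw_sum_right {ι : Type*} (B : N₁ →ₗ[ℝ] N₂ →ₗ[ℝ] N) {p r n : ℕ} (s : Finset ι)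
    (a : V [⋀^Fin p]→L[ℝ] N₁) (b : ι → V [⋀^Fin r]→L[ℝ] N₂) :
    tw B p r n a (∑ i ∈ s, b i) = ∑ i ∈ s, tw B p r n a (b i) := by
  simp only [← twL_apply, map_sum]

theorem iota_add (u : V) {p : ℕ} (a b : V [⋀^Fin p]→L[ℝ] N) :
    iota u (a + b) = iota u a + iota u b := by
  cases p with
  | zero => simp [iota]
  | succ p => rfl

theorem iota_smul (u : V) {p : ℕ} (c : ℝ) (a : V [⋀^Fin p]→L[ℝ] N) :
    iota u (c • a) = c • iota u a := by
  cases p with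
  | zero => simp [iota]
  | succ p => rfl

theorem ext_iota {n : ℕ} {a b : V [⋀^Fin (n + 1)]→L[ℝ] N} (h : ∀ u, iota u a = iota u b) :
    a = b := by
  ext v
  have := congrArg (fun f => f (Matrix.vecTail v)) (h (Matrix.vecHead v))
  simpa [iota, contract_apply] using this

/-- The contraction is an antiderivation. -/
theorem iota_tw (B : N₁ →ₗ[ℝ] N₂ →ₗ[ℝ] N) {p r n : ℕ} (h : p + r = n) (u : V)
    (a : V [⋀^Fin p]→L[ℝ] N₁) (b : V [⋀^Fin r]→L[ℝ] N₂) :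
    iota u (tw B p r n a b) = tw B (p - 1) r (n - 1) (iota u a) b +
      (-1 : ℝ) ^ p • tw B p (r - 1) (n - 1) a (iota u b) := by
  cases n with
  | zero =>
    obtain ⟨rfl, rfl⟩ : p = 0 ∧ r = 0 := by omega
    simp [iota, tw_zero_left, tw_zero_right]
  | succ m =>
    ext v
    refine factorial_cancel (p := p) (r := r) ?_
    change ((p.factorial * r.factorial : ℕ) : ℝ) • tw B p r (m + 1) a b (Matrix.vecCons u v) = _
    rw [factorial_smul_tw B h]
    refine Eq.trans (sum_perm_cons (V := V) (fun w => B (a fun i => w (Fin.cast h (Fin.castAdd r i)))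
      (b fun j => w (Fin.cast h (Fin.natAdd p j)))) u v) ?_
    rw [← (finCongr h).sum_comp, Fin.sum_univ_add, ContinuousAlternatingMap.add_apply, smul_add]
    congr 1
    · cases p with
      | zero => simp [iota, tw_zero_left]
      | succ p =>
        have h' : p + r = m := by omega
        have hfac : ((((p + 1).factorial * r.factorial : ℕ)) : ℝ) =
            ((p + 1 : ℕ) : ℝ) * ((p.factorial * r.factorial : ℕ) : ℝ) := by
          push_cast [Nat.factorial_succ]; ring
        rw [hfac, mul_smul]
        change _ = ((p + 1 : ℕ) : ℝ) • (_ • (tw B p r m (contract u a) b) v)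
        rw [factorial_smul_tw B h', Nat.cast_smul_eq_nsmul]
        have key : ∀ j : Fin (p + 1), ∀ τ : Equiv.Perm (Fin m),
            ((-1 : ℝ) ^ ((Fin.cast h (Fin.castAdd r j) : Fin (m + 1)) : ℕ) *
              ((Equiv.Perm.sign τ : ℤ) : ℝ)) •
            B (a fun i => (Fin.insertNth (Fin.cast h (Fin.castAdd r j)) u (v ∘ τ)
                : Fin (m + 1) → V) (Fin.cast h (Fin.castAdd r i)))
              (b fun k => (Fin.insertNth (Fin.cast h (Fin.castAdd r j)) u (v ∘ τ)
                : Fin (m + 1) → V) (Fin.cast h (Fin.natAdd (p + 1) k))) =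
            ((Equiv.Perm.sign τ : ℤ) : ℝ) •
              B (contract u a fun i => v (τ (Fin.cast h' (Fin.castAdd r i))))
                (b fun k => v (τ (Fin.cast h' (Fin.natAdd p k)))) := by
          intro j τ
          have e1 : (fun i => (Fin.insertNth (Fin.cast h (Fin.castAdd r j)) u
              (v ∘ τ) : Fin (m + 1) → V) (Fin.cast h (Fin.castAdd r i))) =
              j.insertNth u fun i => v (τ (Fin.cast h' (Fin.castAdd r i))) := by
            funext i
            refine Fin.succAboveCases j ?_ (fun i => ?_) i
            · rw [Fin.insertNth_apply_same]
              exact (Fin.insertNth_apply_same (α := fun _ => V) j u _).symm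
            · rw [Fin.insertNth_apply_succAbove]
              have : Fin.cast h (Fin.castAdd r (j.succAbove i)) =
                  Fin.succAbove (Fin.cast h (Fin.castAdd r j))
                    (Fin.cast h' (Fin.castAdd r i)) := by
                ext
                simp only [Fin.val_cast, Fin.val_castAdd, Fin.succAbove, Fin.lt_def,
                  Fin.val_castSucc]
                split_ifs <;> simp
              rw [this, Fin.insertNth_apply_succAbove]; rfl
          have e2 : (fun k => (Fin.insertNth (Fin.cast h (Fin.castAdd r j)) u
              (v ∘ τ) : Fin (m + 1) → V) (Fin.cast h (Fin.natAdd (p + 1) k))) =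
              fun k => v (τ (Fin.cast h' (Fin.natAdd p k))) := by
            funext k
            have : Fin.cast h (Fin.natAdd (p + 1) k) =
                Fin.succAbove (Fin.cast h (Fin.castAdd r j)) (Fin.cast h' (Fin.natAdd p k)) := by
              ext
              have := j.2
              simp only [Fin.val_cast, Fin.val_castAdd, Fin.val_natAdd, Fin.succAbove, Fin.lt_def,
                Fin.val_castSucc]
              split_ifs <;> simp <;> omega
            rw [this, Fin.insertNth_apply_succAbove]; rfl
          rw [e1, e2, map_insertNth_real]
          simp only [map_smul, LinearMap.smul_apply, smul_smul, contract_apply, Fin.val_cast,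
            Fin.val_castAdd]
          rw [mul_right_comm, ← mul_pow]
          norm_num
        refine (Finset.sum_congr rfl fun j _ => Finset.sum_congr rfl fun τ _ => key j τ).trans ?_
        simp
    · cases r with
      | zero => simp [iota, tw_zero_right]
      | succ r =>
        have h' : p + r = m := by omega
        have hfac : (((p.factorial * (r + 1).factorial : ℕ)) : ℝ) =
            ((r + 1 : ℕ) : ℝ) * ((p.factorial * r.factorial : ℕ) : ℝ) := by
          push_cast [Nat.factorial_succ]; ring
        rw [hfac, mul_smul]
        change _ = ((r + 1 : ℕ) : ℝ) • (_ • ((-1 : ℝ) ^ p • (tw B p r m a (contract u b) v)))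
        rw [smul_comm _ ((-1 : ℝ) ^ p), factorial_smul_tw B h', Nat.cast_smul_eq_nsmul]
        have key : ∀ j : Fin (r + 1), ∀ τ : Equiv.Perm (Fin m),
            ((-1 : ℝ) ^ ((Fin.cast h (Fin.natAdd p j) : Fin (m + 1)) : ℕ) *
              ((Equiv.Perm.sign τ : ℤ) : ℝ)) •
            B (a fun i => (Fin.insertNth (Fin.cast h (Fin.natAdd p j)) u (v ∘ τ)
                : Fin (m + 1) → V) (Fin.cast h (Fin.castAdd (r + 1) i)))
              (b fun k => (Fin.insertNth (Fin.cast h (Fin.natAdd p j)) u (v ∘ τ)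
                : Fin (m + 1) → V) (Fin.cast h (Fin.natAdd p k))) =
            (-1 : ℝ) ^ p • ((Equiv.Perm.sign τ : ℤ) : ℝ) •
              B (a fun i => v (τ (Fin.cast h' (Fin.castAdd r i))))
                (contract u b fun k => v (τ (Fin.cast h' (Fin.natAdd p k)))) := by
          intro j τ
          have e1 : (fun k => (Fin.insertNth (Fin.cast h (Fin.natAdd p j)) u
              (v ∘ τ) : Fin (m + 1) → V) (Fin.cast h (Fin.natAdd p k))) =
              j.insertNth u fun i => v (τ (Fin.cast h' (Fin.natAdd p i))) := by
            funext i
            refine Fin.succAboveCases j ?_ (fun i => ?_) i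
            · rw [Fin.insertNth_apply_same]
              exact (Fin.insertNth_apply_same (α := fun _ => V) j u _).symm
            · rw [Fin.insertNth_apply_succAbove]
              have : Fin.cast h (Fin.natAdd p (j.succAbove i)) =
                  Fin.succAbove (Fin.cast h (Fin.natAdd p j))
                    (Fin.cast h' (Fin.natAdd p i)) := by
                ext
                simp only [Fin.val_cast, Fin.val_natAdd, Fin.succAbove, Fin.lt_def,
                  Fin.val_castSucc, add_lt_add_iff_left]
                split_ifs <;> simp [add_assoc]
              rw [this, Fin.insertNth_apply_succAbove]; rfl
          have e2 : (fun k => (Fin.insertNth (Fin.cast h (Fin.natAdd p j)) u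
              (v ∘ τ) : Fin (m + 1) → V) (Fin.cast h (Fin.castAdd (r + 1) k))) =
              fun k => v (τ (Fin.cast h' (Fin.castAdd r k))) := by
            funext k
            have : Fin.cast h (Fin.castAdd (r + 1) k) =
                Fin.succAbove (Fin.cast h (Fin.natAdd p j)) (Fin.cast h' (Fin.castAdd r k)) := by
              ext
              have := k.2
              simp only [Fin.val_cast, Fin.val_castAdd, Fin.val_natAdd, Fin.succAbove, Fin.lt_def,
                Fin.val_castSucc]
              split_ifs <;> simp <;> omega
            rw [this, Fin.insertNth_apply_succAbove]; rfl
          rw [e1, e2, map_insertNth_real]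
          simp only [map_smul, smul_smul, contract_apply, Fin.val_cast, Fin.val_natAdd]
          have hs : ((-1 : ℝ) ^ (j : ℕ) * (-1) ^ (j : ℕ)) = 1 := by rw [← mul_pow]; norm_num
          congr 1
          rw [pow_add]
          linear_combination (-1 : ℝ) ^ p * ((Equiv.Perm.sign τ : ℤ) : ℝ) * hs
        rw [Finset.smul_sum]
        refine (Finset.sum_congr rfl fun j _ => Finset.sum_congr rfl fun τ _ => key j τ).trans ?_
        simp

theorem iota_of_eq_zero {p : ℕ} (hp : p = 0) (u : V) (a : V [⋀^Fin p]→L[ℝ] N) : iota u a = 0 := by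
  subst hp; rfl

theorem tw_zero_zero (B : N₁ →ₗ[ℝ] N₂ →ₗ[ℝ] N) (a : V [⋀^Fin 0]→L[ℝ] N₁)
    (b : V [⋀^Fin 0]→L[ℝ] N₂) (v : Fin 0 → V) : tw B 0 0 0 a b v = B (a v) (b v) := by
  have h := factorial_smul_tw B (p := 0) (r := 0) (n := 0) rfl a b v
  simp only [Nat.factorial, mul_one, Nat.cast_one, one_smul, Finset.univ_unique,
    Finset.sum_singleton] at h
  rw [h]
  simp only [Equiv.Perm.default_eq, Equiv.Perm.sign_one, Units.val_one, Int.cast_one, one_smul]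
  rw [Subsingleton.elim (fun i => v ((1 : Equiv.Perm (Fin 0)) (Fin.cast rfl (Fin.castAdd 0 i)))) v,
    Subsingleton.elim (fun i => v ((1 : Equiv.Perm (Fin 0)) (Fin.cast rfl (Fin.natAdd 0 i)))) v]

theorem contract_tw (B : N₁ →ₗ[ℝ] N₂ →ₗ[ℝ] N) {p r n : ℕ} (h : p + r = n + 1) (u : V)
    (a : V [⋀^Fin p]→L[ℝ] N₁) (b : V [⋀^Fin r]→L[ℝ] N₂) :
    contract u (tw B p r (n + 1) a b) = tw B (p - 1) r n (iota u a) b +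
      (-1 : ℝ) ^ p • tw B p (r - 1) n a (iota u b) := iota_tw B h u a b

theorem contract_smul {p : ℕ} (u : V) (c : ℝ) (a : V [⋀^Fin (p + 1)]→L[ℝ] N) :
    contract u (c • a) = c • contract u a := rfl

theorem contract_add {p : ℕ} (u : V) (a b : V [⋀^Fin (p + 1)]→L[ℝ] N) :
    contract u (a + b) = contract u a + contract u b := rfl

theorem ext_contract {n : ℕ} {a b : V [⋀^Fin (n + 1)]→L[ℝ] N} (h : ∀ u, contract u a = contract u b) :
    a = b := ext_iota h

theorem tw_assoc (B₁₂ : N₁ →ₗ[ℝ] N₂ →ₗ[ℝ] N₁₂) (B : N₁₂ →ₗ[ℝ] N₃ →ₗ[ℝ] N)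
    (B₂₃ : N₂ →ₗ[ℝ] N₃ →ₗ[ℝ] N₂₃) (B' : N₁ →ₗ[ℝ] N₂₃ →ₗ[ℝ] N)
    (hB : ∀ x y z, B (B₁₂ x y) z = B' x (B₂₃ y z)) (n : ℕ) : ∀ {p r s m k : ℕ} (_ : p + r = m)
    (_ : r + s = k) (a : V [⋀^Fin p]→L[ℝ] N₁) (b : V [⋀^Fin r]→L[ℝ] N₂) (c : V [⋀^Fin s]→L[ℝ] N₃),
    tw B m s n (tw B₁₂ p r m a b) c = tw B' p k n a (tw B₂₃ r s k b c) := by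
  induction n with
  | zero =>
    intro p r s m k hm hk a b c
    by_cases h : m + s = 0
    · obtain ⟨rfl, rfl, rfl⟩ : p = 0 ∧ r = 0 ∧ s = 0 := by omega
      obtain ⟨rfl, rfl⟩ : m = 0 ∧ k = 0 := by omega
      ext v
      simp only [tw_zero_zero, hB]
    · rw [tw_of_ne B h, tw_of_ne B' (by omega)]
  | succ n ih =>
    intro p r s m k hm hk a b c
    by_cases h : m + s = n + 1
    · refine ext_contract fun u => ?_
      have h' : p + k = n + 1 := by omega
      rw [contract_tw B h, contract_tw B' h', iota_tw B₁₂ hm, iota_tw B₂₃ hk]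
      simp only [tw_add_left, tw_add_right, tw_smul_left, tw_smul_right,
        smul_add, smul_smul]
      have e1 : tw B (m - 1) s n (tw B₁₂ (p - 1) r (m - 1) (iota u a) b) c =
          tw B' (p - 1) k n (iota u a) (tw B₂₃ r s k b c) := by
        by_cases hp : p = 0
        · simp only [iota_of_eq_zero hp, tw_zero_left]
        · exact ih (by omega) (by omega) _ _ _
      have e2 : tw B (m - 1) s n (tw B₁₂ p (r - 1) (m - 1) a (iota u b)) c =
          tw B' p (k - 1) n a (tw B₂₃ (r - 1) s (k - 1) (iota u b) c) := by
        by_cases hp : r = 0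
        · simp only [iota_of_eq_zero hp, tw_zero_left, tw_zero_right]
        · exact ih (by omega) (by omega) _ _ _
      have e3 : tw B m (s - 1) n (tw B₁₂ p r m a b) (iota u c) =
          tw B' p (k - 1) n a (tw B₂₃ r (s - 1) (k - 1) b (iota u c)) := by
        by_cases hp : s = 0
        · simp only [iota_of_eq_zero hp, tw_zero_right]
        · exact ih (by omega) (by omega) _ _ _
      rw [e1, e2, e3, ← hm, pow_add, add_assoc]
    · rw [tw_of_ne B h, tw_of_ne B' (by omega)]

theorem tw_comm (B : N₁ →ₗ[ℝ] N₂ →ₗ[ℝ] N) (n : ℕ) : ∀ {p r : ℕ} (a : V [⋀^Fin p]→L[ℝ] N₁)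
    (b : V [⋀^Fin r]→L[ℝ] N₂), tw B p r n a b = (-1 : ℝ) ^ (p * r) • tw B.flip r p n b a := by
  induction n with
  | zero =>
    intro p r a b
    by_cases h : p + r = 0
    · obtain ⟨rfl, rfl⟩ : p = 0 ∧ r = 0 := by omega
      ext v
      simp [tw_zero_zero]
    · rw [tw_of_ne B h, tw_of_ne _ (by omega), smul_zero]
  | succ n ih =>
    intro p r a b
    by_cases h : p + r = n + 1
    · refine ext_contract fun u => ?_
      rw [contract_smul, contract_tw B h, contract_tw B.flip (by omega : r + p = n + 1)]
      simp only [smul_add, smul_smul]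
      rw [add_comm, ih (iota u a) b, ih a (iota u b), smul_smul]
      congr 1
      · cases r with
        | zero => simp [iota, tw_zero_left]
        | succ r =>
          congr 1
          rw [Nat.add_sub_cancel, ← pow_add]
          congr 1; ring
      · cases p with
        | zero => simp [iota, tw_zero_right]
        | succ p =>
          congr 1
          rw [Nat.add_sub_cancel, ← pow_add, show (p + 1) * r + r = p * r + 2 * r by ring, pow_add,
            pow_mul _ 2]
          norm_num
    · rw [tw_of_ne B h, tw_of_ne _ (by omega), smul_zero]

/-- Moving a form of degree `r` to the front. -/
theorem tw_left_comm (B₂₃ : N₂ →ₗ[ℝ] N₃ →ₗ[ℝ] N₂₃) (B : N₁ →ₗ[ℝ] N₂₃ →ₗ[ℝ] N)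
    (B₁₃ : N₁ →ₗ[ℝ] N₃ →ₗ[ℝ] N₁₂) (B' : N₂ →ₗ[ℝ] N₁₂ →ₗ[ℝ] N)
    (hB : ∀ x y z, B x (B₂₃ y z) = B' y (B₁₃ x z)) (n : ℕ) : ∀ {p r s m k : ℕ} (_ : p + s = m)
    (_ : r + s = k) (a : V [⋀^Fin p]→L[ℝ] N₁) (b : V [⋀^Fin r]→L[ℝ] N₂) (c : V [⋀^Fin s]→L[ℝ] N₃),
    tw B p k n a (tw B₂₃ r s k b c) = (-1 : ℝ) ^ (p * r) • tw B' r m n b (tw B₁₃ p s m a c) := by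
  induction n with
  | zero =>
    intro p r s m k hm hk a b c
    by_cases h : p + k = 0
    · obtain ⟨rfl, rfl, rfl⟩ : p = 0 ∧ r = 0 ∧ s = 0 := by omega
      obtain ⟨rfl, rfl⟩ : m = 0 ∧ k = 0 := by omega
      ext v
      simp [tw_zero_zero, hB]
    · rw [tw_of_ne B h, tw_of_ne B' (by omega), smul_zero]
  | succ n ih =>
    intro p r s m k hm hk a b c
    by_cases h : p + k = n + 1
    · refine ext_contract fun u => ?_
      have h' : r + m = n + 1 := by omega
      rw [contract_smul, contract_tw B h, contract_tw B' h', iota_tw B₁₃ hm, iota_tw B₂₃ hk]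
      simp only [tw_add_right, tw_smul_right, smul_add, smul_smul]
      have e1 : tw B (p - 1) k n (iota u a) (tw B₂₃ r s k b c) = ((-1 : ℝ) ^ (p * r) * (-1) ^ r) •
          tw B' r (m - 1) n b (tw B₁₃ (p - 1) s (m - 1) (iota u a) c) := by
        cases p with
        | zero => simp only [iota, tw_zero_left, tw_zero_right, smul_zero]
        | succ p =>
          rw [ih (m := m - 1) (by omega) (by omega)]
          congr 1
          rw [Nat.add_sub_cancel, ← pow_add, show (p + 1) * r + r = p * r + 2 * r by ring, pow_add,
            pow_mul _ 2]
          norm_num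
      have e2 : (-1 : ℝ) ^ p • tw B p (k - 1) n a (tw B₂₃ (r - 1) s (k - 1) (iota u b) c) =
          (-1 : ℝ) ^ (p * r) • tw B' (r - 1) m n (iota u b) (tw B₁₃ p s m a c) := by
        cases r with
        | zero => simp only [iota, tw_zero_left, tw_zero_right, smul_zero]
        | succ r =>
          rw [ih (m := m) (by omega) (by omega), smul_smul]
          congr 1
          rw [Nat.add_sub_cancel, ← pow_add]
          congr 1; ring
      have e3 : tw B p (k - 1) n a (tw B₂₃ r (s - 1) (k - 1) b (iota u c)) = (-1 : ℝ) ^ (p * r) •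
          tw B' r (m - 1) n b (tw B₁₃ p (s - 1) (m - 1) a (iota u c)) := by
        by_cases hp : s = 0
        · simp only [iota_of_eq_zero hp, tw_zero_right, smul_zero]
        · exact ih (by omega) (by omega) _ _ _
      rw [e1, e2, e3, smul_smul]
      rw [show (-1 : ℝ) ^ p * (-1) ^ r * (-1) ^ (p * r) = (-1 : ℝ) ^ (p * r) * ((-1) ^ r * (-1) ^ p)
        by ring]
      abel
    · rw [tw_of_ne B h, tw_of_ne B' (by omega), smul_zero]

/-- The wedge product is natural for pullbacks and for linear maps of the values. -/
theorem tw_natural {N₁' N₂' N' : Type*} [AddCommGroup N₁'] [Module ℝ N₁'] [TopologicalSpace N₁']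
    [IsTopologicalAddGroup N₁'] [ContinuousSMul ℝ N₁'] [AddCommGroup N₂'] [Module ℝ N₂']
    [TopologicalSpace N₂'] [IsTopologicalAddGroup N₂'] [ContinuousSMul ℝ N₂'] [AddCommGroup N']
    [Module ℝ N'] [TopologicalSpace N'] [IsTopologicalAddGroup N'] [ContinuousSMul ℝ N']
    (L : V' →L[ℝ] V) (f₁ : N₁ →L[ℝ] N₁') (f₂ : N₂ →L[ℝ] N₂') (f : N →L[ℝ] N')
    (B : N₁ →ₗ[ℝ] N₂ →ₗ[ℝ] N) (B' : N₁' →ₗ[ℝ] N₂' →ₗ[ℝ] N')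
    (hB : ∀ x y, f (B x y) = B' (f₁ x) (f₂ y)) {p r n : ℕ} (a : V [⋀^Fin p]→L[ℝ] N₁)
    (b : V [⋀^Fin r]→L[ℝ] N₂) :
    f.compContinuousAlternatingMap ((tw B p r n a b).compContinuousLinearMap L) =
      tw B' p r n (f₁.compContinuousAlternatingMap (a.compContinuousLinearMap L))
        (f₂.compContinuousAlternatingMap (b.compContinuousLinearMap L)) := by
  by_cases h : p + r = n
  · ext v
    refine factorial_cancel (p := p) (r := r) ?_
    rw [factorial_smul_tw B' h]
    change _ • f (tw B p r n a b (L ∘ v)) = _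
    rw [← map_smul, factorial_smul_tw B h, map_sum]
    simp only [map_smul, hB]
    rfl
  · rw [tw_of_ne B h, tw_of_ne B' h]
    ext v; simp

theorem tw_zero_apply (B : N₁ →ₗ[ℝ] N₂ →ₗ[ℝ] N) (n : ℕ) : ∀ (a : V [⋀^Fin 0]→L[ℝ] N₁)
    (b : V [⋀^Fin n]→L[ℝ] N₂) (v : Fin n → V), tw B 0 n n a b v = B (a ![]) (b v) := by
  induction n with
  | zero =>
    intro a b v
    rw [tw_zero_zero, Subsingleton.elim v ![]]
  | succ n ih =>
    intro a b v
    have h := congrArg (fun f => f (Matrix.vecTail v))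
      (contract_tw B (zero_add (n + 1)) (Matrix.vecHead v) a b)
    have h' : (tw B 0 (n + 1) (n + 1) a b) v =
        tw B 0 n n a (contract (Matrix.vecHead v) b) (Matrix.vecTail v) := by
      simpa [iota, contract_apply, tw_zero_left] using h
    rw [h', ih]
    simp [contract_apply]

theorem tw_apply_zero (B : N₁ →ₗ[ℝ] N₂ →ₗ[ℝ] N) (n : ℕ) (a : V [⋀^Fin n]→L[ℝ] N₁)
    (b : V [⋀^Fin 0]→L[ℝ] N₂) (v : Fin n → V) : tw B n 0 n a b v = B (a v) (b ![]) := by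
  rw [tw_comm]
  simp [tw_zero_apply]

theorem contract_tw_total (B : N₁ →ₗ[ℝ] N₂ →ₗ[ℝ] N) (p r n : ℕ) (u : V) (a : V [⋀^Fin p]→L[ℝ] N₁)
    (b : V [⋀^Fin r]→L[ℝ] N₂) :
    contract u (tw B p r (n + 1) a b) = tw B (p - 1) r n (iota u a) b +
      (-1 : ℝ) ^ p • tw B p (r - 1) n a (iota u b) := by
  by_cases h : p + r = n + 1
  · exact contract_tw B h u a b
  · have h1 : tw B (p - 1) r n (iota u a) b = 0 := by
      by_cases hp : p = 0
      · rw [iota_of_eq_zero hp, tw_zero_left]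
      · exact tw_of_ne _ (by omega) _ _
    have h2 : tw B p (r - 1) n a (iota u b) = 0 := by
      by_cases hr : r = 0
      · rw [iota_of_eq_zero hr, tw_zero_right]
      · exact tw_of_ne _ (by omega) _ _
    rw [tw_of_ne _ h, h1, h2, smul_zero, add_zero]
    rfl

theorem alt_eq_zero_of_iota : ∀ {r : ℕ} (a : V [⋀^Fin r]→L[ℝ] N) (v : Fin r → V) (j : Fin r),
    iota (v j) a = 0 → a v = 0
  | 0, _, _, j, _ => j.elim0
  | r + 1, a, v, j, h => by
    have h1 : a (Matrix.vecCons (v j) (j.removeNth v)) = 0 :=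
      congrArg (fun b : V [⋀^Fin r]→L[ℝ] N => b (j.removeNth v)) h
    have h2 := map_insertNth_real a j (v j) (j.removeNth v)
    rw [Fin.insertNth_self_removeNth, h1, smul_zero] at h2
    exact h2

theorem alt_congr_of_iota {r : ℕ} (a : V [⋀^Fin r]→L[ℝ] N) (w u : Fin r → V)
    (h : ∀ i, iota (u i) a = 0) : a (w + u) = a w := by
  classical
  have h1 := a.toMultilinearMap.map_add_univ w u
  refine h1.trans ?_
  rw [Finset.sum_eq_single Finset.univ]
  · rw [Finset.piecewise_univ]; rfl
  · intro s _ hs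
    obtain ⟨j, hj⟩ : ∃ j, j ∉ s := by
      by_contra hcon
      exact hs (Finset.eq_univ_iff_forall.2 fun j => by_contra fun hj => hcon ⟨j, hj⟩)
    refine alt_eq_zero_of_iota a _ j ?_
    rw [Finset.piecewise_eq_of_notMem _ _ _ hj]
    exact h j
  · intro hu; exact absurd (Finset.mem_univ _) hu

end Algebra

/-! ## The wedge product and the exterior derivative on a normed space -/

section Normed

variable {V : Type*} [NormedAddCommGroup V] [NormedSpace ℝ V] [FiniteDimensional ℝ V]
  {N₁ : Type*} [NormedAddCommGroup N₁] [NormedSpace ℝ N₁]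
  {N₂ : Type*} [NormedAddCommGroup N₂] [NormedSpace ℝ N₂]
  {N : Type*} [NormedAddCommGroup N] [NormedSpace ℝ N]

instance alternating_finiteDimensional [FiniteDimensional ℝ N] (p : ℕ) :
    FiniteDimensional ℝ (V [⋀^Fin p]→L[ℝ] N) := by
  let f : (V [⋀^Fin p]→L[ℝ] N) →ₗ[ℝ] MultilinearMap ℝ (fun _ : Fin p => V) N :=
    { toFun := fun a => a.toMultilinearMap
      map_add' := fun _ _ => rfl
      map_smul' := fun _ _ => rfl }
  refine FiniteDimensional.of_injective f fun a b h => ?_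
  ext v
  exact congrArg (fun g => g v) h

/-- The contraction as a linear map. -/
def iotaL (u : V) (p : ℕ) : (V [⋀^Fin p]→L[ℝ] N) →ₗ[ℝ] V [⋀^Fin (p - 1)]→L[ℝ] N where
  toFun := iota u
  map_add' := iota_add u
  map_smul' := iota_smul u

/-- The antisymmetrization `∑ᵢ (-1)ⁱ f(vᵢ)(v₀, …, v̂ᵢ, …)`. -/
def asym : ∀ {p : ℕ}, (V →ₗ[ℝ] V [⋀^Fin (p - 1)]→L[ℝ] N) →ₗ[ℝ] V [⋀^Fin p]→L[ℝ] N
  | 0 => 0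
  | p + 1 =>
    { toFun := fun f => ContinuousAlternatingMap.alternatizeUncurryFin
        (LinearMap.toContinuousLinearMap f)
      map_add' := fun f g => by
        rw [map_add, ContinuousAlternatingMap.alternatizeUncurryFin_add]
      map_smul' := fun c f => by
        rw [map_smul, ContinuousAlternatingMap.alternatizeUncurryFin_smul]; rfl }

theorem asym_apply {p : ℕ} (f : V →ₗ[ℝ] V [⋀^Fin p]→L[ℝ] N) (v : Fin (p + 1) → V) :
    asym (p := p + 1) f v = ∑ i : Fin (p + 1), (-1 : ℝ) ^ (i : ℕ) • f (v i) (i.removeNth v) := by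
  refine (ContinuousAlternatingMap.alternatizeUncurryFin_apply _ v).trans ?_
  refine Finset.sum_congr rfl fun i _ => ?_
  rcases Nat.even_or_odd (i : ℕ) with h' | h' <;> simp [h'.neg_one_pow]

theorem extDeriv_eq_asym {p : ℕ} (α : V → V [⋀^Fin p]→L[ℝ] N) (x : V) :
    extDeriv α x = asym (p := p + 1) (fderiv ℝ α x : V →ₗ[ℝ] V [⋀^Fin p]→L[ℝ] N) := rfl

theorem contract_asym {p : ℕ} (f : V →ₗ[ℝ] V [⋀^Fin p]→L[ℝ] N) (u : V) :
    contract u (asym (p := p + 1) f) = f u - asym (p := p) (iotaL u p ∘ₗ f) := by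
  ext v
  rw [contract_apply, asym_apply, Fin.sum_univ_succ, sub_eq_add_neg]
  rw [ContinuousAlternatingMap.add_apply, ContinuousAlternatingMap.neg_apply]
  congr 1
  · simp
  · cases p with
    | zero => simp [asym]
    | succ p =>
      rw [asym_apply, ← Finset.sum_neg_distrib]
      refine Finset.sum_congr rfl fun i _ => ?_
      have : i.succ.removeNth (Matrix.vecCons u v) = Matrix.vecCons u (i.removeNth v) := by
        funext j
        refine Fin.cases ?_ (fun j => ?_) j <;> simp [Fin.removeNth]
      rw [this, Fin.val_succ, pow_succ]
      simp [iotaL, iota, contract_apply]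

theorem asym_tw_left (B : N₁ →ₗ[ℝ] N₂ →ₗ[ℝ] N) (n : ℕ) : ∀ {p r : ℕ} (_ : p + r = n)
    (A : V →ₗ[ℝ] V [⋀^Fin p]→L[ℝ] N₁) (b : V [⋀^Fin r]→L[ℝ] N₂),
    asym (p := n + 1) ((twL B p r n).flip b ∘ₗ A) =
      tw B (p + 1) r (n + 1) (asym (p := p + 1) A) b := by
  induction n with
  | zero =>
    intro p r h A b
    obtain ⟨rfl, rfl⟩ : p = 0 ∧ r = 0 := by omega
    refine ext_contract fun u => ?_
    rw [contract_asym, contract_tw B (by omega)]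
    simp only [asym, LinearMap.zero_apply, sub_zero, iota, tw_zero_right, smul_zero, add_zero]
    have := contract_asym A u
    simp only [asym, LinearMap.zero_apply, sub_zero] at this
    exact congrArg (fun a => tw B 0 0 0 a b) this.symm
  | succ n ih =>
    intro p r h A b
    refine ext_contract fun u => ?_
    rw [contract_asym, contract_tw B (by omega)]
    have e0 : iotaL u (n + 1) ∘ₗ ((twL B p r (n + 1)).flip b ∘ₗ A) =
        (twL B (p - 1) r n).flip b ∘ₗ (iotaL u p ∘ₗ A) +
          (-1 : ℝ) ^ p • ((twL B p (r - 1) n).flip (iota u b) ∘ₗ A) := by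
      ext1 v
      exact contract_tw B h u (A v) b
    have e1 : asym (p := n + 1) ((twL B (p - 1) r n).flip b ∘ₗ (iotaL u p ∘ₗ A)) =
        tw B p r (n + 1) (asym (iotaL u p ∘ₗ A)) b := by
      cases p with
      | zero =>
        have : iotaL u 0 ∘ₗ A = 0 := rfl
        rw [this, LinearMap.comp_zero, map_zero, map_zero, tw_zero_left]
      | succ p => exact ih (by omega) _ _
    have e2 : asym (p := n + 1) ((twL B p (r - 1) n).flip (iota u b) ∘ₗ A) =
        tw B (p + 1) (r - 1) (n + 1) (asym (p := p + 1) A) (iota u b) := by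
      cases r with
      | zero => simp [iota, tw_zero_right]
      | succ r => exact ih (by omega) _ _
    have e3 : iota u (asym (p := p + 1) A) = A u - asym (p := p) (iotaL u p ∘ₗ A) :=
      contract_asym A u
    rw [e3]
    have e4 := (asym (N := N) (V := V) (p := n + 1)).map_add
      ((twL B (p - 1) r n).flip b ∘ₗ (iotaL u p ∘ₗ A))
      ((-1 : ℝ) ^ p • ((twL B p (r - 1) n).flip (iota u b) ∘ₗ A))
    rw [map_smul, e1, e2, ← e0] at e4
    rw [e4]
    change tw B p r (n + 1) (A u) b - _ = tw B p r (n + 1) _ b + _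
    rw [tw_sub_left, pow_succ]
    simp only [mul_neg, mul_one, neg_smul]
    abel

theorem asym_tw_right (B : N₁ →ₗ[ℝ] N₂ →ₗ[ℝ] N) {n p r : ℕ} (h : p + r = n)
    (a : V [⋀^Fin p]→L[ℝ] N₁) (C : V →ₗ[ℝ] V [⋀^Fin r]→L[ℝ] N₂) :
    asym (p := n + 1) (twL B p r n a ∘ₗ C) =
      (-1 : ℝ) ^ p • tw B p (r + 1) (n + 1) a (asym (p := r + 1) C) := by
  have e1 : twL B p r n a ∘ₗ C = (-1 : ℝ) ^ (p * r) • ((twL B.flip r p n).flip a ∘ₗ C) := by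
    ext1 v
    exact tw_comm B n a (C v)
  have e2 := (asym (N := N) (V := V) (p := n + 1)).map_smul ((-1 : ℝ) ^ (p * r))
    ((twL B.flip r p n).flip a ∘ₗ C)
  rw [asym_tw_left B.flip n (by omega)] at e2
  rw [e1]
  refine e2.trans ?_
  rw [tw_comm B (n + 1) a, smul_smul]
  congr 1
  rw [← pow_add, show p + p * (r + 1) = p * r + 2 * p by ring, pow_add, pow_mul _ 2]
  norm_num

/-- The wedge product as a continuous bilinear map. -/
def twCL [FiniteDimensional ℝ N₁] [FiniteDimensional ℝ N₂] (B : N₁ →ₗ[ℝ] N₂ →ₗ[ℝ] N) (p r n : ℕ) :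
    (V [⋀^Fin p]→L[ℝ] N₁) →L[ℝ] (V [⋀^Fin r]→L[ℝ] N₂) →L[ℝ] V [⋀^Fin n]→L[ℝ] N :=
  LinearMap.toContinuousBilinearMap (twL B p r n)

/-- The exterior derivative is an antiderivation. -/
theorem extDeriv_tw [FiniteDimensional ℝ N₁] [FiniteDimensional ℝ N₂] (B : N₁ →ₗ[ℝ] N₂ →ₗ[ℝ] N)
    {p r n : ℕ} (h : p + r = n) {α : V → V [⋀^Fin p]→L[ℝ] N₁} {β : V → V [⋀^Fin r]→L[ℝ] N₂} {x : V}
    (hα : DifferentiableAt ℝ α x) (hβ : DifferentiableAt ℝ β x) :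
    extDeriv (fun y => tw B p r n (α y) (β y)) x =
      tw B (p + 1) r (n + 1) (extDeriv α x) (β x) +
        (-1 : ℝ) ^ p • tw B p (r + 1) (n + 1) (α x) (extDeriv β x) := by
  have h1 : fderiv ℝ (fun y => tw B p r n (α y) (β y)) x =
      (twCL B p r n (α x)).comp (fderiv ℝ β x) + ((twCL B p r n).flip (β x)).comp (fderiv ℝ α x) :=
    ((twCL B p r n).hasFDerivAt_of_bilinear hα.hasFDerivAt hβ.hasFDerivAt).fderiv
  rw [extDeriv_eq_asym, h1, extDeriv_eq_asym α, extDeriv_eq_asym β, ← asym_tw_left B n h,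
    ← asym_tw_right B h]
  exact ((asym (N := N) (V := V) (p := n + 1)).map_add _ _).trans (add_comm _ _)

end Normed

/-! ## Smooth families of alternating maps -/

section SmoothFamilies

variable {E : Type*} [NormedAddCommGroup E] [NormedSpace ℝ E]
  {H : Type*} [TopologicalSpace H] {I : ModelWithCorners ℝ E H}
  {M : Type*} [TopologicalSpace M] [ChartedSpace H M]
  {V : Type*} [NormedAddCommGroup V] [NormedSpace ℝ V] [FiniteDimensional ℝ V]
  {V' : Type*} [NormedAddCommGroup V'] [NormedSpace ℝ V'] [FiniteDimensional ℝ V']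
  {F : Type*} [NormedAddCommGroup F] [NormedSpace ℝ F] [FiniteDimensional ℝ F]
  {F' : Type*} [NormedAddCommGroup F'] [NormedSpace ℝ F'] [FiniteDimensional ℝ F']

theorem contMDiffAt_of_injective {W : Type*} [NormedAddCommGroup W] [NormedSpace ℝ W]
    [FiniteDimensional ℝ W] (Φ : F →ₗ[ℝ] W) (hΦ : Function.Injective Φ) {f : M → F} {x : M}
    (h : ContMDiffAt I 𝓘(ℝ, W) ∞ (fun y => Φ (f y)) x) :
    ContMDiffAt I 𝓘(ℝ, F) ∞ f x := by
  obtain ⟨g, hg⟩ := Φ.exists_leftInverse_of_injective (LinearMap.ker_eq_bot.2 hΦ)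
  have : f = fun y => (LinearMap.toContinuousLinearMap g) (Φ (f y)) := by
    funext y
    exact (LinearMap.congr_fun hg (f y)).symm
  rw [this]
  exact (LinearMap.toContinuousLinearMap g).contMDiff.contMDiffAt.comp x h

theorem contMDiffAt_clm_of_apply {f : M → F →L[ℝ] F'} {x : M}
    (h : ∀ v, ContMDiffAt I 𝓘(ℝ, F') ∞ (fun y => f y v) x) :
    ContMDiffAt I 𝓘(ℝ, F →L[ℝ] F') ∞ f x := by
  let b := Module.finBasis ℝ F
  let Φ : (F →L[ℝ] F') →ₗ[ℝ] (Fin (Module.finrank ℝ F) → F') :=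
    { toFun := fun a r => a (b r)
      map_add' := fun _ _ => rfl
      map_smul' := fun _ _ => rfl }
  refine contMDiffAt_of_injective Φ (fun a a' haa => ?_) ?_
  · refine ContinuousLinearMap.coe_injective (b.ext fun i => ?_)
    exact congrFun haa i
  · exact contMDiffAt_pi_space.2 fun r => h _

theorem contMDiffAt_alt_of_apply {p : ℕ} {f : M → V [⋀^Fin p]→L[ℝ] F} {x : M}
    (h : ∀ v, ContMDiffAt I 𝓘(ℝ, F) ∞ (fun y => f y v) x) :
    ContMDiffAt I 𝓘(ℝ, V [⋀^Fin p]→L[ℝ] F) ∞ f x := by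
  let b := Module.finBasis ℝ V
  let Φ : (V [⋀^Fin p]→L[ℝ] F) →ₗ[ℝ] ((Fin p → Fin (Module.finrank ℝ V)) → F) :=
    { toFun := fun a r => a fun i => b (r i)
      map_add' := fun _ _ => rfl
      map_smul' := fun _ _ => rfl }
  refine contMDiffAt_of_injective Φ (fun a a' haa => ?_) ?_
  · have : a.toAlternatingMap = a'.toAlternatingMap :=
      AlternatingMap.coe_multilinearMap_injective <|
        Module.Basis.ext_multilinear (fun _ => b) fun r => congrFun haa r
    ext v
    exact congrArg (fun g => g v) this
  · exact contMDiffAt_pi_space.2 fun r => h _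

theorem contMDiffAt_alt_apply {p : ℕ} {f : M → V [⋀^Fin p]→L[ℝ] F} {w : M → Fin p → V} {x : M}
    (hf : ContMDiffAt I 𝓘(ℝ, V [⋀^Fin p]→L[ℝ] F) ∞ f x)
    (hw : ∀ i, ContMDiffAt I 𝓘(ℝ, V) ∞ (fun y => w y i) x) :
    ContMDiffAt I 𝓘(ℝ, F) ∞ (fun y => f y (w y)) x := by
  let b := Module.finBasis ℝ V
  have h : (fun y => f y (w y)) = fun y =>
      ∑ r : Fin p → Fin (Module.finrank ℝ V),
        (∏ i, b.coord (r i) (w y i)) • f y (fun i => b (r i)) := by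
    funext y
    conv_lhs => rw [show w y = fun i => ∑ j, b.coord j (w y i) • b j from
      funext fun i => by simp [b.sum_repr]]
    change (f y).toMultilinearMap _ = _
    rw [MultilinearMap.map_sum]
    exact Finset.sum_congr rfl fun r _ => MultilinearMap.map_smul_univ _ _ _
  rw [h]
  refine contMDiffAt_finsetSum fun r _ => ?_
  have h₁ : ContMDiffAt I 𝓘(ℝ, ℝ) ∞ (fun y => ∏ i, b.coord (r i) (w y i)) x := by
    refine contMDiffAt_finsetProd fun i _ => ?_
    exact (LinearMap.toContinuousLinearMap (b.coord (r i))).contMDiff.contMDiffAt.comp x (hw i)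
  have h₂ : ContMDiffAt I 𝓘(ℝ, F) ∞ (fun y => f y fun i => b (r i)) x := by
    let ev : (V [⋀^Fin p]→L[ℝ] F) →ₗ[ℝ] F :=
      { toFun := fun a => a fun i => b (r i)
        map_add' := fun _ _ => rfl
        map_smul' := fun _ _ => rfl }
    exact (LinearMap.toContinuousLinearMap ev).contMDiff.contMDiffAt.comp x hf
  exact h₁.smul h₂

theorem contMDiffAt_comp_alt_comp {p : ℕ} {f : M → V [⋀^Fin p]→L[ℝ] F} {L : M → V' →L[ℝ] V}
    {K : M → F →L[ℝ] F'} {x : M}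
    (hf : ContMDiffAt I 𝓘(ℝ, V [⋀^Fin p]→L[ℝ] F) ∞ f x)
    (hL : ContMDiffAt I 𝓘(ℝ, V' →L[ℝ] V) ∞ L x)
    (hK : ContMDiffAt I 𝓘(ℝ, F →L[ℝ] F') ∞ K x) :
    ContMDiffAt I 𝓘(ℝ, V' [⋀^Fin p]→L[ℝ] F') ∞
      (fun y => (K y).compContinuousAlternatingMap ((f y).compContinuousLinearMap (L y))) x :=
  contMDiffAt_alt_of_apply fun v => hK.clm_apply (f := fun y => f y fun i => L y (v i)) <|
    contMDiffAt_alt_apply hf fun _ => hL.clm_apply contMDiffAt_const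

theorem contMDiffAt_tw {N₁ N₂ : Type*} [NormedAddCommGroup N₁] [NormedSpace ℝ N₁]
    [FiniteDimensional ℝ N₁] [NormedAddCommGroup N₂] [NormedSpace ℝ N₂] [FiniteDimensional ℝ N₂]
    (B : N₁ →ₗ[ℝ] N₂ →ₗ[ℝ] F) {p r n : ℕ} {a : M → V [⋀^Fin p]→L[ℝ] N₁}
    {b : M → V [⋀^Fin r]→L[ℝ] N₂} {x : M}
    (ha : ContMDiffAt I 𝓘(ℝ, V [⋀^Fin p]→L[ℝ] N₁) ∞ a x)
    (hb : ContMDiffAt I 𝓘(ℝ, V [⋀^Fin r]→L[ℝ] N₂) ∞ b x) :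
    ContMDiffAt I 𝓘(ℝ, V [⋀^Fin n]→L[ℝ] F) ∞ (fun y => tw B p r n (a y) (b y)) x :=
  ((twCL B p r n).contMDiff.contMDiffAt.comp x ha).clm_apply hb

end SmoothFamilies

/-! ## Trivializations -/

section Triv

variable {EX : Type*} [NormedAddCommGroup EX] [NormedSpace ℝ EX] [FiniteDimensional ℝ EX]
  {X : Type*} [TopologicalSpace X] [ChartedSpace EX X]

/-- The set on which the trivialization of `A` at `x₀` is defined. -/
def VBundle.nb (A : VBundle.{v} EX X) (x₀ : X) : Set X := (trivializationAt A.F A.fib x₀).baseSet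

/-- The trivialization of `A` at `x₀`, on the fibre over `x`. -/
def VBundle.tr (A : VBundle.{v} EX X) (x₀ x : X) : A.fib x →L[ℝ] A.F :=
  (trivializationAt A.F A.fib x₀).continuousLinearMapAt ℝ x

/-- The inverse of the trivialization of `A` at `x₀`, on the fibre over `x`. -/
def VBundle.trs (A : VBundle.{v} EX X) (x₀ x : X) : A.F →L[ℝ] A.fib x :=
  (trivializationAt A.F A.fib x₀).symmL ℝ x

theorem VBundle.mem_nb (A : VBundle.{v} EX X) (x : X) : x ∈ A.nb x :=
  mem_baseSet_trivializationAt A.F A.fib x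

theorem VBundle.isOpen_nb (A : VBundle.{v} EX X) (x : X) : IsOpen (A.nb x) :=
  (trivializationAt A.F A.fib x).open_baseSet

theorem VBundle.tr_trs (A : VBundle.{v} EX X) {x₀ x : X} (h : x ∈ A.nb x₀) (a : A.F) :
    A.tr x₀ x (A.trs x₀ x a) = a :=
  (trivializationAt A.F A.fib x₀).continuousLinearMapAt_symmL h a

theorem VBundle.trs_tr (A : VBundle.{v} EX X) {x₀ x : X} (h : x ∈ A.nb x₀) (a : A.fib x) :
    A.trs x₀ x (A.tr x₀ x a) = a :=
  (trivializationAt A.F A.fib x₀).symmL_continuousLinearMapAt h a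

theorem VBundle.tr_eq (A : VBundle.{v} EX X) {x₀ x : X} (h : x ∈ A.nb x₀) (a : A.fib x) :
    A.tr x₀ x a = (trivializationAt A.F A.fib x₀ ⟨x, a⟩).2 := by
  rw [VBundle.tr, Trivialization.continuousLinearMapAt_apply, Trivialization.linearMapAt_apply]
  exact if_pos h

theorem VBundle.tr_injective (A : VBundle.{v} EX X) {x₀ x : X} (h : x ∈ A.nb x₀) :
    Function.Injective (A.tr x₀ x) := fun a b hab => by
  rw [← A.trs_tr h a, hab, A.trs_tr h]

theorem VBundle.contMDiffAt_tr_trs (A : VBundle.{v} EX X) {x₀ x₁ x : X} (h₀ : x ∈ A.nb x₀)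
    (h₁ : x ∈ A.nb x₁) : ContMDiffAt 𝓘(ℝ, EX) 𝓘(ℝ, A.F →L[ℝ] A.F) ∞
      (fun y => (A.tr x₁ y).comp (A.trs x₀ y)) x := by
  have h := contMDiffAt_coordChangeL (IB := 𝓘(ℝ, EX)) (n := ∞)
    (e := trivializationAt A.F A.fib x₀) (e' := trivializationAt A.F A.fib x₁) h₀ h₁
  refine h.congr_of_eventuallyEq ?_
  filter_upwards [(A.isOpen_nb x₀).mem_nhds h₀, (A.isOpen_nb x₁).mem_nhds h₁] with y hy₀ hy₁
  ext a
  change A.tr x₁ y (A.trs x₀ y a) = Trivialization.coordChangeL ℝ _ _ y a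
  rw [Trivialization.coordChangeL_apply _ _ ⟨hy₀, hy₁⟩, VBundle.tr_eq _ hy₁, VBundle.trs,
    Trivialization.symmL_apply]
  exact hy₀

/-- A vector in the fibre of the trivial line bundle as a number. -/
def lineVal (x : X) : (VBundle.line EX X).fib x →ₗ[ℝ] ℝ where
  toFun a := a
  map_add' _ _ := rfl
  map_smul' _ _ := rfl

theorem VBundle.line_tr (x₀ x : X) (a : (VBundle.line EX X).fib x) :
    (VBundle.line EX X).tr x₀ x a = lineVal x a :=
  VBundle.tr_eq (VBundle.line EX X) (Set.mem_univ _) a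

/-- A vector in the fibre of `Hom(A, B)` as a linear map. -/
def homVal (A B : VBundle.{v} EX X) (x : X) :
    (A.hom B).fib x →ₗ[ℝ] (A.fib x →L[ℝ] B.fib x) where
  toFun f := f
  map_add' _ _ := rfl
  map_smul' _ _ := rfl

theorem VBundle.hom_tr (A B : VBundle.{v} EX X) {x₀ x : X} (hA : x ∈ A.nb x₀) (hB : x ∈ B.nb x₀)
    (f : (A.hom B).fib x) :
    (A.hom B).tr x₀ x f = (B.tr x₀ x).comp ((homVal A B x f).comp (A.trs x₀ x)) :=
  VBundle.tr_eq (A.hom B) ⟨hA, hB⟩ f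

theorem fib_subsingleton (A : VBundle.{v} EX X) (h : ¬ Nontrivial A.F) (x : X) :
    Subsingleton (A.fib x) := by
  rw [not_nontrivial_iff_subsingleton] at h
  exact (A.tr_injective (A.mem_nb x)).subsingleton

instance fib_t2 (A : VBundle.{v} EX X) (x : X) : T2Space (A.fib x) := FiberBundle.t2Space A.F A.fib x

instance fib_finite (A : VBundle.{v} EX X) (x : X) : FiniteDimensional ℝ (A.fib x) :=
  VectorBundle.finiteDimensional ℝ A.F A.fib x

/-- The trivialization of the tangent bundle given by the preferred chart at `x₀`. -/
def tangentTr (x₀ x : X) [IsManifold 𝓘(ℝ, EX) ∞ X] : TangentSpace 𝓘(ℝ, EX) x →L[ℝ] EX :=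
  (trivializationAt EX (TangentSpace 𝓘(ℝ, EX) : X → Type _) x₀).continuousLinearMapAt ℝ x

/-- The inverse of `tangentTr`. -/
def tangentTrs (x₀ x : X) [IsManifold 𝓘(ℝ, EX) ∞ X] : EX →L[ℝ] TangentSpace 𝓘(ℝ, EX) x :=
  (trivializationAt EX (TangentSpace 𝓘(ℝ, EX) : X → Type _) x₀).symmL ℝ x

variable [IsManifold 𝓘(ℝ, EX) ∞ X]

theorem tangentTr_tangentTrs {x₀ x : X} (h : x ∈ (chartAt EX x₀).source) (a : EX) :
    tangentTr x₀ x (tangentTrs x₀ x a) = a :=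
  (trivializationAt EX (TangentSpace 𝓘(ℝ, EX) : X → Type _) x₀).continuousLinearMapAt_symmL h a

theorem tangentTrs_tangentTr {x₀ x : X} (h : x ∈ (chartAt EX x₀).source)
    (a : TangentSpace 𝓘(ℝ, EX) x) : tangentTrs x₀ x (tangentTr x₀ x a) = a :=
  (trivializationAt EX (TangentSpace 𝓘(ℝ, EX) : X → Type _) x₀).symmL_continuousLinearMapAt h a

theorem tangentTr_eq {x₀ x : X} (h : x ∈ (chartAt EX x₀).source) :
    tangentTr x₀ x = mfderiv 𝓘(ℝ, EX) 𝓘(ℝ, EX) (chartAt EX x₀) x := by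
  rw [tangentTr, TangentBundle.continuousLinearMapAt_trivializationAt h]
  simp
  rfl

theorem tangentTrs_eq {x₀ : X} {y : EX} (h : y ∈ (chartAt EX x₀).target) :
    tangentTrs (EX := EX) x₀ ((chartAt EX x₀).symm y) =
      mfderiv 𝓘(ℝ, EX) 𝓘(ℝ, EX) (chartAt EX x₀).symm y := by
  rw [tangentTrs, TangentBundle.symmL_trivializationAt ((chartAt EX x₀).map_target h)]
  simp only [modelWithCornersSelf_coe]
  have h₁ : extChartAt 𝓘(ℝ, EX) x₀ ((chartAt EX x₀).symm y) = y := by simp [h]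
  have h₂ : ∀ z : EX, z = y →
      (id (mfderivWithin 𝓘(ℝ, EX) 𝓘(ℝ, EX) (extChartAt 𝓘(ℝ, EX) x₀).symm (Set.range id) z) :
        EX →L[ℝ] EX) = id (mfderiv 𝓘(ℝ, EX) 𝓘(ℝ, EX) (chartAt EX x₀).symm y) := by
    rintro z rfl
    simp
    rfl
  exact h₂ _ h₁

end Triv

/-! ## Local smoothness of forms -/

section Manifolds

variable {EX : Type*} [NormedAddCommGroup EX] [NormedSpace ℝ EX] [FiniteDimensional ℝ EX]
  {X : Type*} [TopologicalSpace X] [ChartedSpace EX X] [IsManifold 𝓘(ℝ, EX) ∞ X]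
  {EM : Type*} [NormedAddCommGroup EM] [NormedSpace ℝ EM] [FiniteDimensional ℝ EM]
  {M : Type*} [TopologicalSpace M] [ChartedSpace EM M] [IsManifold 𝓘(ℝ, EM) ∞ M]

section LocalForms

/-- Smoothness of a form at a point. -/
def SmoothFormAt {A : VBundle.{v} EX X} {p : ℕ} (α : RawForm A p) (x₀ : X) : Prop :=
  ContMDiffAt 𝓘(ℝ, EX) (𝓘(ℝ, EX).prod 𝓘(ℝ, EX [⋀^Fin p]→L[ℝ] A.F)) ∞
    (fun x => TotalSpace.mk' (EX [⋀^Fin p]→L[ℝ] A.F)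
      (E := fun x : X => TangentSpace 𝓘(ℝ, EX) x [⋀^Fin p]→L[ℝ] A.fib x) x (α x)) x₀

/-- The form `α` in the trivializations at `x₀`. -/
def rep {A : VBundle.{v} EX X} {p : ℕ} (x₀ : X) (α : RawForm A p) (x : X) :
    EX [⋀^Fin p]→L[ℝ] A.F :=
  (A.tr x₀ x).compContinuousAlternatingMap ((α x).compContinuousLinearMap (tangentTrs x₀ x))

theorem SmoothForm.at {A : VBundle.{v} EX X} {p : ℕ} {α : RawForm A p} (h : SmoothForm α) (x : X) :
    SmoothFormAt α x := h x

theorem smoothForm_of_at {A : VBundle.{v} EX X} {p : ℕ} {α : RawForm A p}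
    (h : ∀ x, SmoothFormAt α x) : SmoothForm α := h

theorem smoothFormAt_iff {A : VBundle.{v} EX X} {p : ℕ} (α : RawForm A p) (x₀ : X) :
    SmoothFormAt α x₀ ↔ ContMDiffAt 𝓘(ℝ, EX) 𝓘(ℝ, EX [⋀^Fin p]→L[ℝ] A.F) ∞ (rep x₀ α) x₀ :=
  contMDiffAt_section _

theorem contMDiffAt_tangentTr_tangentTrs {x₀ x₁ x : X} (h₀ : x ∈ (chartAt EX x₀).source)
    (h₁ : x ∈ (chartAt EX x₁).source) : ContMDiffAt 𝓘(ℝ, EX) 𝓘(ℝ, EX →L[ℝ] EX) ∞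
      (fun y : X => (tangentTr (EX := EX) x₁ y).comp (tangentTrs x₀ y)) x := by
  have h := contMDiffAt_coordChangeL (IB := 𝓘(ℝ, EX)) (n := ∞)
    (e := trivializationAt EX (TangentSpace 𝓘(ℝ, EX) : X → Type _) x₀)
    (e' := trivializationAt EX (TangentSpace 𝓘(ℝ, EX) : X → Type _) x₁) h₀ h₁
  refine h.congr_of_eventuallyEq ?_
  filter_upwards [(chartAt EX x₀).open_source.mem_nhds h₀,
    (chartAt EX x₁).open_source.mem_nhds h₁] with y hy₀ hy₁
  ext a
  change tangentTr x₁ y (tangentTrs x₀ y a) = Trivialization.coordChangeL ℝ _ _ y a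
  rw [Trivialization.coordChangeL_apply _ _ ⟨hy₀, hy₁⟩, tangentTr, tangentTrs,
    Trivialization.continuousLinearMapAt_apply, Trivialization.linearMapAt_apply,
    Trivialization.symmL_apply]
  · exact if_pos hy₁
  · exact hy₀

theorem contMDiffAt_rep_of_rep {A : VBundle.{v} EX X} {p : ℕ} {α : RawForm A p} {x₀ x₁ x : X}
    (h₀ : x ∈ (chartAt EX x₀).source) (h₀' : x ∈ A.nb x₀)
    (h₁ : x ∈ (chartAt EX x₁).source) (h₁' : x ∈ A.nb x₁)
    (h : ContMDiffAt 𝓘(ℝ, EX) 𝓘(ℝ, EX [⋀^Fin p]→L[ℝ] A.F) ∞ (rep x₀ α) x) :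
    ContMDiffAt 𝓘(ℝ, EX) 𝓘(ℝ, EX [⋀^Fin p]→L[ℝ] A.F) ∞ (rep x₁ α) x := by
  refine (contMDiffAt_comp_alt_comp h (contMDiffAt_tangentTr_tangentTrs h₁ h₀)
    (A.contMDiffAt_tr_trs h₀' h₁')).congr_of_eventuallyEq ?_
  filter_upwards [(chartAt EX x₀).open_source.mem_nhds h₀, (A.isOpen_nb x₀).mem_nhds h₀']
    with y hy hy'
  ext v
  change A.tr x₁ y (α y fun i => tangentTrs x₁ y (v i)) = A.tr x₁ y (A.trs x₀ y (A.tr x₀ y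
    (α y fun i => tangentTrs x₀ y (tangentTr x₀ y (tangentTrs x₁ y (v i))))))
  rw [A.trs_tr hy']
  congr 2
  funext i
  exact (tangentTrs_tangentTr hy _).symm

theorem smoothFormAt_iff_rep {A : VBundle.{v} EX X} {p : ℕ} (α : RawForm A p) {x₀ x : X}
    (h : x ∈ (chartAt EX x₀).source) (h' : x ∈ A.nb x₀) :
    SmoothFormAt α x ↔ ContMDiffAt 𝓘(ℝ, EX) 𝓘(ℝ, EX [⋀^Fin p]→L[ℝ] A.F) ∞ (rep x₀ α) x := by
  rw [smoothFormAt_iff]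
  exact ⟨contMDiffAt_rep_of_rep (mem_chart_source EX x) (A.mem_nb x) h h',
    contMDiffAt_rep_of_rep h h' (mem_chart_source EX x) (A.mem_nb x)⟩

theorem SmoothFormAt.congr {A : VBundle.{v} EX X} {p : ℕ} {α β : RawForm A p} {x₀ : X}
    (h : SmoothFormAt α x₀) (hαβ : ∀ᶠ x in nhds x₀, β x = α x) : SmoothFormAt β x₀ :=
  ContMDiffAt.congr_of_eventuallyEq h (hαβ.mono fun x hx => congrArg _ hx)

theorem rep_add {A : VBundle.{v} EX X} {p : ℕ} (x₀ : X) (α β : RawForm A p) (x : X) :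
    rep x₀ (α + β) x = rep x₀ α x + rep x₀ β x := by
  ext v; simp [rep]

theorem rep_smul {A : VBundle.{v} EX X} {p : ℕ} (x₀ : X) (c : ℝ) (α : RawForm A p) (x : X) :
    rep x₀ (c • α) x = c • rep x₀ α x := by
  ext v; simp [rep]

theorem rep_injective {A : VBundle.{v} EX X} {p : ℕ} (x : X) {α β : RawForm A p}
    (h : rep x α x = rep x β x) : α x = β x := by
  refine ContinuousAlternatingMap.ext fun w => A.tr_injective (A.mem_nb x) ?_
  have h1 := congrArg (fun a => a fun i => tangentTr x x (w i)) h
  have h2 : (fun i => tangentTrs x x (tangentTr x x (w i))) = w :=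
    funext fun i => tangentTrs_tangentTr (mem_chart_source EX x) (w i)
  change A.tr x x (α x fun i => tangentTrs x x (tangentTr x x (w i))) =
    A.tr x x (β x fun i => tangentTrs x x (tangentTr x x (w i))) at h1
  rwa [h2] at h1

theorem SmoothFormAt.add {A : VBundle.{v} EX X} {p : ℕ} {α β : RawForm A p} {x₀ : X}
    (hα : SmoothFormAt α x₀) (hβ : SmoothFormAt β x₀) : SmoothFormAt (α + β) x₀ := by
  rw [smoothFormAt_iff] at *
  rw [funext (rep_add x₀ α β)]
  exact hα.add hβ

theorem SmoothFormAt.smul {A : VBundle.{v} EX X} {p : ℕ} {α : RawForm A p} {x₀ : X}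
    (c : ℝ) (hα : SmoothFormAt α x₀) : SmoothFormAt (c • α) x₀ := by
  rw [smoothFormAt_iff] at *
  rw [funext (rep_smul x₀ c α)]
  exact (c • ContinuousLinearMap.id ℝ (EX [⋀^Fin p]→L[ℝ] A.F)).contMDiff.contMDiffAt.comp x₀ hα

theorem smoothFormAt_zero {A : VBundle.{v} EX X} {p : ℕ} {x₀ : X} :
    SmoothFormAt (0 : RawForm A p) x₀ := by
  rw [smoothFormAt_iff]
  have : rep x₀ (0 : RawForm A p) = fun _ => 0 := by
    funext x; ext v; simp [rep]
  rw [this]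
  exact contMDiffAt_const

theorem SmoothFormAt.sum {ι : Type*} {A : VBundle.{v} EX X} {p : ℕ} {s : Finset ι}
    {α : ι → RawForm A p} {x₀ : X} (h : ∀ i ∈ s, SmoothFormAt (α i) x₀) :
    SmoothFormAt (∑ i ∈ s, α i) x₀ := by
  classical
  induction s using Finset.induction_on with
  | empty => rw [Finset.sum_empty]; exact smoothFormAt_zero
  | insert i s hi ih =>
    rw [Finset.sum_insert hi]
    exact (h i (Finset.mem_insert_self i s)).add (ih fun j hj => h j (Finset.mem_insert_of_mem hj))

/-- The pullback of a form along a map, followed by linear maps of the values. -/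
def pullMap {A : VBundle.{v} EX X} {A' : VBundle.{w} EM M} (f : M → X)
    (c : ∀ m, A.fib (f m) →L[ℝ] A'.fib m) {p : ℕ} (α : RawForm A p) : RawForm A' p :=
  fun m => (c m).compContinuousAlternatingMap
    ((α (f m)).compContinuousLinearMap (mfderiv 𝓘(ℝ, EM) 𝓘(ℝ, EX) f m))

theorem SmoothFormAt.pullMap {A : VBundle.{v} EX X} {A' : VBundle.{w} EM M} {f : M → X}
    {c : ∀ m, A.fib (f m) →L[ℝ] A'.fib m} {p : ℕ} {α : RawForm A p} {m₀ : M} {x₀ : X}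
    (hα : SmoothFormAt α (f m₀)) (hf : ContMDiffAt 𝓘(ℝ, EM) 𝓘(ℝ, EX) ∞ f m₀)
    (hx₀ : f m₀ ∈ A.nb x₀) {K : M → A.F →L[ℝ] A'.F}
    (hK : ContMDiffAt 𝓘(ℝ, EM) 𝓘(ℝ, A.F →L[ℝ] A'.F) ∞ K m₀)
    (hc : ∀ᶠ m in nhds m₀, ∀ a, A'.tr m₀ m (c m a) = K m (A.tr x₀ (f m) a)) :
    SmoothFormAt (ChernWeil.pullMap f c α) m₀ := by
  rw [smoothFormAt_iff] at hα ⊢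
  have hT : ContMDiffAt 𝓘(ℝ, EM) 𝓘(ℝ, EM →L[ℝ] EX) ∞
      (inTangentCoordinates 𝓘(ℝ, EM) 𝓘(ℝ, EX) id f (mfderiv 𝓘(ℝ, EM) 𝓘(ℝ, EX) f) m₀) m₀ :=
    hf.mfderiv_const le_rfl
  have hK' : ContMDiffAt 𝓘(ℝ, EM) 𝓘(ℝ, A.F →L[ℝ] A'.F) ∞
      (fun m => (K m).comp ((A.tr x₀ (f m)).comp (A.trs (f m₀) (f m)))) m₀ :=
    hK.clm_comp ((A.contMDiffAt_tr_trs (A.mem_nb _) hx₀).comp m₀ hf)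
  refine (contMDiffAt_comp_alt_comp (hα.comp m₀ hf) hT hK').congr_of_eventuallyEq ?_
  filter_upwards [hc, hf.continuousAt.preimage_mem_nhds ((A.isOpen_nb _).mem_nhds (A.mem_nb (f m₀))),
    hf.continuousAt.preimage_mem_nhds (chart_source_mem_nhds EX (f m₀)),
    chart_source_mem_nhds EM m₀] with m hm h1 h2 h3
  ext v
  change A'.tr m₀ m (c m (α (f m) fun i => mfderiv 𝓘(ℝ, EM) 𝓘(ℝ, EX) f m (tangentTrs m₀ m (v i)))) =
    K m (A.tr x₀ (f m) (A.trs (f m₀) (f m) (A.tr (f m₀) (f m) (α (f m) fun i =>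
      tangentTrs (f m₀) (f m) (tangentTr (f m₀) (f m)
        (mfderiv 𝓘(ℝ, EM) 𝓘(ℝ, EX) f m (tangentTrs m₀ m (v i))))))))
  rw [hm, A.trs_tr h1]
  congr 3
  funext i
  exact (tangentTrs_tangentTr h2 _).symm

/-- Bilinear maps of the fibres of bundles which are constant in the trivializations. -/
def BilinAt {A₁ : VBundle.{v} EX X} {A₂ : VBundle.{u} EX X} {A₃ : VBundle.{w} EX X}
    (B : ∀ x, A₁.fib x →ₗ[ℝ] A₂.fib x →ₗ[ℝ] A₃.fib x) (x₀ : X) : Prop :=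
  ∃ Bm : A₁.F →ₗ[ℝ] A₂.F →ₗ[ℝ] A₃.F, ∀ᶠ x in nhds x₀, ∀ a b,
    A₃.tr x₀ x (B x a b) = Bm (A₁.tr x₀ x a) (A₂.tr x₀ x b)

theorem SmoothFormAt.tw {A₁ : VBundle.{v} EX X} {A₂ : VBundle.{u} EX X} {A₃ : VBundle.{w} EX X}
    {B : ∀ x, A₁.fib x →ₗ[ℝ] A₂.fib x →ₗ[ℝ] A₃.fib x} {x₀ : X} (hB : BilinAt B x₀) {p r n : ℕ}
    {α : RawForm A₁ p} {β : RawForm A₂ r} (hα : SmoothFormAt α x₀) (hβ : SmoothFormAt β x₀) :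
    SmoothFormAt (A := A₃) (p := n) (fun x => tw (B x) p r n (α x) (β x)) x₀ := by
  obtain ⟨Bm, hBm⟩ := hB
  rw [smoothFormAt_iff] at hα hβ ⊢
  refine (contMDiffAt_tw Bm hα hβ).congr_of_eventuallyEq ?_
  filter_upwards [hBm] with x hx
  exact tw_natural (tangentTrs x₀ x) (A₁.tr x₀ x) (A₂.tr x₀ x) (A₃.tr x₀ x) (B x) Bm hx (α x) (β x)

/-- The multiplication by scalars. -/
def scalarB (A : VBundle.{v} EX X) (x : X) : (VBundle.line EX X).fib x →ₗ[ℝ] A.fib x →ₗ[ℝ] A.fib x :=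
  (LinearMap.lsmul ℝ (A.fib x)).comp (lineVal x)

/-- The evaluation of homomorphisms. -/
def evalB (A B : VBundle.{v} EX X) (x : X) : (A.hom B).fib x →ₗ[ℝ] A.fib x →ₗ[ℝ] B.fib x :=
  (ContinuousLinearMap.coeLM ℝ).comp (homVal A B x)

/-- The composition of homomorphisms. -/
def compB (A B C : VBundle.{v} EX X) (x : X) :
    (B.hom C).fib x →ₗ[ℝ] (A.hom B).fib x →ₗ[ℝ] (A.hom C).fib x :=
  LinearMap.mk₂ ℝ (fun f g => ((homVal B C x f).comp (homVal A B x g) : A.fib x →L[ℝ] C.fib x))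
    (fun _ _ _ => ContinuousLinearMap.add_comp ..) (fun _ _ _ => ContinuousLinearMap.smul_comp ..)
    (fun _ _ _ => ContinuousLinearMap.comp_add ..) (fun _ _ _ => ContinuousLinearMap.comp_smul ..)

theorem bilinAt_scalarB (A : VBundle.{v} EX X) (x₀ : X) : BilinAt (scalarB A) x₀ :=
  ⟨LinearMap.lsmul ℝ A.F, Filter.Eventually.of_forall fun _ a b => by
    rw [VBundle.line_tr]
    exact map_smul _ _ _⟩

theorem bilinAt_evalB (A B : VBundle.{v} EX X) (x₀ : X) : BilinAt (evalB A B) x₀ := by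
  refine ⟨ContinuousLinearMap.coeLM ℝ, ?_⟩
  filter_upwards [(A.isOpen_nb x₀).mem_nhds (A.mem_nb x₀),
    (B.isOpen_nb x₀).mem_nhds (B.mem_nb x₀)] with x hA hB f a
  rw [A.hom_tr B hA hB]
  change _ = B.tr x₀ x (homVal A B x f (A.trs x₀ x (A.tr x₀ x a)))
  rw [A.trs_tr hA]
  rfl

theorem bilinAt_compB (A B C : VBundle.{v} EX X) (x₀ : X) : BilinAt (compB A B C) x₀ := by
  refine ⟨LinearMap.mk₂ ℝ (fun f g => f.comp g) (fun _ _ _ => ContinuousLinearMap.add_comp ..)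
    (fun _ _ _ => ContinuousLinearMap.smul_comp ..) (fun _ _ _ => ContinuousLinearMap.comp_add ..)
    (fun _ _ _ => ContinuousLinearMap.comp_smul ..), ?_⟩
  filter_upwards [(A.isOpen_nb x₀).mem_nhds (A.mem_nb x₀),
    (B.isOpen_nb x₀).mem_nhds (B.mem_nb x₀), (C.isOpen_nb x₀).mem_nhds (C.mem_nb x₀)]
    with x hA hB hC f g
  rw [A.hom_tr B hA hB, B.hom_tr C hB hC, A.hom_tr C hA hC]
  refine ContinuousLinearMap.ext fun a => ?_
  change C.tr x₀ x (homVal B C x f (homVal A B x g (A.trs x₀ x a))) =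
    C.tr x₀ x (homVal B C x f (B.trs x₀ x (B.tr x₀ x (homVal A B x g (A.trs x₀ x a)))))
  rw [B.trs_tr hB]

/-! ## The wedge products as sums of homogeneous wedge products -/

theorem scalarWedge_eq {ι : Type} {V : ι → VBundle.{v} EX X} {k : ℕ}
    (σ : RawForm (VBundle.line EX X) k) (α : RawForms V) (n : ℕ) (i : ι) (x : X) :
    scalarWedge σ α n i x = tw (scalarB (V i) x) k (n - k) n (σ x) (α (n - k) i x) := by
  unfold scalarWedge
  split_ifs with h
  · rw [tw_of_eq _ (Nat.add_sub_cancel' h)]; rfl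
  · rw [tw_of_ne _ (by omega)]

/-- The component of a `Hom(E, E')`-valued form with values in `Hom(E^q, E'^q')`. -/
def hc {E E' : GradedBundle.{v} EX X} (α : RawForms (E.hom E')) (p : ℕ) (q q' : ℤ) :
    RawForm ((E.part q).hom (E'.part q')) p :=
  α p (q, q')

theorem homWedge_eq {E E' : GradedBundle.{v} EX X} (α : RawForms (E.hom E')) (η : RawForms E.part)
    (n : ℕ) (q' : ℤ) (x : X) : homWedge α η n q' x =
      ∑ q ∈ E.support, ∑ y ∈ Finset.HasAntidiagonal.antidiagonal n,
        ((-1 : ℝ) ^ ((q' - q) * (y.2 : ℤ))) •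
          tw (evalB (E.part q) (E'.part q') x) y.1 y.2 n (hc α y.1 q q' x) (η y.2 q x) := by
  unfold homWedge
  rw [Finset.sum_comm]
  refine Finset.sum_congr rfl fun q _ => ?_
  rw [Finset.Nat.sum_antidiagonal_eq_sum_range_succ_mk, ← Fin.sum_univ_eq_sum_range
    (fun p => ((-1 : ℝ) ^ ((q' - q) * ((n - p : ℕ) : ℤ))) •
        tw (evalB (E.part q) (E'.part q') x) p (n - p) n (hc α p q q' x) (η (n - p) q x))]
  refine Finset.sum_congr rfl fun p _ => congrArg (HSMul.hSMul _) ?_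
  exact (tw_of_eq (evalB (E.part q) (E'.part q') x) (Nat.add_sub_cancel' (Nat.lt_succ_iff.mp p.2))
    (hc α p q q' x) (η (n - p) q x)).symm

theorem homComp_eq {E E' E'' : GradedBundle.{v} EX X} (ψ : RawForms (E'.hom E''))
    (α : RawForms (E.hom E')) (n : ℕ) (q₁ q₃ : ℤ) (x : X) : hc (homComp ψ α) n q₁ q₃ x =
      ∑ q ∈ E'.support, ∑ y ∈ Finset.HasAntidiagonal.antidiagonal n,
        ((-1 : ℝ) ^ ((q₃ - q) * (y.2 : ℤ))) •
          tw (compB (E.part q₁) (E'.part q) (E''.part q₃) x) y.1 y.2 n (hc ψ y.1 q q₃ x)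
            (hc α y.2 q₁ q x) := by
  have h : hc (homComp ψ α) n q₁ q₃ x = ∑ p : Fin (n + 1), ∑ q ∈ E'.support,
      ((-1 : ℝ) ^ ((q₃ - q) * ((n - p : ℕ) : ℤ))) •
        wedge (compB (E.part q₁) (E'.part q) (E''.part q₃) x)
          (Nat.add_sub_cancel' (Nat.lt_succ_iff.mp p.2)) (hc ψ p q q₃ x) (hc α (n - p) q₁ q x) :=
    rfl
  rw [h, Finset.sum_comm]
  refine Finset.sum_congr rfl fun q _ => ?_
  rw [Finset.Nat.sum_antidiagonal_eq_sum_range_succ_mk, ← Fin.sum_univ_eq_sum_range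
    (fun p => ((-1 : ℝ) ^ ((q₃ - q) * ((n - p : ℕ) : ℤ))) •
        tw (compB (E.part q₁) (E'.part q) (E''.part q₃) x) p (n - p) n (hc ψ p q q₃ x)
          (hc α (n - p) q₁ q x))]
  refine Finset.sum_congr rfl fun p _ => congrArg (HSMul.hSMul _) ?_
  exact (tw_of_eq (compB (E.part q₁) (E'.part q) (E''.part q₃) x)
    (Nat.add_sub_cancel' (Nat.lt_succ_iff.mp p.2)) (hc ψ p q q₃ x) (hc α (n - p) q₁ q x)).symm

theorem omega_scalarWedge {ι : Type} {V : ι → VBundle.{v} EX X} {k : ℕ}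
    {σ : RawForm (VBundle.line EX X) k} (hσ : SmoothForm σ) {α : RawForms V} (hα : α ∈ Omega V) :
    scalarWedge σ α ∈ Omega V := fun n i => smoothForm_of_at fun x₀ => by
  have : scalarWedge σ α n i = fun x => tw (scalarB (V i) x) k (n - k) n (σ x) (α (n - k) i x) :=
    funext fun x => scalarWedge_eq σ α n i x
  rw [this]
  exact SmoothFormAt.tw (bilinAt_scalarB _ _) (hσ x₀) (hα _ _ x₀)

theorem omega_homWedge {E E' : GradedBundle.{v} EX X} {α : RawForms (E.hom E')}
    {η : RawForms E.part} (hα : α ∈ Omega (E.hom E')) (hη : η ∈ Omega E.part) :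
    homWedge α η ∈ Omega E'.part := fun n q' => smoothForm_of_at fun x₀ => by
  have : homWedge α η n q' = ∑ q ∈ E.support, ∑ y ∈ Finset.HasAntidiagonal.antidiagonal n,
      ((-1 : ℝ) ^ ((q' - q) * (y.2 : ℤ))) • fun x =>
        tw (evalB (E.part q) (E'.part q') x) y.1 y.2 n (hc α y.1 q q' x) (η y.2 q x) := by
    funext x
    rw [homWedge_eq]
    simp only [Finset.sum_apply, Pi.smul_apply]
  rw [this]
  exact SmoothFormAt.sum fun q _ => SmoothFormAt.sum fun y _ => SmoothFormAt.smul _ <|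
    SmoothFormAt.tw (bilinAt_evalB _ _ _) (α := hc α y.1 q q') (hα y.1 (q, q') x₀) (hη y.2 q x₀)

theorem omega_homComp {E E' E'' : GradedBundle.{v} EX X} {ψ : RawForms (E'.hom E'')}
    {α : RawForms (E.hom E')} (hψ : ψ ∈ Omega (E'.hom E'')) (hα : α ∈ Omega (E.hom E')) :
    homComp ψ α ∈ Omega (E.hom E'') := fun n i => smoothForm_of_at fun x₀ => by
  change SmoothFormAt (hc (homComp ψ α) n i.1 i.2) x₀
  have : hc (homComp ψ α) n i.1 i.2 =
      ∑ q ∈ E'.support, ∑ y ∈ Finset.HasAntidiagonal.antidiagonal n,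
      ((-1 : ℝ) ^ ((i.2 - q) * (y.2 : ℤ))) • fun x =>
        tw (compB (E.part i.1) (E'.part q) (E''.part i.2) x) y.1 y.2 n (hc ψ y.1 q i.2 x)
          (hc α y.2 i.1 q x) := by
    funext x
    rw [homComp_eq]
    simp only [Finset.sum_apply, Pi.smul_apply]
  rw [this]
  exact SmoothFormAt.sum fun q _ => SmoothFormAt.sum fun y _ => SmoothFormAt.smul _ <|
    SmoothFormAt.tw (bilinAt_compB _ _ _ _) (α := hc ψ y.1 q i.2) (β := hc α y.2 i.1 q)
      (hψ y.1 (q, i.2) x₀) (hα y.2 (i.1, q) x₀)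

end LocalForms

/-! ## The exterior derivative of scalar forms on a manifold -/

theorem two_le_infty : (2 : WithTop ℕ∞) ≤ ∞ :=
  WithTop.coe_le_coe.2 (le_top : (2 : ℕ∞) ≤ ⊤)

section Scalar

variable {EX : Type*} [NormedAddCommGroup EX] [NormedSpace ℝ EX] [FiniteDimensional ℝ EX]
  {X : Type*} [TopologicalSpace X] [ChartedSpace EX X]
  {EM : Type*} [NormedAddCommGroup EM] [NormedSpace ℝ EM] [FiniteDimensional ℝ EM]
  {M : Type*} [TopologicalSpace M] [ChartedSpace EM M]

/-- The value of a scalar form as an alternating map with real values. -/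
def sval {k : ℕ} (σ : RawForm (VBundle.line EX X) k) (x : X) : EX [⋀^Fin k]→L[ℝ] ℝ := σ x

/-- The scalar form `σ` in the chart at `x₀`. -/
def lr (x₀ : X) {k : ℕ} (σ : RawForm (VBundle.line EX X) k) (y : EX) : EX [⋀^Fin k]→L[ℝ] ℝ :=
  (sval σ ((chartAt EX x₀).symm y)).compContinuousLinearMap
    (mfderiv 𝓘(ℝ, EX) 𝓘(ℝ, EX) (chartAt EX x₀).symm y)

/-- The exterior derivative of `σ` computed in the chart at `x₀`. -/
def extDIn (x₀ : X) {k : ℕ} (σ : RawForm (VBundle.line EX X) k) : RawForm (VBundle.line EX X) (k + 1) :=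
  fun x => (extDeriv (lr x₀ σ) (chartAt EX x₀ x)).compContinuousLinearMap
    (mfderiv 𝓘(ℝ, EX) 𝓘(ℝ, EX) (chartAt EX x₀) x)

theorem extD_eq_extDIn {k : ℕ} (σ : RawForm (VBundle.line EX X) k) (x : X) :
    extD σ x = extDIn x σ x := rfl

variable (EM) in
/-- The pullback of a scalar form. -/
def pullS (f : M → X) {k : ℕ} (σ : RawForm (VBundle.line EX X) k) : RawForm (VBundle.line EM M) k :=
  fun m => (sval σ (f m)).compContinuousLinearMap (mfderiv 𝓘(ℝ, EM) 𝓘(ℝ, EX) f m)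

variable [IsManifold 𝓘(ℝ, EX) ∞ X] [IsManifold 𝓘(ℝ, EM) ∞ M]

theorem mdifferentiableAt_chart {x₀ x : X} (h : x ∈ (chartAt EX x₀).source) :
    MDifferentiableAt 𝓘(ℝ, EX) 𝓘(ℝ, EX) (chartAt EX x₀) x :=
  ((contMDiffAt_of_mem_maximalAtlas (n := ∞) (IsManifold.chart_mem_maximalAtlas x₀) h)).mdifferentiableAt
    (by simp)

theorem contMDiffAt_chart_symm {x₀ : X} {y : EX} (h : y ∈ (chartAt EX x₀).target) :
    ContMDiffAt 𝓘(ℝ, EX) 𝓘(ℝ, EX) ∞ (chartAt EX x₀).symm y :=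
  contMDiffAt_symm_of_mem_maximalAtlas (IsManifold.chart_mem_maximalAtlas x₀) h

theorem mdifferentiableAt_chart_symm {x₀ : X} {y : EX} (h : y ∈ (chartAt EX x₀).target) :
    MDifferentiableAt 𝓘(ℝ, EX) 𝓘(ℝ, EX) (chartAt EX x₀).symm y :=
  (contMDiffAt_chart_symm h).mdifferentiableAt (by simp)

theorem rep_eq_lr {x₀ : X} {k : ℕ} (σ : RawForm (VBundle.line EX X) k) {y : EX}
    (h : y ∈ (chartAt EX x₀).target) : rep x₀ σ ((chartAt EX x₀).symm y) = lr x₀ σ y := by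
  refine ContinuousAlternatingMap.ext fun v => ?_
  refine (VBundle.line_tr x₀ _ _).trans ?_
  rw [tangentTrs_eq h]
  rfl

theorem contDiffAt_lr {x₀ : X} {k : ℕ} {σ : RawForm (VBundle.line EX X) k} {y : EX}
    (h : y ∈ (chartAt EX x₀).target) (hσ : SmoothFormAt σ ((chartAt EX x₀).symm y)) :
    ContDiffAt ℝ ∞ (lr x₀ σ) y := by
  rw [smoothFormAt_iff_rep σ ((chartAt EX x₀).map_target h) (Set.mem_univ _)] at hσ
  have := hσ.comp y (contMDiffAt_chart_symm h)
  refine contMDiffAt_iff_contDiffAt.1 (this.congr_of_eventuallyEq ?_)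
  filter_upwards [(chartAt EX x₀).open_target.mem_nhds h] with z hz
  exact (rep_eq_lr σ hz).symm

theorem lr_pullS {f : M → X} {k : ℕ} (σ : RawForm (VBundle.line EX X) k) {m₀ : M} {x₀ : X} {z : EM}
    (hz : z ∈ (chartAt EM m₀).target) (hf : MDifferentiableAt 𝓘(ℝ, EM) 𝓘(ℝ, EX) f ((chartAt EM m₀).symm z))
    (hx : f ((chartAt EM m₀).symm z) ∈ (chartAt EX x₀).source) :
    lr m₀ (pullS EM f σ) z = (lr x₀ σ (chartAt EX x₀ (f ((chartAt EM m₀).symm z)))).compContinuousLinearMap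
      (fderiv ℝ (fun w => chartAt EX x₀ (f ((chartAt EM m₀).symm w))) z) := by
  set F := fun w => chartAt EX x₀ (f ((chartAt EM m₀).symm w)) with hF
  have hFd : MDifferentiableAt 𝓘(ℝ, EM) 𝓘(ℝ, EX) F z :=
    (mdifferentiableAt_chart hx).comp z (hf.comp z (mdifferentiableAt_chart_symm hz))
  have h1 : (chartAt EX x₀).symm (F z) = f ((chartAt EM m₀).symm z) := (chartAt EX x₀).left_inv hx
  have h2 : mfderiv 𝓘(ℝ, EM) 𝓘(ℝ, EX) (fun w => f ((chartAt EM m₀).symm w)) z =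
      (mfderiv 𝓘(ℝ, EX) 𝓘(ℝ, EX) (chartAt EX x₀).symm (F z)).comp (mfderiv 𝓘(ℝ, EM) 𝓘(ℝ, EX) F z) := by
    rw [← mfderiv_comp z (mdifferentiableAt_chart_symm ((chartAt EX x₀).map_source hx)) hFd]
    refine Filter.EventuallyEq.mfderiv_eq ?_
    have := hf.continuousAt.comp (mdifferentiableAt_chart_symm hz).continuousAt
    filter_upwards [this.preimage_mem_nhds ((chartAt EX x₀).open_source.mem_nhds hx)] with w hw
    exact ((chartAt EX x₀).left_inv hw).symm
  have h3 : mfderiv 𝓘(ℝ, EM) 𝓘(ℝ, EX) (fun w => f ((chartAt EM m₀).symm w)) z =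
      (mfderiv 𝓘(ℝ, EM) 𝓘(ℝ, EX) f ((chartAt EM m₀).symm z)).comp
        (mfderiv 𝓘(ℝ, EM) 𝓘(ℝ, EM) (chartAt EM m₀).symm z) :=
    mfderiv_comp z hf (mdifferentiableAt_chart_symm hz)
  refine ContinuousAlternatingMap.ext fun v => ?_
  have h4 : ∀ x : X, x = f ((chartAt EM m₀).symm z) → ∀ w : Fin k → EX,
      sval σ x w = sval σ (f ((chartAt EM m₀).symm z)) w := by rintro x rfl w; rfl
  refine Eq.trans ?_ (h4 _ h1 _).symm
  change sval σ _ _ = sval σ _ _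
  congr 1
  funext i
  have h5 := congrArg (fun L : EM →L[ℝ] EX => L (v i)) (h3.symm.trans h2)
  rw [mfderiv_eq_fderiv] at h5
  exact h5

theorem extDIn_pullS {f : M → X} {k : ℕ} {σ : RawForm (VBundle.line EX X) k} {m₀ m : M} {x₀ : X}
    (hm : m ∈ (chartAt EM m₀).source) (hx : f m ∈ (chartAt EX x₀).source)
    (hf : ContMDiffAt 𝓘(ℝ, EM) 𝓘(ℝ, EX) ∞ f m) (hσ : SmoothFormAt σ (f m)) :
    extDIn m₀ (pullS EM f σ) m = pullS EM f (extDIn x₀ σ) m := by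
  set F := fun w => chartAt EX x₀ (f ((chartAt EM m₀).symm w)) with hF
  set z := chartAt EM m₀ m with hz
  have hzt : z ∈ (chartAt EM m₀).target := (chartAt EM m₀).map_source hm
  have hzm : (chartAt EM m₀).symm z = m := (chartAt EM m₀).left_inv hm
  have hf2 : ∀ᶠ m' in nhds m, MDifferentiableAt 𝓘(ℝ, EM) 𝓘(ℝ, EX) f m' :=
    ((contMDiffAt_iff_contMDiffAt_nhds (n := 1) (by simp)).1 (hf.of_le (by simp))).mono fun m' h => h.mdifferentiableAt (by simp)
  have hsymm : Filter.Tendsto (chartAt EM m₀).symm (nhds z) (nhds m) := by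
    have := (mdifferentiableAt_chart_symm hzt).continuousAt
    rwa [ContinuousAt, hzm] at this
  have e1 : lr m₀ (pullS EM f σ) =ᶠ[nhds z] fun w => (lr x₀ σ (F w)).compContinuousLinearMap (fderiv ℝ F w) := by
    filter_upwards [(chartAt EM m₀).open_target.mem_nhds hzt, hsymm.eventually hf2,
      hsymm.eventually (hf.continuousAt.preimage_mem_nhds ((chartAt EX x₀).open_source.mem_nhds hx))]
      with w h1 h2 h3
    exact lr_pullS σ h1 h2 h3
  have hFz : F z = chartAt EX x₀ (f m) := by rw [hF]; simp only [hzm]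
  have hFt : F z ∈ (chartAt EX x₀).target := by rw [hFz]; exact (chartAt EX x₀).map_source hx
  have hFs : (chartAt EX x₀).symm (F z) = f m := by rw [hFz]; exact (chartAt EX x₀).left_inv hx
  have hFd : ContMDiffAt 𝓘(ℝ, EM) 𝓘(ℝ, EX) ∞ F z := by
    have h1 : ContMDiffAt 𝓘(ℝ, EX) 𝓘(ℝ, EX) ∞ (chartAt EX x₀) (f m) :=
      contMDiffAt_of_mem_maximalAtlas (IsManifold.chart_mem_maximalAtlas x₀) hx
    exact ContMDiffAt.comp_of_eq h1 (ContMDiffAt.comp_of_eq hf (contMDiffAt_chart_symm hzt) hzm)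
      (by rw [hzm])
  have e2 : extDeriv (lr m₀ (pullS EM f σ)) z =
      (extDeriv (lr x₀ σ) (F z)).compContinuousLinearMap (fderiv ℝ F z) := by
    rw [e1.extDeriv_eq]
    refine extDeriv_pullback (r := ∞) ?_ (contMDiffAt_iff_contDiffAt.1 hFd) (by simpa using two_le_infty)
    exact (contDiffAt_lr hFt (by rw [hFs]; exact hσ)).differentiableAt (by simp)
  have h3 : mfderiv 𝓘(ℝ, EM) 𝓘(ℝ, EX) (fun m' => F (chartAt EM m₀ m')) m =
      (mfderiv 𝓘(ℝ, EM) 𝓘(ℝ, EX) F z).comp (mfderiv 𝓘(ℝ, EM) 𝓘(ℝ, EM) (chartAt EM m₀) m) :=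
    mfderiv_comp m (hFd.mdifferentiableAt (by simp)) (mdifferentiableAt_chart hm)
  have h4 : mfderiv 𝓘(ℝ, EM) 𝓘(ℝ, EX) (fun m' => F (chartAt EM m₀ m')) m =
      (mfderiv 𝓘(ℝ, EX) 𝓘(ℝ, EX) (chartAt EX x₀) (f m)).comp (mfderiv 𝓘(ℝ, EM) 𝓘(ℝ, EX) f m) := by
    rw [← mfderiv_comp m (mdifferentiableAt_chart hx) (hf.mdifferentiableAt (by simp))]
    refine Filter.EventuallyEq.mfderiv_eq ?_
    filter_upwards [(chartAt EM m₀).open_source.mem_nhds hm] with w hw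
    change chartAt EX x₀ (f ((chartAt EM m₀).symm (chartAt EM m₀ w))) = _
    rw [(chartAt EM m₀).left_inv hw]; rfl
  refine ContinuousAlternatingMap.ext fun v => ?_
  change extDeriv (lr m₀ (pullS EM f σ)) z (fun i => mfderiv 𝓘(ℝ, EM) 𝓘(ℝ, EM) (chartAt EM m₀) m (v i)) =
    extDeriv (lr x₀ σ) (chartAt EX x₀ (f m)) fun i =>
      mfderiv 𝓘(ℝ, EX) 𝓘(ℝ, EX) (chartAt EX x₀) (f m) (mfderiv 𝓘(ℝ, EM) 𝓘(ℝ, EX) f m (v i))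
  rw [e2, hFz]
  change extDeriv (lr x₀ σ) (chartAt EX x₀ (f m)) _ = _
  congr 1
  funext i
  have h5 := congrArg (fun L : EM →L[ℝ] EX => L (v i)) (h3.symm.trans h4)
  rw [mfderiv_eq_fderiv] at h5
  exact h5

theorem pullS_id {k : ℕ} (σ : RawForm (VBundle.line EX X) k) : pullS EX id σ = σ := by
  funext x
  refine ContinuousAlternatingMap.ext fun v => ?_
  change sval σ x (fun i => mfderiv 𝓘(ℝ, EX) 𝓘(ℝ, EX) id x (v i)) = σ x v
  rw [mfderiv_id]
  rfl

theorem extD_eq {k : ℕ} {σ : RawForm (VBundle.line EX X) k} {x₀ x : X}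
    (h : x ∈ (chartAt EX x₀).source) (hσ : SmoothFormAt σ x) : extD σ x = extDIn x₀ σ x := by
  have := extDIn_pullS (f := id) (m₀ := x) (x₀ := x₀) (m := x) (mem_chart_source EX x) h
    contMDiffAt_id hσ
  rwa [pullS_id, pullS_id] at this

theorem pullS_congr {f : M → X} {k : ℕ} {σ σ' : RawForm (VBundle.line EX X) k} {m : M}
    (h : σ (f m) = σ' (f m)) : pullS EM f σ m = pullS EM f σ' m := by
  have h' : sval σ (f m) = sval σ' (f m) := h
  rw [pullS, pullS, h']

theorem extD_pullS {f : M → X} {k : ℕ} {σ : RawForm (VBundle.line EX X) k} {m : M}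
    (hf : ContMDiffAt 𝓘(ℝ, EM) 𝓘(ℝ, EX) ∞ f m) (hσ : SmoothFormAt σ (f m)) :
    extD (pullS EM f σ) m = pullS EM f (extD σ) m :=
  (extD_eq_extDIn _ m).trans <|
    (extDIn_pullS (mem_chart_source EM m) (mem_chart_source EX (f m)) hf hσ).trans
      (pullS_congr (extD_eq_extDIn σ (f m)).symm)

theorem SmoothFormAt.pullS {f : M → X} {k : ℕ} {σ : RawForm (VBundle.line EX X) k} {m : M}
    (hf : ContMDiffAt 𝓘(ℝ, EM) 𝓘(ℝ, EX) ∞ f m) (hσ : SmoothFormAt σ (f m)) :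
    SmoothFormAt (ChernWeil.pullS EM f σ) m :=
  SmoothFormAt.pullMap (A := VBundle.line EX X) (A' := VBundle.line EM M) (x₀ := f m)
    (c := fun _ => ContinuousLinearMap.id ℝ ℝ) (K := fun _ => ContinuousLinearMap.id ℝ ℝ)
    hσ hf (Set.mem_univ _) contMDiffAt_const <| Filter.Eventually.of_forall fun m' a => by
      refine (VBundle.line_tr m m' _).trans ?_
      exact (VBundle.line_tr (f m) (f m') a).symm

end Scalar

section ExtD

theorem rep_extD {x₀ x : X} (h : x ∈ (chartAt EX x₀).source) {k : ℕ}
    {σ : RawForm (VBundle.line EX X) k} (hσ : SmoothFormAt σ x) :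
    rep x₀ (extD σ) x = extDeriv (lr x₀ σ) (chartAt EX x₀ x) := by
  refine ContinuousAlternatingMap.ext fun v => ?_
  refine (VBundle.line_tr x₀ x _).trans ?_
  rw [extD_eq h hσ]
  change extDeriv (lr x₀ σ) (chartAt EX x₀ x)
    (fun i => mfderiv 𝓘(ℝ, EX) 𝓘(ℝ, EX) (chartAt EX x₀) x (tangentTrs x₀ x (v i))) = _
  congr 1
  funext i
  rw [← tangentTr_eq h]
  exact tangentTr_tangentTrs h (v i)

theorem contDiffAt_extDeriv {k : ℕ} {α : EX → EX [⋀^Fin k]→L[ℝ] ℝ} {y : EX}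
    (h : ContDiffAt ℝ ∞ α y) : ContDiffAt ℝ ∞ (extDeriv α) y := by
  have h1 : ContDiffAt ℝ ∞ (fderiv ℝ α) y := h.fderiv_right (by simp)
  exact (ContinuousAlternatingMap.alternatizeUncurryFinCLM ℝ EX ℝ).contDiff.contDiffAt.comp y h1

theorem smoothForm_extD {k : ℕ} {σ : RawForm (VBundle.line EX X) k} (hσ : SmoothForm σ) :
    SmoothForm (extD σ) := smoothForm_of_at fun x => by
  rw [smoothFormAt_iff]
  have h1 : ContDiffAt ℝ ∞ (extDeriv (lr x σ)) (chartAt EX x x) :=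
    contDiffAt_extDeriv (contDiffAt_lr (mem_chart_target EX x) (hσ _))
  have h2 : ContMDiffAt 𝓘(ℝ, EX) 𝓘(ℝ, EX) ∞ (chartAt EX x) x :=
    contMDiffAt_of_mem_maximalAtlas (IsManifold.chart_mem_maximalAtlas x) (mem_chart_source EX x)
  refine ((contMDiffAt_iff_contDiffAt.2 h1).comp x h2).congr_of_eventuallyEq ?_
  filter_upwards [chart_source_mem_nhds EX x] with z hz
  exact rep_extD hz (hσ z)

theorem lr_extD {x₀ : X} {k : ℕ} {σ : RawForm (VBundle.line EX X) k} (hσ : SmoothForm σ) {y : EX}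
    (h : y ∈ (chartAt EX x₀).target) : lr x₀ (extD σ) y = extDeriv (lr x₀ σ) y := by
  rw [← rep_eq_lr _ h, rep_extD ((chartAt EX x₀).map_target h) (hσ _), (chartAt EX x₀).right_inv h]

theorem extD_extD {k : ℕ} {σ : RawForm (VBundle.line EX X) k} (hσ : SmoothForm σ) :
    extD (extD σ) = 0 := by
  funext x
  have h1 : lr x (extD σ) =ᶠ[nhds (chartAt EX x x)] extDeriv (lr x σ) := by
    filter_upwards [(chartAt EX x).open_target.mem_nhds (mem_chart_target EX x)] with y hy
    exact lr_extD hσ hy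
  have h2 : extDeriv (lr x (extD σ)) (chartAt EX x x) = 0 := by
    rw [h1.extDeriv_eq]
    exact extDeriv_extDeriv_apply (r := ∞) (contDiffAt_lr (mem_chart_target EX x) (hσ _))
      (by simpa using two_le_infty)
  refine ContinuousAlternatingMap.ext fun v => ?_
  change extDeriv (lr x (extD σ)) (chartAt EX x x) _ = 0
  rw [h2]
  rfl

theorem extD_congr {k : ℕ} {σ τ : RawForm (VBundle.line EX X) k} {x : X}
    (h : ∀ᶠ y in nhds x, σ y = τ y) : extD σ x = extD τ x := by
  have h1 : lr x σ =ᶠ[nhds (chartAt EX x x)] lr x τ := by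
    have hs : Filter.Tendsto (chartAt EX x).symm (nhds (chartAt EX x x)) (nhds x) := by
      have := (chartAt EX x).continuousAt_symm (mem_chart_target EX x)
      rwa [ContinuousAt, (chartAt EX x).left_inv (mem_chart_source EX x)] at this
    filter_upwards [hs.eventually h] with y hy
    have : sval σ ((chartAt EX x).symm y) = sval τ ((chartAt EX x).symm y) := hy
    rw [lr, lr, this]
  have h2 := h1.extDeriv_eq
  refine ContinuousAlternatingMap.ext fun v => ?_
  exact congrArg (fun a : EX [⋀^Fin (k + 1)]→L[ℝ] ℝ =>
    a fun i => mfderiv 𝓘(ℝ, EX) 𝓘(ℝ, EX) (chartAt EX x) x (v i)) h2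

theorem extD_add {k : ℕ} {σ τ : RawForm (VBundle.line EX X) k} (hσ : SmoothForm σ)
    (hτ : SmoothForm τ) : extD (σ + τ) = extD σ + extD τ := by
  funext x
  have h2 : extDeriv (lr x (σ + τ)) (chartAt EX x x) =
      extDeriv (lr x σ) (chartAt EX x x) + extDeriv (lr x τ) (chartAt EX x x) :=
    extDeriv_add ((contDiffAt_lr (mem_chart_target EX x) (hσ _)).differentiableAt (by simp))
      ((contDiffAt_lr (mem_chart_target EX x) (hτ _)).differentiableAt (by simp))
  refine ContinuousAlternatingMap.ext fun v => ?_
  exact congrArg (fun a : EX [⋀^Fin (k + 1)]→L[ℝ] ℝ =>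
    a fun i => mfderiv 𝓘(ℝ, EX) 𝓘(ℝ, EX) (chartAt EX x) x (v i)) h2

theorem extD_smul {k : ℕ} (c : ℝ) (σ : RawForm (VBundle.line EX X) k) :
    extD (c • σ) = c • extD σ := by
  funext x
  have h2 : extDeriv (lr x (c • σ)) (chartAt EX x x) = c • extDeriv (lr x σ) (chartAt EX x x) := by
    have : lr x (c • σ) = c • lr x σ := rfl
    rw [this, extDeriv_smul]
  refine ContinuousAlternatingMap.ext fun v => ?_
  exact congrArg (fun a : EX [⋀^Fin (k + 1)]→L[ℝ] ℝ =>
    a fun i => mfderiv 𝓘(ℝ, EX) 𝓘(ℝ, EX) (chartAt EX x) x (v i)) h2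

theorem extD_zero {k : ℕ} : extD (0 : RawForm (VBundle.line EX X) k) = 0 := by
  have := extD_smul (0 : ℝ) (0 : RawForm (VBundle.line EX X) k)
  rwa [zero_smul, zero_smul] at this

/-- The wedge product of scalar forms, with values in the `n`-forms. -/
def swedge {p r : ℕ} (n : ℕ) (σ : RawForm (VBundle.line EX X) p)
    (τ : RawForm (VBundle.line EX X) r) : RawForm (VBundle.line EX X) n :=
  fun x => tw (scalarB (VBundle.line EX X) x) p r n (σ x) (τ x)

theorem smoothForm_swedge {p r n : ℕ} {σ : RawForm (VBundle.line EX X) p}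
    {τ : RawForm (VBundle.line EX X) r} (hσ : SmoothForm σ) (hτ : SmoothForm τ) :
    SmoothForm (swedge n σ τ) := smoothForm_of_at fun x =>
  SmoothFormAt.tw (bilinAt_scalarB (VBundle.line EX X) x) (hσ x) (hτ x)

theorem lr_swedge {p r n : ℕ} (σ : RawForm (VBundle.line EX X) p)
    (τ : RawForm (VBundle.line EX X) r) (x₀ : X) (y : EX) :
    lr x₀ (swedge n σ τ) y = tw (LinearMap.lsmul ℝ ℝ) p r n (lr x₀ σ y) (lr x₀ τ y) :=
  tw_natural (show EX →L[ℝ] EX from mfderiv 𝓘(ℝ, EX) 𝓘(ℝ, EX) (chartAt EX x₀).symm y)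
    (ContinuousLinearMap.id ℝ ℝ) (ContinuousLinearMap.id ℝ ℝ) (ContinuousLinearMap.id ℝ ℝ)
    (scalarB (VBundle.line EX X) _) (LinearMap.lsmul ℝ ℝ) (fun _ _ => rfl) _ _

theorem lr_injective {k : ℕ} {σ τ : RawForm (VBundle.line EX X) k} (x : X)
    (h : lr x σ (chartAt EX x x) = lr x τ (chartAt EX x x)) : σ x = τ x := by
  rw [← rep_eq_lr _ (mem_chart_target EX x), ← rep_eq_lr _ (mem_chart_target EX x),
    (chartAt EX x).left_inv (mem_chart_source EX x)] at h
  exact rep_injective x h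

theorem extD_swedge {p r n : ℕ} (h : p + r = n) {σ : RawForm (VBundle.line EX X) p}
    {τ : RawForm (VBundle.line EX X) r} (hσ : SmoothForm σ) (hτ : SmoothForm τ) :
    extD (swedge n σ τ) =
      swedge (n + 1) (extD σ) τ + (-1 : ℝ) ^ p • swedge (n + 1) σ (extD τ) := by
  funext x
  have h1 : lr x (swedge n σ τ) = fun y => tw (LinearMap.lsmul ℝ ℝ) p r n (lr x σ y) (lr x τ y) :=
    funext (lr_swedge σ τ x)
  have h2 := extDeriv_tw (LinearMap.lsmul ℝ ℝ) h
    ((contDiffAt_lr (mem_chart_target EX x) (hσ _)).differentiableAt (by simp))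
    ((contDiffAt_lr (mem_chart_target EX x) (hτ _)).differentiableAt (by simp))
  rw [← h1, ← lr_extD hσ (mem_chart_target EX x), ← lr_extD hτ (mem_chart_target EX x),
    ← lr_swedge, ← lr_swedge, ← lr_extD (smoothForm_swedge hσ hτ) (mem_chart_target EX x)] at h2
  exact lr_injective x h2

end ExtD

/-! ## Algebra of the wedge products -/

section WedgeAlgebra

theorem sum_range_single {M : Type*} [AddCommMonoid M] (N j : ℕ) (f : ℕ → M)
    (h : ∀ k, k ≠ j → f k = 0) (hN : N ≤ j → f j = 0) : ∑ k ∈ Finset.range N, f k = f j :=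
  Finset.sum_eq_single j (fun k _ hk => h k hk) fun hj => hN (by simpa using hj)

theorem sum_antidiagonal_range {M : Type*} [AddCommMonoid M] {n N : ℕ} (hN : n < N)
    (g : ℕ → ℕ → M) (hg : ∀ p r, p + r ≠ n → g p r = 0) :
    ∑ y ∈ Finset.HasAntidiagonal.antidiagonal n, g y.1 y.2 =
      ∑ p ∈ Finset.range N, ∑ r ∈ Finset.range N, g p r := by
  rw [← Finset.sum_product']
  refine Finset.sum_subset (fun y hy => ?_) fun y _ hy => hg _ _ fun h => hy (by simpa using h)
  have : y.1 + y.2 = n := by simpa using hy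
  simp only [Finset.mem_product, Finset.mem_range]
  omega

theorem neg_one_zpow_congr {a b : ℤ} (h : ∃ c, a - b = 2 * c) : (-1 : ℝ) ^ a = (-1 : ℝ) ^ b := by
  obtain ⟨c, hc⟩ := h
  rw [show a = b + 2 * c by omega, zpow_add₀ (by norm_num), zpow_mul]
  norm_num

theorem homWedge_sum {E E' : GradedBundle.{v} EX X} (α : RawForms (E.hom E')) (η : RawForms E.part)
    {n N : ℕ} (hN : n < N) (q' : ℤ) (x : X) : homWedge α η n q' x =
      ∑ q ∈ E.support, ∑ p ∈ Finset.range N, ∑ r ∈ Finset.range N,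
        ((-1 : ℝ) ^ ((q' - q) * (r : ℤ))) •
          tw (evalB (E.part q) (E'.part q') x) p r n (hc α p q q' x) (η r q x) := by
  rw [homWedge_eq]
  refine Finset.sum_congr rfl fun q _ => sum_antidiagonal_range hN (fun p r =>
    ((-1 : ℝ) ^ ((q' - q) * (r : ℤ))) •
      tw (evalB (E.part q) (E'.part q') x) p r n (hc α p q q' x) (η r q x)) fun p r h => ?_
  rw [tw_of_ne _ h, smul_zero]

theorem homComp_sum {E E' E'' : GradedBundle.{v} EX X} (ψ : RawForms (E'.hom E''))
    (α : RawForms (E.hom E')) {n N : ℕ} (hN : n < N) (q₁ q₃ : ℤ) (x : X) :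
    hc (homComp ψ α) n q₁ q₃ x =
      ∑ q ∈ E'.support, ∑ p ∈ Finset.range N, ∑ r ∈ Finset.range N,
        ((-1 : ℝ) ^ ((q₃ - q) * (r : ℤ))) •
          tw (compB (E.part q₁) (E'.part q) (E''.part q₃) x) p r n (hc ψ p q q₃ x)
            (hc α r q₁ q x) := by
  rw [homComp_eq]
  refine Finset.sum_congr rfl fun q _ => sum_antidiagonal_range hN (fun p r =>
    ((-1 : ℝ) ^ ((q₃ - q) * (r : ℤ))) •
          tw (compB (E.part q₁) (E'.part q) (E''.part q₃) x) p r n (hc ψ p q q₃ x)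
            (hc α r q₁ q x)) fun p r h => ?_
  rw [tw_of_ne _ h, smul_zero]

theorem scalarWedge_sum {ι : Type} {V : ι → VBundle.{v} EX X} {k : ℕ}
    (σ : RawForm (VBundle.line EX X) k) (η : RawForms V) {n N : ℕ} (hN : n < N) (i : ι) (x : X) :
    scalarWedge σ η n i x = ∑ s ∈ Finset.range N, tw (scalarB (V i) x) k s n (σ x) (η s i x) := by
  rw [scalarWedge_eq, sum_range_single N (n - k) (fun s => tw (scalarB (V i) x) k s n (σ x) (η s i x))]
  · intro s hs
    exact tw_of_ne _ (by omega) _ _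
  · intro h
    exact tw_of_ne _ (by omega) _ _

theorem scalarB_scalarB (A : VBundle.{v} EX X) (x : X) (a b : (VBundle.line EX X).fib x)
    (c : A.fib x) : scalarB A x (scalarB (VBundle.line EX X) x a b) c =
      scalarB A x a (scalarB A x b c) := by
  have : lineVal x (scalarB (VBundle.line EX X) x a b) = lineVal x a * lineVal x b := rfl
  change lineVal x (scalarB (VBundle.line EX X) x a b) • c = lineVal x a • lineVal x b • c
  rw [this, mul_smul]

theorem scalarWedge_scalarWedge {ι : Type} {V : ι → VBundle.{v} EX X} {p r m : ℕ} (h : p + r = m)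
    (σ : RawForm (VBundle.line EX X) p) (τ : RawForm (VBundle.line EX X) r) (η : RawForms V) :
    scalarWedge σ (scalarWedge τ η) = scalarWedge (swedge m σ τ) η := by
  funext n i x
  rw [scalarWedge_eq, scalarWedge_eq, scalarWedge_eq]
  by_cases hn : m ≤ n
  · have e : swedge m σ τ x = tw (scalarB (VBundle.line EX X) x) p r m (σ x) (τ x) := rfl
    rw [e, show n - m = n - p - r by omega, tw_assoc (scalarB (VBundle.line EX X) x) (scalarB (V i) x) (scalarB (V i) x)
      (scalarB (V i) x) (scalarB_scalarB (V i) x) n h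
      (Nat.add_sub_cancel' (show r ≤ n - p by omega))]
  · rw [tw_of_ne _ (show m + (n - m) ≠ n by omega)]
    by_cases hp : p ≤ n
    · rw [tw_of_ne _ (show r + (n - p - r) ≠ n - p by omega), tw_zero_right]
    · exact tw_of_ne _ (by omega) _ _

theorem homWedge_scalarWedge {E E' : GradedBundle.{v} EX X} {α : RawForms (E.hom E')} {m : ℤ}
    (hα : IsHomogeneous homDeg m α) {k : ℕ} (σ : RawForm (VBundle.line EX X) k)
    (η : RawForms E.part) :
    homWedge α (scalarWedge σ η) = (-1 : ℝ) ^ (m * k) • scalarWedge σ (homWedge α η) := by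
  funext n q' x
  change _ = (-1 : ℝ) ^ (m * k) • scalarWedge σ (homWedge α η) n q' x
  have h1 : homWedge α (scalarWedge σ η) n q' x = ∑ q ∈ E.support, ∑ p ∈ Finset.range (n + 1),
      ∑ s ∈ Finset.range (n + 1), ((-1 : ℝ) ^ ((q' - q) * ((k + s : ℕ) : ℤ))) •
        tw (evalB (E.part q) (E'.part q') x) p (k + s) n (hc α p q q' x)
          (tw (scalarB (E.part q) x) k s (k + s) (σ x) (η s q x)) := by
    rw [homWedge_sum _ _ (Nat.lt_succ_self n)]
    refine Finset.sum_congr rfl fun q _ => Finset.sum_congr rfl fun p _ => ?_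
    rw [Finset.sum_congr rfl fun r hr => by
      rw [scalarWedge_sum σ η (show r < n + 1 from Finset.mem_range.1 hr), tw_sum_right,
        Finset.smul_sum], Finset.sum_comm]
    refine Finset.sum_congr rfl fun s _ => ?_
    rw [sum_range_single (n + 1) (k + s) (fun r => ((-1 : ℝ) ^ ((q' - q) * (r : ℤ))) •
      tw (evalB (E.part q) (E'.part q') x) p r n (hc α p q q' x)
        (tw (scalarB (E.part q) x) k s r (σ x) (η s q x)))]
    · intro r hr
      rw [tw_of_ne (scalarB (E.part q) x) hr.symm, tw_zero_right, smul_zero]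
    · intro h
      rw [tw_of_ne _ (by omega), smul_zero]
  have h2 : scalarWedge σ (homWedge α η) n q' x = ∑ q ∈ E.support, ∑ p ∈ Finset.range (n + 1),
      ∑ s ∈ Finset.range (n + 1), ((-1 : ℝ) ^ ((q' - q) * (s : ℤ))) •
        tw (scalarB (E'.part q') x) k (p + s) n (σ x)
          (tw (evalB (E.part q) (E'.part q') x) p s (p + s) (hc α p q q' x) (η s q x)) := by
    rw [scalarWedge_sum _ _ (Nat.lt_succ_self n)]
    rw [Finset.sum_congr rfl fun l hl => by
      rw [homWedge_sum α η (show l < n + 1 from Finset.mem_range.1 hl), tw_sum_right],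
      Finset.sum_comm]
    refine Finset.sum_congr rfl fun q _ => ?_
    rw [Finset.sum_congr rfl fun l _ => by rw [tw_sum_right], Finset.sum_comm]
    refine Finset.sum_congr rfl fun p _ => ?_
    rw [Finset.sum_congr rfl fun l _ => by rw [tw_sum_right], Finset.sum_comm]
    refine Finset.sum_congr rfl fun s _ => ?_
    rw [sum_range_single (n + 1) (p + s) (fun l => tw (scalarB (E'.part q') x) k l n (σ x)
      (((-1 : ℝ) ^ ((q' - q) * (s : ℤ))) •
        tw (evalB (E.part q) (E'.part q') x) p s l (hc α p q q' x) (η s q x))), tw_smul_right]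
    · intro l hl
      rw [tw_of_ne (evalB (E.part q) (E'.part q') x) hl.symm, smul_zero, tw_zero_right]
    · intro h
      rw [tw_of_ne _ (by omega)]
  rw [h1, h2, Finset.smul_sum]
  refine Finset.sum_congr rfl fun q _ => ?_
  rw [Finset.smul_sum]
  refine Finset.sum_congr rfl fun p _ => ?_
  rw [Finset.smul_sum]
  refine Finset.sum_congr rfl fun s _ => ?_
  by_cases hz : (p : ℤ) + (q' - q) = m
  · rw [tw_left_comm (scalarB (E.part q) x) (evalB (E.part q) (E'.part q') x)
      (evalB (E.part q) (E'.part q') x) (scalarB (E'.part q') x)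
      (fun f c e => map_smul (homVal (E.part q) (E'.part q') x f) _ _) n (m := p + s) rfl rfl,
      smul_smul, smul_smul]
    congr 1
    rw [← zpow_natCast, ← zpow_add₀ (by norm_num), ← zpow_add₀ (by norm_num)]
    subst hz
    refine neg_one_zpow_congr ⟨0, ?_⟩
    push_cast
    ring
  · have : hc α p q q' x = 0 := congrFun (hα p (q, q') hz) x
    rw [this]
    simp only [tw_zero_left, tw_zero_right, smul_zero]

theorem homWedge_homComp {E E' E'' : GradedBundle.{v} EX X} (ψ : RawForms (E'.hom E''))
    (α : RawForms (E.hom E')) (η : RawForms E.part) :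
    homWedge (homComp ψ α) η = homWedge ψ (homWedge α η) := by
  funext n q₃ x
  have h1 : homWedge (homComp ψ α) η n q₃ x = ∑ q₁ ∈ E.support, ∑ q₂ ∈ E'.support,
      ∑ p ∈ Finset.range (n + 1), ∑ r ∈ Finset.range (n + 1), ∑ s ∈ Finset.range (n + 1),
        ((-1 : ℝ) ^ ((q₃ - q₂) * (r : ℤ) + (q₃ - q₁) * (s : ℤ))) •
          tw (evalB (E.part q₁) (E''.part q₃) x) (p + r) s n
            (tw (compB (E.part q₁) (E'.part q₂) (E''.part q₃) x) p r (p + r) (hc ψ p q₂ q₃ x)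
              (hc α r q₁ q₂ x)) (η s q₁ x) := by
    rw [homWedge_sum _ _ (Nat.lt_succ_self n)]
    refine Finset.sum_congr rfl fun q₁ _ => ?_
    rw [Finset.sum_congr rfl fun m hm => Finset.sum_congr rfl fun s _ => by
      rw [homComp_sum ψ α (show m < n + 1 from Finset.mem_range.1 hm), tw_sum_left,
        Finset.smul_sum]]
    rw [Finset.sum_congr rfl fun m _ => Finset.sum_comm, Finset.sum_comm]
    refine Finset.sum_congr rfl fun q₂ _ => ?_
    rw [Finset.sum_congr rfl fun m _ => Finset.sum_congr rfl fun s _ => by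
      rw [tw_sum_left, Finset.smul_sum]]
    rw [Finset.sum_congr rfl fun m _ => Finset.sum_comm, Finset.sum_comm]
    refine Finset.sum_congr rfl fun p _ => ?_
    rw [Finset.sum_congr rfl fun m _ => Finset.sum_congr rfl fun s _ => by
      rw [tw_sum_left, Finset.smul_sum]]
    rw [Finset.sum_congr rfl fun m _ => Finset.sum_comm, Finset.sum_comm]
    refine Finset.sum_congr rfl fun r _ => ?_
    rw [Finset.sum_comm]
    refine Finset.sum_congr rfl fun s _ => ?_
    rw [sum_range_single (n + 1) (p + r) (fun m => ((-1 : ℝ) ^ ((q₃ - q₁) * (s : ℤ))) •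
      tw (evalB (E.part q₁) (E''.part q₃) x) m s n
        (((-1 : ℝ) ^ ((q₃ - q₂) * (r : ℤ))) •
          tw (compB (E.part q₁) (E'.part q₂) (E''.part q₃) x) p r m (hc ψ p q₂ q₃ x)
            (hc α r q₁ q₂ x)) (η s q₁ x)), tw_smul_left, smul_smul, ← zpow_add₀ (by norm_num), add_comm]
    · intro m hm
      rw [tw_of_ne _ hm.symm, smul_zero, tw_zero_left, smul_zero]
    · intro h
      rw [tw_of_ne _ (by omega), smul_zero]
  have h2 : homWedge ψ (homWedge α η) n q₃ x = ∑ q₂ ∈ E'.support, ∑ q₁ ∈ E.support,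
      ∑ p ∈ Finset.range (n + 1), ∑ r ∈ Finset.range (n + 1), ∑ s ∈ Finset.range (n + 1),
        ((-1 : ℝ) ^ ((q₃ - q₂) * ((r + s : ℕ) : ℤ) + (q₂ - q₁) * (s : ℤ))) •
          tw (evalB (E'.part q₂) (E''.part q₃) x) p (r + s) n (hc ψ p q₂ q₃ x)
            (tw (evalB (E.part q₁) (E'.part q₂) x) r s (r + s)
              (hc α r q₁ q₂ x) (η s q₁ x)) := by
    rw [homWedge_sum _ _ (Nat.lt_succ_self n)]
    refine Finset.sum_congr rfl fun q₂ _ => ?_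
    rw [Finset.sum_congr rfl fun p _ => Finset.sum_congr rfl fun l hl => by
      rw [homWedge_sum α η (show l < n + 1 from Finset.mem_range.1 hl), tw_sum_right,
        Finset.smul_sum]]
    rw [Finset.sum_congr rfl fun p _ => Finset.sum_comm, Finset.sum_comm]
    refine Finset.sum_congr rfl fun q₁ _ => Finset.sum_congr rfl fun p _ => ?_
    rw [Finset.sum_congr rfl fun l _ => by rw [tw_sum_right, Finset.smul_sum], Finset.sum_comm]
    refine Finset.sum_congr rfl fun r _ => ?_
    rw [Finset.sum_congr rfl fun l _ => by rw [tw_sum_right, Finset.smul_sum], Finset.sum_comm]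
    refine Finset.sum_congr rfl fun s _ => ?_
    rw [sum_range_single (n + 1) (r + s) (fun l => ((-1 : ℝ) ^ ((q₃ - q₂) * (l : ℤ))) •
      tw (evalB (E'.part q₂) (E''.part q₃) x) p l n (hc ψ p q₂ q₃ x)
        (((-1 : ℝ) ^ ((q₂ - q₁) * (s : ℤ))) •
          tw (evalB (E.part q₁) (E'.part q₂) x) r s l (hc α r q₁ q₂ x) (η s q₁ x))),
      tw_smul_right, smul_smul, ← zpow_add₀ (by norm_num)]
    · intro m hm
      rw [tw_of_ne (evalB (E.part q₁) (E'.part q₂) x) hm.symm, smul_zero, tw_zero_right, smul_zero]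
    · intro h
      rw [tw_of_ne _ (by omega), smul_zero]
  rw [h1, h2, Finset.sum_comm]
  refine Finset.sum_congr rfl fun q₂ _ => Finset.sum_congr rfl fun q₁ _ =>
    Finset.sum_congr rfl fun p _ => Finset.sum_congr rfl fun r _ => Finset.sum_congr rfl fun s _ => ?_
  rw [tw_assoc (compB (E.part q₁) (E'.part q₂) (E''.part q₃) x) (evalB (E.part q₁) (E''.part q₃) x)
    (evalB (E.part q₁) (E'.part q₂) x) (evalB (E'.part q₂) (E''.part q₃) x) (fun _ _ _ => rfl) n rfl rfl]
  congr 1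
  refine neg_one_zpow_congr ⟨0, ?_⟩
  push_cast
  ring

end WedgeAlgebra

/-! ## Frames and local generation -/

section Frames

/-- The form with values in the sum of the bundles `V i` which has only one component. -/
def incl {ι : Type} [DecidableEq ι] {V : ι → VBundle.{v} EX X} (p : ℕ) (i : ι)
    (η : RawForm (V i) p) : RawForms V :=
  Pi.single p (Pi.single (M := fun i => RawForm (V i) p) i η)

theorem incl_same {ι : Type} [DecidableEq ι] {V : ι → VBundle.{v} EX X} (p : ℕ) (i : ι)
    (η : RawForm (V i) p) : incl p i η p i = η := by
  simp [incl]

theorem incl_of_ne {ι : Type} [DecidableEq ι] {V : ι → VBundle.{v} EX X} {p p' : ℕ} {i i' : ι}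
    (η : RawForm (V i) p) (h : ¬(p' = p ∧ i' = i)) : incl p i η p' i' = 0 := by
  by_cases hp : p' = p
  · subst hp
    simp [incl, show i' ≠ i from fun hi => h ⟨rfl, hi⟩]
  · simp [incl, hp]

theorem incl_mem_omega {ι : Type} [DecidableEq ι] {V : ι → VBundle.{v} EX X} {p : ℕ} {i : ι}
    {η : RawForm (V i) p} (h : SmoothForm η) : incl p i η ∈ Omega V := fun p' i' => by
  by_cases hi : p' = p ∧ i' = i
  · obtain ⟨rfl, rfl⟩ := hi
    rwa [incl_same]
  · rw [incl_of_ne η hi]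
    exact (Omega V).zero_mem p' i'

/-- `incl` on smooth forms. -/
def inclΩ {ι : Type} [DecidableEq ι] {V : ι → VBundle.{v} EX X} (p : ℕ) (i : ι)
    (η : RawForm (V i) p) (h : SmoothForm η) : Omega V := ⟨incl p i η, incl_mem_omega h⟩

theorem incl_add {ι : Type} [DecidableEq ι] {V : ι → VBundle.{v} EX X} (p : ℕ) (i : ι)
    (η η' : RawForm (V i) p) : incl p i (η + η') = incl p i η + incl p i η' := by
  rw [incl, Pi.single_add, Pi.single_add]; rfl

theorem incl_smul {ι : Type} [DecidableEq ι] {V : ι → VBundle.{v} EX X} (p : ℕ) (i : ι) (c : ℝ)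
    (η : RawForm (V i) p) : incl p i (c • η) = c • incl p i η := by
  rw [incl, Pi.single_smul, Pi.single_smul]; rfl

theorem rawForm_eq_zero {A : VBundle.{v} EX X} {p : ℕ} (hp : Module.finrank ℝ EX < p)
    (η : RawForm A p) : η = 0 := by
  funext x
  refine ContinuousAlternatingMap.ext fun v => ?_
  refine (η x).toAlternatingMap.map_linearDependent v fun h => ?_
  have := LinearIndependent.fintype_card_le_finrank (R := ℝ) (M := EX) h
  rw [Fintype.card_fin] at this
  omega

theorem rawForm_eq_zero_of_subsingleton {A : VBundle.{v} EX X} {p : ℕ} (h : ¬ Nontrivial A.F)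
    (η : RawForm A p) : η = 0 := by
  funext x
  have := fib_subsingleton A h x
  exact ContinuousAlternatingMap.ext fun v => Subsingleton.elim _ _

theorem not_nontrivial_of_notMem {E : GradedBundle.{v} EX X} {q : ℤ} (h : q ∉ E.support) :
    ¬ Nontrivial (E.part q).F := fun h' => h (by rw [GradedBundle.support, Set.Finite.mem_toFinset]; exact h')

theorem eq_sum_incl {E : GradedBundle.{v} EX X} (η : RawForms E.part) :
    η = ∑ p ∈ Finset.range (Module.finrank ℝ EX + 1), ∑ q ∈ E.support, incl p q (η p q) := by
  funext p q
  simp only [Finset.sum_apply]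
  by_cases hp : p < Module.finrank ℝ EX + 1
  · by_cases hq : q ∈ E.support
    · rw [Finset.sum_eq_single_of_mem p (Finset.mem_range.2 hp),
        Finset.sum_eq_single_of_mem q hq, incl_same]
      · exact fun q' _ h => incl_of_ne _ fun h' => h h'.2.symm
      · exact fun p' _ h => Finset.sum_eq_zero fun q' _ => incl_of_ne _ fun h' => h h'.1.symm
    · rw [rawForm_eq_zero_of_subsingleton (not_nontrivial_of_notMem hq) (η p q)]
      refine (Finset.sum_eq_zero fun p' _ => Finset.sum_eq_zero fun q' hq' => ?_).symm
      exact incl_of_ne _ fun h' => hq (h'.2 ▸ hq')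
  · rw [rawForm_eq_zero (by omega) (η p q)]
    refine (Finset.sum_eq_zero fun p' hp' => Finset.sum_eq_zero fun q' _ => ?_).symm
    exact incl_of_ne _ fun h' => hp (h'.1 ▸ Finset.mem_range.1 hp')

theorem scalarWedge_add {ι : Type} {V : ι → VBundle.{v} EX X} {k : ℕ}
    (σ : RawForm (VBundle.line EX X) k) (η η' : RawForms V) :
    scalarWedge σ (η + η') = scalarWedge σ η + scalarWedge σ η' := by
  funext n i x
  change scalarWedge σ (η + η') n i x = scalarWedge σ η n i x + scalarWedge σ η' n i x
  rw [scalarWedge_eq, scalarWedge_eq, scalarWedge_eq]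
  exact tw_add_right _ _ _ _

theorem scalarWedge_smul {ι : Type} {V : ι → VBundle.{v} EX X} {k : ℕ}
    (σ : RawForm (VBundle.line EX X) k) (c : ℝ) (η : RawForms V) :
    scalarWedge σ (c • η) = c • scalarWedge σ η := by
  funext n i x
  change scalarWedge σ (c • η) n i x = c • scalarWedge σ η n i x
  rw [scalarWedge_eq, scalarWedge_eq]
  exact tw_smul_right _ _ _ _

theorem scalarWedge_sub {ι : Type} {V : ι → VBundle.{v} EX X} {k : ℕ}
    (σ : RawForm (VBundle.line EX X) k) (η η' : RawForms V) :
    scalarWedge σ (η - η') = scalarWedge σ η - scalarWedge σ η' := by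
  rw [sub_eq_add_neg, ← neg_one_smul ℝ, scalarWedge_add, scalarWedge_smul, neg_one_smul,
    ← sub_eq_add_neg]

/-- The multiplication of smooth forms by a smooth scalar form. -/
def mulS {ι : Type} {V : ι → VBundle.{v} EX X} {k : ℕ} (σ : RawForm (VBundle.line EX X) k)
    (hσ : SmoothForm σ) : Omega V →ₗ[ℝ] Omega V where
  toFun η := ⟨scalarWedge σ η, omega_scalarWedge hσ η.2⟩
  map_add' _ _ := Subtype.ext <| scalarWedge_add σ _ _
  map_smul' c _ := Subtype.ext <| scalarWedge_smul σ c _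

theorem scalarWedge_incl {ι : Type} [DecidableEq ι] {V : ι → VBundle.{v} EX X} {k p n : ℕ}
    (h : k + p = n) (σ : RawForm (VBundle.line EX X) k) (i : ι) (η : RawForm (V i) p) :
    scalarWedge σ (incl p i η) = incl n i fun x => tw (scalarB (V i) x) k p n (σ x) (η x) := by
  funext n' i' x
  rw [scalarWedge_eq]
  by_cases hi : n' = n ∧ i' = i
  · obtain ⟨rfl, rfl⟩ := hi
    obtain rfl : p = n' - k := by omega
    rw [incl_same, incl_same]
  · rw [incl_of_ne _ hi]
    by_cases hk : k ≤ n'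
    · rw [incl_of_ne _ (show ¬(n' - k = p ∧ i' = i) from fun h' => hi ⟨by omega, h'.2⟩)]
      exact tw_zero_right _ _
    · exact tw_of_ne _ (by omega) _ _

/-- The `0`-form given by a function. -/
def fnForm (φ : X → ℝ) : RawForm (VBundle.line EX X) 0 :=
  fun x => ContinuousAlternatingMap.constOfIsEmpty ℝ _ _ (φ x)

/-- The `0`-form given by a section. -/
def secForm {A : VBundle.{v} EX X} (s : ∀ x, A.fib x) : RawForm A 0 :=
  fun x => ContinuousAlternatingMap.constOfIsEmpty ℝ _ _ (s x)

theorem smoothFormAt_secForm {A : VBundle.{v} EX X} {s : ∀ x, A.fib x} {x₀ x : X}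
    (h : x ∈ A.nb x₀)
    (hs : ContMDiffAt 𝓘(ℝ, EX) 𝓘(ℝ, A.F) ∞ (fun y => A.tr x₀ y (s y)) x) :
    SmoothFormAt (secForm s) x := by
  rw [smoothFormAt_iff]
  refine contMDiffAt_alt_of_apply fun v => ?_
  refine ((A.contMDiffAt_tr_trs h (A.mem_nb x)).clm_apply hs).congr_of_eventuallyEq ?_
  filter_upwards [(A.isOpen_nb x₀).mem_nhds h] with y hy
  change A.tr x y (s y) = A.tr x y (A.trs x₀ y (A.tr x₀ y (s y)))
  rw [A.trs_tr hy]

theorem smoothForm_fnForm {φ : X → ℝ} (hφ : ContMDiff 𝓘(ℝ, EX) 𝓘(ℝ, ℝ) ∞ φ) :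
    SmoothForm (fnForm (EX := EX) φ) := smoothForm_of_at fun x => by
  rw [smoothFormAt_iff]
  refine contMDiffAt_alt_of_apply fun v => ?_
  refine (hφ x).congr_of_eventuallyEq (Filter.Eventually.of_forall fun y => ?_)
  exact VBundle.line_tr (EX := EX) x y _

/-- The form obtained by applying linear maps to the values. -/
def mapVal {A : VBundle.{v} EX X} {A' : VBundle.{w} EX X} (c : ∀ x, A.fib x →L[ℝ] A'.fib x) {p : ℕ}
    (α : RawForm A p) : RawForm A' p :=
  fun x => (c x).compContinuousAlternatingMap (α x)

theorem SmoothFormAt.mapVal {A : VBundle.{v} EX X} {A' : VBundle.{w} EX X}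
    {c : ∀ x, A.fib x →L[ℝ] A'.fib x} {p : ℕ} {α : RawForm A p} {x₀ : X}
    (hα : SmoothFormAt α x₀) {K : X → A.F →L[ℝ] A'.F}
    (hK : ContMDiffAt 𝓘(ℝ, EX) 𝓘(ℝ, A.F →L[ℝ] A'.F) ∞ K x₀)
    (hc : ∀ᶠ x in nhds x₀, ∀ a, A'.tr x₀ x (c x a) = K x (A.tr x₀ x a)) :
    SmoothFormAt (ChernWeil.mapVal c α) x₀ := by
  have := SmoothFormAt.pullMap (f := id) (c := c) (x₀ := x₀) hα contMDiffAt_id (A.mem_nb x₀) hK hc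
  refine this.congr (Filter.Eventually.of_forall fun x => ?_)
  refine ContinuousAlternatingMap.ext fun v => ?_
  change c x (α x v) = c x (α x fun i => mfderiv 𝓘(ℝ, EX) 𝓘(ℝ, EX) id x (v i))
  rw [mfderiv_id]
  rfl

variable [T2Space X]

/-- A bump function at `x₀` with support in the domain of the trivialization of `A` at `x₀`. -/
def VBundle.bump (A : VBundle.{v} EX X) (x₀ : X) : SmoothBumpFunction 𝓘(ℝ, EX) x₀ :=
  ((SmoothBumpFunction.nhds_basis_tsupport (I := 𝓘(ℝ, EX)) x₀).mem_iff.1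
    ((A.isOpen_nb x₀).mem_nhds (A.mem_nb x₀))).choose

theorem VBundle.tsupport_bump (A : VBundle.{v} EX X) (x₀ : X) : tsupport (A.bump x₀) ⊆ A.nb x₀ :=
  ((SmoothBumpFunction.nhds_basis_tsupport (I := 𝓘(ℝ, EX)) x₀).mem_iff.1
    ((A.isOpen_nb x₀).mem_nhds (A.mem_nb x₀))).choose_spec.2

theorem VBundle.bump_self (A : VBundle.{v} EX X) (x₀ : X) : A.bump x₀ x₀ = 1 :=
  (A.bump x₀).eq_one

theorem VBundle.bump_eq_zero (A : VBundle.{v} EX X) {x₀ x : X} (h : x ∉ A.nb x₀) :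
    A.bump x₀ x = 0 := by
  by_contra h'
  exact h (A.tsupport_bump x₀ (subset_tsupport _ h'))

/-- The section which is constant in the trivialization at `x₀`, cut off outside a neighbourhood. -/
def VBundle.sec (A : VBundle.{v} EX X) (x₀ : X) (e : A.F) (x : X) : A.fib x :=
  A.bump x₀ x • A.trs x₀ x e

theorem eventually_eq_zero_of_notMem_tsupport {φ : X → ℝ} {x : X} (h : x ∉ tsupport φ) :
    ∀ᶠ y in nhds x, φ y = 0 :=
  notMem_tsupport_iff_eventuallyEq.1 h

theorem smoothForm_sec (A : VBundle.{v} EX X) (x₀ : X) (e : A.F) :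
    SmoothForm (secForm (A.sec x₀ e)) := smoothForm_of_at fun x => by
  by_cases h : x ∈ tsupport (A.bump x₀)
  · have hx := A.tsupport_bump x₀ h
    refine smoothFormAt_secForm hx ?_
    have : ContMDiffAt 𝓘(ℝ, EX) 𝓘(ℝ, A.F) ∞ (fun y => A.bump x₀ y • e) x :=
      (A.bump x₀).contMDiffAt.smul contMDiffAt_const
    refine this.congr_of_eventuallyEq ?_
    filter_upwards [(A.isOpen_nb x₀).mem_nhds hx] with y hy
    rw [VBundle.sec, map_smul, A.tr_trs hy]
  · refine smoothFormAt_zero.congr ?_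
    filter_upwards [eventually_eq_zero_of_notMem_tsupport h] with y hy
    refine ContinuousAlternatingMap.ext fun v => ?_
    change A.bump x₀ y • A.trs x₀ y e = 0
    rw [hy, zero_smul]

/-- The smooth `0`-forms in `S` generate the forms with values in `A` near `x₀`. -/
def Generates (A : VBundle.{v} EX X) (x₀ : X) (S : Set (RawForm A 0)) : Prop :=
  ∀ (p : ℕ) (η : RawForm A p), SmoothForm η → ∃ f : RawForm (VBundle.line EX X) 0, SmoothForm f ∧
    sval f x₀ ![] = 1 ∧ ∃ (n : ℕ) (σ : Fin n → RawForm (VBundle.line EX X) p)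
      (s : Fin n → RawForm A 0), (∀ j, SmoothForm (σ j)) ∧ (∀ j, s j ∈ S) ∧
      (fun x => tw (scalarB A x) 0 p p (f x) (η x)) =
        ∑ j, fun x => tw (scalarB A x) p 0 p (σ j x) (s j x)

section Coef

variable {A : VBundle.{v} EX X} {A' : VBundle.{v} EM M} (x₀ : X) {f : M → X}
  (c : ∀ m, A.fib (f m) ≃L[ℝ] A'.fib m)

/-- The coefficients of the vectors of `A' ≅ f* A` in the frame of `A` near `x₀`, cut off outside a
neighbourhood. -/
def VBundle.coefMap (j : Fin (Module.finrank ℝ A.F)) (m : M) :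
    A'.fib m →L[ℝ] (VBundle.line EM M).fib m :=
  A.bump x₀ (f m) • (show A'.fib m →L[ℝ] ℝ from
    (LinearMap.toContinuousLinearMap ((Module.finBasis ℝ A.F).coord j)).comp
      ((A.tr x₀ (f m)).comp (c m).symm.toContinuousLinearMap))

theorem smoothForm_coef (hf : ContMDiff 𝓘(ℝ, EM) 𝓘(ℝ, EX) ∞ f)
    (hc : ∀ m₀, ∃ K : A.F ≃L[ℝ] A'.F, ∀ᶠ m in nhds m₀, ∀ a,
      A'.tr m₀ m (c m a) = K (A.tr (f m₀) (f m) a))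
    (j : Fin (Module.finrank ℝ A.F)) {p : ℕ} {η : RawForm A' p}
    (hη : SmoothForm η) : SmoothForm (mapVal (VBundle.coefMap x₀ c j) η) :=
  smoothForm_of_at fun m => by
  have hχs : ContMDiff 𝓘(ℝ, EM) 𝓘(ℝ, ℝ) ∞ fun m => A.bump x₀ (f m) :=
    (A.bump x₀).contMDiff.comp hf
  by_cases h : f m ∈ tsupport (A.bump x₀)
  · have hx := A.tsupport_bump _ h
    obtain ⟨K, hK⟩ := hc m
    refine SmoothFormAt.mapVal (hη m) (K := fun m' => A.bump x₀ (f m') •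
      (LinearMap.toContinuousLinearMap ((Module.finBasis ℝ A.F).coord j)).comp
        (((A.tr x₀ (f m')).comp (A.trs (f m) (f m'))).comp K.symm.toContinuousLinearMap)) ?_ ?_
    · have h1 : ContMDiffAt 𝓘(ℝ, EM) 𝓘(ℝ, A.F →L[ℝ] A.F) ∞
          (fun m' => (A.tr x₀ (f m')).comp (A.trs (f m) (f m'))) m :=
        (A.contMDiffAt_tr_trs (A.mem_nb _) hx).comp m (hf m)
      exact (hχs m).smul (contMDiffAt_const.clm_comp (h1.clm_comp contMDiffAt_const))
    · filter_upwards [hK, (hf m).continuousAt.preimage_mem_nhds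
        ((A.isOpen_nb (f m)).mem_nhds (A.mem_nb _))] with m' h1 h2 a
      refine (VBundle.line_tr m m' _).trans ?_
      have h3 : A'.tr m m' a = K (A.tr (f m) (f m') ((c m').symm a)) := by
        rw [← h1, ContinuousLinearEquiv.apply_symm_apply]
      rw [h3]
      change A.bump x₀ (f m') * (Module.finBasis ℝ A.F).coord j (A.tr x₀ (f m') ((c m').symm a)) =
        A.bump x₀ (f m') * (Module.finBasis ℝ A.F).coord j (A.tr x₀ (f m') (A.trs (f m) (f m')
          (K.symm (K (A.tr (f m) (f m') ((c m').symm a))))))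
      rw [K.symm_apply_apply, A.trs_tr h2]
  · refine smoothFormAt_zero.congr ?_
    filter_upwards [(hf m).continuousAt.eventually (eventually_eq_zero_of_notMem_tsupport h)]
      with m' hm'
    refine ContinuousAlternatingMap.ext fun v => ?_
    change A.bump x₀ (f m') * _ = 0
    rw [show A.bump x₀ (f m') = 0 from hm', zero_mul]

theorem sum_coef {p : ℕ} (η : RawForm A' p) :
    (fun m => tw (scalarB A' m) 0 p p
      (fnForm (EX := EM) (fun m => A.bump x₀ (f m) * A.bump x₀ (f m)) m) (η m)) =
      ∑ j, fun m => tw (scalarB A' m) p 0 p (mapVal (VBundle.coefMap x₀ c j) η m)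
        (secForm (fun m => c m (A.sec x₀ (Module.finBasis ℝ A.F j) (f m))) m) := by
  set b := Module.finBasis ℝ A.F
  funext m
  rw [Finset.sum_apply]
  refine ContinuousAlternatingMap.ext fun v => ?_
  rw [tw_zero_apply, ContinuousAlternatingMap.sum_apply]
  simp only [tw_apply_zero]
  set χ : M → ℝ := fun m => A.bump x₀ (f m) with hχ
  change (χ m * χ m) • η m v = ∑ j, (χ m * b.coord j (A.tr x₀ (f m) ((c m).symm (η m v)))) •
    c m (χ m • A.trs x₀ (f m) (b j))
  by_cases hm : f m ∈ A.nb x₀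
  · have h1 : ∑ j, (b.coord j (A.tr x₀ (f m) ((c m).symm (η m v)))) •
        c m (A.trs x₀ (f m) (b j)) = η m v := by
      simp_rw [← map_smul, ← map_sum]
      simp only [Module.Basis.coord_apply, b.sum_repr]
      rw [A.trs_tr hm, ContinuousLinearEquiv.apply_symm_apply]
    conv_lhs => rw [← h1]
    rw [Finset.smul_sum]
    refine Finset.sum_congr rfl fun j _ => ?_
    rw [map_smul, smul_smul, smul_smul]
    congr 1
    ring
  · have : χ m = 0 := A.bump_eq_zero hm
    simp [this]

theorem generates_sec (hf : ContMDiff 𝓘(ℝ, EM) 𝓘(ℝ, EX) ∞ f)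
    (hc : ∀ m₀, ∃ K : A.F ≃L[ℝ] A'.F, ∀ᶠ m in nhds m₀, ∀ a,
      A'.tr m₀ m (c m a) = K (A.tr (f m₀) (f m) a))
    {m₀ : M} (h : A.bump x₀ (f m₀) = 1) : Generates A' m₀
    (Set.range fun j => secForm fun m => c m (A.sec x₀ (Module.finBasis ℝ A.F j) (f m))) := by
  intro p η hη
  have hχs : ContMDiff 𝓘(ℝ, EM) 𝓘(ℝ, ℝ) ∞ fun m => A.bump x₀ (f m) :=
    (A.bump x₀).contMDiff.comp hf
  refine ⟨_, smoothForm_fnForm (hχs.mul hχs), ?_, _, fun j => mapVal (VBundle.coefMap x₀ c j) η,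
    fun j => secForm fun m => c m (A.sec x₀ (Module.finBasis ℝ A.F j) (f m)),
    fun j => smoothForm_coef x₀ c hf hc j hη, fun j => ⟨j, rfl⟩, sum_coef x₀ c η⟩
  change A.bump x₀ (f m₀) * A.bump x₀ (f m₀) = 1
  rw [h, one_mul]

end Coef

end Frames

/-! ## Local generation and representation of tensorial operators -/

section Tensorial

theorem smoothForm_comp {ι : Type} {V : ι → VBundle.{v} EX X} (η : Omega V) (p : ℕ) (i : ι) :
    SmoothForm ((η : RawForms V) p i) := η.2 p i

theorem eq_sum_inclΩ {E : GradedBundle.{v} EX X} (η : Omega E.part) :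
    η = ∑ p ∈ Finset.range (Module.finrank ℝ EX + 1), ∑ q ∈ E.support,
      inclΩ p q ((η : RawForms E.part) p q) (smoothForm_comp η p q) := by
  refine Subtype.ext ?_
  rw [AddSubmonoidClass.coe_finsetSum]
  simp only [AddSubmonoidClass.coe_finsetSum]
  exact eq_sum_incl _

/-- Local generation: an operator which is compatible with the multiplication by scalar forms
vanishes if it vanishes on a generating set of sections. -/
theorem eq_zero_of_generates {E : GradedBundle.{v} EX X} {W : Type*} [AddCommGroup W] [Module ℝ W]
    (x₀ : X) (S : ∀ q, Set (RawForm (E.part q) 0)) (hS : ∀ q ∈ E.support, Generates (E.part q) x₀ (S q))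
    (hSs : ∀ q, ∀ s ∈ S q, SmoothForm s) (T : Omega E.part →ₗ[ℝ] W)
    (hT : ∀ (k : ℕ) (σ : RawForm (VBundle.line EX X) k) (hσ : SmoothForm σ) (η : Omega E.part),
      T η = 0 → T (mulS σ hσ η) = 0)
    (hf : ∀ (f : RawForm (VBundle.line EX X) 0) (hf : SmoothForm f) (η : Omega E.part),
      sval f x₀ ![] = 1 → T (mulS f hf η) = 0 → T η = 0)
    (h0 : ∀ q ∈ E.support, ∀ s (hs : s ∈ S q), T (inclΩ 0 q s (hSs q s hs)) = 0) (η : Omega E.part) :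
    T η = 0 := by
  rw [eq_sum_inclΩ η, map_sum]
  refine Finset.sum_eq_zero fun p _ => ?_
  rw [map_sum]
  refine Finset.sum_eq_zero fun q hq => ?_
  obtain ⟨f, hfs, hf1, n, σ, s, hσ, hs, h⟩ := hS q hq p _ (smoothForm_comp η p q)
  refine hf f hfs _ hf1 ?_
  have h1 : mulS f hfs (inclΩ p q ((η : RawForms E.part) p q) (smoothForm_comp η p q)) =
      ∑ j, mulS (σ j) (hσ j) (inclΩ 0 q (s j) (hSs q _ (hs j))) := by
    refine Subtype.ext ?_
    rw [AddSubmonoidClass.coe_finsetSum]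
    refine (scalarWedge_incl (zero_add p) f q _).trans ?_
    rw [h]
    have : ∀ t : Finset (Fin n), incl p q (∑ j ∈ t, fun x => tw (scalarB (E.part q) x) p 0 p (σ j x) (s j x)) =
        ∑ j ∈ t, incl (V := E.part) p q fun x => tw (scalarB (E.part q) x) p 0 p (σ j x) (s j x) := by
      intro t
      induction t using Finset.induction_on with
      | empty => simp [incl]
      | insert j t hj ih => rw [Finset.sum_insert hj, Finset.sum_insert hj, incl_add, ih]
    rw [this]
    exact Finset.sum_congr rfl fun j _ => (scalarWedge_incl (add_zero p) (σ j) q (s j)).symm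
  rw [h1, map_sum]
  exact Finset.sum_eq_zero fun j _ => hT _ _ _ _ (h0 q hq _ (hs j))

/-- The multiplication of smooth forms by a smooth `Hom`-valued form. -/
def rawH {E E' : GradedBundle.{v} EX X} (α : RawForms (E.hom E')) :
    RawForms E.part →ₗ[ℝ] RawForms E'.part where
  toFun η := homWedge α η
  map_add' η η' := by
    funext n q x
    change homWedge α _ n q x = homWedge α η n q x + homWedge α η' n q x
    simp only [homWedge_eq, ← Finset.sum_add_distrib, ← smul_add]
    refine Finset.sum_congr rfl fun q' _ => Finset.sum_congr rfl fun y _ => congrArg _ ?_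
    exact tw_add_right _ _ _ _
  map_smul' c η := by
    funext n q x
    change homWedge α _ n q x = c • homWedge α η n q x
    simp only [homWedge_eq, Finset.smul_sum]
    refine Finset.sum_congr rfl fun q' _ => Finset.sum_congr rfl fun y _ => ?_
    rw [smul_comm]
    refine congrArg _ ?_
    exact tw_smul_right _ _ _ _

/-- The multiplication of smooth forms by a smooth `Hom`-valued form. -/
def mulH {E E' : GradedBundle.{v} EX X} (α : RawForms (E.hom E')) (hα : α ∈ Omega (E.hom E')) :
    Omega E.part →ₗ[ℝ] Omega E'.part :=
  (rawH α).restrict fun _ hη => omega_homWedge hα hη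

theorem homWedge_add_left {E E' : GradedBundle.{v} EX X} (α β : RawForms (E.hom E'))
    (η : RawForms E.part) : homWedge (α + β) η = homWedge α η + homWedge β η := by
  funext n q x
  change _ = homWedge α η n q x + homWedge β η n q x
  simp only [homWedge_eq, ← Finset.sum_add_distrib, ← smul_add]
  refine Finset.sum_congr rfl fun q' _ => Finset.sum_congr rfl fun y _ => congrArg _ ?_
  exact tw_add_left _ _ _ _

theorem homWedge_smul_left {E E' : GradedBundle.{v} EX X} (c : ℝ) (α : RawForms (E.hom E'))
    (η : RawForms E.part) : homWedge (c • α) η = c • homWedge α η := by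
  funext n q x
  change _ = c • homWedge α η n q x
  simp only [homWedge_eq, Finset.smul_sum]
  refine Finset.sum_congr rfl fun q' _ => Finset.sum_congr rfl fun y _ => ?_
  rw [smul_comm]
  refine congrArg _ ?_
  exact tw_smul_left _ _ _ _

theorem homWedge_incl_zero {E E' : GradedBundle.{v} EX X} (α : RawForms (E.hom E')) {q : ℤ}
    (hq : q ∈ E.support) (s : RawForm (E.part q) 0) (n : ℕ) (q' : ℤ) (x : X)
    (v : Fin n → TangentSpace 𝓘(ℝ, EX) x) :
    homWedge α (incl 0 q s) n q' x v =
      homVal (E.part q) (E'.part q') x (hc α n q q' x v) (s x ![]) := by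
  rw [homWedge_eq, Finset.sum_eq_single_of_mem q hq, Finset.sum_eq_single (n, 0)]
  · rw [incl_same]
    simp only [Nat.cast_zero, mul_zero, zpow_zero, one_smul]
    exact tw_apply_zero _ _ _ _ _
  · intro y hy hy'
    have : y.1 + y.2 = n := by simpa using hy
    rw [incl_of_ne _ (show ¬(y.2 = 0 ∧ q = q) from fun h => hy' (Prod.ext (by omega) h.1))]
    rw [show (0 : RawForm (E.part q) y.2) x = 0 from rfl, tw_zero_right, smul_zero]
  · intro h
    exact absurd (by simp) h
  · intro q₁ _ hne
    refine Finset.sum_eq_zero fun y _ => ?_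
    rw [incl_of_ne _ (show ¬(y.2 = 0 ∧ q₁ = q) from fun h => hne h.2)]
    rw [show (0 : RawForm (E.part q₁) y.2) x = 0 from rfl, tw_zero_right, smul_zero]

theorem homForm_eq_zero {E E' : GradedBundle.{v} EX X} {q q' : ℤ} (hq : q ∉ E.support) {p : ℕ}
    (α : RawForm (E.hom E' (q, q')) p) : α = 0 := by
  funext x
  have := fib_subsingleton (E.part q) (not_nontrivial_of_notMem hq) x
  refine ContinuousAlternatingMap.ext fun v => ?_
  refine (show Function.Injective (homVal (E.part q) (E'.part q') x) from fun _ _ h => h) ?_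
  exact ContinuousLinearMap.ext fun e => by
    rw [Subsingleton.elim e 0, map_zero, map_zero]

variable [T2Space X]

/-- A smooth section with the given value at `x₀`. -/
def VBundle.ext (A : VBundle.{v} EX X) (x₀ : X) (e : A.fib x₀) : RawForm A 0 :=
  secForm (A.sec x₀ (A.tr x₀ x₀ e))

theorem VBundle.smooth_ext (A : VBundle.{v} EX X) (x₀ : X) (e : A.fib x₀) : SmoothForm (A.ext x₀ e) :=
  smoothForm_sec A x₀ _

theorem VBundle.ext_self (A : VBundle.{v} EX X) (x₀ : X) (e : A.fib x₀) : A.ext x₀ e x₀ ![] = e := by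
  change A.bump x₀ x₀ • A.trs x₀ x₀ (A.tr x₀ x₀ e) = e
  rw [A.bump_self, one_smul, A.trs_tr (A.mem_nb x₀)]

theorem VBundle.ext_add (A : VBundle.{v} EX X) (x₀ : X) (e e' : A.fib x₀) :
    A.ext x₀ (e + e') = A.ext x₀ e + A.ext x₀ e' := by
  funext x
  refine ContinuousAlternatingMap.ext fun v => ?_
  change A.bump x₀ x • A.trs x₀ x (A.tr x₀ x₀ (e + e')) =
    A.bump x₀ x • A.trs x₀ x (A.tr x₀ x₀ e) + A.bump x₀ x • A.trs x₀ x (A.tr x₀ x₀ e')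
  rw [map_add, map_add, smul_add]

theorem VBundle.ext_smul (A : VBundle.{v} EX X) (x₀ : X) (c : ℝ) (e : A.fib x₀) :
    A.ext x₀ (c • e) = c • A.ext x₀ e := by
  funext x
  refine ContinuousAlternatingMap.ext fun v => ?_
  change A.bump x₀ x • A.trs x₀ x (A.tr x₀ x₀ (c • e)) =
    c • (A.bump x₀ x • A.trs x₀ x (A.tr x₀ x₀ e))
  rw [map_smul, map_smul, smul_comm]

theorem generates_ext (A : VBundle.{v} EX X) (x₀ : X) :
    Generates A x₀ (Set.range (A.ext x₀)) := by
  have h := generates_sec (A := A) (A' := A) x₀ (f := id)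
    (fun m => ContinuousLinearEquiv.refl ℝ (A.fib m)) contMDiff_id
    (fun m₀ => ⟨ContinuousLinearEquiv.refl ℝ A.F, Filter.Eventually.of_forall fun m a => rfl⟩)
    (m₀ := x₀) (A.bump_self x₀)
  have e : (Set.range fun j => secForm fun m => (ContinuousLinearEquiv.refl ℝ (A.fib m))
      (A.sec x₀ (Module.finBasis ℝ A.F j) (id m))) ⊆ Set.range (A.ext x₀) := by
    rintro _ ⟨j, rfl⟩
    refine ⟨A.trs x₀ x₀ (Module.finBasis ℝ A.F j), ?_⟩
    rw [VBundle.ext, A.tr_trs (A.mem_nb x₀)]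
    rfl
  intro p η hη
  obtain ⟨f, hf, h1, n, σ, s, hσ, hs, heq⟩ := h p η hη
  exact ⟨f, hf, h1, n, σ, s, hσ, fun j => e (hs j), heq⟩

/-- A `Hom`-valued form is determined by its action on smooth forms. -/
theorem homForms_ext {E E' : GradedBundle.{v} EX X} {α β : RawForms (E.hom E')}
    (h : ∀ η ∈ Omega E.part, homWedge α η = homWedge β η) : α = β := by
  funext p i
  obtain ⟨q, q'⟩ := i
  by_cases hq : q ∈ E.support
  · funext x
    refine ContinuousAlternatingMap.ext fun v => ?_
    refine (show Function.Injective (homVal (E.part q) (E'.part q') x) from fun _ _ h => h) ?_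
    refine ContinuousLinearMap.ext fun e => ?_
    have h1 := congrArg (fun ζ : RawForms E'.part => ζ p q' x v)
      (h _ (incl_mem_omega (i := q) ((E.part q).smooth_ext x e)))
    simp only [homWedge_incl_zero _ hq, VBundle.ext_self] at h1
    exact h1
  · rw [homForm_eq_zero hq (α p (q, q')), homForm_eq_zero hq (β p (q, q'))]

/-- The `Hom`-valued form which represents a tensorial operator. -/
def repr {E E' : GradedBundle.{v} EX X} (T : Omega E.part →ₗ[ℝ] Omega E'.part) :
    RawForms (E.hom E') := fun p i x =>
  toContAlt (N := (E.part i.1).fib x →L[ℝ] (E'.part i.2).fib x)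
    { toFun := fun v => LinearMap.toContinuousLinearMap
        { toFun := fun e =>
            (T (inclΩ 0 i.1 ((E.part i.1).ext x e) ((E.part i.1).smooth_ext x e)) : RawForms E'.part) p i.2 x v
          map_add' := fun e e' => by
            have : inclΩ 0 i.1 ((E.part i.1).ext x (e + e')) ((E.part i.1).smooth_ext x (e + e')) =
                inclΩ 0 i.1 ((E.part i.1).ext x e) ((E.part i.1).smooth_ext x e) +
                inclΩ 0 i.1 ((E.part i.1).ext x e') ((E.part i.1).smooth_ext x e') := Subtype.ext <| by
              change incl 0 i.1 _ = incl 0 i.1 _ + incl 0 i.1 _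
              rw [VBundle.ext_add, incl_add]
            rw [this, map_add]
            rfl
          map_smul' := fun c e => by
            have : inclΩ 0 i.1 ((E.part i.1).ext x (c • e)) ((E.part i.1).smooth_ext x (c • e)) =
                c • inclΩ 0 i.1 ((E.part i.1).ext x e) ((E.part i.1).smooth_ext x e) := Subtype.ext <| by
              change incl 0 i.1 _ = c • incl 0 i.1 _
              rw [VBundle.ext_smul, incl_smul]
            rw [this, map_smul]
            rfl }
      map_update_add' := fun v j a b => by
        refine ContinuousLinearMap.ext fun e => ?_
        exact ContinuousAlternatingMap.map_update_add _ v j a b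
      map_update_smul' := fun v j c a => by
        refine ContinuousLinearMap.ext fun e => ?_
        exact ContinuousAlternatingMap.map_update_smul _ v j c a
      map_eq_zero_of_eq' := fun v j k h hjk => by
        refine ContinuousLinearMap.ext fun e => ?_
        exact ContinuousAlternatingMap.map_eq_zero_of_eq _ v h hjk }

theorem repr_apply {E E' : GradedBundle.{v} EX X} (T : Omega E.part →ₗ[ℝ] Omega E'.part) (p : ℕ)
    (q q' : ℤ) (x : X) (v : Fin p → TangentSpace 𝓘(ℝ, EX) x) (e : (E.part q).fib x) :
    homVal (E.part q) (E'.part q') x (hc (repr T) p q q' x v) e =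
      (T (inclΩ 0 q ((E.part q).ext x e) ((E.part q).smooth_ext x e)) : RawForms E'.part) p q' x v :=
  rfl

/-- `T` has degree `m` and commutes with the multiplication by scalar forms, up to the Koszul
sign. -/
structure IsTensorial {E E' : GradedBundle.{v} EX X} (m : ℤ)
    (T : Omega E.part →ₗ[ℝ] Omega E'.part) : Prop where
  degree : ∀ (n : ℤ) (η : Omega E.part), IsHomogeneous id n (η : RawForms E.part) →
    IsHomogeneous id (n + m) (T η : RawForms E'.part)
  mul : ∀ (k : ℕ) (σ : RawForm (VBundle.line EX X) k) (hσ : SmoothForm σ) (η : Omega E.part),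
    T (mulS σ hσ η) = (-1 : ℝ) ^ (m * k) • mulS σ hσ (T η)

theorem isHomogeneous_incl {E : GradedBundle.{v} EX X} (p : ℕ) (q : ℤ) (η : RawForm (E.part q) p) :
    IsHomogeneous id (p + q) (incl p q η : RawForms E.part) := fun p' q' h =>
  incl_of_ne η fun h' => h (by rw [h'.1, h'.2]; rfl)

theorem isHomogeneous_repr {E E' : GradedBundle.{v} EX X} {m : ℤ}
    {T : Omega E.part →ₗ[ℝ] Omega E'.part} (hT : IsTensorial m T) :
    IsHomogeneous homDeg m (repr T) := by
  rintro p ⟨q, q'⟩ h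
  funext x
  refine ContinuousAlternatingMap.ext fun v => ?_
  refine (show Function.Injective (homVal (E.part q) (E'.part q') x) from fun _ _ h => h) ?_
  refine ContinuousLinearMap.ext fun e => ?_
  refine (repr_apply T p q q' x v e).trans ?_
  rw [hT.degree _ _ (isHomogeneous_incl 0 q ((E.part q).ext x e)) p q' fun h' => h ?_]
  · rfl
  · simp only [id, homDeg] at h' ⊢
    push_cast at h'
    omega

/-- The value of a form at `x₀`. -/
def evalAt {ι : Type} {V : ι → VBundle.{v} EX X} (x₀ : X) :
    RawForms V →ₗ[ℝ] ∀ (p : ℕ) (i : ι), TangentSpace 𝓘(ℝ, EX) x₀ [⋀^Fin p]→L[ℝ] (V i).fib x₀ where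
  toFun η p i := η p i x₀
  map_add' _ _ := rfl
  map_smul' _ _ := rfl

theorem evalAt_scalarWedge {ι : Type} {V : ι → VBundle.{v} EX X} {x₀ : X} {k : ℕ}
    (σ : RawForm (VBundle.line EX X) k) {η : RawForms V} (h : evalAt x₀ η = 0) :
    evalAt x₀ (scalarWedge σ η) = 0 := by
  funext n i
  change scalarWedge σ η n i x₀ = 0
  rw [scalarWedge_eq, show η (n - k) i x₀ = 0 from congrFun (congrFun h (n - k)) i, tw_zero_right]

theorem evalAt_scalarWedge_one {ι : Type} {V : ι → VBundle.{v} EX X} {x₀ : X}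
    {f : RawForm (VBundle.line EX X) 0} (hf : sval f x₀ ![] = 1) (η : RawForms V) :
    evalAt x₀ (scalarWedge f η) = evalAt x₀ η := by
  funext n i
  change scalarWedge f η n i x₀ = η n i x₀
  rw [scalarWedge_eq]
  refine ContinuousAlternatingMap.ext fun v => (tw_zero_apply _ _ _ _ _).trans ?_
  change sval f x₀ ![] • η n i x₀ v = _
  rw [hf, one_smul]

theorem homWedge_repr {E E' : GradedBundle.{v} EX X} {m : ℤ}
    {T : Omega E.part →ₗ[ℝ] Omega E'.part} (hT : IsTensorial m T) (η : Omega E.part) :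
    homWedge (repr T) (η : RawForms E.part) = (T η : RawForms E'.part) := by
  have key : ∀ x₀ : X, evalAt x₀ (T η : RawForms E'.part) -
      evalAt x₀ (homWedge (repr T) (η : RawForms E.part)) = 0 := by
    intro x₀
    let T' := (evalAt x₀).comp ((Omega E'.part).subtype.comp T) -
      (evalAt x₀).comp ((rawH (repr T)).comp (Omega E.part).subtype)
    have hT' : ∀ (k : ℕ) (σ : RawForm (VBundle.line EX X) k) (hσ : SmoothForm σ) (η : Omega E.part),
        T' (mulS σ hσ η) = (-1 : ℝ) ^ (m * k) • evalAt x₀ (scalarWedge σ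
          ((T η : RawForms E'.part) - homWedge (repr T) (η : RawForms E.part))) := by
      intro k σ hσ η
      have h1 : T' (mulS σ hσ η) = evalAt x₀ (T (mulS σ hσ η) : RawForms E'.part) -
        evalAt x₀ (homWedge (repr T) (scalarWedge σ (η : RawForms E.part))) := rfl
      have h2 : (T (mulS σ hσ η) : RawForms E'.part) =
          (-1 : ℝ) ^ (m * k) • scalarWedge σ (T η : RawForms E'.part) := by
        rw [hT.mul]; rfl
      rw [h1, h2, homWedge_scalarWedge (isHomogeneous_repr hT), ← map_sub, ← map_smul, ← smul_sub,
        scalarWedge_sub]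
    refine eq_zero_of_generates x₀ (fun q => Set.range ((E.part q).ext x₀))
      (fun q _ => generates_ext (E.part q) x₀) (fun q s hs => ?_) T' (fun k σ hσ η h => ?_)
      (fun f hf η hf1 h => ?_) (fun q hq s hs => ?_) η
    · obtain ⟨e, rfl⟩ := hs
      exact (E.part q).smooth_ext x₀ e
    · rw [hT', evalAt_scalarWedge, smul_zero]
      exact h
    · rw [hT', evalAt_scalarWedge_one hf1] at h
      rw [Nat.cast_zero, mul_zero, zpow_zero, one_smul, map_sub] at h
      exact h
    · obtain ⟨e, rfl⟩ := hs
      refine sub_eq_zero.2 ?_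
      funext p q'
      refine ContinuousAlternatingMap.ext fun v => ?_
      refine Eq.trans ?_ (homWedge_incl_zero (repr T) hq ((E.part q).ext x₀ e) p q' x₀ v).symm
      rw [repr_apply, VBundle.ext_self]
      rfl
  funext p q x
  exact (sub_eq_zero.1 (congrFun (congrFun (key x) p) q)).symm

theorem smooth_repr {E E' : GradedBundle.{v} EX X} {m : ℤ}
    {T : Omega E.part →ₗ[ℝ] Omega E'.part} (hT : IsTensorial m T) :
    repr T ∈ Omega (E.hom E') := by
  rintro p ⟨q, q'⟩
  by_cases hq : q ∈ E.support
  swap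
  · rw [homForm_eq_zero hq (repr T p (q, q'))]
    exact (Omega (E.hom E')).zero_mem p (q, q')
  refine smoothForm_of_at fun x₀ => ?_
  change SmoothFormAt (hc (repr T) p q q') x₀
  rw [smoothFormAt_iff]
  refine contMDiffAt_alt_of_apply fun v => contMDiffAt_clm_of_apply fun e => ?_
  set s := secForm ((E.part q).sec x₀ e) with hs
  have hss : SmoothForm s := smoothForm_sec _ _ _
  have h1 := (smoothFormAt_iff _ _).1 ((T (inclΩ 0 q s hss)).2 p q' x₀)
  refine (contMDiffAt_alt_apply h1 (w := fun _ => v) fun i => contMDiffAt_const).congr_of_eventuallyEq ?_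
  filter_upwards [((E.part q).isOpen_nb x₀).mem_nhds ((E.part q).mem_nb x₀),
    ((E'.part q').isOpen_nb x₀).mem_nhds ((E'.part q').mem_nb x₀),
    ((E.part q).bump x₀).eventuallyEq_one] with x hx hx' hx1
  have h2 : rep x₀ (hc (repr T) p q q') x v =
    ((E.part q).hom (E'.part q')).tr x₀ x (hc (repr T) p q q' x fun i => tangentTrs x₀ x (v i)) := rfl
  rw [h2, VBundle.hom_tr _ _ hx hx']
  change (E'.part q').tr x₀ x (homVal (E.part q) (E'.part q') x (hc (repr T) p q q' x fun i =>
    tangentTrs x₀ x (v i)) ((E.part q).trs x₀ x e)) = (E'.part q').tr x₀ x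
      ((T (inclΩ 0 q s hss) : RawForms E'.part) p q' x fun i => tangentTrs x₀ x (v i))
  rw [← homWedge_repr hT]
  refine congrArg _ (Eq.trans ?_ (homWedge_incl_zero (repr T) hq s p q' x _).symm)
  congr 1
  change _ = (E.part q).bump x₀ x • (E.part q).trs x₀ x e
  rw [hx1]
  exact (one_smul _ _).symm

end Tensorial

/-! ## DG categories of local systems -/

section DG

theorem neg_one_zpow_mul_self (k : ℤ) : (-1 : ℝ) ^ k * (-1 : ℝ) ^ k = 1 := by
  rw [← zpow_add₀ (by norm_num), neg_one_zpow_congr (b := 0) ⟨k, by ring⟩, zpow_zero]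

theorem isHomogeneous_homWedge {E E' : GradedBundle.{v} EX X} {α : RawForms (E.hom E')}
    {η : RawForms E.part} {m n : ℤ} (hα : IsHomogeneous homDeg m α) (hη : IsHomogeneous id n η) :
    IsHomogeneous id (n + m) (homWedge α η) := fun p q' h => by
  funext x
  rw [homWedge_eq]
  refine Finset.sum_eq_zero fun q _ => Finset.sum_eq_zero fun y hy => ?_
  have hy' : y.1 + y.2 = p := by simpa using hy
  by_cases h1 : (y.1 : ℤ) + (q' - q) = m
  · have : η y.2 q = 0 := hη _ _ fun h2 => h (by simp only [id] at h2 ⊢; omega)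
    rw [this, show (0 : RawForm (E.part q) y.2) x = 0 from rfl, tw_zero_right, smul_zero]
  · have : hc α y.1 q q' = 0 := hα _ (q, q') h1
    rw [this, show (0 : RawForm ((E.part q).hom (E'.part q')) y.1) x = 0 from rfl, tw_zero_left,
      smul_zero]

theorem isHomogeneous_homComp {E E' E'' : GradedBundle.{v} EX X} {ψ : RawForms (E'.hom E'')}
    {α : RawForms (E.hom E')} {m n : ℤ} (hψ : IsHomogeneous homDeg m ψ)
    (hα : IsHomogeneous homDeg n α) : IsHomogeneous homDeg (m + n) (homComp ψ α) := by
  rintro p ⟨q₁, q₃⟩ h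
  change hc (homComp ψ α) p q₁ q₃ = 0
  funext x
  rw [homComp_eq]
  refine Finset.sum_eq_zero fun q _ => Finset.sum_eq_zero fun y hy => ?_
  have hy' : y.1 + y.2 = p := by simpa using hy
  by_cases h1 : (y.1 : ℤ) + (q₃ - q) = m
  · have : hc α y.2 q₁ q = 0 := hα _ (q₁, q) fun h2 => h (by simp only [homDeg] at h2 ⊢; omega)
    rw [this, show (0 : RawForm ((E.part q₁).hom (E'.part q)) y.2) x = 0 from rfl, tw_zero_right,
      smul_zero]
  · have : hc ψ y.1 q q₃ = 0 := hψ _ (q, q₃) h1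
    rw [this, show (0 : RawForm ((E'.part q).hom (E''.part q₃)) y.1) x = 0 from rfl, tw_zero_left,
      smul_zero]

theorem isHomogeneous_scalarWedge {E : GradedBundle.{v} EX X} {k : ℕ}
    (σ : RawForm (VBundle.line EX X) k) {η : RawForms E.part} {n : ℤ} (hη : IsHomogeneous id n η) :
    IsHomogeneous id (n + k) (scalarWedge σ η) := fun p q h => by
  funext x
  rw [scalarWedge_eq]
  by_cases hk : k ≤ p
  · have : η (p - k) q = 0 := hη _ _ fun h2 => h (by simp only [id] at h2 ⊢; omega)
    rw [this, show (0 : RawForm (E.part q) (p - k)) x = 0 from rfl, tw_zero_right]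
    rfl
  · exact tw_of_ne _ (by omega) _ _

theorem isHomogeneous_add {ι : Type} {V : ι → VBundle.{v} EX X} {deg : ι → ℤ} {n : ℤ}
    {α β : RawForms V} (hα : IsHomogeneous deg n α) (hβ : IsHomogeneous deg n β) :
    IsHomogeneous deg n (α + β) := fun p i h => by
  change α p i + β p i = 0
  rw [hα p i h, hβ p i h, add_zero]

theorem isHomogeneous_smul {ι : Type} {V : ι → VBundle.{v} EX X} {deg : ι → ℤ} {n : ℤ} (c : ℝ)
    {α : RawForms V} (hα : IsHomogeneous deg n α) : IsHomogeneous deg n (c • α) := fun p i h => by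
  change c • α p i = 0
  rw [hα p i h, smul_zero]

theorem isHomogeneous_zero {ι : Type} {V : ι → VBundle.{v} EX X} {deg : ι → ℤ} {n : ℤ} :
    IsHomogeneous deg n (0 : RawForms V) := fun _ _ _ => rfl

theorem homOne_val {E : GradedBundle.{v} EX X} (q : ℤ) (x : X) (v : Fin 0 → TangentSpace 𝓘(ℝ, EX) x) :
    homVal (E.part q) (E.part q) x (hc (homOne E) 0 q q x v) = ContinuousLinearMap.id ℝ _ := by
  change (if h : q = q then h ▸ ContinuousLinearMap.id ℝ ((E.part q).fib x) else 0) = _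
  rw [dif_pos rfl]

theorem homOne_of_ne {E : GradedBundle.{v} EX X} {p : ℕ} {q q' : ℤ} (h : ¬(p = 0 ∧ q = q')) :
    hc (homOne E) p q q' = 0 := by
  cases p with
  | zero =>
    funext x
    refine ContinuousAlternatingMap.ext fun v => ?_
    refine (show Function.Injective (homVal (E.part q) (E.part q') x) from fun _ _ h => h) ?_
    exact dif_neg fun h' => h ⟨rfl, h'⟩
  | succ p => rfl

theorem homWedge_homOne {E : GradedBundle.{v} EX X} (η : RawForms E.part) :
    homWedge (homOne E) η = η := by
  funext n q' x
  rw [homWedge_eq]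
  by_cases hq : q' ∈ E.support
  · rw [Finset.sum_eq_single_of_mem q' hq, Finset.sum_eq_single (0, n)]
    · rw [sub_self, zero_mul, zpow_zero, one_smul]
      refine ContinuousAlternatingMap.ext fun v => (tw_zero_apply _ _ _ _ _).trans ?_
      change homVal (E.part q') (E.part q') x (hc (homOne E) 0 q' q' x ![]) (η n q' x v) = _
      rw [homOne_val]
      rfl
    · intro y hy hy'
      have : y.1 + y.2 = n := by simpa using hy
      rw [homOne_of_ne (fun h => hy' (Prod.ext h.1 (by omega))),
        show (0 : RawForm ((E.part q').hom (E.part q')) y.1) x = 0 from rfl, tw_zero_left, smul_zero]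
    · intro h
      exact absurd (by simp) h
    · intro q _ hne
      refine Finset.sum_eq_zero fun y _ => ?_
      rw [homOne_of_ne (fun h => hne h.2),
        show (0 : RawForm ((E.part q).hom (E.part q')) y.1) x = 0 from rfl, tw_zero_left, smul_zero]
  · have := fib_subsingleton (E.part q') (not_nontrivial_of_notMem hq) x
    exact ContinuousAlternatingMap.ext fun v => Subsingleton.elim _ _

theorem isHomogeneous_homOne (E : GradedBundle.{v} EX X) : IsHomogeneous homDeg 0 (homOne E) := by
  rintro p ⟨q, q'⟩ h
  exact homOne_of_ne fun h' => h (by rw [h'.1, h'.2]; simp [homDeg])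

theorem omega_homOne (E : GradedBundle.{v} EX X) : homOne E ∈ Omega (E.hom E) := by
  rintro p ⟨q, q'⟩
  change SmoothForm (hc (homOne E) p q q')
  by_cases h : p = 0 ∧ q = q'
  · obtain ⟨rfl, rfl⟩ := h
    refine smoothForm_of_at fun x₀ => ?_
    rw [smoothFormAt_iff]
    refine contMDiffAt_alt_of_apply fun v => ?_
    have h1 : ContMDiffAt 𝓘(ℝ, EX) 𝓘(ℝ, (E.part q).F →L[ℝ] (E.part q).F) ∞
      (fun _ : X => ContinuousLinearMap.id ℝ (E.part q).F) x₀ := contMDiffAt_const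
    refine h1.congr_of_eventuallyEq ?_
    filter_upwards [((E.part q).isOpen_nb x₀).mem_nhds ((E.part q).mem_nb x₀)] with x hx
    have h2 : rep x₀ (hc (homOne E) 0 q q) x v =
      ((E.part q).hom (E.part q)).tr x₀ x (hc (homOne E) 0 q q x fun i => tangentTrs x₀ x (v i)) := rfl
    rw [h2, VBundle.hom_tr _ _ hx hx, homOne_val]
    exact ContinuousLinearMap.ext fun a => (E.part q).tr_trs hx a
  · rw [homOne_of_ne h]
    exact smoothForm_of_at fun x => smoothFormAt_zero

theorem IsSuperconnection.mulS {E : GradedBundle.{v} EX X} {D : Omega E.part →ₗ[ℝ] Omega E.part}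
    (hD : IsSuperconnection E D) {k : ℕ} {σ : RawForm (VBundle.line EX X) k} (hσ : SmoothForm σ)
    (η : Omega E.part) : D (ChernWeil.mulS σ hσ η) =
      ChernWeil.mulS (extD σ) (smoothForm_extD hσ) η + (-1 : ℝ) ^ k • ChernWeil.mulS σ hσ (D η) := by
  obtain ⟨h, h'⟩ := hD.leibniz k σ hσ η
  exact Subtype.ext h'

theorem isDifferential_iff {E E' : GradedBundle.{v} EX X} {D : Omega E.part →ₗ[ℝ] Omega E.part}
    {D' : Omega E'.part →ₗ[ℝ] Omega E'.part} {k : ℤ} {α β : RawForms (E.hom E')}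
    (hα : α ∈ Omega (E.hom E')) (hβ : β ∈ Omega (E.hom E')) : IsDifferential D D' k α β ↔
      ∀ η, D' (mulH α hα η) = mulH β hβ η + (-1 : ℝ) ^ k • mulH α hα (D η) :=
  ⟨fun h η => Subtype.ext (h η).choose_spec,
    fun h η => ⟨omega_homWedge hα η.2, congrArg Subtype.val (h η)⟩⟩

theorem mulH_mulS {E E' : GradedBundle.{v} EX X} {α : RawForms (E.hom E')}
    (hα : α ∈ Omega (E.hom E')) {m : ℤ} (hm : IsHomogeneous homDeg m α) {k : ℕ}
    {σ : RawForm (VBundle.line EX X) k} (hσ : SmoothForm σ) (η : Omega E.part) :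
    mulH α hα (mulS σ hσ η) = (-1 : ℝ) ^ (m * k) • mulS σ hσ (mulH α hα η) :=
  Subtype.ext (homWedge_scalarWedge hm σ _)

theorem mulH_homComp {E E' E'' : GradedBundle.{v} EX X} {ψ : RawForms (E'.hom E'')}
    {α : RawForms (E.hom E')} (hψ : ψ ∈ Omega (E'.hom E'')) (hα : α ∈ Omega (E.hom E'))
    (η : Omega E.part) : mulH (homComp ψ α) (omega_homComp hψ hα) η = mulH ψ hψ (mulH α hα η) :=
  Subtype.ext (homWedge_homComp ψ α _)

/-- The operator `D' ∧ α - (-1)ᵏ α ∧ D` is tensorial. -/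
theorem isTensorial_differential {E E' : GradedBundle.{v} EX X}
    {D : Omega E.part →ₗ[ℝ] Omega E.part} {D' : Omega E'.part →ₗ[ℝ] Omega E'.part}
    (hD : IsSuperconnection E D) (hD' : IsSuperconnection E' D') {k : ℤ} {α : RawForms (E.hom E')}
    (hα : α ∈ Omega (E.hom E')) (hk : IsHomogeneous homDeg k α) :
    IsTensorial (k + 1) (D'.comp (mulH α hα) - (-1 : ℝ) ^ k • (mulH α hα).comp D) where
  degree n η hη := by
    have h1 := hD'.degree _ _ (show IsHomogeneous id (n + k) (mulH α hα η : RawForms E'.part) from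
      isHomogeneous_homWedge hk hη)
    have h2 : IsHomogeneous id (n + 1 + k) (mulH α hα (D η) : RawForms E'.part) :=
      isHomogeneous_homWedge hk (hD.degree _ _ hη)
    have h3 := isHomogeneous_add h1 (isHomogeneous_smul (-(-1 : ℝ) ^ k)
      (by rwa [show n + 1 + k = n + k + 1 by ring] at h2))
    rw [neg_smul, ← sub_eq_add_neg] at h3
    rw [← add_assoc]
    exact h3
  mul r σ hσ η := by
    simp only [LinearMap.sub_apply, LinearMap.comp_apply, LinearMap.smul_apply]
    rw [mulH_mulS hα hk, map_smul, hD'.mulS, hD.mulS, map_add, mulH_mulS hα hk, map_smul,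
      mulH_mulS hα hk, map_sub, map_smul]
    simp only [smul_add, smul_sub, smul_smul]
    have e1 : (-1 : ℝ) ^ (k * r) = (-1 : ℝ) ^ k * (-1 : ℝ) ^ (k * ((r + 1 : ℕ) : ℤ)) := by
      rw [← zpow_add₀ (by norm_num)]
      exact neg_one_zpow_congr ⟨-k, by push_cast; ring⟩
    have e2 : (-1 : ℝ) ^ (k * r) * (-1 : ℝ) ^ r = (-1 : ℝ) ^ ((k + 1) * r) := by
      rw [← zpow_natCast, ← zpow_add₀ (by norm_num)]
      exact neg_one_zpow_congr ⟨0, by ring⟩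
    have e3 : (-1 : ℝ) ^ k * ((-1 : ℝ) ^ r * (-1 : ℝ) ^ (k * r)) =
        (-1 : ℝ) ^ ((k + 1) * r) * (-1 : ℝ) ^ k := by
      rw [← e2]; ring
    have key : ∀ (a b : ℝ) (u v w : Omega E'.part), a = b → a • u + v - (b • u + w) = v - w :=
      fun a b u v w h => by rw [h, add_sub_add_left_eq_sub]
    rw [e3, e2]
    exact key _ _ _ _ _ e1

variable [T2Space X]

theorem exists_differential {E E' : GradedBundle.{v} EX X}
    {D : Omega E.part →ₗ[ℝ] Omega E.part} {D' : Omega E'.part →ₗ[ℝ] Omega E'.part}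
    (hD : IsSuperconnection E D) (hD' : IsSuperconnection E' D') {k : ℤ} {α : RawForms (E.hom E')}
    (hα : α ∈ homForms E E' k) : ∃ β ∈ homForms E E' (k + 1), IsDifferential D D' k α β := by
  have hT := isTensorial_differential hD hD' hα.1 hα.2
  refine ⟨_, ⟨smooth_repr hT, isHomogeneous_repr hT⟩, ?_⟩
  refine (isDifferential_iff hα.1 (smooth_repr hT)).2 fun η => ?_
  have : mulH (repr (D'.comp (mulH α hα.1) - (-1 : ℝ) ^ k • (mulH α hα.1).comp D)) (smooth_repr hT) η =
      (D'.comp (mulH α hα.1) - (-1 : ℝ) ^ k • (mulH α hα.1).comp D) η := Subtype.ext (homWedge_repr hT η)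
  rw [this]
  simp only [LinearMap.sub_apply, LinearMap.comp_apply, LinearMap.smul_apply]
  abel

theorem IsDifferential.unique {E E' : GradedBundle.{v} EX X}
    {D : Omega E.part →ₗ[ℝ] Omega E.part} {D' : Omega E'.part →ₗ[ℝ] Omega E'.part} {k : ℤ}
    {α β β' : RawForms (E.hom E')} (h : IsDifferential D D' k α β)
    (h' : IsDifferential D D' k α β') : β = β' :=
  homForms_ext fun η hη => by
    have h1 := (h ⟨η, hη⟩).choose_spec.symm.trans (h' ⟨η, hη⟩).choose_spec
    exact add_right_cancel h1

theorem locHasDifferentials : LocHasDifferentials.{v} EX X := fun A B k α hα => by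
  obtain ⟨β, hβ, h⟩ := exists_differential A.superconnection B.superconnection hα
  exact ⟨β, ⟨hβ, h⟩, fun β' h' => h'.2.unique h⟩

theorem homForms_zero_mem (E E' : GradedBundle.{v} EX X) (n : ℤ) : 0 ∈ homForms E E' n :=
  ⟨(Omega (E.hom E')).zero_mem, isHomogeneous_zero⟩

theorem homForms_add_mem {E E' : GradedBundle.{v} EX X} {n : ℤ} {α β : RawForms (E.hom E')}
    (hα : α ∈ homForms E E' n) (hβ : β ∈ homForms E E' n) : α + β ∈ homForms E E' n :=
  ⟨(Omega (E.hom E')).add_mem hα.1 hβ.1, isHomogeneous_add hα.2 hβ.2⟩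

theorem homForms_smul_mem {E E' : GradedBundle.{v} EX X} {n : ℤ} (c : ℝ) {α : RawForms (E.hom E')}
    (hα : α ∈ homForms E E' n) : c • α ∈ homForms E E' n :=
  ⟨(Omega (E.hom E')).smul_mem c hα.1, isHomogeneous_smul c hα.2⟩

theorem homForms_comp_mem {E E' E'' : GradedBundle.{v} EX X} {m n : ℤ} {ψ : RawForms (E'.hom E'')}
    {α : RawForms (E.hom E')} (hψ : ψ ∈ homForms E' E'' m) (hα : α ∈ homForms E E' n) :
    homComp ψ α ∈ homForms E E'' (m + n) :=
  ⟨omega_homComp hψ.1 hα.1, isHomogeneous_homComp hψ.2 hα.2⟩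

theorem homOne_mem (E : GradedBundle.{v} EX X) : homOne E ∈ homForms E E 0 :=
  ⟨omega_homOne E, isHomogeneous_homOne E⟩

theorem homForms_independent {E E' : GradedBundle.{v} EX X} {s : Finset ℤ}
    {f : ℤ → RawForms (E.hom E')} (hf : ∀ n ∈ s, IsHomogeneous homDeg n (f n))
    (hs : ∑ n ∈ s, f n = 0) {n : ℤ} (hn : n ∈ s) : f n = 0 := by
  funext p i
  by_cases hd : (p : ℤ) + homDeg i = n
  · have h1 := congrFun (congrFun hs p) i
    rw [Finset.sum_apply, Finset.sum_apply, Finset.sum_eq_single_of_mem n hn] at h1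
    · exact h1
    · exact fun m hm hmn => hf m hm p i fun h' => hmn (h'.symm.trans hd)
  · exact hf n hn p i hd

section Comp

variable {E₁ E₂ E₃ E₄ : GradedBundle.{v} EX X}

theorem homComp_add_left (f f' : RawForms (E₂.hom E₃)) (g : RawForms (E₁.hom E₂)) :
    homComp (f + f') g = homComp f g + homComp f' g := homForms_ext fun η _ => by
  simp only [homWedge_homComp, homWedge_add_left]

theorem homComp_add_right (f : RawForms (E₂.hom E₃)) (g g' : RawForms (E₁.hom E₂)) :
    homComp f (g + g') = homComp f g + homComp f g' := homForms_ext fun η _ => by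
  rw [homWedge_homComp, homWedge_add_left, homWedge_add_left, homWedge_homComp, homWedge_homComp]
  exact (rawH f).map_add _ _

theorem homComp_smul_left (c : ℝ) (f : RawForms (E₂.hom E₃)) (g : RawForms (E₁.hom E₂)) :
    homComp (c • f) g = c • homComp f g := homForms_ext fun η _ => by
  simp only [homWedge_homComp, homWedge_smul_left]

theorem homComp_smul_right (c : ℝ) (f : RawForms (E₂.hom E₃)) (g : RawForms (E₁.hom E₂)) :
    homComp f (c • g) = c • homComp f g := homForms_ext fun η _ => by
  rw [homWedge_homComp, homWedge_smul_left, homWedge_smul_left, homWedge_homComp]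
  exact (rawH f).map_smul _ _

theorem homComp_assoc (f : RawForms (E₃.hom E₄)) (g : RawForms (E₂.hom E₃))
    (h : RawForms (E₁.hom E₂)) : homComp (homComp f g) h = homComp f (homComp g h) :=
  homForms_ext fun η _ => by simp only [homWedge_homComp]

theorem homOne_comp (f : RawForms (E₁.hom E₂)) : homComp (homOne E₂) f = f :=
  homForms_ext fun η _ => by simp only [homWedge_homComp, homWedge_homOne]

theorem comp_homOne (f : RawForms (E₁.hom E₂)) : homComp f (homOne E₁) = f :=
  homForms_ext fun η _ => by simp only [homWedge_homComp, homWedge_homOne]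

variable {D₁ : Omega E₁.part →ₗ[ℝ] Omega E₁.part} {D₂ : Omega E₂.part →ₗ[ℝ] Omega E₂.part}
  {D₃ : Omega E₃.part →ₗ[ℝ] Omega E₃.part}

theorem mulH_add {α β γ : RawForms (E₁.hom E₂)} (hα : α ∈ Omega (E₁.hom E₂))
    (hβ : β ∈ Omega (E₁.hom E₂)) (hγ : γ ∈ Omega (E₁.hom E₂)) (h : γ = α + β) (η : Omega E₁.part) :
    mulH γ hγ η = mulH α hα η + mulH β hβ η := by
  subst h
  exact Subtype.ext (homWedge_add_left _ _ _)

theorem mulH_smul (c : ℝ) {α β : RawForms (E₁.hom E₂)} (hα : α ∈ Omega (E₁.hom E₂))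
    (hβ : β ∈ Omega (E₁.hom E₂)) (h : β = c • α) (η : Omega E₁.part) :
    mulH β hβ η = c • mulH α hα η := by
  subst h
  exact Subtype.ext (homWedge_smul_left _ _ _)

theorem mulH_zero (η : Omega E₁.part) :
    mulH (0 : RawForms (E₁.hom E₂)) (Omega (E₁.hom E₂)).zero_mem η = 0 := by
  rw [mulH_smul 0 (Omega (E₁.hom E₂)).zero_mem _ (zero_smul ℝ _).symm, zero_smul]

theorem IsDifferential.add {n : ℤ} {f g f' g' : RawForms (E₁.hom E₂)} (hf : f ∈ Omega (E₁.hom E₂))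
    (hg : g ∈ Omega (E₁.hom E₂)) (hf' : f' ∈ Omega (E₁.hom E₂)) (hg' : g' ∈ Omega (E₁.hom E₂))
    (h₁ : IsDifferential D₁ D₂ n f f') (h₂ : IsDifferential D₁ D₂ n g g') :
    IsDifferential D₁ D₂ n (f + g) (f' + g') := by
  rw [isDifferential_iff hf hf'] at h₁
  rw [isDifferential_iff hg hg'] at h₂
  refine (isDifferential_iff ((Omega _).add_mem hf hg) ((Omega _).add_mem hf' hg')).2 fun η => ?_
  rw [mulH_add hf hg _ rfl, mulH_add hf hg _ rfl, mulH_add hf' hg' _ rfl, map_add, h₁, h₂, smul_add]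
  abel

theorem IsDifferential.smul {n : ℤ} (c : ℝ) {f f' : RawForms (E₁.hom E₂)}
    (hf : f ∈ Omega (E₁.hom E₂)) (hf' : f' ∈ Omega (E₁.hom E₂))
    (h₁ : IsDifferential D₁ D₂ n f f') : IsDifferential D₁ D₂ n (c • f) (c • f') := by
  rw [isDifferential_iff hf hf'] at h₁
  refine (isDifferential_iff ((Omega _).smul_mem c hf) ((Omega _).smul_mem c hf')).2 fun η => ?_
  rw [mulH_smul c hf _ rfl, mulH_smul c hf _ rfl, mulH_smul c hf' _ rfl, map_smul, h₁, smul_add,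
    smul_comm _ c]

theorem IsDifferential.flat (hD₁ : IsFlat D₁) (hD₂ : IsFlat D₂) {n : ℤ} {f f' : RawForms (E₁.hom E₂)}
    (hf : f ∈ Omega (E₁.hom E₂)) (hf' : f' ∈ Omega (E₁.hom E₂))
    (h₁ : IsDifferential D₁ D₂ n f f') : IsDifferential D₁ D₂ (n + 1) f' 0 := by
  rw [isDifferential_iff hf hf'] at h₁
  refine (isDifferential_iff hf' (Omega _).zero_mem).2 fun η => ?_
  have e1 := congrArg D₂ (h₁ η)
  rw [hD₂, map_add, map_smul, h₁, hD₁, map_zero, smul_zero, add_zero] at e1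
  rw [mulH_zero, zero_add, zpow_add_one₀ (by norm_num), mul_neg_one]
  exact (eq_neg_of_add_eq_zero_left e1.symm).trans (neg_smul _ _).symm

theorem IsDifferential.comp {m n : ℤ} {f f' : RawForms (E₂.hom E₃)} {g g' : RawForms (E₁.hom E₂)}
    (hf : f ∈ Omega (E₂.hom E₃)) (hf' : f' ∈ Omega (E₂.hom E₃)) (hg : g ∈ Omega (E₁.hom E₂))
    (hg' : g' ∈ Omega (E₁.hom E₂)) (h₁ : IsDifferential D₂ D₃ m f f')
    (h₂ : IsDifferential D₁ D₂ n g g') :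
    IsDifferential D₁ D₃ (m + n) (homComp f g) (homComp f' g + (-1 : ℝ) ^ m • homComp f g') := by
  rw [isDifferential_iff hf hf'] at h₁
  rw [isDifferential_iff hg hg'] at h₂
  have hΩ := (Omega (E₁.hom E₃)).smul_mem ((-1 : ℝ) ^ m) (omega_homComp hf hg')
  refine (isDifferential_iff (omega_homComp hf hg)
    ((Omega _).add_mem (omega_homComp hf' hg) hΩ)).2 fun η => ?_
  rw [mulH_add (omega_homComp hf' hg) hΩ _ rfl, mulH_smul _ (omega_homComp hf hg') _ rfl,
    mulH_homComp hf hg, mulH_homComp hf hg, mulH_homComp hf' hg, mulH_homComp hf hg', h₁, h₂,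
    map_add, map_smul, smul_add, smul_smul, ← zpow_add₀ (by norm_num), add_assoc]

end Comp

section DGOf

variable {O : Type*} {S : O → LocalSystem.{v} EX X}
  {H : ∀ A B : O, ℤ → Set (RawForms ((S A).E.hom (S B).E))}

theorem dgOf_d_mem (h : HasDifferentials S H) {A B : O} {k : ℤ}
    {α : RawForms ((S A).E.hom (S B).E)} (hα : α ∈ H A B k) :
    (dgOf S H h).d (A := A) (B := B) k α ∈ H A B (k + 1) ∧
      IsDifferential (S A).D (S B).D k α ((dgOf S H h).d (A := A) (B := B) k α) := by
  have : (dgOf S H h).d (A := A) (B := B) k α = (h A B k α hα).choose := dif_pos hα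
  rw [this]
  exact (h A B k α hα).choose_spec.1

theorem dgOf_d_eq (h : HasDifferentials S H) {A B : O} {k : ℤ}
    {α β : RawForms ((S A).E.hom (S B).E)} (hα : α ∈ H A B k)
    (hβ : IsDifferential (S A).D (S B).D k α β) : (dgOf S H h).d (A := A) (B := B) k α = β :=
  (dgOf_d_mem h hα).2.unique hβ

theorem isDGCategory_dgOf (h : HasDifferentials S H)
    (hH : ∀ A B n, ∀ α ∈ H A B n, α ∈ homForms (S A).E (S B).E n)
    (h_zero : ∀ A B n, 0 ∈ H A B n)
    (h_add : ∀ A B n, ∀ α ∈ H A B n, ∀ β ∈ H A B n, α + β ∈ H A B n)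
    (h_smul : ∀ A B n (c : ℝ), ∀ α ∈ H A B n, c • α ∈ H A B n)
    (h_comp : ∀ A₁ A₂ A₃ m n, ∀ ψ ∈ H A₂ A₃ m, ∀ α ∈ H A₁ A₂ n, homComp ψ α ∈ H A₁ A₃ (m + n))
    (h_one : ∀ A, homOne (S A).E ∈ H A A 0) : (dgOf S H h).IsDGCategory where
  zero_mem := h_zero
  add_mem := h_add
  smul_mem := h_smul
  independent A B s f hf hs n hn :=
    homForms_independent (E := (S A).E) (E' := (S B).E) (fun m hm => (hH _ _ _ _ (hf m hm)).2) hs hn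
  d_mem A B n f hf := (dgOf_d_mem h hf).1
  d_add A B n f hf g hg := by
    obtain ⟨hm₁, h₁⟩ := dgOf_d_mem h hf
    obtain ⟨hm₂, h₂⟩ := dgOf_d_mem h hg
    exact dgOf_d_eq h (h_add A B n f hf g hg) (IsDifferential.add (hH _ _ _ _ hf).1
      (hH _ _ _ _ hg).1 (hH _ _ _ _ hm₁).1 (hH _ _ _ _ hm₂).1 h₁ h₂)
  d_smul A B n c f hf := by
    obtain ⟨hm₁, h₁⟩ := dgOf_d_mem h hf
    exact dgOf_d_eq h (h_smul A B n c f hf)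
      (IsDifferential.smul c (hH _ _ _ _ hf).1 (hH _ _ _ _ hm₁).1 h₁)
  d_d A B n f hf := by
    obtain ⟨hm₁, h₁⟩ := dgOf_d_mem h hf
    exact dgOf_d_eq h hm₁ (IsDifferential.flat (LocalSystem.flat _) (LocalSystem.flat _)
      (hH _ _ _ _ hf).1 (hH _ _ _ _ hm₁).1 h₁)
  comp_mem := h_comp
  add_comp _ _ _ _ _ f _ f' _ g _ := homComp_add_left f f' g
  comp_add _ _ _ _ _ f _ g _ g' _ := homComp_add_right f g g'
  smul_comp _ _ _ _ _ c f _ g _ := homComp_smul_left c f g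
  comp_smul _ _ _ _ _ c f _ g _ := homComp_smul_right c f g
  assoc _ _ _ _ _ _ _ f _ g _ g' _ := homComp_assoc f g g'
  one_mem := h_one
  one_comp _ _ _ f _ := homOne_comp f
  comp_one _ _ _ f _ := comp_homOne f
  leibniz A₁ A₂ A₃ m n f hf g hg := by
    obtain ⟨hm₁, h₁⟩ := dgOf_d_mem h hf
    obtain ⟨hm₂, h₂⟩ := dgOf_d_mem h hg
    exact dgOf_d_eq h (h_comp _ _ _ _ _ f hf g hg) (IsDifferential.comp (hH _ _ _ _ hf).1
      (hH _ _ _ _ hm₁).1 (hH _ _ _ _ hg).1 (hH _ _ _ _ hm₂).1 h₁ h₂)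

theorem isDGCategory_loc (h : LocHasDifferentials.{v} EX X) : (Loc EX X h).IsDGCategory :=
  isDGCategory_dgOf h (fun _ _ _ _ hα => hα) (fun _ _ _ => homForms_zero_mem _ _ _)
    (fun _ _ _ _ hα _ hβ => homForms_add_mem hα hβ) (fun _ _ _ c _ hα => homForms_smul_mem c hα)
    (fun _ _ _ _ _ _ hψ _ hα => homForms_comp_mem hψ hα) fun A => homOne_mem A.E

end DGOf

end DG

/-! ## The action of the structure group on forms -/

section Natural

/-- The map `a ↦ f ∘ a ∘ L` of alternating maps. -/
def altMap {V V' N N' : Type*} [AddCommGroup V] [Module ℝ V] [TopologicalSpace V]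
    [AddCommGroup V'] [Module ℝ V'] [TopologicalSpace V'] [AddCommGroup N] [Module ℝ N]
    [TopologicalSpace N] [IsTopologicalAddGroup N] [ContinuousSMul ℝ N] [AddCommGroup N']
    [Module ℝ N'] [TopologicalSpace N'] [IsTopologicalAddGroup N'] [ContinuousSMul ℝ N']
    (L : V' →L[ℝ] V) (f : N →L[ℝ] N') (n : ℕ) :
    (V [⋀^Fin n]→L[ℝ] N) →ₗ[ℝ] (V' [⋀^Fin n]→L[ℝ] N') where
  toFun a := f.compContinuousAlternatingMap (a.compContinuousLinearMap L)
  map_add' _ _ := ContinuousAlternatingMap.ext fun _ => map_add f _ _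
  map_smul' _ _ := ContinuousAlternatingMap.ext fun _ => map_smul f _ _

theorem altMap_apply {V V' N N' : Type*} [AddCommGroup V] [Module ℝ V] [TopologicalSpace V]
    [AddCommGroup V'] [Module ℝ V'] [TopologicalSpace V'] [AddCommGroup N] [Module ℝ N]
    [TopologicalSpace N] [IsTopologicalAddGroup N] [ContinuousSMul ℝ N] [AddCommGroup N']
    [Module ℝ N'] [TopologicalSpace N'] [IsTopologicalAddGroup N'] [ContinuousSMul ℝ N']
    (L : V' →L[ℝ] V) (f : N →L[ℝ] N') (n : ℕ) (a : V [⋀^Fin n]→L[ℝ] N) (v : Fin n → V') :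
    altMap L f n a v = f (a fun i => L (v i)) := rfl

/-- The map `f ↦ c' ∘ f ∘ c⁻¹` of homomorphisms. -/
def homConj {A B : VBundle.{v} EX X} {A' B' : VBundle.{v} EM M} {x : X} {m : M}
    (c : A.fib x ≃L[ℝ] A'.fib m) (c' : B.fib x ≃L[ℝ] B'.fib m) :
    (A.hom B).fib x →L[ℝ] (A'.hom B').fib m :=
  show (A.fib x →L[ℝ] B.fib x) →L[ℝ] (A'.fib m →L[ℝ] B'.fib m) from
    ((c.arrowCongr c' : (A.fib x →L[ℝ] B.fib x) ≃L[ℝ] (A'.fib m →L[ℝ] B'.fib m)) :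
      (A.fib x →L[ℝ] B.fib x) →L[ℝ] (A'.fib m →L[ℝ] B'.fib m))

theorem homVal_homConj {A B : VBundle.{v} EX X} {A' B' : VBundle.{v} EM M} {x : X} {m : M}
    (c : A.fib x ≃L[ℝ] A'.fib m) (c' : B.fib x ≃L[ℝ] B'.fib m) (f : (A.hom B).fib x)
    (a : A'.fib m) : homVal A' B' m (homConj c c' f) a = c' (homVal A B x f (c.symm a)) := rfl

theorem alt_hom_ext {A B : VBundle.{v} EX X} {x : X} {p : ℕ}
    {α β : TangentSpace 𝓘(ℝ, EX) x [⋀^Fin p]→L[ℝ] (A.hom B).fib x}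
    (h : ∀ v a, homVal A B x (α v) a = homVal A B x (β v) a) : α = β :=
  ContinuousAlternatingMap.ext fun v =>
    (show Function.Injective (homVal A B x) from fun _ _ h => h) (ContinuousLinearMap.ext (h v))

section

variable {x : X} {m : M} (L : TangentSpace 𝓘(ℝ, EM) m →L[ℝ] TangentSpace 𝓘(ℝ, EX) x)

theorem scalarWedge_natural {ι : Type} {V : ι → VBundle.{v} EX X} {V' : ι → VBundle.{v} EM M}
    (c : ∀ i, (V i).fib x ≃L[ℝ] (V' i).fib m) {k : ℕ} {σ : RawForm (VBundle.line EX X) k}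
    {σ' : RawForm (VBundle.line EM M) k} {η : RawForms V} {η' : RawForms V'}
    (hσ : sval σ' m = (sval σ x).compContinuousLinearMap L)
    (hη : ∀ p i, η' p i m = altMap L (c i : (V i).fib x →L[ℝ] (V' i).fib m) p (η p i x)) (n : ℕ)
    (i : ι) : scalarWedge σ' η' n i m =
      altMap L (c i : (V i).fib x →L[ℝ] (V' i).fib m) n (scalarWedge σ η n i x) := by
  rw [scalarWedge_eq, scalarWedge_eq, hη]
  refine Eq.trans ?_ (tw_natural L (show (VBundle.line EX X).fib x →L[ℝ] (VBundle.line EM M).fib m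
    from ContinuousLinearMap.id ℝ ℝ) (c i : (V i).fib x →L[ℝ] (V' i).fib m) (c i : _ →L[ℝ] _)
    (scalarB (V i) x) (scalarB (V' i) m) (fun a b => map_smul (c i) _ _) (σ x)
    (η (n - k) i x)).symm
  exact congrArg (fun s => tw (scalarB (V' i) m) k (n - k) n s _) hσ

variable {E E' E'' : GradedBundle.{v} EX X} {F F' F'' : GradedBundle.{v} EM M}
  (c : ∀ q, (E.part q).fib x ≃L[ℝ] (F.part q).fib m)
  (c' : ∀ q, (E'.part q).fib x ≃L[ℝ] (F'.part q).fib m)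
  (c'' : ∀ q, (E''.part q).fib x ≃L[ℝ] (F''.part q).fib m)

theorem homWedge_natural (hF : F.support = E.support) {α : RawForms (E.hom E')}
    {α' : RawForms (F.hom F')} {η : RawForms E.part} {η' : RawForms F.part}
    (hα : ∀ p q q', hc α' p q q' m = altMap L (homConj (c q) (c' q')) p (hc α p q q' x))
    (hη : ∀ p q, η' p q m = altMap L (c q : (E.part q).fib x →L[ℝ] (F.part q).fib m) p (η p q x))
    (n : ℕ) (q' : ℤ) : homWedge α' η' n q' m =
      altMap L (c' q' : (E'.part q').fib x →L[ℝ] (F'.part q').fib m) n (homWedge α η n q' x) := by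
  rw [homWedge_eq, homWedge_eq, hF, map_sum]
  refine Finset.sum_congr rfl fun q _ => ?_
  rw [map_sum]
  refine Finset.sum_congr rfl fun y _ => ?_
  rw [map_smul, hα, hη]
  refine congrArg (fun z => ((-1 : ℝ) ^ ((q' - q) * (y.2 : ℤ))) • z) (Eq.symm ?_)
  refine tw_natural L (homConj (c q) (c' q')) (c q : (E.part q).fib x →L[ℝ] (F.part q).fib m)
    (c' q' : (E'.part q').fib x →L[ℝ] (F'.part q').fib m)
    (evalB (E.part q) (E'.part q') x) (evalB (F.part q) (F'.part q') m) (fun f a => ?_) _ _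
  change c' q' (homVal _ _ x f a) = c' q' (homVal _ _ x f ((c q).symm (c q a)))
  rw [ContinuousLinearEquiv.symm_apply_apply]

theorem homComp_natural (hF : F'.support = E'.support) {ψ : RawForms (E'.hom E'')}
    {ψ' : RawForms (F'.hom F'')} {α : RawForms (E.hom E')} {α' : RawForms (F.hom F')}
    (hψ : ∀ p q q', hc ψ' p q q' m = altMap L (homConj (c' q) (c'' q')) p (hc ψ p q q' x))
    (hα : ∀ p q q', hc α' p q q' m = altMap L (homConj (c q) (c' q')) p (hc α p q q' x))
    (n : ℕ) (q q'' : ℤ) : hc (homComp ψ' α') n q q'' m =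
      altMap L (homConj (c q) (c'' q'')) n (hc (homComp ψ α) n q q'' x) := by
  rw [homComp_eq, homComp_eq, hF, map_sum]
  refine Finset.sum_congr rfl fun q' _ => ?_
  rw [map_sum]
  refine Finset.sum_congr rfl fun y _ => ?_
  rw [map_smul, hα, hψ]
  refine congrArg _ (tw_natural L (homConj (c' q') (c'' q'')) (homConj (c q) (c' q'))
    (homConj (c q) (c'' q'')) (compB (E.part q) (E'.part q') (E''.part q'') x)
    (compB (F.part q) (F'.part q') (F''.part q'') m) (fun f f' => ?_) _ _).symm
  refine (show Function.Injective (homVal (F.part q) (F''.part q'') m) from fun _ _ h => h) ?_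
  refine ContinuousLinearMap.ext fun a => ?_
  change c'' q'' (homVal _ _ x f (homVal _ _ x f' ((c q).symm a))) =
    c'' q'' (homVal _ _ x f ((c' q').symm (c' q' (homVal _ _ x f' ((c q).symm a)))))
  rw [ContinuousLinearEquiv.symm_apply_apply]

theorem homOne_natural (n : ℕ) (q q' : ℤ) : hc (homOne F) n q q' m =
    altMap L (homConj (c q) (c q')) n (hc (homOne E) n q q' x) := by
  by_cases h : n = 0 ∧ q = q'
  · obtain ⟨rfl, rfl⟩ := h
    refine alt_hom_ext fun v a => ?_
    rw [homOne_val, altMap_apply, homVal_homConj, homOne_val]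
    exact ((c q).apply_symm_apply a).symm
  · rw [homOne_of_ne h, homOne_of_ne h]
    exact (map_zero (altMap L (homConj (c q) (c q')) n)).symm

end

end Natural

end Manifolds

section Action

variable {EG : Type*} [NormedAddCommGroup EG] [NormedSpace ℝ EG] [FiniteDimensional ℝ EG]
  {G : Type*} [TopologicalSpace G] [ChartedSpace EG G] [Group G]
  {EP : Type*} [NormedAddCommGroup EP] [NormedSpace ℝ EP] [FiniteDimensional ℝ EP]
  {P : Type*} [TopologicalSpace P] [ChartedSpace EP P]
  {EX : Type*} [NormedAddCommGroup EX] [NormedSpace ℝ EX] [FiniteDimensional ℝ EX]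
  {X : Type*} [TopologicalSpace X] [ChartedSpace EX X]
  (Q : PrincipalBundle EG G EP P EX X)

/-- The left action on forms with values in a single bundle. -/
def PrincipalBundle.actF {A : VBundle.{v} EP P} (ρ : Q.FibreAction A) (g : G) {r : ℕ}
    (φ : RawForm A r) : RawForm A r :=
  pullMap (fun p => Q.act p g) (fun p => ((ρ g p).symm : A.fib (Q.act p g) →L[ℝ] A.fib p)) φ

theorem PrincipalBundle.actForms_eq {ι : Type} {V : ι → VBundle.{v} EP P}
    (ρ : ∀ i, Q.FibreAction (V i)) (g : G) (φ : RawForms V) (r : ℕ) (i : ι) :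
    Q.actForms ρ g φ r i = Q.actF (ρ i) g (φ r i) := rfl

theorem PrincipalBundle.contMDiff_act_right (g : G) :
    ContMDiff 𝓘(ℝ, EP) 𝓘(ℝ, EP) ∞ (fun p => Q.act p g) :=
  Q.smooth_act.comp (contMDiff_id.prodMk contMDiff_const)

theorem PrincipalBundle.contMDiff_act_left (p : P) :
    ContMDiff 𝓘(ℝ, EG) 𝓘(ℝ, EP) ∞ (fun g => Q.act p g) :=
  Q.smooth_act.comp (contMDiff_const.prodMk contMDiff_id)

theorem PrincipalBundle.mdifferentiable_act_right (g : G) :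
    MDifferentiable 𝓘(ℝ, EP) 𝓘(ℝ, EP) (fun p => Q.act p g) :=
  (Q.contMDiff_act_right g).mdifferentiable (by simp)

theorem compForm_transport {A : VBundle.{v} EP P} {r : ℕ} (φ : RawForm A r) {p q q' : P}
    (h : q = q') (L : TangentSpace 𝓘(ℝ, EP) p →L[ℝ] TangentSpace 𝓘(ℝ, EP) q)
    (L' : TangentSpace 𝓘(ℝ, EP) p →L[ℝ] TangentSpace 𝓘(ℝ, EP) q')
    (hL : ∀ v, (L v : EP) = (L' v : EP)) (R : A.fib p ≃L[ℝ] A.fib q) (R' : A.fib p ≃L[ℝ] A.fib q')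
    (hR : ∀ a, (⟨q, R a⟩ : TotalSpace A.F A.fib) = ⟨q', R' a⟩) :
    (R.symm : A.fib q →L[ℝ] A.fib p).compContinuousAlternatingMap
        ((φ q).compContinuousLinearMap L) =
      (R'.symm : A.fib q' →L[ℝ] A.fib p).compContinuousAlternatingMap
        ((φ q').compContinuousLinearMap L') := by
  subst h
  have h1 : R = R' := ContinuousLinearEquiv.ext (funext fun a => by simpa using hR a)
  have h2 : L = L' := ContinuousLinearMap.ext hL
  rw [h1, h2]

theorem PrincipalBundle.IsAction.actF_mul {A : VBundle.{v} EP P} {ρ : Q.FibreAction A}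
    (hρ : Q.IsAction ρ) (g h : G) {r : ℕ} (φ : RawForm A r) :
    Q.actF ρ (g * h) φ = Q.actF ρ g (Q.actF ρ h φ) := by
  funext p
  refine compForm_transport φ (Q.act_mul p g h) _
    ((mfderiv 𝓘(ℝ, EP) 𝓘(ℝ, EP) (fun q => Q.act q h) (Q.act p g)).comp
      (mfderiv 𝓘(ℝ, EP) 𝓘(ℝ, EP) (fun q => Q.act q g) p)) (fun v => ?_) _
    ((ρ g p).trans (ρ h (Q.act p g))) (hρ.mul g h p)
  have e : (fun q => Q.act q (g * h)) = (fun q => Q.act q h) ∘ fun q => Q.act q g :=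
    funext fun q => Q.act_mul q g h
  exact (congrArg (fun f : P → P => (mfderiv 𝓘(ℝ, EP) 𝓘(ℝ, EP) f p v : EP)) e).trans
    (congrArg (fun L => (L v : EP)) (mfderiv_comp p (Q.mdifferentiable_act_right h _)
      (Q.mdifferentiable_act_right g p)))

theorem PrincipalBundle.IsAction.actF_one {A : VBundle.{v} EP P} {ρ : Q.FibreAction A}
    (hρ : Q.IsAction ρ) {r : ℕ} (φ : RawForm A r) : Q.actF ρ 1 φ = φ := by
  funext p
  refine (compForm_transport φ (Q.act_one p) _ (ContinuousLinearMap.id ℝ _) (fun v => ?_) _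
    (ContinuousLinearEquiv.refl ℝ _) (hρ.one p)).trans rfl
  have e : (fun q => Q.act q 1) = id := funext Q.act_one
  exact (congrArg (fun f : P → P => (mfderiv 𝓘(ℝ, EP) 𝓘(ℝ, EP) f p v : EP)) e).trans
    (congrArg (fun L => (L v : EP)) (mfderiv_id (I := 𝓘(ℝ, EP)) (x := p)))

theorem PrincipalBundle.actF_add {A : VBundle.{v} EP P} (ρ : Q.FibreAction A) (g : G) {r : ℕ}
    (φ ψ : RawForm A r) : Q.actF ρ g (φ + ψ) = Q.actF ρ g φ + Q.actF ρ g ψ := by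
  funext p
  exact ContinuousAlternatingMap.ext fun v => map_add ((ρ g p).symm) _ _

theorem PrincipalBundle.actF_smul {A : VBundle.{v} EP P} (ρ : Q.FibreAction A) (g : G) {r : ℕ}
    (c : ℝ) (φ : RawForm A r) : Q.actF ρ g (c • φ) = c • Q.actF ρ g φ := by
  funext p
  exact ContinuousAlternatingMap.ext fun v => map_smul ((ρ g p).symm) _ _

theorem PrincipalBundle.IsAction.act_inv {A : VBundle.{v} EP P} {ρ : Q.FibreAction A}
    (hρ : Q.IsAction ρ) (g : G) (p : P) (b : A.fib (Q.act p g)) :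
    (⟨Q.act (Q.act p g) g⁻¹, ρ g⁻¹ (Q.act p g) b⟩ : TotalSpace A.F A.fib) =
      ⟨p, (ρ g p).symm b⟩ := by
  have h := hρ.mul g g⁻¹ p ((ρ g p).symm b)
  rw [ContinuousLinearEquiv.apply_symm_apply] at h
  rw [← h, mul_inv_cancel]
  exact hρ.one p _

section Smooth

variable {EM : Type*} [NormedAddCommGroup EM] [NormedSpace ℝ EM]
  {H : Type*} [TopologicalSpace H] {I : ModelWithCorners ℝ EM H}
  {M : Type*} [TopologicalSpace M] [ChartedSpace H M]

theorem PrincipalBundle.IsAction.contMDiffAt_symm [LieGroup 𝓘(ℝ, EG) ∞ G] {A : VBundle.{v} EP P}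
    {ρ : Q.FibreAction A} (hρ : Q.IsAction ρ) {a : M → P} {γ : M → G} {m₀ : M}
    (ha : ContMDiffAt I 𝓘(ℝ, EP) ∞ a m₀) (hγ : ContMDiffAt I 𝓘(ℝ, EG) ∞ γ m₀)
    {p₁ p₂ : P} (h₁ : a m₀ ∈ A.nb p₁) (h₂ : Q.act (a m₀) (γ m₀) ∈ A.nb p₂) :
    ContMDiffAt I 𝓘(ℝ, A.F →L[ℝ] A.F) ∞ (fun m => (A.tr p₁ (a m)).comp
      (((ρ (γ m) (a m)).symm : A.fib (Q.act (a m) (γ m)) →L[ℝ] A.fib (a m)).comp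
        (A.trs p₂ (Q.act (a m) (γ m))))) m₀ := by
  refine contMDiffAt_clm_of_apply fun e => ?_
  have hact : ContMDiffAt I 𝓘(ℝ, EP) ∞ (fun m => Q.act (a m) (γ m)) m₀ :=
    (Q.smooth_act (a m₀, γ m₀)).comp m₀ (ha.prodMk hγ)
  have hs : ContMDiffAt I (𝓘(ℝ, EP).prod 𝓘(ℝ, A.F)) ∞ (fun m =>
      (⟨Q.act (a m) (γ m), A.trs p₂ (Q.act (a m) (γ m)) e⟩ : TotalSpace A.F A.fib)) m₀ := by
    refine ((trivializationAt A.F A.fib p₂).contMDiffAt_iff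
      (by exact (Trivialization.mem_source _).2 h₂)).2 ⟨hact, ?_⟩
    refine (contMDiffAt_const (c := e)).congr_of_eventuallyEq ?_
    filter_upwards [hact.continuousAt.preimage_mem_nhds ((A.isOpen_nb _).mem_nhds h₂)] with m hm
    exact (A.tr_eq hm _).symm.trans (A.tr_trs hm e)
  have h := (hρ.smooth (⟨Q.act (a m₀) (γ m₀), A.trs p₂ _ e⟩, (γ m₀)⁻¹)).comp m₀ (hs.prodMk hγ.inv)
  have h' : ContMDiffAt I (𝓘(ℝ, EP).prod 𝓘(ℝ, A.F)) ∞ (fun m =>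
      (⟨a m, (ρ (γ m) (a m)).symm (A.trs p₂ (Q.act (a m) (γ m)) e)⟩ : TotalSpace A.F A.fib)) m₀ :=
    h.congr_of_eventuallyEq (Filter.Eventually.of_forall fun m => (hρ.act_inv Q (γ m) (a m) _).symm)
  refine (((trivializationAt A.F A.fib p₁).contMDiffAt_iff
    (by exact (Trivialization.mem_source _).2 h₁)).1 h').2.congr_of_eventuallyEq ?_
  filter_upwards [ha.continuousAt.preimage_mem_nhds ((A.isOpen_nb _).mem_nhds h₁)] with m hm
  exact A.tr_eq hm _

theorem PrincipalBundle.IsAction.contMDiffAt_act {A : VBundle.{v} EP P}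
    {ρ : Q.FibreAction A} (hρ : Q.IsAction ρ) {a : M → P} {γ : M → G} {m₀ : M}
    (ha : ContMDiffAt I 𝓘(ℝ, EP) ∞ a m₀) (hγ : ContMDiffAt I 𝓘(ℝ, EG) ∞ γ m₀)
    {p₁ p₂ : P} (h₁ : a m₀ ∈ A.nb p₁) (h₂ : Q.act (a m₀) (γ m₀) ∈ A.nb p₂) :
    ContMDiffAt I 𝓘(ℝ, A.F →L[ℝ] A.F) ∞ (fun m => (A.tr p₂ (Q.act (a m) (γ m))).comp
      ((ρ (γ m) (a m) : A.fib (a m) →L[ℝ] A.fib (Q.act (a m) (γ m))).comp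
        (A.trs p₁ (a m)))) m₀ := by
  refine contMDiffAt_clm_of_apply fun e => ?_
  have hact : ContMDiffAt I 𝓘(ℝ, EP) ∞ (fun m => Q.act (a m) (γ m)) m₀ :=
    (Q.smooth_act (a m₀, γ m₀)).comp m₀ (ha.prodMk hγ)
  have hs : ContMDiffAt I (𝓘(ℝ, EP).prod 𝓘(ℝ, A.F)) ∞ (fun m =>
      (⟨a m, A.trs p₁ (a m) e⟩ : TotalSpace A.F A.fib)) m₀ := by
    refine ((trivializationAt A.F A.fib p₁).contMDiffAt_iff
      (by exact (Trivialization.mem_source _).2 h₁)).2 ⟨ha, ?_⟩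
    refine (contMDiffAt_const (c := e)).congr_of_eventuallyEq ?_
    filter_upwards [ha.continuousAt.preimage_mem_nhds ((A.isOpen_nb _).mem_nhds h₁)] with m hm
    exact (A.tr_eq hm _).symm.trans (A.tr_trs hm e)
  have h := (hρ.smooth (⟨a m₀, A.trs p₁ _ e⟩, γ m₀)).comp m₀ (hs.prodMk hγ)
  refine (((trivializationAt A.F A.fib p₂).contMDiffAt_iff
    (by exact (Trivialization.mem_source _).2 h₂)).1 h).2.congr_of_eventuallyEq ?_
  filter_upwards [hact.continuousAt.preimage_mem_nhds ((A.isOpen_nb _).mem_nhds h₂)] with m hm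
  exact A.tr_eq hm _

end Smooth

variable [IsManifold 𝓘(ℝ, EP) ∞ P]

theorem PrincipalBundle.IsAction.smoothForm_actF [LieGroup 𝓘(ℝ, EG) ∞ G] {A : VBundle.{v} EP P}
    {ρ : Q.FibreAction A} (hρ : Q.IsAction ρ) (g : G) {r : ℕ} {φ : RawForm A r}
    (hφ : SmoothForm φ) : SmoothForm (Q.actF ρ g φ) := smoothForm_of_at fun p₀ => by
  refine SmoothFormAt.pullMap (f := fun p => Q.act p g)
    (c := fun p => ((ρ g p).symm : A.fib (Q.act p g) →L[ℝ] A.fib p)) (hφ.at (Q.act p₀ g))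
    (Q.contMDiff_act_right g p₀) (A.mem_nb _)
    (hρ.contMDiffAt_symm Q (a := fun p => p) (γ := fun _ => g) contMDiffAt_id contMDiffAt_const
      (A.mem_nb p₀) (A.mem_nb (Q.act p₀ g))) ?_
  filter_upwards [(Q.contMDiff_act_right g p₀).continuousAt.preimage_mem_nhds
    ((A.isOpen_nb _).mem_nhds (A.mem_nb (Q.act p₀ g)))] with p hp a
  exact congrArg (fun b => A.tr p₀ p ((ρ g p).symm b)) (A.trs_tr hp a).symm

/-- The function `g ↦ (g · φ)_p`, with values in a normed space. -/
def PrincipalBundle.orbit {A : VBundle.{v} EP P} (ρ : Q.FibreAction A) {r : ℕ} (φ : RawForm A r)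
    (p : P) (g : G) : EP [⋀^Fin r]→L[ℝ] A.F :=
  (A.tr p p).compContinuousAlternatingMap (Q.actF ρ g φ p)

theorem tangentTr_congr {p p' q q' : P} (h : p = p') (h' : q = q') (u : EP) :
    tangentTr (EX := EP) p q u = tangentTr (EX := EP) p' q' u := by
  subst h h'; rfl

theorem PrincipalBundle.IsAction.contMDiff_orbit [LieGroup 𝓘(ℝ, EG) ∞ G] {A : VBundle.{v} EP P}
    {ρ : Q.FibreAction A} (hρ : Q.IsAction ρ) {r : ℕ} {φ : RawForm A r} (hφ : SmoothForm φ) (p : P) :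
    ContMDiff 𝓘(ℝ, EG) 𝓘(ℝ, EP [⋀^Fin r]→L[ℝ] A.F) ∞ (Q.orbit ρ φ p) := fun g₀ => by
  refine contMDiffAt_alt_of_apply fun v => ?_
  have h1 := hρ.contMDiffAt_symm Q (contMDiffAt_const (c := p)) (contMDiffAt_id (x := g₀))
    (A.mem_nb p) (A.mem_nb (Q.act p g₀))
  have h2 : ContMDiffAt 𝓘(ℝ, EG) 𝓘(ℝ, EP [⋀^Fin r]→L[ℝ] A.F) ∞
      (fun g => rep (Q.act p g₀) φ (Q.act p g)) g₀ :=
    ((smoothFormAt_iff _ _).1 (hφ.at _)).comp g₀ (Q.contMDiff_act_left p g₀)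
  have h3 : ContMDiffAt 𝓘(ℝ, EG) 𝓘(ℝ, EP →L[ℝ] EP) ∞ (fun g =>
      (tangentTr (Q.act p g₀) (Q.act p g)).comp ((mfderiv 𝓘(ℝ, EP) 𝓘(ℝ, EP)
        (fun q => Q.act q g) p).comp (tangentTrs (EX := EP) p p))) g₀ :=
    ContMDiffAt.mfderiv (fun g q => Q.act q g) (fun _ : G => p)
      ((Q.smooth_act (p, g₀)).comp (g₀, p) (contMDiffAt_snd.prodMk contMDiffAt_fst))
      contMDiffAt_const le_rfl
  have h4 := h1.clm_apply (contMDiffAt_alt_apply h2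
    fun i => h3.clm_apply (contMDiffAt_const (c := tangentTr (EX := EP) p p (v i))))
  refine h4.congr_of_eventuallyEq ?_
  filter_upwards [(Q.contMDiff_act_left p g₀).continuousAt.preimage_mem_nhds
      ((A.isOpen_nb _).mem_nhds (A.mem_nb (Q.act p g₀))),
    (Q.contMDiff_act_left p g₀).continuousAt.preimage_mem_nhds
      (chart_source_mem_nhds EP (Q.act p g₀))] with g hg hg'
  change A.tr p p ((ρ g p).symm (φ (Q.act p g) fun i =>
      mfderiv 𝓘(ℝ, EP) 𝓘(ℝ, EP) (fun q => Q.act q g) p (v i))) =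
    A.tr p p ((ρ g p).symm (A.trs (Q.act p g₀) (Q.act p g) (A.tr (Q.act p g₀) (Q.act p g)
      (φ (Q.act p g) fun i => tangentTrs (Q.act p g₀) (Q.act p g) (tangentTr (Q.act p g₀) (Q.act p g)
        (mfderiv 𝓘(ℝ, EP) 𝓘(ℝ, EP) (fun q => Q.act q g) p
          (tangentTrs p p (tangentTr (EX := EP) p p (v i)))))))))
  rw [A.trs_tr hg]
  congr 3
  funext i
  rw [tangentTrs_tangentTr hg']
  exact congrArg _ (tangentTrs_tangentTr (mem_chart_source EP p) (v i)).symm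

/-- The infinitesimal action on forms with values in a single bundle. -/
def PrincipalBundle.lieF {A : VBundle.{v} EP P} (ρ : Q.FibreAction A)
    (x : GroupLieAlgebra 𝓘(ℝ, EG) G) {r : ℕ} (φ : RawForm A r) : RawForm A r := fun p =>
  (A.trs p p).compContinuousAlternatingMap (show EP [⋀^Fin r]→L[ℝ] A.F from
    mfderiv 𝓘(ℝ, EG) 𝓘(ℝ, EP [⋀^Fin r]→L[ℝ] A.F) (Q.orbit ρ φ p) 1 x)

theorem PrincipalBundle.lieDerivative_eq {ι : Type} {V : ι → VBundle.{v} EP P}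
    (ρ : ∀ i, Q.FibreAction (V i)) (x : GroupLieAlgebra 𝓘(ℝ, EG) G) (φ : RawForms V) (r : ℕ) (i : ι) :
    Q.lieDerivative ρ x φ r i = Q.lieF (ρ i) x (φ r i) := by
  funext p
  have h : ((trivializationAt (V i).F (V i).fib p).continuousLinearEquivAt ℝ p
      (mem_baseSet_trivializationAt (V i).F (V i).fib p) : (V i).fib p →L[ℝ] (V i).F) =
      (V i).tr p p := ContinuousLinearMap.ext fun a => ((V i).tr_eq ((V i).mem_nb p) a).symm
  have h' : ∀ b, ((trivializationAt (V i).F (V i).fib p).continuousLinearEquivAt ℝ p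
      (mem_baseSet_trivializationAt (V i).F (V i).fib p)).symm b = (V i).trs p p b := fun b => by
    rw [ContinuousLinearEquiv.symm_apply_eq]
    exact ((V i).tr_trs ((V i).mem_nb p) b).symm.trans ((V i).tr_eq ((V i).mem_nb p) _)
  refine ContinuousAlternatingMap.ext fun v => (h' _).trans (congrArg ((V i).trs p p) ?_)
  exact congrArg (fun e : (V i).fib p →L[ℝ] (V i).F =>
    (show EP [⋀^Fin r]→L[ℝ] (V i).F from mfderiv 𝓘(ℝ, EG) 𝓘(ℝ, EP [⋀^Fin r]→L[ℝ] (V i).F)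
      (fun g : G => (e.compContinuousAlternatingMap (Q.actForms ρ g φ r i p) :
        EP [⋀^Fin r]→L[ℝ] (V i).F)) 1 x) v) h

end Action

/-! ## Lie derivatives -/

section NormedLie

variable {V : Type*} [NormedAddCommGroup V] [NormedSpace ℝ V] [FiniteDimensional ℝ V]
  {N : Type*} [NormedAddCommGroup N] [NormedSpace ℝ N]

theorem sum_update_eq_asym {k : ℕ} (s : V [⋀^Fin k]→L[ℝ] N) (A : V →ₗ[ℝ] V) (v : Fin k → V) :
    ∑ i, s (Function.update v i (A (v i))) =
      asym (p := k)
        { toFun := fun u => iota (A u) s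
          map_add' := fun u u' => by
            cases k with
            | zero => exact (add_zero _).symm
            | succ k =>
              rw [map_add]
              exact ContinuousAlternatingMap.ext fun v =>
                congrArg (fun f => f v) (s.toAlternatingMap.curryLeft.map_add (A u) (A u'))
          map_smul' := fun c u => by
            cases k with
            | zero => exact (smul_zero _).symm
            | succ k =>
              rw [map_smul]
              exact ContinuousAlternatingMap.ext fun v =>
                congrArg (fun f => f v) (s.toAlternatingMap.curryLeft.map_smul c (A u)) } v := by
  cases k with
  | zero => simp [asym]
  | succ k =>
    rw [asym_apply]
    refine Finset.sum_congr rfl fun i _ => ?_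
    have h : Function.update v i (A (v i)) = i.insertNth (A (v i)) (i.removeNth v) := by
      rw [Fin.insertNth_removeNth]
    rw [h, map_insertNth_real]
    rfl

/-- The derivative of the pullbacks of a form along a family `F t` of maps with `F 0 = id`. -/
theorem hasDerivAt_pullback_family {k : ℕ} {F : ℝ × V → V} {y₀ : V} (hF : ContDiffAt ℝ ∞ F (0, y₀))
    (h0 : ∀ᶠ y in nhds y₀, F (0, y) = y) {s : V → V [⋀^Fin k]→L[ℝ] N} (hs : DifferentiableAt ℝ s y₀) :
    ∃ M : V →L[ℝ] V, HasFDerivAt (fun y => fderiv ℝ F (0, y) (1, 0)) M y₀ ∧ ∀ w,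
      (∀ v, w v = fderiv ℝ s y₀ (fderiv ℝ F (0, y₀) (1, 0)) v +
        ∑ i, s y₀ (Function.update v i (M (v i)))) →
      HasDerivAt (fun t => (s (F (t, y₀))).compContinuousLinearMap
        (fderiv ℝ (fun y => F (t, y)) y₀)) w 0 := by
  have hF0 : F (0, y₀) = y₀ := h0.self_of_nhds
  have hF1 : ContDiffAt ℝ ∞ (fderiv ℝ F) (0, y₀) := hF.fderiv_right (by simp)
  have hF2 := (hF1.differentiableAt (by simp)).hasFDerivAt
  set H := fderiv ℝ (fderiv ℝ F) (0, y₀) with hH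
  have hsym : IsSymmSndFDerivAt ℝ F (0, y₀) := hF.isSymmSndFDerivAt (by
    rw [minSmoothness_of_isRCLikeNormedField]; exact two_le_infty)
  have hl : HasFDerivAt (fun y : V => ((0 : ℝ), y)) (ContinuousLinearMap.inr ℝ ℝ V) y₀ :=
    hasFDerivAt_prodMk_right 0 y₀
  have hX : HasFDerivAt (fun y => fderiv ℝ F (0, y) (1, 0))
      ((ContinuousLinearMap.apply ℝ V ((1 : ℝ), (0 : V))).comp
        (H.comp (ContinuousLinearMap.inr ℝ ℝ V))) y₀ :=
    (ContinuousLinearMap.apply ℝ V ((1 : ℝ), (0 : V))).hasFDerivAt.comp y₀ (hF2.comp y₀ hl)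
  refine ⟨_, hX, fun w hw => ?_⟩
  have hdiff : ∀ᶠ z in nhds ((0 : ℝ), y₀), DifferentiableAt ℝ F z :=
    (hF.of_le (m := 1) (by simp)).eventually (by simp) |>.mono fun z hz => hz.differentiableAt (by simp)
  have hc : Filter.Tendsto (fun t : ℝ => (t, y₀)) (nhds 0) (nhds (0, y₀)) :=
    (continuous_id.prodMk continuous_const).tendsto' _ _ rfl
  have e1 : (fun t => fderiv ℝ (fun y => F (t, y)) y₀) =ᶠ[nhds 0]
      fun t => (fderiv ℝ F (t, y₀)).comp (ContinuousLinearMap.inr ℝ ℝ V) := by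
    filter_upwards [hc.eventually hdiff] with t ht
    exact (ht.hasFDerivAt.comp y₀ (hasFDerivAt_prodMk_right t y₀)).fderiv
  have e2 : (fderiv ℝ F (0, y₀)).comp (ContinuousLinearMap.inr ℝ ℝ V) =
      ContinuousLinearMap.id ℝ V := by
    exact e1.self_of_nhds.symm.trans ((hasFDerivAt_id y₀).congr_of_eventuallyEq h0).fderiv
  have ht : HasFDerivAt (fun t : ℝ => (t, y₀)) (ContinuousLinearMap.inl ℝ ℝ V) 0 :=
    hasFDerivAt_prodMk_left 0 y₀
  have hs' : HasFDerivAt (fun t => s (F (t, y₀)))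
      ((fderiv ℝ s y₀).comp ((fderiv ℝ F (0, y₀)).comp (ContinuousLinearMap.inl ℝ ℝ V))) 0 := by
    have h1 : HasFDerivAt F (fderiv ℝ F (0, y₀)) (0, y₀) :=
      (hF.differentiableAt (by simp)).hasFDerivAt
    have h2 : HasFDerivAt s (fderiv ℝ s y₀) (F (0, y₀)) := by rw [hF0]; exact hs.hasFDerivAt
    exact h2.comp (0 : ℝ) (h1.comp (0 : ℝ) ht)
  have hg : HasFDerivAt (fun t => (fderiv ℝ F (t, y₀)).comp (ContinuousLinearMap.inr ℝ ℝ V))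
      (((ContinuousLinearMap.compL ℝ V (ℝ × V) V).flip (ContinuousLinearMap.inr ℝ ℝ V)).comp
        (H.comp (ContinuousLinearMap.inl ℝ ℝ V))) 0 :=
    ((ContinuousLinearMap.compL ℝ V (ℝ × V) V).flip
      (ContinuousLinearMap.inr ℝ ℝ V)).hasFDerivAt.comp (0 : ℝ) (hF2.comp (0 : ℝ) ht)
  have hfin := (hs'.continuousAlternatingMapCompContinuousLinearMap hg).hasDerivAt
  have hfin' := hfin.congr_of_eventuallyEq (f₁ := fun t => (s (F (t, y₀))).compContinuousLinearMap
        (fderiv ℝ (fun y => F (t, y)) y₀)) (e1.mono fun t ht => by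
          exact congrArg (fun L => (s (F (t, y₀))).compContinuousLinearMap L) ht)
  refine hfin'.congr_deriv (ContinuousAlternatingMap.ext fun v => ?_)
  rw [hw]
  simp only [e2, hF0]
  have key : ∀ u, H (0, u) (1, 0) = H (1, 0) (0, u) := fun u => hsym _ _
  simp [key]
  refine Finset.sum_congr rfl fun i _ => congrArg _ (funext fun j => ?_)
  by_cases hj : j = i
  · subst hj; simp
  · simp [hj]

end NormedLie

section LocallyConstant

variable {E : Type*} [NormedAddCommGroup E] [NormedSpace ℝ E]
  {M : Type*} [TopologicalSpace M] [ChartedSpace E M] [IsManifold 𝓘(ℝ, E) ∞ M]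
  {W : Type*} [NormedAddCommGroup W] [NormedSpace ℝ W]

theorem eq_of_mfderiv_eq_zero [PreconnectedSpace M] {f : M → W} (hf : MDifferentiable 𝓘(ℝ, E) 𝓘(ℝ, W) f)
    (h : ∀ x, mfderiv 𝓘(ℝ, E) 𝓘(ℝ, W) f x = 0) (x y : M) : f x = f y := by
  refine IsLocallyConstant.apply_eq_of_preconnectedSpace
    ((IsLocallyConstant.iff_eventually_eq f).2 fun x => ?_) x y
  obtain ⟨ε, hε, hb⟩ := Metric.isOpen_iff.1 (chartAt E x).open_target _ (mem_chart_target E x)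
  have hd : ∀ z ∈ (chartAt E x).target, HasFDerivAt (fun z => f ((chartAt E x).symm z)) (0 : E →L[ℝ] W) z := by
    intro z hz
    have h1 := (hf ((chartAt E x).symm z)).hasMFDerivAt
    rw [h] at h1
    have h2 : MDifferentiableAt 𝓘(ℝ, E) 𝓘(ℝ, E) (chartAt E x).symm z :=
      (contMDiffAt_symm_of_mem_maximalAtlas (n := ∞) (IsManifold.chart_mem_maximalAtlas x)
        hz).mdifferentiableAt (by simp)
    have h3 := h1.comp z h2.hasMFDerivAt
    exact (hasMFDerivAt_iff_hasFDerivAt.1 h3).congr_fderiv (ContinuousLinearMap.zero_comp _)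
  have hn : (chartAt E x).source ∩ chartAt E x ⁻¹' Metric.ball (chartAt E x x) ε ∈ nhds x :=
    (chartAt E x).continuousAt (mem_chart_source E x) |>.preimage_mem_nhds
      (Metric.ball_mem_nhds _ hε) |> Filter.inter_mem (chart_source_mem_nhds E x)
  filter_upwards [hn] with y hy
  have := Metric.isOpen_ball.is_const_of_fderiv_eq_zero (𝕜 := ℝ) (convex_ball _ ε).isPreconnected
    (f := fun z => f ((chartAt E x).symm z)) (fun z hz => ((hd z (hb hz)).differentiableAt).differentiableWithinAt)
    (fun z hz => (hd z (hb hz)).fderiv) hy.2 (Metric.mem_ball_self hε)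
  rwa [(chartAt E x).left_inv hy.1, (chartAt E x).left_inv (mem_chart_source E x)] at this

end LocallyConstant

theorem tangentTrs_congr {E M : Type*} [NormedAddCommGroup E] [NormedSpace ℝ E] [TopologicalSpace M]
    [ChartedSpace E M] [IsManifold 𝓘(ℝ, E) ∞ M] {p p' q q' : M} (h : p = p') (h' : q = q') (u : E) :
    (tangentTrs (EX := E) p q u : E) = tangentTrs (EX := E) p' q' u := by
  subst h h'; rfl

section Curve

variable {EG : Type*} [NormedAddCommGroup EG] [NormedSpace ℝ EG] [FiniteDimensional ℝ EG]
  {G : Type*} [TopologicalSpace G] [ChartedSpace EG G] [Group G]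

/-- A curve in `G` through `1` with velocity `x`. -/
def curve (x : GroupLieAlgebra 𝓘(ℝ, EG) G) (t : ℝ) : G :=
  (chartAt EG (1 : G)).symm (chartAt EG (1 : G) 1 + t • (show EG from
    mfderiv 𝓘(ℝ, EG) 𝓘(ℝ, EG) (chartAt EG (1 : G)) 1 x))

theorem curve_zero (x : GroupLieAlgebra 𝓘(ℝ, EG) G) : curve x 0 = 1 := by
  rw [curve, zero_smul, add_zero, (chartAt EG (1 : G)).left_inv (mem_chart_source EG _)]

variable [LieGroup 𝓘(ℝ, EG) ∞ G]

theorem contMDiffAt_curve (x : GroupLieAlgebra 𝓘(ℝ, EG) G) :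
    ContMDiffAt 𝓘(ℝ, ℝ) 𝓘(ℝ, EG) ∞ (curve x) 0 := by
  have h : ContDiff ℝ ∞ fun t : ℝ => chartAt EG (1 : G) 1 + t • (show EG from
    mfderiv 𝓘(ℝ, EG) 𝓘(ℝ, EG) (chartAt EG (1 : G)) 1 x) :=
    contDiff_const.add (contDiff_id.smul contDiff_const)
  refine ContMDiffAt.comp (0 : ℝ) (contMDiffAt_chart_symm ?_) h.contMDiff.contMDiffAt
  rw [zero_smul, add_zero]
  exact mem_chart_target EG 1

theorem mfderiv_curve (x : GroupLieAlgebra 𝓘(ℝ, EG) G) :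
    (mfderiv 𝓘(ℝ, ℝ) 𝓘(ℝ, EG) (curve x) 0 (1 : ℝ) : EG) = x := by
  set x' : EG := mfderiv 𝓘(ℝ, EG) 𝓘(ℝ, EG) (chartAt EG (1 : G)) 1 x with hx'
  have h : HasFDerivAt (fun t : ℝ => chartAt EG (1 : G) 1 + t • x')
      ((ContinuousLinearMap.id ℝ ℝ).smulRight x') 0 :=
    ((hasFDerivAt_id (0 : ℝ)).smul_const x').const_add _
  have h0 : chartAt EG (1 : G) 1 + (0 : ℝ) • x' = chartAt EG (1 : G) 1 := by
    rw [zero_smul, add_zero]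
  have hs : HasMFDerivAt 𝓘(ℝ, EG) 𝓘(ℝ, EG) (chartAt EG (1 : G)).symm
      (chartAt EG (1 : G) 1 + (0 : ℝ) • x')
      (mfderiv 𝓘(ℝ, EG) 𝓘(ℝ, EG) (chartAt EG (1 : G)).symm (chartAt EG (1 : G) 1 + (0 : ℝ) • x')) :=
    (mdifferentiableAt_chart_symm (by rw [h0]; exact mem_chart_target EG 1)).hasMFDerivAt
  have h1 := (hs.comp (0 : ℝ) (hasMFDerivAt_iff_hasFDerivAt.2 h)).mfderiv
  have h2 : (mfderiv 𝓘(ℝ, ℝ) 𝓘(ℝ, EG) (curve x) 0 (1 : ℝ) : EG) =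
      mfderiv 𝓘(ℝ, EG) 𝓘(ℝ, EG) (chartAt EG (1 : G)).symm
        (chartAt EG (1 : G) 1 + (0 : ℝ) • x') x' := by
    refine (congrArg (fun L => (L (1 : ℝ) : EG)) h1).trans ?_
    change (mfderiv 𝓘(ℝ, EG) 𝓘(ℝ, EG) (chartAt EG (1 : G)).symm
        (chartAt EG (1 : G) 1 + (0 : ℝ) • x') ((1 : ℝ) • x') : EG) = _
    rw [one_smul]
  have h3 : ((mfderiv 𝓘(ℝ, EG) 𝓘(ℝ, EG) (chartAt EG (1 : G)).symm (chartAt EG (1 : G) 1)).comp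
      (mfderiv 𝓘(ℝ, EG) 𝓘(ℝ, EG) (chartAt EG (1 : G)) 1)) = ContinuousLinearMap.id ℝ _ := by
    rw [← tangentTrs_eq (mem_chart_target EG (1 : G)), ← tangentTr_eq (mem_chart_source EG (1 : G))]
    refine ContinuousLinearMap.ext fun a => ?_
    refine (tangentTrs_congr (E := EG) rfl ((chartAt EG (1 : G)).left_inv (mem_chart_source EG _)) _).trans ?_
    exact tangentTrs_tangentTr (mem_chart_source EG (1 : G)) a
  rw [h2, h0]
  exact congrArg (fun L => (L x : EG)) h3

end Curve

/-! ## Lie derivatives, contractions and invariant forms -/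

section Equivariant

variable {EG : Type*} [NormedAddCommGroup EG] [NormedSpace ℝ EG] [FiniteDimensional ℝ EG]
  {G : Type*} [TopologicalSpace G] [ChartedSpace EG G] [Group G] [LieGroup 𝓘(ℝ, EG) ∞ G]
  {EP : Type*} [NormedAddCommGroup EP] [NormedSpace ℝ EP] [FiniteDimensional ℝ EP]
  {P : Type*} [TopologicalSpace P] [ChartedSpace EP P] [IsManifold 𝓘(ℝ, EP) ∞ P]
  {EX : Type*} [NormedAddCommGroup EX] [NormedSpace ℝ EX] [FiniteDimensional ℝ EX]
  {X : Type*} [TopologicalSpace X] [ChartedSpace EX X]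
  (Q : PrincipalBundle EG G EP P EX X)

section Lie

theorem hasDerivAt_comp_curve {W : Type*} [NormedAddCommGroup W] [NormedSpace ℝ W] {f : G → W}
    (hf : MDifferentiableAt 𝓘(ℝ, EG) 𝓘(ℝ, W) f 1) (x : GroupLieAlgebra 𝓘(ℝ, EG) G) :
    HasDerivAt (fun t => f (curve x t)) (mfderiv 𝓘(ℝ, EG) 𝓘(ℝ, W) f 1 x : W) 0 := by
  have h1 : HasMFDerivAt 𝓘(ℝ, EG) 𝓘(ℝ, W) f (curve x 0)
      (mfderiv 𝓘(ℝ, EG) 𝓘(ℝ, W) f (curve x 0)) := by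
    refine MDifferentiableAt.hasMFDerivAt ?_
    rwa [curve_zero]
  have h2 := h1.comp (0 : ℝ) ((contMDiffAt_curve x).mdifferentiableAt (by simp)).hasMFDerivAt
  have h3 : HasFDerivAt (fun t => f (curve x t)) (show ℝ →L[ℝ] W from
      (mfderiv 𝓘(ℝ, EG) 𝓘(ℝ, W) f (curve x 0)).comp
        (mfderiv 𝓘(ℝ, ℝ) 𝓘(ℝ, EG) (curve x) 0)) 0 := hasMFDerivAt_iff_hasFDerivAt.1 h2
  refine h3.hasDerivAt.congr_deriv ?_
  change (mfderiv 𝓘(ℝ, EG) 𝓘(ℝ, W) f (curve x 0)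
    (mfderiv 𝓘(ℝ, ℝ) 𝓘(ℝ, EG) (curve x) 0 (1 : ℝ) : EG) : W) = _
  rw [mfderiv_curve, curve_zero]

theorem PrincipalBundle.fundamental_eq (x : GroupLieAlgebra 𝓘(ℝ, EG) G) (p : P) :
    (Q.fundamental x p : EP) =
      mfderiv 𝓘(ℝ, ℝ) 𝓘(ℝ, EP) (fun t => Q.act p (curve x t)) 0 (1 : ℝ) := by
  have h1 : HasMFDerivAt 𝓘(ℝ, EG) 𝓘(ℝ, EP) (fun g => Q.act p g) (curve x 0)
      (mfderiv 𝓘(ℝ, EG) 𝓘(ℝ, EP) (fun g => Q.act p g) (curve x 0)) :=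
    ((Q.contMDiff_act_left p).mdifferentiable (by simp) _).hasMFDerivAt
  have h2 := (h1.comp (0 : ℝ) ((contMDiffAt_curve x).mdifferentiableAt (by simp)).hasMFDerivAt).mfderiv
  refine Eq.trans ?_ (congrArg (fun L => (L (1 : ℝ) : EP)) h2).symm
  change (mfderiv 𝓘(ℝ, EG) 𝓘(ℝ, EP) (fun g => Q.act p g) 1 x : EP) =
    mfderiv 𝓘(ℝ, EG) 𝓘(ℝ, EP) (fun g => Q.act p g) (curve x 0)
      (mfderiv 𝓘(ℝ, ℝ) 𝓘(ℝ, EG) (curve x) 0 (1 : ℝ) : EG)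
  rw [mfderiv_curve, curve_zero]

variable {A : VBundle.{v} EP P} {ρ : Q.FibreAction A}

theorem PrincipalBundle.tr_lieF (x : GroupLieAlgebra 𝓘(ℝ, EG) G) {r : ℕ} (φ : RawForm A r) (p : P) :
    (A.tr p p).compContinuousAlternatingMap (Q.lieF ρ x φ p) =
      (show EP [⋀^Fin r]→L[ℝ] A.F from
        mfderiv 𝓘(ℝ, EG) 𝓘(ℝ, EP [⋀^Fin r]→L[ℝ] A.F) (Q.orbit ρ φ p) 1 x) :=
  ContinuousAlternatingMap.ext fun _ => A.tr_trs (A.mem_nb p) _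

theorem PrincipalBundle.IsAction.hasDerivAt_orbit (hρ : Q.IsAction ρ)
    (x : GroupLieAlgebra 𝓘(ℝ, EG) G) {r : ℕ} {φ : RawForm A r} (hφ : SmoothForm φ) (p : P) :
    HasDerivAt (fun t => Q.orbit ρ φ p (curve x t))
      ((A.tr p p).compContinuousAlternatingMap (Q.lieF ρ x φ p) : EP [⋀^Fin r]→L[ℝ] A.F) 0 := by
  refine (hasDerivAt_comp_curve ((hρ.contMDiff_orbit Q hφ p).mdifferentiable (by simp) 1) x).congr_deriv ?_
  exact (Q.tr_lieF x φ p).symm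

theorem PrincipalBundle.IsAction.lieF_eq (hρ : Q.IsAction ρ) {x : GroupLieAlgebra 𝓘(ℝ, EG) G}
    {r : ℕ} {φ : RawForm A r} (hφ : SmoothForm φ) {p : P}
    {ψ : TangentSpace 𝓘(ℝ, EP) p [⋀^Fin r]→L[ℝ] A.fib p}
    (h : HasDerivAt (fun t => Q.orbit ρ φ p (curve x t))
      ((A.tr p p).compContinuousAlternatingMap ψ : EP [⋀^Fin r]→L[ℝ] A.F) 0) :
    Q.lieF ρ x φ p = ψ := by
  have h1 := h.unique (hρ.hasDerivAt_orbit Q x hφ p)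
  exact ContinuousAlternatingMap.ext fun v =>
    A.tr_injective (A.mem_nb p) (congrArg (fun a => a v) h1).symm

/-- Linear functions of `g ↦ (g · φ)_p` have the expected derivative. -/
theorem PrincipalBundle.IsAction.hasDerivAt_linear (hρ : Q.IsAction ρ)
    (x : GroupLieAlgebra 𝓘(ℝ, EG) G) {r : ℕ} {φ : RawForm A r} (hφ : SmoothForm φ) {p : P}
    {W : Type*} [NormedAddCommGroup W] [NormedSpace ℝ W]
    (Λ : (TangentSpace 𝓘(ℝ, EP) p [⋀^Fin r]→L[ℝ] A.fib p) →ₗ[ℝ] W) :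
    HasDerivAt (fun t => Λ (Q.actF ρ (curve x t) φ p)) (Λ (Q.lieF ρ x φ p)) 0 := by
  let C : (EP [⋀^Fin r]→L[ℝ] A.F) →ₗ[ℝ] (TangentSpace 𝓘(ℝ, EP) p [⋀^Fin r]→L[ℝ] A.fib p) :=
    { toFun := fun b => (A.trs p p).compContinuousAlternatingMap b
      map_add' := fun b b' => ContinuousAlternatingMap.ext fun v => map_add (A.trs p p) _ _
      map_smul' := fun c b => ContinuousAlternatingMap.ext fun v => map_smul (A.trs p p) _ _ }
  have hC : ∀ a, C ((A.tr p p).compContinuousAlternatingMap a) = a := fun a =>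
    ContinuousAlternatingMap.ext fun v => A.trs_tr (A.mem_nb p) _
  have h := (LinearMap.toContinuousLinearMap (Λ ∘ₗ C)).hasFDerivAt.comp_hasDerivAt (0 : ℝ)
    (hρ.hasDerivAt_orbit Q x hφ p)
  have e1 : ((LinearMap.toContinuousLinearMap (Λ ∘ₗ C)) ∘ fun t => Q.orbit ρ φ p (curve x t)) =
      fun t => Λ (Q.actF ρ (curve x t) φ p) := funext fun t => congrArg Λ (hC _)
  rw [e1] at h
  exact h.congr_deriv (congrArg Λ (hC _))

theorem PrincipalBundle.IsAction.lieF_add (hρ : Q.IsAction ρ)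
    (x : GroupLieAlgebra 𝓘(ℝ, EG) G) {r : ℕ} {φ ψ : RawForm A r} (hφ : SmoothForm φ)
    (hψ : SmoothForm ψ) : Q.lieF ρ x (φ + ψ) = Q.lieF ρ x φ + Q.lieF ρ x ψ := by
  funext p
  refine hρ.lieF_eq Q (fun q => (hφ.at q).add (hψ.at q)) ?_
  have h := (hρ.hasDerivAt_orbit Q x hφ p).add (hρ.hasDerivAt_orbit Q x hψ p)
  refine (h.congr_of_eventuallyEq (Filter.Eventually.of_forall fun t => ?_)).congr_deriv ?_
  · change (A.tr p p).compContinuousAlternatingMap (Q.actF ρ _ (φ + ψ) p) = _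
    rw [Q.actF_add]
    exact ContinuousAlternatingMap.ext fun v => map_add (A.tr p p) _ _
  · exact ContinuousAlternatingMap.ext fun v => (map_add (A.tr p p) _ _).symm

theorem PrincipalBundle.IsAction.lieF_smul (hρ : Q.IsAction ρ)
    (x : GroupLieAlgebra 𝓘(ℝ, EG) G) {r : ℕ} (c : ℝ) {φ : RawForm A r} (hφ : SmoothForm φ) :
    Q.lieF ρ x (c • φ) = c • Q.lieF ρ x φ := by
  funext p
  refine hρ.lieF_eq Q (fun q => (hφ.at q).smul c) ?_
  have h := (hρ.hasDerivAt_orbit Q x hφ p).const_smul c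
  refine (h.congr_of_eventuallyEq (Filter.Eventually.of_forall fun t => ?_)).congr_deriv ?_
  · change (A.tr p p).compContinuousAlternatingMap (Q.actF ρ _ (c • φ) p) = _
    rw [Q.actF_smul]
    exact ContinuousAlternatingMap.ext fun v => map_smul (A.tr p p) _ _
  · exact ContinuousAlternatingMap.ext fun v => (map_smul (A.tr p p) _ _).symm

theorem PrincipalBundle.lieF_eq_zero_of_invariant {x : GroupLieAlgebra 𝓘(ℝ, EG) G} {r : ℕ}
    {φ : RawForm A r} (h : ∀ g, Q.actF ρ g φ = φ) : Q.lieF ρ x φ = 0 := by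
  funext p
  have h1 : Q.orbit ρ φ p = fun _ => (A.tr p p).compContinuousAlternatingMap (φ p) :=
    funext fun g => by unfold PrincipalBundle.orbit; rw [h]; rfl
  have h2 : mfderiv 𝓘(ℝ, EG) 𝓘(ℝ, EP [⋀^Fin r]→L[ℝ] A.F) (Q.orbit ρ φ p) 1 = 0 := by
    rw [h1]; exact mfderiv_const
  refine ContinuousAlternatingMap.ext fun v => A.tr_injective (A.mem_nb p) ?_
  refine (congrArg (fun a => a v) (Q.tr_lieF x φ p)).trans ?_
  exact (congrArg (fun L => (show EP [⋀^Fin r]→L[ℝ] A.F from L x) v) h2).trans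
    (map_zero (A.tr p p)).symm

/-- Since `G` is connected, forms with vanishing Lie derivatives are invariant. -/
theorem PrincipalBundle.IsAction.invariant_of_lieF_eq_zero [PreconnectedSpace G] (hρ : Q.IsAction ρ)
    {r : ℕ} {φ : RawForm A r} (hφ : SmoothForm φ) (h : ∀ x, Q.lieF ρ x φ = 0) (g : G) :
    Q.actF ρ g φ = φ := by
  funext p
  have hd := (hρ.contMDiff_orbit Q hφ p).mdifferentiable (by simp)
  have h0 : ∀ k, mfderiv 𝓘(ℝ, EG) 𝓘(ℝ, EP [⋀^Fin r]→L[ℝ] A.F) (Q.orbit ρ φ p) k = 0 := by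
    intro k
    let Λ : (TangentSpace 𝓘(ℝ, EP) (Q.act p k) [⋀^Fin r]→L[ℝ] A.fib (Q.act p k)) →ₗ[ℝ]
        (EP [⋀^Fin r]→L[ℝ] A.F) :=
      { toFun := fun b => (A.tr p p).compContinuousAlternatingMap
          (((ρ k p).symm : A.fib (Q.act p k) →L[ℝ] A.fib p).compContinuousAlternatingMap
            (b.compContinuousLinearMap (mfderiv 𝓘(ℝ, EP) 𝓘(ℝ, EP) (fun q => Q.act q k) p)))
        map_add' := fun b b' => ContinuousAlternatingMap.ext fun v =>
          (congrArg (A.tr p p) (map_add (ρ k p).symm _ _)).trans (map_add (A.tr p p) _ _)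
        map_smul' := fun c b => ContinuousAlternatingMap.ext fun v =>
          (congrArg (A.tr p p) (map_smul (ρ k p).symm _ _)).trans (map_smul (A.tr p p) _ _) }
    have e : ∀ l, Λ (Q.actF ρ l φ (Q.act p k)) = Q.orbit ρ φ p (k * l) := fun l => by
      unfold PrincipalBundle.orbit
      rw [hρ.actF_mul Q k l φ]
      rfl
    have hk : MDifferentiableAt 𝓘(ℝ, EG) 𝓘(ℝ, EP [⋀^Fin r]→L[ℝ] A.F)
        (fun l => Q.orbit ρ φ p (k * l)) 1 :=
      (hd _).comp (1 : G) ((contMDiff_mul_left (I := 𝓘(ℝ, EG)) (n := ∞) (a := k)).mdifferentiable (by simp) 1)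
    have hk0 : mfderiv 𝓘(ℝ, EG) 𝓘(ℝ, EP [⋀^Fin r]→L[ℝ] A.F)
        (fun l => Q.orbit ρ φ p (k * l)) 1 = 0 := by
      refine ContinuousLinearMap.ext fun x => ?_
      have h1 := hρ.hasDerivAt_linear Q x hφ Λ
      rw [h, show Λ ((0 : RawForm A r) (Q.act p k)) = 0 from map_zero Λ] at h1
      simp only [e] at h1
      exact (hasDerivAt_comp_curve hk x).unique h1
    have e2 : Q.orbit ρ φ p = (fun l => Q.orbit ρ φ p (k * l)) ∘ fun l => k⁻¹ * l :=
      funext fun l => by simp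
    have h3 : HasMFDerivAt 𝓘(ℝ, EG) 𝓘(ℝ, EP [⋀^Fin r]→L[ℝ] A.F)
        (fun l => Q.orbit ρ φ p (k * l)) (k⁻¹ * k) 0 := by
      rw [inv_mul_cancel]
      have := hk.hasMFDerivAt
      rwa [hk0] at this
    have h4 := (h3.comp k ((contMDiff_mul_left (I := 𝓘(ℝ, EG)) (n := ∞) (a := k⁻¹)).mdifferentiable
      (by simp) k).hasMFDerivAt).mfderiv
    rw [ContinuousLinearMap.zero_comp, ← e2] at h4
    exact h4
  have h1 := eq_of_mfderiv_eq_zero hd h0 g 1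
  unfold PrincipalBundle.orbit at h1
  rw [hρ.actF_one] at h1
  exact ContinuousAlternatingMap.ext fun v =>
    A.tr_injective (A.mem_nb p) (congrArg (fun a => a v) h1)

/-- The contraction of forms with values in a single bundle. -/
def PrincipalBundle.contrF (x : GroupLieAlgebra 𝓘(ℝ, EG) G) {r : ℕ} (φ : RawForm A (r + 1)) :
    RawForm A r := fun p => contract (Q.fundamental x p) (φ p)

theorem PrincipalBundle.smoothForm_contrF (x : GroupLieAlgebra 𝓘(ℝ, EG) G) {r : ℕ}
    {φ : RawForm A (r + 1)} (hφ : SmoothForm φ) : SmoothForm (Q.contrF x φ) :=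
  smoothForm_of_at fun p₀ => by
  rw [smoothFormAt_iff]
  have h1 : ContMDiffAt 𝓘(ℝ, EP) 𝓘(ℝ, EG →L[ℝ] EP) ∞ (fun p =>
      (tangentTr (Q.act p₀ 1) (Q.act p 1)).comp ((mfderiv 𝓘(ℝ, EG) 𝓘(ℝ, EP)
        (fun g => Q.act p g) 1).comp (tangentTrs (EX := EG) (1 : G) 1))) p₀ :=
    ContMDiffAt.mfderiv (fun p g => Q.act p g) (fun _ : P => (1 : G)) (Q.smooth_act (p₀, 1))
      contMDiffAt_const le_rfl
  have h2 := h1.clm_apply (contMDiffAt_const (c := tangentTr (EX := EG) (1 : G) 1 x))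
  have h3 : ContMDiffAt 𝓘(ℝ, EP) 𝓘(ℝ, EP) ∞
      (fun p => (tangentTr p₀ p (Q.fundamental x p) : EP)) p₀ := by
    refine h2.congr_of_eventuallyEq (Filter.Eventually.of_forall fun p => ?_)
    refine (tangentTr_congr (Q.act_one p₀).symm (Q.act_one p).symm _).trans ?_
    exact congrArg (fun u : EG => (tangentTr (Q.act p₀ 1) (Q.act p 1) (mfderiv 𝓘(ℝ, EG) 𝓘(ℝ, EP)
        (fun g => Q.act p g) 1 u) : EP)) (tangentTrs_tangentTr (mem_chart_source EG (1 : G)) x).symm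
  refine contMDiffAt_alt_of_apply fun v => ?_
  have h4 := contMDiffAt_alt_apply ((smoothFormAt_iff _ _).1 (hφ.at p₀))
    (w := fun p => Matrix.vecCons (tangentTr p₀ p (Q.fundamental x p) : EP) v) (fun i => by
      refine Fin.cases h3 (fun j => ?_) i
      exact contMDiffAt_const)
  refine h4.congr_of_eventuallyEq ?_
  filter_upwards [chart_source_mem_nhds EP p₀] with p hp
  refine congrArg (A.tr p₀ p) (congrArg (φ p) (funext fun i => ?_))
  refine Fin.cases ?_ (fun j => rfl) i
  exact (tangentTrs_tangentTr hp _).symm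

end Lie

/-! ## Naturality of the products, and contractions -/

section HomAction

theorem hom_total_ext {A B : VBundle.{v} EP P} {p p' : P} (h : p = p')
    {f : A.fib p →L[ℝ] B.fib p} {f' : A.fib p' →L[ℝ] B.fib p'}
    (hf : ∀ a a', (⟨p, a⟩ : TotalSpace A.F A.fib) = ⟨p', a'⟩ →
      (⟨p, f a⟩ : TotalSpace B.F B.fib) = ⟨p', f' a'⟩) :
    (⟨p, f⟩ : TotalSpace (A.hom B).F (A.hom B).fib) = ⟨p', f'⟩ := by
  subst h
  have : f = f' := ContinuousLinearMap.ext fun a => by simpa using hf a a rfl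
  rw [this]

theorem total_ext_iff {A : VBundle.{v} EP P} {p : P} {a b : A.fib p} :
    (⟨p, a⟩ : TotalSpace A.F A.fib) = ⟨p, b⟩ ↔ a = b := by simp

/-- The action on `Hom(A, B)` induced by actions on `A` and `B`. -/
def PrincipalBundle.homAct {A B : VBundle.{v} EP P} (ρ : Q.FibreAction A) (ρ' : Q.FibreAction B) :
    Q.FibreAction (A.hom B) := fun g p => (ρ g p).arrowCongr (ρ' g p)

variable {Q} in
theorem PrincipalBundle.IsAction.homAct {A B : VBundle.{v} EP P} {ρ : Q.FibreAction A}
    {ρ' : Q.FibreAction B} (hρ : Q.IsAction ρ) (hρ' : Q.IsAction ρ') :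
    Q.IsAction (Q.homAct ρ ρ') where
  one p f := by
    refine hom_total_ext (A := A) (B := B) (f := (Q.homAct ρ ρ' 1 p f : A.fib _ →L[ℝ] B.fib _))
      (f' := homVal A B p f) (Q.act_one p) fun a a' h => ?_
    have h1 : a = ρ 1 p a' := total_ext_iff.1 (h.trans (hρ.one p a').symm)
    subst h1
    change (⟨Q.act p 1, ρ' 1 p (homVal A B p f ((ρ 1 p).symm (ρ 1 p a')))⟩ : TotalSpace B.F B.fib) = _
    rw [ContinuousLinearEquiv.symm_apply_apply]
    exact hρ'.one p _
  mul g h p f := by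
    refine hom_total_ext (A := A) (B := B)
      (f := (Q.homAct ρ ρ' (g * h) p f : A.fib _ →L[ℝ] B.fib _))
      (f' := (Q.homAct ρ ρ' h (Q.act p g) (Q.homAct ρ ρ' g p f) : A.fib _ →L[ℝ] B.fib _))
      (Q.act_mul p g h) fun a a' ha => ?_
    obtain ⟨b, rfl⟩ := (ρ (g * h) p).surjective a
    have h1 : a' = ρ h (Q.act p g) (ρ g p b) := total_ext_iff.1 (ha.symm.trans (hρ.mul g h p b))
    subst h1
    change (⟨_, ρ' (g * h) p (homVal A B p f ((ρ (g * h) p).symm (ρ (g * h) p b)))⟩ :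
      TotalSpace B.F B.fib) = ⟨_, ρ' h (Q.act p g) (ρ' g p (homVal A B p f ((ρ g p).symm
        ((ρ h (Q.act p g)).symm (ρ h (Q.act p g) (ρ g p b))))))⟩
    rw [ContinuousLinearEquiv.symm_apply_apply, ContinuousLinearEquiv.symm_apply_apply,
      ContinuousLinearEquiv.symm_apply_apply]
    exact hρ'.mul g h p _
  smooth := fun m₀ => by
    set p₀ := m₀.1.1 with hp₀
    set q₀ := Q.act m₀.1.1 m₀.2 with hq₀
    have hpr : ContMDiff ((𝓘(ℝ, EP).prod 𝓘(ℝ, (A.hom B).F)).prod 𝓘(ℝ, EG)) 𝓘(ℝ, EP) ∞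
        (fun m : TotalSpace (A.hom B).F (A.hom B).fib × G => m.1.1) :=
      (Bundle.contMDiff_proj (A.hom B).fib).comp contMDiff_fst
    have hact : ContMDiff ((𝓘(ℝ, EP).prod 𝓘(ℝ, (A.hom B).F)).prod 𝓘(ℝ, EG)) 𝓘(ℝ, EP) ∞
        (fun m : TotalSpace (A.hom B).F (A.hom B).fib × G => Q.act m.1.1 m.2) :=
      Q.smooth_act.comp (hpr.prodMk contMDiff_snd)
    have h1 := hρ'.contMDiffAt_act Q (hpr m₀) contMDiffAt_snd (p₁ := p₀) (p₂ := q₀)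
      (B.mem_nb p₀) (B.mem_nb q₀)
    have h2 := hρ.contMDiffAt_symm Q (hpr m₀) contMDiffAt_snd (p₁ := p₀) (p₂ := q₀)
      (A.mem_nb p₀) (A.mem_nb q₀)
    have h3 : ContMDiffAt ((𝓘(ℝ, EP).prod 𝓘(ℝ, (A.hom B).F)).prod 𝓘(ℝ, EG)) 𝓘(ℝ, A.F →L[ℝ] B.F) ∞
        (fun m : TotalSpace (A.hom B).F (A.hom B).fib × G =>
          (show A.F →L[ℝ] B.F from (trivializationAt (A.hom B).F (A.hom B).fib p₀ m.1).2)) m₀ :=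
      (((trivializationAt (A.hom B).F (A.hom B).fib p₀).contMDiffAt_iff
        (f := fun m : TotalSpace (A.hom B).F (A.hom B).fib × G => m.1) (x₀ := m₀)
        (by exact (Trivialization.mem_source _).2 ((A.hom B).mem_nb p₀))).1 contMDiffAt_fst).2
    refine ((trivializationAt (A.hom B).F (A.hom B).fib q₀).contMDiffAt_iff
      (by exact (Trivialization.mem_source _).2 ((A.hom B).mem_nb q₀))).2 ⟨hact m₀, ?_⟩
    refine (h1.clm_comp (h3.clm_comp h2)).congr_of_eventuallyEq ?_
    filter_upwards [(hpr m₀).continuousAt.preimage_mem_nhds ((A.isOpen_nb _).mem_nhds (A.mem_nb p₀)),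
      (hpr m₀).continuousAt.preimage_mem_nhds ((B.isOpen_nb _).mem_nhds (B.mem_nb p₀)),
      (hact m₀).continuousAt.preimage_mem_nhds ((A.isOpen_nb _).mem_nhds (A.mem_nb q₀)),
      (hact m₀).continuousAt.preimage_mem_nhds ((B.isOpen_nb _).mem_nhds (B.mem_nb q₀))]
      with m hA hB hA' hB'
    have e1 := (A.hom B).tr_eq (x₀ := p₀) (x := m.1.1) ⟨hA, hB⟩ m.1.2
    have e2 := (A.hom B).tr_eq (x₀ := q₀) (x := Q.act m.1.1 m.2) ⟨hA', hB'⟩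
      (Q.homAct ρ ρ' m.2 m.1.1 m.1.2)
    rw [A.hom_tr B hA hB] at e1
    rw [A.hom_tr B hA' hB'] at e2
    refine e2.symm.trans ?_
    refine Eq.trans ?_ (congrArg (fun T : A.F →L[ℝ] B.F => ContinuousLinearMap.comp _
      (ContinuousLinearMap.comp T _)) e1)
    refine ContinuousLinearMap.ext fun a => ?_
    change B.tr q₀ _ (ρ' m.2 m.1.1 (homVal A B m.1.1 m.1.2 ((ρ m.2 m.1.1).symm
        (A.trs q₀ (Q.act m.1.1 m.2) a)))) =
      B.tr q₀ _ (ρ' m.2 m.1.1 (B.trs p₀ m.1.1 (B.tr p₀ m.1.1 (homVal A B m.1.1 m.1.2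
        (A.trs p₀ m.1.1 (A.tr p₀ m.1.1 ((ρ m.2 m.1.1).symm (A.trs q₀ (Q.act m.1.1 m.2) a))))))))
    rw [A.trs_tr hA, B.trs_tr hB]

variable {ι : Type} {V : ι → VBundle.{v} EP P} (ρ : ∀ i, Q.FibreAction (V i))
  {E E' E'' : GradedBundle.{v} EP P} (ρE : ∀ k, Q.FibreAction (E.part k))
  (ρE' : ∀ k, Q.FibreAction (E'.part k)) (ρE'' : ∀ k, Q.FibreAction (E''.part k))

theorem PrincipalBundle.actForms_scalarWedge (g : G) {k : ℕ} (σ : RawForm (VBundle.line EP P) k)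
    (η : RawForms V) : Q.actForms ρ g (scalarWedge σ η) =
      scalarWedge (pullS EP (fun p => Q.act p g) σ) (Q.actForms ρ g η) := by
  funext n i p
  exact (scalarWedge_natural (mfderiv 𝓘(ℝ, EP) 𝓘(ℝ, EP) (fun q => Q.act q g) p)
    (fun i => (ρ i g p).symm) rfl (fun _ _ => rfl) n i).symm

theorem PrincipalBundle.actForms_homWedge (g : G) (α : RawForms (E.hom E')) (η : RawForms E.part) :
    Q.actForms ρE' g (homWedge α η) =
      homWedge (Q.actForms (Q.homAction ρE ρE') g α) (Q.actForms ρE g η) := by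
  funext n q' p
  exact (homWedge_natural (mfderiv 𝓘(ℝ, EP) 𝓘(ℝ, EP) (fun q => Q.act q g) p)
    (fun q => (ρE q g p).symm) (fun q => (ρE' q g p).symm) rfl (fun _ _ _ => rfl)
    (fun _ _ => rfl) n q').symm

theorem PrincipalBundle.actForms_homComp (g : G) (ψ : RawForms (E'.hom E''))
    (α : RawForms (E.hom E')) : Q.actForms (Q.homAction ρE ρE'') g (homComp ψ α) =
      homComp (Q.actForms (Q.homAction ρE' ρE'') g ψ) (Q.actForms (Q.homAction ρE ρE') g α) := by
  funext n i p
  exact (homComp_natural (mfderiv 𝓘(ℝ, EP) 𝓘(ℝ, EP) (fun q => Q.act q g) p)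
    (fun q => (ρE q g p).symm) (fun q => (ρE' q g p).symm) (fun q => (ρE'' q g p).symm) rfl
    (fun _ _ _ => rfl) (fun _ _ _ => rfl) n i.1 i.2).symm

theorem PrincipalBundle.actForms_homOne (g : G) :
    Q.actForms (Q.homAction ρE ρE) g (homOne E) = homOne E := by
  funext n i p
  exact (homOne_natural (mfderiv 𝓘(ℝ, EP) 𝓘(ℝ, EP) (fun q => Q.act q g) p)
    (fun q => (ρE q g p).symm) n i.1 i.2).symm

end HomAction

/-! ## Cartan calculus -/

section Cartan

theorem PrincipalBundle.contraction_scalarWedge_zero {ι : Type} {V : ι → VBundle.{v} EP P}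
    (x : GroupLieAlgebra 𝓘(ℝ, EG) G) (σ : RawForm (VBundle.line EP P) 0) (η : RawForms V) :
    Q.contraction x (scalarWedge σ η) = scalarWedge σ (Q.contraction x η) := by
  funext n i p
  change contract (Q.fundamental x p) (scalarWedge σ η (n + 1) i p) = _
  rw [scalarWedge_sum σ η (Nat.lt_succ_self (n + 1)),
    scalarWedge_sum σ _ (show n < n + 1 from Nat.lt_succ_self n)]
  rw [sum_range_single _ (n + 1), sum_range_single _ n, contract_tw_total, iota_of_eq_zero rfl,
    tw_zero_left, zero_add, pow_zero, one_smul]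
  · rfl
  · intro s hs; exact tw_of_ne _ (by omega) _ _
  · intro h; omega
  · intro s hs; exact tw_of_ne _ (by omega) _ _
  · intro h; omega

theorem contract_sum {V N : Type*} [AddCommGroup V] [Module ℝ V] [TopologicalSpace V]
    [IsTopologicalAddGroup V] [ContinuousSMul ℝ V] [T2Space V] [FiniteDimensional ℝ V]
    [AddCommGroup N] [Module ℝ N] [TopologicalSpace N] [IsTopologicalAddGroup N]
    [ContinuousSMul ℝ N] {ι : Type*} (s : Finset ι) {p : ℕ} (u : V)
    (a : ι → V [⋀^Fin (p + 1)]→L[ℝ] N) :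
    contract u (∑ i ∈ s, a i) = ∑ i ∈ s, contract u (a i) := by
  classical
  induction s using Finset.induction_on with
  | empty => rfl
  | insert i s hi ih => rw [Finset.sum_insert hi, Finset.sum_insert hi, contract_add, ih]

theorem PrincipalBundle.contraction_scalarWedge_succ {ι : Type} {V : ι → VBundle.{v} EP P}
    (x : GroupLieAlgebra 𝓘(ℝ, EG) G) {k : ℕ} (σ : RawForm (VBundle.line EP P) (k + 1))
    (η : RawForms V) : Q.contraction x (scalarWedge σ η) =
      scalarWedge (Q.contrF x σ) η - (-1 : ℝ) ^ k • scalarWedge σ (Q.contraction x η) := by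
  funext n i p
  change contract (Q.fundamental x p) (scalarWedge σ η (n + 1) i p) =
    scalarWedge (Q.contrF x σ) η n i p - (-1 : ℝ) ^ k • scalarWedge σ (Q.contraction x η) n i p
  rw [scalarWedge_sum σ η (show n + 1 < n + 1 + 1 from Nat.lt_succ_self (n + 1)),
    scalarWedge_sum _ η (show n < n + 1 + 1 by omega),
    scalarWedge_sum σ _ (show n < n + 1 from Nat.lt_succ_self n), contract_sum,
    Finset.sum_congr rfl fun s _ => contract_tw_total (scalarB (V i) p) (k + 1) s n _ (σ p) (η s i p),
    Finset.sum_add_distrib, sub_eq_add_neg]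
  refine congrArg₂ (· + ·) rfl ?_
  rw [Finset.sum_range_succ', iota_of_eq_zero rfl, tw_zero_right, smul_zero, add_zero,
    Finset.smul_sum, ← Finset.sum_neg_distrib]
  refine Finset.sum_congr rfl fun s _ => ?_
  rw [pow_succ, mul_neg_one, neg_smul]
  rfl

theorem PrincipalBundle.contraction_homWedge {E E' : GradedBundle.{v} EP P}
    (x : GroupLieAlgebra 𝓘(ℝ, EG) G) {α : RawForms (E.hom E')} {m : ℤ}
    (hα : IsHomogeneous homDeg m α) (η : RawForms E.part) : Q.contraction x (homWedge α η) =
      homWedge (Q.contraction x α) η + (-1 : ℝ) ^ m • homWedge α (Q.contraction x η) := by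
  funext n q' p
  change contract (Q.fundamental x p) (homWedge α η (n + 1) q' p) =
    homWedge (Q.contraction x α) η n q' p + (-1 : ℝ) ^ m • homWedge α (Q.contraction x η) n q' p
  rw [homWedge_sum α η (show n + 1 < n + 1 + 1 from Nat.lt_succ_self (n + 1)),
    homWedge_sum _ η (show n < n + 1 + 1 by omega),
    homWedge_sum α _ (show n < n + 1 + 1 by omega), contract_sum, Finset.smul_sum,
    ← Finset.sum_add_distrib]
  refine Finset.sum_congr rfl fun q _ => ?_
  have h1 : ∀ a ∈ Finset.range (n + 1 + 1), ∀ r ∈ Finset.range (n + 1 + 1),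
      contract (Q.fundamental x p) (((-1 : ℝ) ^ ((q' - q) * (r : ℤ))) •
        tw (evalB (E.part q) (E'.part q') p) a r (n + 1) (hc α a q q' p) (η r q p)) =
      ((-1 : ℝ) ^ ((q' - q) * (r : ℤ))) • tw (evalB (E.part q) (E'.part q') p) (a - 1) r n
        (iota (Q.fundamental x p) (hc α a q q' p)) (η r q p) +
      ((-1 : ℝ) ^ ((q' - q) * (r : ℤ)) * (-1 : ℝ) ^ a) •
        tw (evalB (E.part q) (E'.part q') p) a (r - 1) n (hc α a q q' p)
          (iota (Q.fundamental x p) (η r q p)) := fun a _ r _ => by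
    rw [contract_smul, contract_tw_total, smul_add, smul_smul]
  rw [contract_sum, Finset.sum_congr rfl fun a _ => contract_sum _ _ _,
    Finset.sum_congr rfl fun a ha => Finset.sum_congr rfl fun r hr => h1 a ha r hr]
  simp only [Finset.sum_add_distrib]
  congr 1
  · have h2 : ∑ r ∈ Finset.range (n + 1 + 1), ((-1 : ℝ) ^ ((q' - q) * (r : ℤ))) •
        tw (evalB (E.part q) (E'.part q') p) (0 - 1) r n
          (iota (Q.fundamental x p) (hc α 0 q q' p)) (η r q p) = 0 :=
      Finset.sum_eq_zero fun r _ => by rw [iota_of_eq_zero rfl, tw_zero_left, smul_zero]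
    have h3 : ∑ r ∈ Finset.range (n + 1 + 1), ((-1 : ℝ) ^ ((q' - q) * (r : ℤ))) •
        tw (evalB (E.part q) (E'.part q') p) (n + 1) r n
          (hc (Q.contraction x α) (n + 1) q q' p) (η r q p) = 0 :=
      Finset.sum_eq_zero fun r _ => by rw [tw_of_ne _ (by omega), smul_zero]
    refine (Finset.sum_range_succ' (fun a => ∑ r ∈ Finset.range (n + 1 + 1),
      ((-1 : ℝ) ^ ((q' - q) * (r : ℤ))) • tw (evalB (E.part q) (E'.part q') p) (a - 1) r n
        (iota (Q.fundamental x p) (hc α a q q' p)) (η r q p)) (n + 1)).trans ?_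
    refine Eq.trans ?_ (Finset.sum_range_succ (fun a => ∑ r ∈ Finset.range (n + 1 + 1),
      ((-1 : ℝ) ^ ((q' - q) * (r : ℤ))) • tw (evalB (E.part q) (E'.part q') p) a r n
        (hc (Q.contraction x α) a q q' p) (η r q p)) (n + 1)).symm
    rw [h2, h3]
    rfl
  · rw [Finset.smul_sum]
    refine Finset.sum_congr rfl fun a _ => ?_
    rw [Finset.sum_range_succ', Finset.sum_range_succ _ (n + 1), iota_of_eq_zero rfl, tw_zero_right,
      smul_zero, tw_of_ne _ (show a + (n + 1) ≠ n by omega), smul_zero, add_zero, add_zero,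
      Finset.smul_sum]
    refine Finset.sum_congr rfl fun r _ => ?_
    rw [smul_smul]
    by_cases h : (a : ℤ) + (q' - q) = m
    · have e : (-1 : ℝ) ^ ((q' - q) * ((r + 1 : ℕ) : ℤ)) * (-1 : ℝ) ^ a =
          (-1 : ℝ) ^ m * (-1 : ℝ) ^ ((q' - q) * (r : ℤ)) := by
        rw [← zpow_natCast (-1 : ℝ) a, ← zpow_add₀ (by norm_num), ← zpow_add₀ (by norm_num), ← h]
        exact neg_one_zpow_congr ⟨0, by push_cast; ring⟩
      rw [e]
      rfl
    · have h0 : hc α a q q' p = 0 := congrFun (hα a (q, q') h) p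
      rw [h0, tw_zero_left, tw_zero_left, smul_zero, smul_zero]

theorem PrincipalBundle.omega_contraction {ι : Type} {V : ι → VBundle.{v} EP P}
    (x : GroupLieAlgebra 𝓘(ℝ, EG) G) {η : RawForms V} (hη : η ∈ Omega V) :
    Q.contraction x η ∈ Omega V := fun p i => Q.smoothForm_contrF x (hη (p + 1) i)

/-- The Lie derivative of scalar forms, given by Cartan's formula. -/
def PrincipalBundle.cartanS (x : GroupLieAlgebra 𝓘(ℝ, EG) G) :
    ∀ {k : ℕ}, RawForm (VBundle.line EP P) k → RawForm (VBundle.line EP P) k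
  | 0, σ => Q.contrF x (extD σ)
  | _ + 1, σ => extD (Q.contrF x σ) + Q.contrF x (extD σ)

/-- The action of a curve in `G` in the chart at `p`. -/
def PrincipalBundle.actChart (x : GroupLieAlgebra 𝓘(ℝ, EG) G) (p : P) (z : ℝ × EP) : EP :=
  chartAt EP p (Q.act ((chartAt EP p).symm z.2) (curve x z.1))

theorem PrincipalBundle.contDiffAt_actChart (x : GroupLieAlgebra 𝓘(ℝ, EG) G) (p : P) {y : EP}
    (hy : y ∈ (chartAt EP p).target) : ContDiffAt ℝ ∞ (Q.actChart x p) (0, y) := by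
  refine contMDiffAt_iff_contDiffAt.1 ?_
  have h1 : ContMDiffAt 𝓘(ℝ, ℝ × EP) 𝓘(ℝ, EP) ∞ (fun z : ℝ × EP => (chartAt EP p).symm z.2) (0, y) :=
    (contMDiffAt_chart_symm hy).comp (0, y) contDiff_snd.contMDiff.contMDiffAt
  have h2 : ContMDiffAt 𝓘(ℝ, ℝ × EP) 𝓘(ℝ, EG) ∞ (fun z : ℝ × EP => curve x z.1) (0, y) :=
    ContMDiffAt.comp (0, y) (g := curve x) (f := Prod.fst)
      (show ContMDiffAt 𝓘(ℝ, ℝ) 𝓘(ℝ, EG) ∞ (curve x) ((0, y) : ℝ × EP).1 from contMDiffAt_curve x)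
      contDiff_fst.contMDiff.contMDiffAt
  have h3 : ContMDiffAt 𝓘(ℝ, EP) 𝓘(ℝ, EP) ∞ (chartAt EP p)
      (Q.act ((chartAt EP p).symm y) (curve x 0)) := by
    rw [curve_zero, Q.act_one]
    exact contMDiffAt_of_mem_maximalAtlas (IsManifold.chart_mem_maximalAtlas p)
      ((chartAt EP p).map_target hy)
  exact h3.comp (0, y) ((Q.smooth_act _).comp (0, y) (h1.prodMk h2))

theorem PrincipalBundle.actChart_zero (x : GroupLieAlgebra 𝓘(ℝ, EG) G) (p : P) {y : EP}
    (hy : y ∈ (chartAt EP p).target) : Q.actChart x p (0, y) = y := by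
  unfold PrincipalBundle.actChart
  rw [curve_zero, Q.act_one, (chartAt EP p).right_inv hy]

theorem PrincipalBundle.fderiv_actChart (x : GroupLieAlgebra 𝓘(ℝ, EG) G) (p : P) {y : EP}
    (hy : y ∈ (chartAt EP p).target) : fderiv ℝ (Q.actChart x p) (0, y) (1, 0) =
      (mfderiv 𝓘(ℝ, EP) 𝓘(ℝ, EP) (chartAt EP p) ((chartAt EP p).symm y)
        (Q.fundamental x ((chartAt EP p).symm y)) : EP) := by
  set q := (chartAt EP p).symm y with hq
  have h1 : HasFDerivAt (fun t : ℝ => Q.actChart x p (t, y))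
      ((fderiv ℝ (Q.actChart x p) (0, y)).comp (ContinuousLinearMap.inl ℝ ℝ EP)) 0 := by
    have hF : HasFDerivAt (Q.actChart x p) (fderiv ℝ (Q.actChart x p) (0, y)) (0, y) :=
      ((Q.contDiffAt_actChart x p hy).differentiableAt (by simp)).hasFDerivAt
    have ht : HasFDerivAt (fun t : ℝ => (t, y)) (ContinuousLinearMap.inl ℝ ℝ EP) 0 :=
      hasFDerivAt_prodMk_left 0 y
    exact hF.comp (0 : ℝ) ht
  have hc : MDifferentiableAt 𝓘(ℝ, ℝ) 𝓘(ℝ, EP) (fun t => Q.act q (curve x t)) 0 :=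
    ((Q.contMDiff_act_left q).contMDiffAt.comp (0 : ℝ) (contMDiffAt_curve x)).mdifferentiableAt
      (by simp)
  have h2 : HasMFDerivAt 𝓘(ℝ, EP) 𝓘(ℝ, EP) (chartAt EP p) (Q.act q (curve x 0))
      (mfderiv 𝓘(ℝ, EP) 𝓘(ℝ, EP) (chartAt EP p) (Q.act q (curve x 0))) := by
    refine (mdifferentiableAt_chart ?_).hasMFDerivAt
    rw [curve_zero, Q.act_one]
    exact (chartAt EP p).map_target hy
  have h3 : HasFDerivAt (fun t : ℝ => Q.actChart x p (t, y)) (show ℝ →L[ℝ] EP from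
      (mfderiv 𝓘(ℝ, EP) 𝓘(ℝ, EP) (chartAt EP p) (Q.act q (curve x 0))).comp
        (mfderiv 𝓘(ℝ, ℝ) 𝓘(ℝ, EP) (fun t => Q.act q (curve x t)) 0)) 0 :=
    hasMFDerivAt_iff_hasFDerivAt.1 (h2.comp (0 : ℝ) hc.hasMFDerivAt)
  have h4 := congrArg (fun L => L (1 : ℝ)) (h1.unique h3)
  refine Eq.trans (Eq.trans ?_ h4) ?_
  · simp
  · change (mfderiv 𝓘(ℝ, EP) 𝓘(ℝ, EP) (chartAt EP p) (Q.act q (curve x 0))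
      (mfderiv 𝓘(ℝ, ℝ) 𝓘(ℝ, EP) (fun t => Q.act q (curve x t)) 0 (1 : ℝ) : EP) : EP) = _
    rw [← Q.fundamental_eq x q, curve_zero, Q.act_one]

theorem PrincipalBundle.lr_contrF (x : GroupLieAlgebra 𝓘(ℝ, EG) G) (p : P) {k : ℕ}
    (σ : RawForm (VBundle.line EP P) (k + 1)) {y : EP} (hy : y ∈ (chartAt EP p).target) :
    lr p (Q.contrF x σ) y = contract (fderiv ℝ (Q.actChart x p) (0, y) (1, 0)) (lr p σ y) := by
  rw [Q.fderiv_actChart x p hy]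
  refine ContinuousAlternatingMap.ext fun v => ?_
  refine congrArg (sval σ ((chartAt EP p).symm y)) (funext fun i => ?_)
  refine Fin.cases ?_ (fun j => rfl) i
  have hq := (chartAt EP p).map_target hy
  have h := tangentTrs_tangentTr (EX := EP) hq (Q.fundamental x ((chartAt EP p).symm y))
  rw [tangentTr_eq hq, tangentTrs_eq hy] at h
  exact h.symm

theorem sval_eq_lr {k : ℕ} (σ : RawForm (VBundle.line EP P) k) (p : P) :
    sval σ p = (lr p σ (chartAt EP p p)).compContinuousLinearMap
      (mfderiv 𝓘(ℝ, EP) 𝓘(ℝ, EP) (chartAt EP p) p) := by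
  refine ContinuousAlternatingMap.ext fun v => ?_
  have hp := mem_chart_source EP p
  have hl := (chartAt EP p).left_inv hp
  have key : ∀ q : P, q = p → sval σ p v = sval σ q fun i =>
      (tangentTrs p q (tangentTr p p (v i)) : EP) := by
    rintro q rfl
    exact congrArg (sval σ q) (funext fun i => (tangentTrs_tangentTr hp (v i)).symm)
  refine (key _ hl).trans ?_
  rw [tangentTrs_eq (mem_chart_target EP p), tangentTr_eq hp]
  rfl

/-- Cartan's formula for scalar forms. -/
theorem PrincipalBundle.hasDerivAt_pullS (x : GroupLieAlgebra 𝓘(ℝ, EG) G) {k : ℕ}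
    {σ : RawForm (VBundle.line EP P) k} (hσ : SmoothForm σ) (p : P) :
    HasDerivAt (fun t => sval (pullS EP (fun q => Q.act q (curve x t)) σ) p)
      (sval (Q.cartanS x σ) p) 0 := by
  set y₀ := chartAt EP p p with hy₀
  have hy : y₀ ∈ (chartAt EP p).target := mem_chart_target EP p
  have hs : ContDiffAt ℝ ∞ (lr p σ) y₀ := contDiffAt_lr hy (hσ.at _)
  have hsd : DifferentiableAt ℝ (lr p σ) y₀ := hs.differentiableAt (by simp)
  have htgt : ∀ᶠ y in nhds y₀, y ∈ (chartAt EP p).target := (chartAt EP p).open_target.mem_nhds hy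
  obtain ⟨A, hA, hM⟩ := hasDerivAt_pullback_family (Q.contDiffAt_actChart x p hy)
    (htgt.mono fun y hy => Q.actChart_zero x p hy) hsd
  have h1 : HasDerivAt (fun t => (lr p σ (Q.actChart x p (t, y₀))).compContinuousLinearMap
      (fderiv ℝ (fun y => Q.actChart x p (t, y)) y₀)) (lr p (Q.cartanS x σ) y₀) 0 := by
    refine hM _ fun v => ?_
    set Y := fderiv ℝ (Q.actChart x p) (0, y₀) (1, 0) with hY
    have e1 : lr p (Q.contrF x (extD σ)) y₀ = fderiv ℝ (lr p σ) y₀ Y -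
        asym (p := k) (iotaL Y k ∘ₗ (fderiv ℝ (lr p σ) y₀ : EP →ₗ[ℝ] EP [⋀^Fin k]→L[ℝ] ℝ)) := by
      rw [Q.lr_contrF x p _ hy, lr_extD hσ hy, extDeriv_eq_asym, contract_asym]
      rfl
    obtain ⟨T, hT, hsum⟩ : ∃ T : EP →ₗ[ℝ] EP [⋀^Fin (k - 1)]→L[ℝ] ℝ,
        (∀ u, T u = iota (A u) (lr p σ y₀)) ∧
          ∑ i, lr p σ y₀ (Function.update v i (A (v i))) = asym (p := k) T v :=
      ⟨_, fun _ => rfl, sum_update_eq_asym (lr p σ y₀) (A : EP →ₗ[ℝ] EP) v⟩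
    refine Eq.trans ?_ (congrArg (_ + ·) hsum.symm)
    cases k with
    | zero =>
      change lr p (Q.contrF x (extD σ)) y₀ v = _
      rw [e1]
      simp [asym]
    | succ k =>
      change (lr p (extD (Q.contrF x σ)) y₀ + lr p (Q.contrF x (extD σ)) y₀) v = _
      have e2 : lr p (extD (Q.contrF x σ)) y₀ = extDeriv (fun y =>
          contract (fderiv ℝ (Q.actChart x p) (0, y) (1, 0)) (lr p σ y)) y₀ := by
        rw [lr_extD (Q.smoothForm_contrF x hσ) hy]
        exact Filter.EventuallyEq.extDeriv_eq (htgt.mono fun y hy => Q.lr_contrF x p σ hy)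
      let C : EP →ₗ[ℝ] (EP [⋀^Fin (k + 1)]→L[ℝ] ℝ) →ₗ[ℝ] (EP [⋀^Fin k]→L[ℝ] ℝ) :=
        LinearMap.mk₂ ℝ (fun u a => contract u a)
          (fun u u' a => ContinuousAlternatingMap.ext fun v =>
            congrArg (fun f => f v) (a.toAlternatingMap.curryLeft.map_add u u'))
          (fun c u a => ContinuousAlternatingMap.ext fun v =>
            congrArg (fun f => f v) (a.toAlternatingMap.curryLeft.map_smul c u))
          (fun u a a' => contract_add u a a') (fun c u a => contract_smul u c a)
      let C' : EP →L[ℝ] (EP [⋀^Fin (k + 1)]→L[ℝ] ℝ) →L[ℝ] (EP [⋀^Fin k]→L[ℝ] ℝ) :=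
        LinearMap.toContinuousBilinearMap C
      have hC : HasFDerivAt (fun y => C' (fderiv ℝ (Q.actChart x p) (0, y) (1, 0)) (lr p σ y)) _ y₀ :=
        C'.hasFDerivAt_of_bilinear hA hsd.hasFDerivAt
      have e3 : extDeriv (fun y =>
          contract (fderiv ℝ (Q.actChart x p) (0, y) (1, 0)) (lr p σ y)) y₀ = _ :=
        (extDeriv_eq_asym _ _).trans (congrArg (fun L : EP →L[ℝ] (EP [⋀^Fin k]→L[ℝ] ℝ) =>
          asym (p := k + 1) (L : EP →ₗ[ℝ] EP [⋀^Fin k]→L[ℝ] ℝ)) hC.fderiv)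
      have e4 : ∀ L : EP →L[ℝ] EP [⋀^Fin k]→L[ℝ] ℝ,
          (∀ u, L u = iotaL Y (k + 1) (fderiv ℝ (lr p σ) y₀ u) + T u) →
          asym (p := k + 1) (L : EP →ₗ[ℝ] EP [⋀^Fin k]→L[ℝ] ℝ) = asym (p := k + 1)
            (iotaL Y (k + 1) ∘ₗ (fderiv ℝ (lr p σ) y₀ : EP →ₗ[ℝ] EP [⋀^Fin (k + 1)]→L[ℝ] ℝ)) +
              asym (p := k + 1) T := fun L hL =>
        (congrArg (asym (p := k + 1)) (LinearMap.ext hL)).trans (map_add _ _ _)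
      have e5 := e2.trans (e3.trans (e4 (C'.precompR EP (fderiv ℝ (Q.actChart x p) (0, y₀) (1, 0))
        (fderiv ℝ (lr p σ) y₀) + C'.precompL EP A (lr p σ y₀)) fun u =>
          congrArg₂ (· + ·) rfl (hT u).symm))
      have e6 := congrArg₂ (· + ·) e5 e1
      refine (congrArg (fun a : EP [⋀^Fin (k + 1)]→L[ℝ] ℝ => a v) e6).trans ?_
      have e7 : ∀ a b c : EP [⋀^Fin (k + 1)]→L[ℝ] ℝ, (a + b + (c - a)) v = c v + b v :=
        fun a b c => by
          rw [show a + b + (c - a) = c + b by abel]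
          rfl
      exact e7 _ _ _
  have h2 : HasDerivAt (fun t => lr p (pullS EP (fun q => Q.act q (curve x t)) σ) y₀)
      (lr p (Q.cartanS x σ) y₀) 0 := by
    refine h1.congr_of_eventuallyEq ?_
    have hl : (chartAt EP p).symm y₀ = p := (chartAt EP p).left_inv (mem_chart_source EP p)
    have hcont : ContinuousAt (fun t => Q.act p (curve x t)) 0 :=
      ((Q.contMDiff_act_left p).contMDiffAt.comp (0 : ℝ) (contMDiffAt_curve x)).continuousAt
    have hmem : ∀ᶠ t in nhds (0 : ℝ), Q.act p (curve x t) ∈ (chartAt EP p).source :=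
      hcont.preimage_mem_nhds (by
        simp only [curve_zero, Q.act_one]; exact chart_source_mem_nhds EP p)
    filter_upwards [hmem] with t ht
    exact lr_pullS σ hy (Q.mdifferentiable_act_right _ _) (by rw [hl]; exact ht)
  have h3 := (ContinuousAlternatingMap.compContinuousLinearMapCLM
    (show EP →L[ℝ] EP from mfderiv 𝓘(ℝ, EP) 𝓘(ℝ, EP) (chartAt EP p) p) :
      (EP [⋀^Fin k]→L[ℝ] ℝ) →L[ℝ] (EP [⋀^Fin k]→L[ℝ] ℝ)).hasFDerivAt.comp_hasDerivAt
    (0 : ℝ) h2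
  refine (h3.congr_of_eventuallyEq (Filter.Eventually.of_forall fun t => sval_eq_lr _ p)).congr_deriv ?_
  exact (sval_eq_lr _ p).symm

end Cartan

/-! ## Basic forms -/

section Basic

theorem PrincipalBundle.pullS_act_one {k : ℕ} (σ : RawForm (VBundle.line EP P) k) :
    pullS EP (fun p => Q.act p 1) σ = σ := by
  have : (fun p => Q.act p 1) = id := funext Q.act_one
  rw [this, pullS_id]

section

variable {ι : Type} {V : ι → VBundle.{v} EP P} {ρ : ∀ i, Q.FibreAction (V i)}

theorem tr_scalarWedge {k : ℕ} (τ : RawForm (VBundle.line EP P) k) (ζ : RawForms V) (n : ℕ) (i : ι)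
    (p : P) : ((V i).tr p p).compContinuousAlternatingMap (scalarWedge τ ζ n i p) =
      (show EP [⋀^Fin n]→L[ℝ] (V i).F from tw (LinearMap.lsmul ℝ (V i).F) k (n - k) n (sval τ p)
        (((V i).tr p p).compContinuousAlternatingMap (ζ (n - k) i p))) := by
  rw [scalarWedge_eq]
  exact tw_natural (ContinuousLinearMap.id ℝ (TangentSpace 𝓘(ℝ, EP) p)) (ContinuousLinearMap.id ℝ ℝ)
    ((V i).tr p p) ((V i).tr p p) (scalarB (V i) p) (LinearMap.lsmul ℝ (V i).F)
    (fun c a => map_smul ((V i).tr p p) _ _) _ _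

/-- The Lie derivative is a derivation. -/
theorem PrincipalBundle.lieDerivative_scalarWedge (hρ : ∀ i, Q.IsAction (ρ i))
    (x : GroupLieAlgebra 𝓘(ℝ, EG) G) {k : ℕ} {σ : RawForm (VBundle.line EP P) k}
    (hσ : SmoothForm σ) {η : RawForms V} (hη : η ∈ Omega V) :
    Q.lieDerivative ρ x (scalarWedge σ η) =
      scalarWedge (Q.cartanS x σ) η + scalarWedge σ (Q.lieDerivative ρ x η) := by
  funext n i p
  rw [Q.lieDerivative_eq]
  refine (hρ i).lieF_eq Q (omega_scalarWedge hσ hη n i) ?_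
  have h1 : ∀ g, Q.orbit (ρ i) (scalarWedge σ η n i) p g =
      tw (LinearMap.lsmul ℝ (V i).F) k (n - k) n (sval (pullS EP (fun q => Q.act q g) σ) p)
        (Q.orbit (ρ i) (η (n - k) i) p g) := fun g =>
    (congrArg (fun ζ : RawForms V => (show EP [⋀^Fin n]→L[ℝ] (V i).F from
      ((V i).tr p p).compContinuousAlternatingMap (ζ n i p)))
        (Q.actForms_scalarWedge ρ g σ η)).trans (tr_scalarWedge _ _ n i p)
  have h2 := (twCL (V := EP) (LinearMap.lsmul ℝ (V i).F) k (n - k) n).hasDerivAt_of_bilinear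
    (fun _ => Q.hasDerivAt_pullS x hσ p) (fun _ => (hρ i).hasDerivAt_orbit Q x (hη (n - k) i) p)
  refine (h2.congr_of_eventuallyEq (Filter.Eventually.of_forall fun t => h1 _)).congr_deriv ?_
  have h3 : Q.orbit (ρ i) (η (n - k) i) p (curve x 0) =
      (show EP [⋀^Fin (n - k)]→L[ℝ] (V i).F from
        ((V i).tr p p).compContinuousAlternatingMap (η (n - k) i p)) := by
    unfold PrincipalBundle.orbit
    rw [curve_zero, (hρ i).actF_one Q]
  rw [h3, curve_zero, Q.pullS_act_one, add_comm]
  have h4 := tr_scalarWedge (Q.cartanS x σ) η n i p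
  have h5 := tr_scalarWedge σ (Q.lieDerivative ρ x η) n i p
  rw [Q.lieDerivative_eq ρ x η (n - k) i] at h5
  refine ContinuousAlternatingMap.ext fun v => Eq.trans ?_ (map_add ((V i).tr p p) _ _).symm
  exact (congrArg₂ (· + ·) (congrArg (fun a => a v) h4) (congrArg (fun a => a v) h5)).symm

theorem PrincipalBundle.contraction_add (x : GroupLieAlgebra 𝓘(ℝ, EG) G) (η ζ : RawForms V) :
    Q.contraction x (η + ζ) = Q.contraction x η + Q.contraction x ζ := rfl

theorem PrincipalBundle.contraction_smul (x : GroupLieAlgebra 𝓘(ℝ, EG) G) (c : ℝ) (η : RawForms V) :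
    Q.contraction x (c • η) = c • Q.contraction x η := rfl

theorem PrincipalBundle.actForms_add (g : G) (η ζ : RawForms V) :
    Q.actForms ρ g (η + ζ) = Q.actForms ρ g η + Q.actForms ρ g ζ :=
  funext fun _ => funext fun _ => Q.actF_add _ g _ _

theorem PrincipalBundle.actForms_smul (g : G) (c : ℝ) (η : RawForms V) :
    Q.actForms ρ g (c • η) = c • Q.actForms ρ g η :=
  funext fun _ => funext fun _ => Q.actF_smul _ g _ _

/-- The contraction of smooth forms. -/
def PrincipalBundle.contrΩ (x : GroupLieAlgebra 𝓘(ℝ, EG) G) : Omega V →ₗ[ℝ] Omega V where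
  toFun η := ⟨Q.contraction x η, Q.omega_contraction x η.2⟩
  map_add' _ _ := rfl
  map_smul' _ _ := rfl

/-- The action on smooth forms. -/
def PrincipalBundle.actΩ (hρ : ∀ i, Q.IsAction (ρ i)) (g : G) : Omega V →ₗ[ℝ] Omega V where
  toFun η := ⟨Q.actForms ρ g η, fun r i => (hρ i).smoothForm_actF Q g (η.2 r i)⟩
  map_add' _ _ := Subtype.ext (Q.actForms_add g _ _)
  map_smul' c _ := Subtype.ext (Q.actForms_smul g c _)

theorem PrincipalBundle.actForms_inv (hρ : ∀ i, Q.IsAction (ρ i)) (g : G) (η : RawForms V) :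
    Q.actForms ρ g (Q.actForms ρ g⁻¹ η) = η :=
  funext fun r => funext fun i => by
    rw [Q.actForms_eq, Q.actForms_eq, ← (hρ i).actF_mul Q, mul_inv_cancel, (hρ i).actF_one Q]

theorem PrincipalBundle.isBasicForm_iff [PreconnectedSpace G] (hρ : ∀ i, Q.IsAction (ρ i))
    {α : RawForms V} (hα : α ∈ Omega V) : Q.IsBasicForm ρ α ↔
      (∀ x, Q.contraction x α = 0) ∧ ∀ g, Q.actForms ρ g α = α := by
  constructor
  · refine fun h => ⟨fun x => (h x).1, fun g => funext fun r => funext fun i => ?_⟩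
    refine (hρ i).invariant_of_lieF_eq_zero Q (hα r i) (fun x => ?_) g
    rw [← Q.lieDerivative_eq, (h x).2]
    rfl
  · refine fun h x => ⟨h.1 x, funext fun r => funext fun i => ?_⟩
    rw [Q.lieDerivative_eq]
    exact Q.lieF_eq_zero_of_invariant fun g => by rw [← Q.actForms_eq, h.2]

end

section Hom

variable {E E' E'' : GradedBundle.{v} EP P} {ρ : ∀ k, Q.FibreAction (E.part k)}
  {ρ' : ∀ k, Q.FibreAction (E'.part k)} {ρ'' : ∀ k, Q.FibreAction (E''.part k)}

theorem PrincipalBundle.lieDerivative_homWedge (hρ : ∀ k, Q.IsAction (ρ k))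
    (hρ' : ∀ k, Q.IsAction (ρ' k)) (x : GroupLieAlgebra 𝓘(ℝ, EG) G) {α : RawForms (E.hom E')}
    (hα : α ∈ Omega (E.hom E')) (hinv : ∀ g, Q.actForms (Q.homAction ρ ρ') g α = α)
    {η : RawForms E.part} (hη : η ∈ Omega E.part) :
    Q.lieDerivative ρ' x (homWedge α η) = homWedge α (Q.lieDerivative ρ x η) := by
  funext n q' p
  rw [Q.lieDerivative_eq]
  refine (hρ' q').lieF_eq Q (omega_homWedge hα hη n q') ?_
  let T : (TangentSpace 𝓘(ℝ, EP) p [⋀^Fin n]→L[ℝ] (E'.part q').fib p) →ₗ[ℝ]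
      EP [⋀^Fin n]→L[ℝ] (E'.part q').F :=
    altMap (ContinuousLinearMap.id ℝ (TangentSpace 𝓘(ℝ, EP) p)) ((E'.part q').tr p p) n
  let Λ : ∀ (q : ℤ) (a r : ℕ), (TangentSpace 𝓘(ℝ, EP) p [⋀^Fin r]→L[ℝ] (E.part q).fib p) →ₗ[ℝ]
      EP [⋀^Fin n]→L[ℝ] (E'.part q').F := fun q a r =>
    T ∘ₗ (((-1 : ℝ) ^ ((q' - q) * (r : ℤ))) •
      twL (evalB (E.part q) (E'.part q') p) a r n (hc α a q q' p))
  have hT : ∀ ζ : RawForms E.part, T (homWedge α ζ n q' p) = ∑ q ∈ E.support,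
      ∑ a ∈ Finset.range (n + 1), ∑ r ∈ Finset.range (n + 1), Λ q a r (ζ r q p) := fun ζ => by
    rw [homWedge_sum α ζ (Nat.lt_succ_self n), map_sum]
    refine Finset.sum_congr rfl fun q _ => ?_
    rw [map_sum]
    refine Finset.sum_congr rfl fun a _ => ?_
    rw [map_sum]
    rfl
  have h1 : ∀ g, Q.orbit (ρ' q') (homWedge α η n q') p g = ∑ q ∈ E.support,
      ∑ a ∈ Finset.range (n + 1), ∑ r ∈ Finset.range (n + 1),
        Λ q a r (Q.actF (ρ q) g (η r q) p) := fun g => by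
    have := Q.actForms_homWedge ρ ρ' g α η
    rw [hinv] at this
    exact (congrArg (fun ζ : RawForms E'.part => T (ζ n q' p)) this).trans (hT _)
  have h2 : HasDerivAt (fun t => ∑ q ∈ E.support, ∑ a ∈ Finset.range (n + 1),
      ∑ r ∈ Finset.range (n + 1), Λ q a r (Q.actF (ρ q) (curve x t) (η r q) p))
      (∑ q ∈ E.support, ∑ a ∈ Finset.range (n + 1), ∑ r ∈ Finset.range (n + 1),
        Λ q a r (Q.lieF (ρ q) x (η r q) p)) 0 :=
    HasDerivAt.fun_sum fun q _ => HasDerivAt.fun_sum fun a _ => HasDerivAt.fun_sum fun r _ =>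
      (hρ q).hasDerivAt_linear Q x (hη r q) (Λ q a r)
  refine (h2.congr_of_eventuallyEq (Filter.Eventually.of_forall fun t => h1 _)).congr_deriv ?_
  refine Eq.trans ?_ (hT (Q.lieDerivative ρ x η)).symm
  refine Finset.sum_congr rfl fun q _ => Finset.sum_congr rfl fun a _ =>
    Finset.sum_congr rfl fun r _ => ?_
  rw [Q.lieDerivative_eq ρ x η r q]

theorem PrincipalBundle.isAction_homAction (hρ : ∀ k, Q.IsAction (ρ k))
    (hρ' : ∀ k, Q.IsAction (ρ' k)) (i : ℤ × ℤ) : Q.IsAction (Q.homAction ρ ρ' i) :=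
  (hρ i.1).homAct (hρ' i.2)

theorem homWedge_zero_left (η : RawForms E.part) : homWedge (0 : RawForms (E.hom E')) η = 0 := by
  have := homWedge_smul_left 0 (0 : RawForms (E.hom E')) η
  rwa [zero_smul, zero_smul] at this

theorem homWedge_add (α : RawForms (E.hom E')) (η ζ : RawForms E.part) :
    homWedge α (η + ζ) = homWedge α η + homWedge α ζ := (rawH α).map_add η ζ

theorem homWedge_smul (α : RawForms (E.hom E')) (c : ℝ) (η : RawForms E.part) :
    homWedge α (c • η) = c • homWedge α η := (rawH α).map_smul c η

/-- The contraction of a basic form with any form. -/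
theorem PrincipalBundle.contraction_homWedge_of_basic {α : RawForms (E.hom E')} {m : ℤ}
    (hm : IsHomogeneous homDeg m α) (x : GroupLieAlgebra 𝓘(ℝ, EG) G)
    (h : Q.contraction x α = 0) (η : RawForms E.part) :
    Q.contraction x (homWedge α η) = (-1 : ℝ) ^ m • homWedge α (Q.contraction x η) := by
  rw [Q.contraction_homWedge x hm, h, homWedge_zero_left, zero_add]

variable [T2Space P]

theorem PrincipalBundle.contraction_homComp {ψ : RawForms (E'.hom E'')} {α : RawForms (E.hom E')}
    {m n : ℤ} (hm : IsHomogeneous homDeg m ψ) (hn : IsHomogeneous homDeg n α)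
    (x : GroupLieAlgebra 𝓘(ℝ, EG) G) (h : Q.contraction x ψ = 0) (h' : Q.contraction x α = 0) :
    Q.contraction x (homComp ψ α) = 0 := homForms_ext fun η _ => by
  have h1 := Q.contraction_homWedge x (isHomogeneous_homComp hm hn) η
  rw [homWedge_homComp, Q.contraction_homWedge_of_basic hm x h,
    Q.contraction_homWedge_of_basic hn x h', homWedge_smul, smul_smul, ← zpow_add₀ (by norm_num),
    ← homWedge_homComp] at h1
  rw [homWedge_zero_left]
  exact right_eq_add.1 h1

theorem PrincipalBundle.contraction_homOne (x : GroupLieAlgebra 𝓘(ℝ, EG) G) :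
    Q.contraction x (homOne E) = 0 := rfl

theorem PrincipalBundle.IsBasicSuperconnection.actΩ [IsManifold 𝓘(ℝ, EX) ∞ X]
    {D : Omega E.part →ₗ[ℝ] Omega E.part} (hD : Q.IsBasicSuperconnection ρ D)
    (hρ : ∀ k, Q.IsAction (ρ k)) (g : G) (η : Omega E.part) :
    D (Q.actΩ hρ g η) = Q.actΩ hρ g (D η) := Subtype.ext (hD.equivariant g η).choose_spec

theorem PrincipalBundle.IsBasicSuperconnection.contrΩ [IsManifold 𝓘(ℝ, EX) ∞ X]
    {D : Omega E.part →ₗ[ℝ] Omega E.part} (hD : Q.IsBasicSuperconnection ρ D)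
    (x : GroupLieAlgebra 𝓘(ℝ, EG) G) (η : Omega E.part) :
    (D (Q.contrΩ x η) : RawForms E.part) =
      Q.lieDerivative ρ x (η : RawForms E.part) - Q.contraction x (D η : RawForms E.part) :=
  (hD.cartan x η).choose_spec

theorem PrincipalBundle.actForms_differential [IsManifold 𝓘(ℝ, EX) ∞ X]
    {D : Omega E.part →ₗ[ℝ] Omega E.part} {D' : Omega E'.part →ₗ[ℝ] Omega E'.part}
    (hρ : ∀ k, Q.IsAction (ρ k)) (hρ' : ∀ k, Q.IsAction (ρ' k))
    (hD : Q.IsBasicSuperconnection ρ D) (hD' : Q.IsBasicSuperconnection ρ' D') {k : ℤ}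
    {α β : RawForms (E.hom E')} (hα : α ∈ Omega (E.hom E')) (hβ : β ∈ Omega (E.hom E'))
    (hd : IsDifferential D D' k α β) {g : G} (h : Q.actForms (Q.homAction ρ ρ') g α = α) :
    Q.actForms (Q.homAction ρ ρ') g β = β := homForms_ext fun η hη => by
  rw [isDifferential_iff hα hβ] at hd
  have hact : ∀ {γ : RawForms (E.hom E')} (hγ : γ ∈ Omega (E.hom E')),
      Q.actForms (Q.homAction ρ ρ') g γ = γ → ∀ ζ : Omega E.part,
      Q.actΩ hρ' g (mulH γ hγ ζ) = mulH γ hγ (Q.actΩ hρ g ζ) := fun hγ h ζ =>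
    Subtype.ext ((Q.actForms_homWedge ρ ρ' g _ _).trans (by rw [h]; rfl))
  set ζ : Omega E.part := Q.actΩ hρ g⁻¹ ⟨η, hη⟩ with hζ
  have hgζ : Q.actΩ hρ g ζ = ⟨η, hη⟩ := Subtype.ext (Q.actForms_inv hρ g η)
  have h1 := congrArg (Q.actΩ hρ' g) (hd ζ)
  rw [← hD'.actΩ Q hρ', hact hα h, map_add, map_smul, hact hα h, ← hD.actΩ Q hρ, hgζ,
    hd ⟨η, hη⟩] at h1
  have h2 := congrArg Subtype.val (add_right_cancel h1)
  have h3 := Q.actForms_homWedge ρ ρ' g β ζ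
  refine Eq.trans ?_ (h3.symm.trans h2.symm)
  exact congrArg (homWedge _) (congrArg Subtype.val hgζ).symm

theorem PrincipalBundle.contraction_differential [IsManifold 𝓘(ℝ, EX) ∞ X]
    {D : Omega E.part →ₗ[ℝ] Omega E.part} {D' : Omega E'.part →ₗ[ℝ] Omega E'.part}
    (hρ : ∀ k, Q.IsAction (ρ k)) (hρ' : ∀ k, Q.IsAction (ρ' k))
    (hD : Q.IsBasicSuperconnection ρ D) (hD' : Q.IsBasicSuperconnection ρ' D') {k : ℤ}
    {α β : RawForms (E.hom E')} (hα : α ∈ homForms E E' k) (hβ : β ∈ homForms E E' (k + 1))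
    (hd : IsDifferential D D' k α β) {x : GroupLieAlgebra 𝓘(ℝ, EG) G}
    (h : Q.contraction x α = 0) (hinv : ∀ g, Q.actForms (Q.homAction ρ ρ') g α = α) :
    Q.contraction x β = 0 := homForms_ext fun η hη => by
  rw [isDifferential_iff hα.1 hβ.1] at hd
  set e : Omega E.part := ⟨η, hη⟩ with he
  have hi : ∀ ζ : Omega E.part, Q.contrΩ x (mulH α hα.1 ζ) =
      (-1 : ℝ) ^ k • mulH α hα.1 (Q.contrΩ x ζ) := fun ζ =>
    Subtype.ext (Q.contraction_homWedge_of_basic hα.2 x h ζ)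
  have h1 : (D' (Q.contrΩ x (mulH α hα.1 e)) : RawForms E'.part) =
      homWedge α (Q.lieDerivative ρ x η) -
        Q.contraction x (D' (mulH α hα.1 e) : RawForms E'.part) := by
    rw [hD'.contrΩ Q]
    exact congrArg (· - _) (Q.lieDerivative_homWedge hρ hρ' x hα.1 hinv hη)
  have h2 : homWedge α (Q.lieDerivative ρ x η) =
      homWedge α (D (Q.contrΩ x e) : RawForms E.part) +
        homWedge α (Q.contraction x (D e : RawForms E.part)) := by
    rw [hD.contrΩ Q, ← homWedge_add, sub_add_cancel]
  have h3 : Q.contraction x (D' (mulH α hα.1 e) : RawForms E'.part) =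
      Q.contraction x (homWedge β η) +
        homWedge α (Q.contraction x (D e : RawForms E.part)) := by
    rw [hd e]
    have h4 := congrArg Subtype.val (hi (D e))
    change Q.contraction x (homWedge β η) +
      (-1 : ℝ) ^ k • Q.contraction x (homWedge α (D e : RawForms E.part)) = _
    refine congrArg (Q.contraction x (homWedge β η) + ·) ?_
    refine (congrArg (fun ζ : RawForms E'.part => (-1 : ℝ) ^ k • ζ) h4).trans ?_
    refine (smul_smul _ _ _).trans ?_
    rw [neg_one_zpow_mul_self, one_smul]
    rfl
  have h5 : (D' (Q.contrΩ x (mulH α hα.1 e)) : RawForms E'.part) =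
      (-1 : ℝ) ^ k • homWedge β (Q.contraction x η) +
        homWedge α (D (Q.contrΩ x e) : RawForms E.part) := by
    rw [hi, map_smul, hd]
    refine (smul_add _ _ _).trans (congrArg (((-1 : ℝ) ^ k • homWedge β (Q.contraction x η)) + ·) ?_)
    refine (smul_smul _ _ _).trans ?_
    rw [neg_one_zpow_mul_self, one_smul]
    rfl
  have h6 := Q.contraction_homWedge x hβ.2 η
  rw [h1, h2, h3, h6, zpow_add₀ (by norm_num), zpow_one, mul_neg_one, neg_smul] at h5
  rw [homWedge_zero_left]
  have key : ∀ a b c d e : RawForms E'.part, a + b - (c + -d + b) = d + a → c = 0 := by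
    intro a b c d _ h
    have h7 : a + b - (c + -d + b) = d + a - c := by abel
    rw [h7] at h
    exact sub_eq_self.1 h
  exact key _ _ _ _ 0 h5

variable [IsManifold 𝓘(ℝ, EX) ∞ X] [PreconnectedSpace G]

theorem PrincipalBundle.mem_basicForms_iff {A B : BasicLocalSystem.{v} Q} {n : ℤ}
    {α : RawForms (A.E.hom B.E)} : α ∈ basicForms Q A B n ↔ α ∈ homForms A.E B.E n ∧
      (∀ x, Q.contraction x α = 0) ∧ ∀ g, Q.actForms (Q.homAction A.act B.act) g α = α :=
  and_congr_right fun h => Q.isBasicForm_iff (Q.isAction_homAction A.isAction B.isAction) h.1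

theorem PrincipalBundle.basHasDifferentials : BasHasDifferentials.{v} Q := fun A B k α hα => by
  obtain ⟨h, hi, hg⟩ := Q.mem_basicForms_iff.1 hα
  obtain ⟨β, hβ, hd⟩ := exists_differential A.superconnection B.superconnection h
  refine ⟨β, ⟨Q.mem_basicForms_iff.2 ⟨hβ, fun x => ?_, fun g => ?_⟩, hd⟩, fun β' h' => ?_⟩
  · exact Q.contraction_differential A.isAction B.isAction A.basic B.basic h hβ hd (hi x) hg
  · exact Q.actForms_differential A.isAction B.isAction A.basic B.basic h.1 hβ.1 hd (hg g)
  · exact h'.2.unique hd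

theorem PrincipalBundle.isDGCategory_locBas (h : BasHasDifferentials.{v} Q) :
    (LocBas Q h).IsDGCategory := by
  refine isDGCategory_dgOf h (fun _ _ _ _ hα => hα.1) (fun A B n => ?_) (fun A B n α hα β hβ => ?_)
    (fun A B n c α hα => ?_) (fun A₁ A₂ A₃ m n ψ hψ α hα => ?_) fun A => ?_
  · refine Q.mem_basicForms_iff.2 ⟨homForms_zero_mem _ _ _, fun x => rfl, fun g => ?_⟩
    have := Q.actForms_smul (ρ := Q.homAction A.act B.act) g 0 0
    rwa [zero_smul, zero_smul] at this
  · rw [Q.mem_basicForms_iff] at hα hβ ⊢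
    refine ⟨homForms_add_mem hα.1 hβ.1, fun x => ?_, fun g => ?_⟩
    · rw [Q.contraction_add, hα.2.1, hβ.2.1, add_zero]
    · rw [Q.actForms_add, hα.2.2, hβ.2.2]
  · rw [Q.mem_basicForms_iff] at hα ⊢
    refine ⟨homForms_smul_mem c hα.1, fun x => ?_, fun g => ?_⟩
    · rw [Q.contraction_smul, hα.2.1, smul_zero]
    · rw [Q.actForms_smul, hα.2.2]
  · rw [Q.mem_basicForms_iff] at hψ hα ⊢
    refine ⟨homForms_comp_mem hψ.1 hα.1, fun x => ?_, fun g => ?_⟩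
    · exact Q.contraction_homComp hψ.1.2 hα.1.2 x (hψ.2.1 x) (hα.2.1 x)
    · rw [Q.actForms_homComp A₁.act A₂.act A₃.act, hψ.2.2, hα.2.2]
  · exact Q.mem_basicForms_iff.2 ⟨homOne_mem A.E, fun x => Q.contraction_homOne x, fun g =>
      Q.actForms_homOne A.act g⟩

end Hom

end Basic

end Equivariant

/-! ## Local sections and descent of basic forms -/

section Sections

variable {EG : Type*} [NormedAddCommGroup EG] [NormedSpace ℝ EG] [FiniteDimensional ℝ EG]
  {G : Type*} [TopologicalSpace G] [ChartedSpace EG G] [Group G]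
  {EP : Type*} [NormedAddCommGroup EP] [NormedSpace ℝ EP] [FiniteDimensional ℝ EP]
  {P : Type*} [TopologicalSpace P] [ChartedSpace EP P]
  {EX : Type*} [NormedAddCommGroup EX] [NormedSpace ℝ EX] [FiniteDimensional ℝ EX]
  {X : Type*} [TopologicalSpace X] [ChartedSpace EX X]
  (Q : PrincipalBundle EG G EP P EX X)

/-- A smooth local section `s` of a principal bundle, with the function `fac` defined by
`p = s(π p) · fac p`. -/
structure PrincipalBundle.LocalSection where
  dom : Set X
  s : X → P
  fac : P → G
  isOpen_dom : IsOpen dom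
  smooth_s : ∀ y ∈ dom, ContMDiffAt 𝓘(ℝ, EX) 𝓘(ℝ, EP) ∞ s y
  proj_s : ∀ y ∈ dom, Q.proj (s y) = y
  smooth_fac : ∀ p, Q.proj p ∈ dom → ContMDiffAt 𝓘(ℝ, EP) 𝓘(ℝ, EG) ∞ fac p
  act_fac : ∀ p, Q.proj p ∈ dom → Q.act (s (Q.proj p)) (fac p) = p
  fac_act : ∀ p g, Q.proj p ∈ dom → fac (Q.act p g) = fac p * g

theorem PrincipalBundle.exists_localSection (x₀ : X) : ∃ τ : Q.LocalSection, x₀ ∈ τ.dom := by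
  obtain ⟨U, e, hU, hx, hs, ht, he, he', hp⟩ := Q.locally_trivial x₀
  have hmem : ∀ p, Q.proj p ∈ U → p ∈ e.source := fun p h => by rw [hs]; exact h
  have hmem' : ∀ y ∈ U, ∀ g : G, (y, g) ∈ e.target := fun y h g => by
    rw [ht]; exact ⟨h, Set.mem_univ _⟩
  have hproj : ∀ y ∈ U, ∀ g : G, Q.proj (e.symm (y, g)) = y := fun y h g => by
    rw [← (hp _ (e.map_target (hmem' y h g))).1, e.right_inv (hmem' y h g)]
  have hact : ∀ y ∈ U, ∀ g k : G, Q.act (e.symm (y, g)) k = e.symm (y, g * k) := fun y h g k => by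
    have h1 := e.map_target (hmem' y h g)
    have h2 : Q.act (e.symm (y, g)) k ∈ e.source := hmem _ (by rwa [Q.proj_act, hproj y h])
    rw [← e.left_inv h2]
    refine congrArg _ (Prod.ext ?_ ?_)
    · rw [(hp _ h2).1, Q.proj_act, hproj y h]
    · rw [(hp _ h1).2, e.right_inv (hmem' y h g)]
  refine ⟨{
    dom := U
    s := fun y => e.symm (y, 1)
    fac := fun p => (e p).2
    isOpen_dom := hU
    smooth_s := fun y h => ?_
    proj_s := fun y h => hproj y h 1
    smooth_fac := fun p h => ?_
    act_fac := fun p h => ?_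
    fac_act := fun p g h => (hp p (hmem p h)).2 g }, hx⟩
  · have h1 : ContMDiffAt (𝓘(ℝ, EX).prod 𝓘(ℝ, EG)) 𝓘(ℝ, EP) ∞ e.symm (y, 1) :=
      (he' _ (hmem' y h 1)).contMDiffAt (e.open_target.mem_nhds (hmem' y h 1))
    exact h1.comp y (contMDiffAt_id.prodMk contMDiffAt_const)
  · exact contMDiffAt_snd.comp p ((he p (hmem p h)).contMDiffAt (e.open_source.mem_nhds (hmem p h)))
  · have := hact (Q.proj p) h 1 (e p).2
    refine this.trans ?_
    rw [one_mul, ← (hp p (hmem p h)).1]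
    exact e.left_inv (hmem p h)

/-- A local section around a point. -/
def PrincipalBundle.sec (x₀ : X) : Q.LocalSection := (Q.exists_localSection x₀).choose

theorem PrincipalBundle.mem_sec (x₀ : X) : x₀ ∈ (Q.sec x₀).dom := (Q.exists_localSection x₀).choose_spec

theorem PrincipalBundle.mdifferentiable_proj : MDifferentiable 𝓘(ℝ, EP) 𝓘(ℝ, EX) Q.proj :=
  Q.proj.contMDiff.mdifferentiable (by simp)

variable {Q}

theorem PrincipalBundle.LocalSection.mfderiv_proj_s (τ : Q.LocalSection) {y : X} (hy : y ∈ τ.dom)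
    (u : EX) : (mfderiv 𝓘(ℝ, EP) 𝓘(ℝ, EX) Q.proj (τ.s y)
      (mfderiv 𝓘(ℝ, EX) 𝓘(ℝ, EP) τ.s y u : EP) : EX) = u := by
  have h1 := ((Q.mdifferentiable_proj (τ.s y)).hasMFDerivAt.comp y
    ((τ.smooth_s y hy).mdifferentiableAt (by simp)).hasMFDerivAt).mfderiv
  have h2 : mfderiv 𝓘(ℝ, EX) 𝓘(ℝ, EX) (Q.proj ∘ τ.s) y = mfderiv 𝓘(ℝ, EX) 𝓘(ℝ, EX) id y := by
    refine Filter.EventuallyEq.mfderiv_eq ?_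
    filter_upwards [τ.isOpen_dom.mem_nhds hy] with z hz using τ.proj_s z hz
  have h3 : (mfderiv 𝓘(ℝ, EX) 𝓘(ℝ, EX) id y u : EX) = u := by rw [mfderiv_id]; rfl
  refine Eq.trans ?_ h3
  exact (congrArg (fun L : EX →L[ℝ] EX => L u) (h1.symm.trans h2) : _)

variable [LieGroup 𝓘(ℝ, EG) ∞ G] [IsManifold 𝓘(ℝ, EP) ∞ P]

/-- The vertical part of a tangent vector. -/
theorem PrincipalBundle.LocalSection.exists_fundamental (τ : Q.LocalSection) {p : P}
    (hp : Q.proj p ∈ τ.dom) (v : EP) : ∃ ξ : GroupLieAlgebra 𝓘(ℝ, EG) G, v =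
      (show EP from mfderiv 𝓘(ℝ, EP) 𝓘(ℝ, EP) (fun q => Q.act q (τ.fac p)) (τ.s (Q.proj p))
        (mfderiv 𝓘(ℝ, EX) 𝓘(ℝ, EP) τ.s (Q.proj p)
          (mfderiv 𝓘(ℝ, EP) 𝓘(ℝ, EX) Q.proj p v : EX) : EP)) +
        (show EP from Q.fundamental ξ p) := by
  have hs : HasMFDerivAt 𝓘(ℝ, EP) 𝓘(ℝ, EP) (fun q => τ.s (Q.proj q)) p
      ((mfderiv 𝓘(ℝ, EX) 𝓘(ℝ, EP) τ.s (Q.proj p)).comp (mfderiv 𝓘(ℝ, EP) 𝓘(ℝ, EX) Q.proj p)) :=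
    ((τ.smooth_s _ hp).mdifferentiableAt (by simp)).hasMFDerivAt.comp p
      (Q.mdifferentiable_proj p).hasMFDerivAt
  have hf : HasMFDerivAt 𝓘(ℝ, EP) 𝓘(ℝ, EG) τ.fac p (mfderiv 𝓘(ℝ, EP) 𝓘(ℝ, EG) τ.fac p) :=
    ((τ.smooth_fac p hp).mdifferentiableAt (by simp)).hasMFDerivAt
  have hact : MDifferentiableAt (𝓘(ℝ, EP).prod 𝓘(ℝ, EG)) 𝓘(ℝ, EP) (fun z : P × G => Q.act z.1 z.2)
      (τ.s (Q.proj p), τ.fac p) := Q.smooth_act.mdifferentiable (by simp) _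
  have h1 := (hact.hasMFDerivAt.comp p (hs.prodMk hf)).mfderiv
  have h2 : mfderiv 𝓘(ℝ, EP) 𝓘(ℝ, EP) ((fun z : P × G => Q.act z.1 z.2) ∘
      fun q => (τ.s (Q.proj q), τ.fac q)) p = mfderiv 𝓘(ℝ, EP) 𝓘(ℝ, EP) id p := by
    refine Filter.EventuallyEq.mfderiv_eq ?_
    filter_upwards [(τ.isOpen_dom.preimage Q.proj.contMDiff.continuous).mem_nhds hp] with q hq
      using τ.act_fac q hq
  have h3 : (mfderiv 𝓘(ℝ, EP) 𝓘(ℝ, EP) id p v : EP) = v := by rw [mfderiv_id]; rfl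
  have h4 := congrArg (fun L : EP →L[ℝ] EP => L v) (h1.symm.trans h2)
  have h5 := mfderiv_prod_eq_add_apply (v := show EP × EG from
        ((show EP from mfderiv 𝓘(ℝ, EX) 𝓘(ℝ, EP) τ.s (Q.proj p)
          (mfderiv 𝓘(ℝ, EP) 𝓘(ℝ, EX) Q.proj p v : EX)),
        (show EG from mfderiv 𝓘(ℝ, EP) 𝓘(ℝ, EG) τ.fac p v))) hact
  set w : EG := mfderiv 𝓘(ℝ, EP) 𝓘(ℝ, EG) τ.fac p v with hw
  set g := τ.fac p with hg
  let ξ : GroupLieAlgebra 𝓘(ℝ, EG) G := (mfderiv 𝓘(ℝ, EG) 𝓘(ℝ, EG) (fun k => g⁻¹ * k) g w : EG)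
  refine ⟨ξ, (h3.symm.trans (h4.symm.trans h5)).trans ?_⟩
  refine congrArg₂ (fun a b : EP => a + b) rfl ?_
  have h6 : (fun k => Q.act (τ.s (Q.proj p)) k) = (fun k => Q.act p k) ∘ fun k => g⁻¹ * k := by
    funext k
    change _ = Q.act p (g⁻¹ * k)
    rw [← τ.act_fac p hp, ← Q.act_mul, τ.act_fac p hp, ← hg, mul_inv_cancel_left]
  have h7 := (((Q.contMDiff_act_left p).mdifferentiable (by simp) (g⁻¹ * g)).hasMFDerivAt.comp g
    ((contMDiff_mul_left (I := 𝓘(ℝ, EG)) (n := ∞) (a := g⁻¹)).mdifferentiable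
      (by simp) g).hasMFDerivAt).mfderiv
  rw [← h6] at h7
  have h8 : ∀ k : G, k = 1 → (mfderiv 𝓘(ℝ, EG) 𝓘(ℝ, EP) (fun g => Q.act p g) k (ξ : EG) : EP) =
      Q.fundamental ξ p := by rintro _ rfl; rfl
  exact (congrArg (fun L : EG →L[ℝ] EP => L w) h7).trans (h8 _ (inv_mul_cancel g))

end Sections

section Descent

theorem VBundle.congrFib_total {EX : Type*} [NormedAddCommGroup EX] [NormedSpace ℝ EX]
    {X : Type*} [TopologicalSpace X] [ChartedSpace EX X] (A : VBundle.{v} EX X) {x y : X} (h : x = y)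
    (a : A.fib x) : (⟨y, A.congrFib h a⟩ : TotalSpace A.F A.fib) = ⟨x, a⟩ := by
  subst h; rfl

theorem VBundle.eq_of_total {EX : Type*} [NormedAddCommGroup EX] [NormedSpace ℝ EX]
    {X : Type*} [TopologicalSpace X] [ChartedSpace EX X] {A : VBundle.{v} EX X} {x : X}
    {a b : A.fib x} (h : (⟨x, a⟩ : TotalSpace A.F A.fib) = ⟨x, b⟩) : a = b := by
  simpa using h

theorem VBundle.tr_congrFib {EX : Type*} [NormedAddCommGroup EX] [NormedSpace ℝ EX]
    {X : Type*} [TopologicalSpace X] [ChartedSpace EX X] (A : VBundle.{v} EX X) {x₀ x₁ x y : X}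
    (h₀ : x₀ = x₁) (h : x = y) (a : A.fib x) : A.tr x₁ y (A.congrFib h a) = A.tr x₀ x a := by
  subst h₀ h; rfl

variable {EG : Type*} [NormedAddCommGroup EG] [NormedSpace ℝ EG] [FiniteDimensional ℝ EG]
  {G : Type*} [TopologicalSpace G] [ChartedSpace EG G] [Group G] [LieGroup 𝓘(ℝ, EG) ∞ G]
  {EP : Type*} [NormedAddCommGroup EP] [NormedSpace ℝ EP] [FiniteDimensional ℝ EP]
  {P : Type*} [TopologicalSpace P] [ChartedSpace EP P] [IsManifold 𝓘(ℝ, EP) ∞ P]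
  {EX : Type*} [NormedAddCommGroup EX] [NormedSpace ℝ EX] [FiniteDimensional ℝ EX]
  {X : Type*} [TopologicalSpace X] [ChartedSpace EX X]
  (Q : PrincipalBundle EG G EP P EX X)
  {A : VBundle.{v} EX X} {A' : VBundle.{v} EP P} (c : ∀ p, A.fib (Q.proj p) ≃L[ℝ] A'.fib p)

/-- The pullback of forms along the projection and an isomorphism `c : π* A ≃ A'`. -/
def PrincipalBundle.pull {r : ℕ} (α : RawForm A r) : RawForm A' r :=
  pullMap Q.proj (fun p => (c p : A.fib (Q.proj p) →L[ℝ] A'.fib p)) α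

theorem PrincipalBundle.pull_apply {r : ℕ} (α : RawForm A r) (p : P)
    (v : Fin r → TangentSpace 𝓘(ℝ, EP) p) : Q.pull c α p v =
      c p (α (Q.proj p) fun i => mfderiv 𝓘(ℝ, EP) 𝓘(ℝ, EX) Q.proj p (v i)) := rfl

theorem PrincipalBundle.pull_add {r : ℕ} (α β : RawForm A r) :
    Q.pull c (α + β) = Q.pull c α + Q.pull c β :=
  funext fun p => ContinuousAlternatingMap.ext fun _ => map_add (c p) _ _

theorem PrincipalBundle.pull_smul {r : ℕ} (k : ℝ) (α : RawForm A r) :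
    Q.pull c (k • α) = k • Q.pull c α :=
  funext fun p => ContinuousAlternatingMap.ext fun _ => map_smul (c p) _ _

theorem PrincipalBundle.pull_injective {r : ℕ} : Function.Injective (Q.pull (r := r) c) := by
  intro α β h
  funext x
  refine ContinuousAlternatingMap.ext fun v => ?_
  have key : ∀ y, y = x → ∀ w : Fin r → EX, α y w = β y w → α x w = β x w := by
    rintro _ rfl _ h; exact h
  refine key _ ((Q.sec x).proj_s x (Q.mem_sec x)) v ?_
  have h1 := congrArg (fun a : TangentSpace 𝓘(ℝ, EP) ((Q.sec x).s x) [⋀^Fin r]→L[ℝ] _ =>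
    a fun i => (mfderiv 𝓘(ℝ, EX) 𝓘(ℝ, EP) (Q.sec x).s x (v i) : EP)) (congrFun h ((Q.sec x).s x))
  have h2 := (c ((Q.sec x).s x)).injective h1
  have h3 : (fun i => (mfderiv 𝓘(ℝ, EP) 𝓘(ℝ, EX) Q.proj ((Q.sec x).s x)
      (mfderiv 𝓘(ℝ, EX) 𝓘(ℝ, EP) (Q.sec x).s x (v i) : EP) : EX)) = v :=
    funext fun i => (Q.sec x).mfderiv_proj_s (Q.mem_sec x) (v i)
  have h4 : ∀ w : Fin r → EX, w = v → α (Q.proj ((Q.sec x).s x)) w = β (Q.proj ((Q.sec x).s x)) w →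
      α (Q.proj ((Q.sec x).s x)) v = β (Q.proj ((Q.sec x).s x)) v := by
    rintro _ rfl h; exact h
  exact h4 _ h3 h2

/-- The form on `X` obtained from a basic form by pulling back with local sections. -/
def PrincipalBundle.desc {r : ℕ} (φ : RawForm A' r) : RawForm A r := fun x =>
  ((A.congrFib ((Q.sec x).proj_s x (Q.mem_sec x)) : _ →L[ℝ] A.fib x).comp
    ((c ((Q.sec x).s x)).symm :
      A'.fib ((Q.sec x).s x) →L[ℝ] A.fib (Q.proj ((Q.sec x).s x)))).compContinuousAlternatingMap
      ((φ ((Q.sec x).s x)).compContinuousLinearMap (mfderiv 𝓘(ℝ, EX) 𝓘(ℝ, EP) (Q.sec x).s x))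

variable {ρ : Q.FibreAction A'}

theorem PrincipalBundle.pull_desc (hc : ∀ g p a, ρ g p (c p a) =
    c (Q.act p g) (A.congrFib (Q.proj_act p g).symm a)) {r : ℕ} {φ : RawForm A' r}
    (hi : ∀ x p, iota (Q.fundamental x p) (φ p) = 0) (hinv : ∀ g, Q.actF ρ g φ = φ) :
    Q.pull c (Q.desc c φ) = φ := by
  funext p
  refine ContinuousAlternatingMap.ext fun v => ?_
  rw [Q.pull_apply, ← ContinuousLinearEquiv.eq_symm_apply]
  apply VBundle.eq_of_total
  set τ := Q.sec (Q.proj p) with hτ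
  have hp : Q.proj p ∈ τ.dom := Q.mem_sec _
  set q := τ.s (Q.proj p) with hq
  set g := τ.fac p with hg
  let w : Fin r → EP := fun i => mfderiv 𝓘(ℝ, EX) 𝓘(ℝ, EP) τ.s (Q.proj p)
    (mfderiv 𝓘(ℝ, EP) 𝓘(ℝ, EX) Q.proj p (v i) : EX)
  let w' : Fin r → EP := fun i => mfderiv 𝓘(ℝ, EP) 𝓘(ℝ, EP) (fun q => Q.act q g) q (w i)
  have h1 : φ p v = φ p w' := by
    choose ξ hξ using fun i => τ.exists_fundamental hp (v i)
    have h2 : (v : Fin r → EP) = w' + fun i => (show EP from Q.fundamental (ξ i) p) :=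
      funext fun i => hξ i
    refine (congrArg (φ p) h2).trans ?_
    exact alt_congr_of_iota (φ p) w' _ fun i => hi (ξ i) p
  rw [h1]
  refine (A.congrFib_total _ _).trans ?_
  have key : ∀ p', Q.act q g = p' →
      (⟨Q.proj q, (c q).symm (φ q w)⟩ : TotalSpace A.F A.fib) = ⟨Q.proj p', (c p').symm (φ p' w')⟩ := by
    rintro _ rfl
    have h2 : (ρ g q).symm (φ (Q.act q g) w') = φ q w :=
      congrArg (fun a => a w) (congrFun (hinv g) q)
    rw [ContinuousLinearEquiv.symm_apply_eq] at h2
    rw [h2, ← (c q).apply_symm_apply (φ q w), hc, ContinuousLinearEquiv.symm_apply_apply,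
      ContinuousLinearEquiv.symm_apply_apply]
    exact (A.congrFib_total _ _).symm
  exact key p (τ.act_fac p hp)

variable [IsManifold 𝓘(ℝ, EX) ∞ X]

theorem PrincipalBundle.smoothForm_pull (hK : ∀ p₀, ∃ K : P → A.F →L[ℝ] A'.F,
    ContMDiffAt 𝓘(ℝ, EP) 𝓘(ℝ, A.F →L[ℝ] A'.F) ∞ K p₀ ∧ ∀ᶠ p in nhds p₀, ∀ a,
      A'.tr p₀ p (c p a) = K p (A.tr (Q.proj p₀) (Q.proj p) a)) {r : ℕ} {α : RawForm A r}
    (hα : SmoothForm α) : SmoothForm (Q.pull c α) := smoothForm_of_at fun p₀ => by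
  obtain ⟨K, hK, h⟩ := hK p₀
  exact (hα.at _).pullMap Q.proj.contMDiff.contMDiffAt (A.mem_nb _) hK h

theorem PrincipalBundle.smoothForm_desc (hK : ∀ p₀, ∃ K : P → A'.F →L[ℝ] A.F,
    ContMDiffAt 𝓘(ℝ, EP) 𝓘(ℝ, A'.F →L[ℝ] A.F) ∞ K p₀ ∧ ∀ᶠ p in nhds p₀, ∀ b,
      A.tr (Q.proj p₀) (Q.proj p) ((c p).symm b) = K p (A'.tr p₀ p b)) {r : ℕ} {φ : RawForm A' r}
    (hφ : SmoothForm φ) (hd : Q.pull c (Q.desc c φ) = φ) : SmoothForm (Q.desc c φ) :=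
  smoothForm_of_at fun x₀ => by
  classical
  set τ := Q.sec x₀ with hτ
  have hx₀ : x₀ ∈ τ.dom := Q.mem_sec x₀
  let c' : ∀ y, A'.fib (τ.s y) →L[ℝ] A.fib y := fun y =>
    if h : Q.proj (τ.s y) = y then
      (A.congrFib h : _ →L[ℝ] A.fib y).comp ((c (τ.s y)).symm :
        A'.fib (τ.s y) →L[ℝ] A.fib (Q.proj (τ.s y))) else 0
  have hc' : ∀ y (hy : y ∈ τ.dom) b,
      c' y b = A.congrFib (τ.proj_s y hy) ((c (τ.s y)).symm b) := fun y hy b => by simp only [c', dif_pos (τ.proj_s y hy)]; rfl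
  have h1 : ∀ y ∈ τ.dom, Q.desc c φ y = pullMap τ.s c' φ y := by
    intro y hy
    refine ContinuousAlternatingMap.ext fun v => ?_
    change _ = c' y (φ (τ.s y) fun i => mfderiv 𝓘(ℝ, EX) 𝓘(ℝ, EP) τ.s y (v i))
    rw [hc' y hy]
    apply VBundle.eq_of_total
    refine Eq.trans ?_ (A.congrFib_total _ _).symm
    have h2 : ∀ w, (c (τ.s y)).symm (φ (τ.s y) w) = Q.desc c φ (Q.proj (τ.s y))
        fun i => mfderiv 𝓘(ℝ, EP) 𝓘(ℝ, EX) Q.proj (τ.s y) (w i) := fun w => by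
      rw [ContinuousLinearEquiv.symm_apply_eq]
      exact congrArg (fun a => a w) (congrFun hd.symm (τ.s y))
    rw [h2]
    have key : ∀ z, z = y → ∀ w : Fin r → EX, w = v →
        (⟨y, Q.desc c φ y v⟩ : TotalSpace A.F A.fib) = ⟨z, Q.desc c φ z w⟩ := by
      rintro _ rfl _ rfl; rfl
    exact key _ (τ.proj_s y hy) _ (funext fun i => τ.mfderiv_proj_s hy (v i))
  have hdom := τ.isOpen_dom.mem_nhds hx₀
  refine SmoothFormAt.congr ?_ (Filter.mem_of_superset hdom h1)
  obtain ⟨K, hK, hKe⟩ := hK (τ.s x₀)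
  have hs := τ.smooth_s x₀ hx₀
  refine (hφ.at _).pullMap hs (A'.mem_nb _) (K := fun y => K (τ.s y)) (hK.comp x₀ hs) ?_
  filter_upwards [hdom, hs.continuousAt.eventually hKe] with y hy h a
  rw [hc' y hy, A.tr_congrFib (τ.proj_s x₀ hx₀)]
  exact h a

end Descent

section Pullbacks

variable {EG : Type*} [NormedAddCommGroup EG] [NormedSpace ℝ EG] [FiniteDimensional ℝ EG]
  {G : Type*} [TopologicalSpace G] [ChartedSpace EG G] [Group G] [LieGroup 𝓘(ℝ, EG) ∞ G]
  {EP : Type*} [NormedAddCommGroup EP] [NormedSpace ℝ EP] [FiniteDimensional ℝ EP]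
  {P : Type*} [TopologicalSpace P] [ChartedSpace EP P] [IsManifold 𝓘(ℝ, EP) ∞ P]
  {EX : Type*} [NormedAddCommGroup EX] [NormedSpace ℝ EX] [FiniteDimensional ℝ EX]
  {X : Type*} [TopologicalSpace X] [ChartedSpace EX X] [IsManifold 𝓘(ℝ, EX) ∞ X]
  (Q : PrincipalBundle EG G EP P EX X)

section PullbackForms

/-- The identity `A_{π p} = (π* A)_p`. -/
def VBundle.toPullback (A : VBundle.{v} EX X) (p : P) : A.fib (Q.proj p) ≃L[ℝ] (A.pullback Q).fib p :=
  ContinuousLinearEquiv.refl ℝ (A.fib (Q.proj p))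

theorem VBundle.tr_toPullback (A : VBundle.{v} EX X) (p₀ : P) : ∃ K : A.F ≃L[ℝ] (A.pullback Q).F,
    ∀ᶠ p in nhds p₀, ∀ a, (A.pullback Q).tr p₀ p (A.toPullback Q p a) =
      K (A.tr (Q.proj p₀) (Q.proj p) a) :=
  ⟨ContinuousLinearEquiv.refl ℝ A.F, Filter.Eventually.of_forall fun _ _ => rfl⟩

theorem smoothForm_pullbackForms {E : GradedBundle.{v} EX X} {η : RawForms E.part}
    (hη : η ∈ Omega E.part) : pullbackForms Q η ∈ Omega (E.pullback Q).part := fun n i =>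
  Q.smoothForm_pull ((E.part i).toPullback Q)
    (fun _ => ⟨fun _ => ContinuousLinearMap.id ℝ (E.part i).F, contMDiffAt_const,
      Filter.Eventually.of_forall fun _ _ => rfl⟩) (hη n i)

/-- The pullback of smooth forms, as a linear map. -/
def pullbackΩ {E : GradedBundle.{v} EX X} : Omega E.part →ₗ[ℝ] Omega (E.pullback Q).part where
  toFun η := ⟨pullbackForms Q (η : RawForms E.part), smoothForm_pullbackForms Q η.2⟩
  map_add' _ _ := rfl
  map_smul' _ _ := rfl

theorem pullbackForms_scalarWedge {E : GradedBundle.{v} EX X} {k : ℕ}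
    (σ : RawForm (VBundle.line EX X) k) (η : RawForms E.part) :
    pullbackForms Q (scalarWedge σ η) = scalarWedge (pullS EP Q.proj σ) (pullbackForms Q η) := by
  funext n i p
  exact (scalarWedge_natural (mfderiv 𝓘(ℝ, EP) 𝓘(ℝ, EX) Q.proj p)
    (fun i => (E.part i).toPullback Q p) (σ := σ)
    (σ' := pullS EP Q.proj σ) (η := η) (η' := pullbackForms Q η) rfl (fun _ _ => rfl) n i).symm

theorem smoothForm_pullS_proj {k : ℕ} {σ : RawForm (VBundle.line EX X) k} (hσ : SmoothForm σ) :
    SmoothForm (pullS EP Q.proj σ) := smoothForm_of_at fun _ =>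
  SmoothFormAt.pullS Q.proj.contMDiff.contMDiffAt (hσ.at _)

theorem extD_pullS_proj {k : ℕ} {σ : RawForm (VBundle.line EX X) k} (hσ : SmoothForm σ) :
    extD (pullS EP Q.proj σ) = pullS EP Q.proj (extD σ) :=
  funext fun _ => extD_pullS Q.proj.contMDiff.contMDiffAt (hσ.at _)

theorem pullbackΩ_mulS {E : GradedBundle.{v} EX X} {k : ℕ}
    {σ : RawForm (VBundle.line EX X) k} (hσ : SmoothForm σ) (η : Omega E.part) :
    pullbackΩ Q (mulS σ hσ η) =
      mulS (pullS EP Q.proj σ) (smoothForm_pullS_proj Q hσ) (pullbackΩ Q η) :=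
  Subtype.ext (pullbackForms_scalarWedge (E := E) Q σ (η : RawForms E.part))

theorem pullbackΩ_inclΩ {E : GradedBundle.{v} EX X} (q : ℤ) {s : ∀ x, (E.part q).fib x}
    (hs : SmoothForm (secForm s)) : (pullbackΩ Q (inclΩ 0 q (secForm s) hs) : RawForms _) =
      incl (V := (E.pullback Q).part) 0 q (secForm fun p => (E.part q).toPullback Q p (s (Q.proj p))) := by
  funext r i
  by_cases h : r = 0 ∧ i = q
  · obtain ⟨rfl, rfl⟩ := h
    rw [incl_same]
    funext p
    refine ContinuousAlternatingMap.ext fun v => ?_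
    change (incl 0 i (secForm s) : RawForms E.part) 0 i (Q.proj p) _ = _
    rw [incl_same]
    rfl
  · rw [incl_of_ne _ h]
    funext p
    refine ContinuousAlternatingMap.ext fun v => ?_
    change (incl 0 q (secForm s) : RawForms E.part) r i (Q.proj p) _ = _
    rw [incl_of_ne _ h]
    rfl

theorem scalarWedge_add_left {ι : Type} {V : ι → VBundle.{v} EX X} {k : ℕ}
    (σ τ : RawForm (VBundle.line EX X) k) (η : RawForms V) :
    scalarWedge (σ + τ) η = scalarWedge σ η + scalarWedge τ η := by
  funext n i x
  rw [scalarWedge_eq]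
  refine (tw_add_left _ _ _ _).trans ?_
  rw [← scalarWedge_eq, ← scalarWedge_eq]
  rfl

theorem scalarWedge_smul_left {ι : Type} {V : ι → VBundle.{v} EX X} {k : ℕ} (c : ℝ)
    (σ : RawForm (VBundle.line EX X) k) (η : RawForms V) :
    scalarWedge (c • σ) η = c • scalarWedge σ η := by
  funext n i x
  rw [scalarWedge_eq]
  refine (tw_smul_left _ _ _ _).trans ?_
  rw [← scalarWedge_eq]
  rfl

theorem scalarWedge_zero_left {ι : Type} {V : ι → VBundle.{v} EX X} {k : ℕ} (η : RawForms V) :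
    scalarWedge (0 : RawForm (VBundle.line EX X) k) η = 0 := by
  simpa using scalarWedge_smul_left 0 (0 : RawForm (VBundle.line EX X) k) η

theorem evalAt_scalarWedge_congr {ι : Type} {V : ι → VBundle.{v} EX X} {x : X} {k : ℕ}
    {σ τ : RawForm (VBundle.line EX X) k} (h : σ x = τ x) (η : RawForms V) :
    evalAt x (scalarWedge σ η) = evalAt x (scalarWedge τ η) := by
  funext n i
  change scalarWedge σ η n i x = scalarWedge τ η n i x
  rw [scalarWedge_eq, scalarWedge_eq, h]

variable [T2Space X] [T2Space P]

theorem eq_zero_of_pullback {E : GradedBundle.{v} EX X} {W : Type*} [AddCommGroup W] [Module ℝ W]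
    (p : P) (T : Omega (E.pullback Q).part →ₗ[ℝ] W)
    (hT : ∀ (k : ℕ) (σ : RawForm (VBundle.line EP P) k) (hσ : SmoothForm σ)
      (η : Omega (E.pullback Q).part), T η = 0 → T (mulS σ hσ η) = 0)
    (hf : ∀ (f : RawForm (VBundle.line EP P) 0) (hf : SmoothForm f)
      (η : Omega (E.pullback Q).part), sval f p ![] = 1 → T (mulS f hf η) = 0 → T η = 0)
    (h0 : ∀ ζ : Omega E.part, T (pullbackΩ Q ζ) = 0) (η : Omega (E.pullback Q).part) : T η = 0 := by
  have hs : ∀ q, ∀ s ∈ Set.range fun j => secForm fun p' : P => (E.part q).toPullback Q p'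
      ((E.part q).sec (Q.proj p) (Module.finBasis ℝ (E.part q).F j) (Q.proj p')),
      SmoothForm s ∧ ∃ ζ : Omega E.part, (pullbackΩ Q ζ : RawForms _) = incl (V := (E.pullback Q).part) 0 q s := by
    rintro q _ ⟨j, rfl⟩
    have h := pullbackΩ_inclΩ Q q (smoothForm_sec (E.part q) (Q.proj p)
      (Module.finBasis ℝ (E.part q).F j))
    refine ⟨?_, _, h⟩
    have h' := (pullbackΩ Q (inclΩ 0 q _ (smoothForm_sec (E.part q) (Q.proj p)
      (Module.finBasis ℝ (E.part q).F j)))).2 0 q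
    rw [h, incl_same] at h'
    exact h'
  refine eq_zero_of_generates p _ (fun q _ => generates_sec (Q.proj p) ((E.part q).toPullback Q)
    Q.proj.contMDiff ((E.part q).tr_toPullback Q) ((E.part q).bump_self _))
    (fun q s h => (hs q s h).1) T hT hf (fun q _ s h => ?_) η
  obtain ⟨ζ, hζ⟩ := (hs q s h).2
  rw [show inclΩ 0 q s (hs q s h).1 = pullbackΩ Q ζ from Subtype.ext hζ.symm]
  exact h0 ζ

/-- Tensorial operators on `Ω(P, π* E)` are determined by their values on pulled back forms. -/
theorem ext_pullback {E : GradedBundle.{v} EX X} {ι : Type} {V : ι → VBundle.{v} EP P}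
    (T : Omega (E.pullback Q).part →ₗ[ℝ] RawForms V) (c : ℕ → ℝ) (hc : c 0 = 1)
    (hT : ∀ (k : ℕ) (σ : RawForm (VBundle.line EP P) k) (hσ : SmoothForm σ)
      (η : Omega (E.pullback Q).part), T (mulS σ hσ η) = c k • scalarWedge σ (T η))
    (h0 : ∀ ζ : Omega E.part, T (pullbackΩ Q ζ) = 0) (η : Omega (E.pullback Q).part) : T η = 0 := by
  funext n i p
  refine congrFun (congrFun (eq_zero_of_pullback Q p ((evalAt p).comp T) (fun k σ hσ η h => ?_)
    (fun f hf η h1 h => ?_) (fun ζ => ?_) η) n) i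
  · change evalAt p (T _) = 0
    rw [hT, map_smul, evalAt_scalarWedge σ (η := T η) h, smul_zero]
  · change evalAt p (T _) = 0 at h
    rw [hT, hc, one_smul, evalAt_scalarWedge_one h1] at h
    exact h
  · change evalAt p (T _) = 0
    rw [h0, map_zero]

end PullbackForms

section MulS

theorem mulS_swedge {ι : Type} {V : ι → VBundle.{v} EX X} {p r m : ℕ} (h : p + r = m)
    {σ : RawForm (VBundle.line EX X) p} (hσ : SmoothForm σ) {τ : RawForm (VBundle.line EX X) r}
    (hτ : SmoothForm τ) {υ : RawForm (VBundle.line EX X) m} (hυ : SmoothForm υ)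
    (e : υ = swedge m σ τ) (η : Omega V) : mulS υ hυ η = mulS σ hσ (mulS τ hτ η) :=
  Subtype.ext (by subst e; exact (scalarWedge_scalarWedge (V := V) h σ τ (η : RawForms V)).symm)

theorem mulS_extD_swedge {ι : Type} {V : ι → VBundle.{v} EX X} {p r m : ℕ} (h : p + r = m)
    {σ : RawForm (VBundle.line EX X) p} (hσ : SmoothForm σ) {τ : RawForm (VBundle.line EX X) r}
    (hτ : SmoothForm τ) {υ : RawForm (VBundle.line EX X) m} (hυ : SmoothForm υ)
    (e : υ = swedge m σ τ) (η : Omega V) : mulS (extD υ) (smoothForm_extD hυ) η =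
      mulS (extD σ) (smoothForm_extD hσ) (mulS τ hτ η) +
        (-1 : ℝ) ^ p • mulS σ hσ (mulS (extD τ) (smoothForm_extD hτ) η) :=
  Subtype.ext <| by
    subst e
    change scalarWedge (extD (swedge m σ τ)) (η : RawForms V) =
      scalarWedge (extD σ) (scalarWedge τ (η : RawForms V)) +
        (-1 : ℝ) ^ p • scalarWedge σ (scalarWedge (extD τ) (η : RawForms V))
    rw [extD_swedge h hσ hτ, scalarWedge_add_left, scalarWedge_smul_left,
      scalarWedge_scalarWedge (by omega : p + 1 + r = m + 1),
      scalarWedge_scalarWedge (by omega : p + (r + 1) = m + 1)]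

theorem add_smul_map {M N : Type*} [AddCommGroup M] [Module ℝ M] [AddCommGroup N] [Module ℝ N]
    (f : M →ₗ[ℝ] N) (a : N) (b c : M) (s t : ℝ) :
    a + s • f b + (s * t) • f c = a + s • f (b + t • c) := by
  rw [map_add, map_smul, smul_add, smul_smul, add_assoc]

theorem linear_eq_zero {E : GradedBundle.{v} EX X} {W : Type*} [AddCommGroup W] [Module ℝ W]
    (T : Omega E.part →ₗ[ℝ] W) (h : ∀ (r : ℕ), ∀ q ∈ E.support, ∀ (ζ : RawForm (E.part q) r)
      (hζ : SmoothForm ζ), T (inclΩ r q ζ hζ) = 0) (η : Omega E.part) : T η = 0 := by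
  rw [eq_sum_inclΩ η, map_sum]
  refine Finset.sum_eq_zero fun r _ => ?_
  rw [map_sum]
  exact Finset.sum_eq_zero fun q hq => h _ _ hq _ _

variable [T2Space X]

theorem evalAt_scalarWedge_right {ι : Type} {V : ι → VBundle.{v} EX X} {x : X} {k : ℕ}
    (σ : RawForm (VBundle.line EX X) k) {η ζ : RawForms V} (h : evalAt x η = evalAt x ζ) :
    evalAt x (scalarWedge σ η) = evalAt x (scalarWedge σ ζ) := by
  rw [← sub_eq_zero, ← map_sub, ← scalarWedge_sub]
  exact evalAt_scalarWedge σ (by rw [map_sub, h, sub_self])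

theorem extD_one : extD (fnForm (EX := EX) (X := X) fun _ => 1) = 0 := by
  have h : SmoothForm (fnForm (EX := EX) (X := X) fun _ => 1) := smoothForm_fnForm contMDiff_const
  have e : swedge 0 (fnForm (EX := EX) (X := X) fun _ => 1) (fnForm fun _ => 1) = fnForm fun _ => 1 :=
    funext fun x => ContinuousAlternatingMap.ext fun v =>
      (tw_zero_zero _ _ _ _).trans (show (1 : ℝ) * 1 = 1 from mul_one 1)
  have h1 := extD_swedge (n := 0) (zero_add 0) h h
  have e1 : ∀ τ : RawForm (VBundle.line EX X) 1,
      swedge 1 (fnForm (EX := EX) (X := X) fun _ => 1) τ = τ := fun τ =>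
    funext fun x => ContinuousAlternatingMap.ext fun v =>
      (tw_zero_apply _ _ _ _ _).trans (one_smul ℝ (τ x v))
  have e2 : ∀ τ : RawForm (VBundle.line EX X) 1,
      swedge 1 τ (fnForm (EX := EX) (X := X) fun _ => 1) = τ := fun τ =>
    funext fun x => ContinuousAlternatingMap.ext fun v =>
      (tw_apply_zero _ _ _ _ _).trans (mul_one (sval τ x v))
  rw [e, e1, e2, pow_zero, one_smul] at h1
  exact left_eq_add.1 h1

end MulS

section LocalOperator

variable [T2Space X] {E : GradedBundle.{v} EX X} (D : Omega E.part →ₗ[ℝ] Omega E.part) (x₀ : X)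

/-- The sections of a local frame of `E` around `x₀`, as forms. -/
def frameForm (q : ℤ) (j : Fin (Module.finrank ℝ (E.part q).F)) : Omega E.part :=
  inclΩ 0 q (secForm ((E.part q).sec x₀ (Module.finBasis ℝ (E.part q).F j)))
    (smoothForm_sec _ _ _)

/-- The coefficients of a form on `P` with respect to the pulled back frame. -/
def frameCoef {q : ℤ} (j : Fin (Module.finrank ℝ (E.part q).F)) {r : ℕ}
    (ζ : RawForm ((E.pullback Q).part q) r) : RawForm (VBundle.line EP P) r :=
  mapVal (A := (E.part q).pullback Q) (VBundle.coefMap x₀ ((E.part q).toPullback Q) j) ζ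

variable {Q} in
theorem smoothForm_frameCoef {q : ℤ} (j : Fin (Module.finrank ℝ (E.part q).F)) {r : ℕ}
    {ζ : RawForm ((E.pullback Q).part q) r} (hζ : SmoothForm ζ) :
    SmoothForm (frameCoef Q x₀ j ζ) :=
  smoothForm_coef x₀ ((E.part q).toPullback Q) Q.proj.contMDiff ((E.part q).tr_toPullback Q) j hζ

theorem frameCoef_add {q : ℤ} (j : Fin (Module.finrank ℝ (E.part q).F)) {r : ℕ}
    (ζ ζ' : RawForm ((E.pullback Q).part q) r) :
    frameCoef Q x₀ j (ζ + ζ') = frameCoef Q x₀ j ζ + frameCoef Q x₀ j ζ' :=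
  funext fun p => ContinuousAlternatingMap.ext fun v =>
    map_add (VBundle.coefMap x₀ ((E.part q).toPullback Q) j p) (ζ p v) (ζ' p v)

theorem frameCoef_smul {q : ℤ} (j : Fin (Module.finrank ℝ (E.part q).F)) {r : ℕ} (c : ℝ)
    (ζ : RawForm ((E.pullback Q).part q) r) :
    frameCoef Q x₀ j (c • ζ) = c • frameCoef Q x₀ j ζ :=
  funext fun p => ContinuousAlternatingMap.ext fun v =>
    map_smul (VBundle.coefMap x₀ ((E.part q).toPullback Q) j p) c (ζ p v)

theorem frameCoef_zero {q : ℤ} (j : Fin (Module.finrank ℝ (E.part q).F)) {r : ℕ} :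
    frameCoef Q x₀ j (0 : RawForm ((E.pullback Q).part q) r) = 0 := by
  simpa using frameCoef_smul Q x₀ j 0 (0 : RawForm ((E.pullback Q).part q) r)

theorem frameCoef_tw {q : ℤ} (j : Fin (Module.finrank ℝ (E.part q).F)) {k r n : ℕ}
    (σ : RawForm (VBundle.line EP P) k) (ζ : RawForm ((E.pullback Q).part q) r) :
    frameCoef Q x₀ j (fun p => tw (scalarB _ p) k r n (σ p) (ζ p)) =
      swedge n σ (frameCoef Q x₀ j ζ) :=
  funext fun p => tw_natural (ContinuousLinearMap.id ℝ (TangentSpace 𝓘(ℝ, EP) p))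
    (ContinuousLinearMap.id ℝ _) (VBundle.coefMap x₀ ((E.part q).toPullback Q) j p)
    (VBundle.coefMap x₀ ((E.part q).toPullback Q) j p) (scalarB _ p)
    (scalarB (VBundle.line EP P) p) (fun a b => map_smul
      (VBundle.coefMap x₀ ((E.part q).toPullback Q) j p) (lineVal p a) b) (σ p) (ζ p)

/-- The component of `localD` which involves one element of the frame. -/
def localTerm (q : ℤ) (j : Fin (Module.finrank ℝ (E.part q).F)) (r : ℕ) :
    Omega (E.pullback Q).part →ₗ[ℝ] Omega (E.pullback Q).part where
  toFun η := mulS (extD (frameCoef Q x₀ j ((η : RawForms (E.pullback Q).part) r q)))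
      (smoothForm_extD (smoothForm_frameCoef x₀ j (smoothForm_comp η r q)))
        (pullbackΩ Q (frameForm x₀ q j)) +
    (-1 : ℝ) ^ r • mulS (frameCoef Q x₀ j ((η : RawForms (E.pullback Q).part) r q))
      (smoothForm_frameCoef x₀ j (smoothForm_comp η r q)) (pullbackΩ Q (D (frameForm x₀ q j)))
  map_add' η ζ := Subtype.ext <| by
    have h : frameCoef Q x₀ j (((η + ζ : Omega (E.pullback Q).part) : RawForms (E.pullback Q).part) r q) =
      frameCoef Q x₀ j ((η : RawForms (E.pullback Q).part) r q) + frameCoef Q x₀ j ((ζ : RawForms (E.pullback Q).part) r q) :=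
      frameCoef_add Q x₀ j _ _
    change scalarWedge (extD (frameCoef Q x₀ j _)) _ + _ • scalarWedge (frameCoef Q x₀ j _) _ =
      (scalarWedge (extD (frameCoef Q x₀ j _)) _ + _ • scalarWedge (frameCoef Q x₀ j _) _) +
        (scalarWedge (extD (frameCoef Q x₀ j _)) _ + _ • scalarWedge (frameCoef Q x₀ j _) _)
    rw [h, extD_add (smoothForm_frameCoef x₀ j (smoothForm_comp η r q))
      (smoothForm_frameCoef x₀ j (smoothForm_comp ζ r q)), scalarWedge_add_left,
      scalarWedge_add_left, smul_add]
    abel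
  map_smul' c η := Subtype.ext <| by
    have h : frameCoef Q x₀ j (((c • η : Omega (E.pullback Q).part) : RawForms (E.pullback Q).part) r q) =
      c • frameCoef Q x₀ j ((η : RawForms (E.pullback Q).part) r q) := frameCoef_smul Q x₀ j _ _
    change scalarWedge (extD (frameCoef Q x₀ j _)) _ + _ • scalarWedge (frameCoef Q x₀ j _) _ =
      c • (scalarWedge (extD (frameCoef Q x₀ j _)) _ + _ • scalarWedge (frameCoef Q x₀ j _) _)
    rw [h, extD_smul, scalarWedge_smul_left, scalarWedge_smul_left, smul_add, smul_comm c]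

theorem localTerm_eq_zero {q : ℤ} (j : Fin (Module.finrank ℝ (E.part q).F)) {r : ℕ}
    {η : Omega (E.pullback Q).part} (h : (η : RawForms (E.pullback Q).part) r q = 0) :
    localTerm Q D x₀ q j r η = 0 := Subtype.ext <| by
  change scalarWedge (extD (frameCoef Q x₀ j ((η : RawForms (E.pullback Q).part) r q))) _ +
    _ • scalarWedge (frameCoef Q x₀ j ((η : RawForms (E.pullback Q).part) r q)) _ = 0
  rw [h, frameCoef_zero, extD_zero, scalarWedge_zero_left, scalarWedge_zero_left, smul_zero,
    add_zero]

theorem localTerm_inclΩ {q : ℤ} (j : Fin (Module.finrank ℝ (E.part q).F)) {r : ℕ}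
    {ζ : RawForm ((E.pullback Q).part q) r} (hζ : SmoothForm ζ) :
    localTerm Q D x₀ q j r (inclΩ r q ζ hζ) =
      mulS (extD (frameCoef Q x₀ j ζ)) (smoothForm_extD (smoothForm_frameCoef x₀ j hζ))
        (pullbackΩ Q (frameForm x₀ q j)) +
      (-1 : ℝ) ^ r • mulS (frameCoef Q x₀ j ζ)
        (smoothForm_frameCoef x₀ j hζ) (pullbackΩ Q (D (frameForm x₀ q j))) := Subtype.ext <| by
  change scalarWedge (extD (frameCoef Q x₀ j ((incl r q ζ : RawForms (E.pullback Q).part) r q))) _ +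
    _ • scalarWedge (frameCoef Q x₀ j ((incl r q ζ : RawForms (E.pullback Q).part) r q)) _ = _
  rw [incl_same]
  rfl

/-- The pullback superconnection, near the points over `x₀`. -/
def localD : Omega (E.pullback Q).part →ₗ[ℝ] Omega (E.pullback Q).part :=
  ∑ r ∈ Finset.range (Module.finrank ℝ EP + 1), ∑ q ∈ E.support, ∑ j, localTerm Q D x₀ q j r

theorem localD_inclΩ {q : ℤ} (hq : q ∈ E.support) {r : ℕ}
    {ζ : RawForm ((E.pullback Q).part q) r} (hζ : SmoothForm ζ) :
    localD Q D x₀ (inclΩ r q ζ hζ) = ∑ j, localTerm Q D x₀ q j r (inclΩ r q ζ hζ) := by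
  rw [localD, LinearMap.sum_apply, Finset.sum_eq_single r, LinearMap.sum_apply,
    Finset.sum_eq_single q, LinearMap.sum_apply]
  · intro q' _ h
    rw [LinearMap.sum_apply]
    exact Finset.sum_eq_zero fun j _ => localTerm_eq_zero Q D x₀ j (incl_of_ne _ fun h' => h h'.2)
  · exact fun h => absurd hq h
  · intro r' _ h
    simp only [LinearMap.sum_apply]
    exact Finset.sum_eq_zero fun q' _ => Finset.sum_eq_zero fun j _ =>
      localTerm_eq_zero Q D x₀ j (incl_of_ne _ fun h' => h h'.1)
  · intro h
    simp only [LinearMap.sum_apply]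
    exact Finset.sum_eq_zero fun q' _ => Finset.sum_eq_zero fun j _ =>
      localTerm_eq_zero Q D x₀ j (rawForm_eq_zero (by simpa using h) _)

theorem sum_frame {q : ℤ} {r : ℕ} {ζ : RawForm ((E.pullback Q).part q) r} (hζ : SmoothForm ζ) :
    scalarWedge (fnForm fun p => (E.part q).bump x₀ (Q.proj p) * (E.part q).bump x₀ (Q.proj p))
      (inclΩ r q ζ hζ : RawForms (E.pullback Q).part) =
    ((∑ j, mulS (frameCoef Q x₀ j ζ) (smoothForm_frameCoef x₀ j hζ)
      (pullbackΩ Q (frameForm x₀ q j)) : Omega (E.pullback Q).part) : RawForms (E.pullback Q).part) := by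
  rw [AddSubmonoidClass.coe_finsetSum]
  refine (scalarWedge_incl (zero_add r) _ q ζ).trans ?_
  refine (congrArg (incl (V := (E.pullback Q).part) r q)
    (sum_coef (A' := (E.part q).pullback Q) x₀ ((E.part q).toPullback Q) ζ)).trans ?_
  have : ∀ (t : Finset (Fin (Module.finrank ℝ (E.part q).F)))
      (u : Fin (Module.finrank ℝ (E.part q).F) → RawForm ((E.pullback Q).part q) r),
      incl r q (∑ j ∈ t, u j) = ∑ j ∈ t, incl (V := (E.pullback Q).part) r q (u j) := by
    intro t u
    induction t using Finset.induction_on with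
    | empty => simp [incl]
    | insert j t hj ih => rw [Finset.sum_insert hj, Finset.sum_insert hj, incl_add, ih]
  refine (this Finset.univ _).trans (Finset.sum_congr rfl fun j _ => ?_)
  refine (scalarWedge_incl (V := (E.pullback Q).part) (add_zero r) _ q _).symm.trans ?_
  exact congrArg (scalarWedge (frameCoef Q x₀ j ζ)) (pullbackΩ_inclΩ Q q _).symm

theorem localD_mulS_inclΩ {q : ℤ} (hq : q ∈ E.support) {k r : ℕ}
    {σ : RawForm (VBundle.line EP P) k} (hσ : SmoothForm σ)
    {ζ : RawForm ((E.pullback Q).part q) r} (hζ : SmoothForm ζ) :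
    localD Q D x₀ (mulS σ hσ (inclΩ r q ζ hζ)) =
      mulS (extD σ) (smoothForm_extD hσ) (∑ j, mulS (frameCoef Q x₀ j ζ)
        (smoothForm_frameCoef x₀ j hζ) (pullbackΩ Q (frameForm x₀ q j))) +
      (-1 : ℝ) ^ k • mulS σ hσ (localD Q D x₀ (inclΩ r q ζ hζ)) := by
  have hs : SmoothForm (A := (E.pullback Q).part q)
      fun p => tw (scalarB ((E.pullback Q).part q) p) k r (k + r) (σ p) (ζ p) :=
    smoothForm_of_at fun p => SmoothFormAt.tw (bilinAt_scalarB _ p) (hσ.at p) (hζ.at p)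
  have h : mulS σ hσ (inclΩ r q ζ hζ) = inclΩ (k + r) q _ hs :=
    Subtype.ext (scalarWedge_incl (V := (E.pullback Q).part) rfl σ q ζ)
  rw [h, localD_inclΩ Q D x₀ hq, localD_inclΩ Q D x₀ hq, map_sum, map_sum, Finset.smul_sum]
  refine Eq.trans ?_ Finset.sum_add_distrib
  refine Finset.sum_congr rfl fun j _ => ?_
  have hc := smoothForm_frameCoef x₀ j hζ
  rw [localTerm_inclΩ, localTerm_inclΩ]
  have h1 := mulS_extD_swedge rfl hσ hc (smoothForm_frameCoef x₀ j hs)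
    (frameCoef_tw Q x₀ j σ ζ) (pullbackΩ Q (frameForm x₀ q j))
  have h2 := mulS_swedge rfl hσ hc (smoothForm_frameCoef x₀ j hs)
    (frameCoef_tw Q x₀ j σ ζ) (pullbackΩ Q (D (frameForm x₀ q j)))
  rw [h1, h2, pow_add]
  exact add_smul_map (mulS σ hσ) _ _ _ _ _

end LocalOperator

section LocalOperator

variable [T2Space X] [T2Space P] {E : GradedBundle.{v} EX X} {D : Omega E.part →ₗ[ℝ] Omega E.part}

/-- The values of smooth forms at a point. -/
def evalΩ {ι : Type} {V : ι → VBundle.{v} EX X} (x : X) : Omega V →ₗ[ℝ]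
    ∀ (p : ℕ) (i : ι), TangentSpace 𝓘(ℝ, EX) x [⋀^Fin p]→L[ℝ] (V i).fib x :=
  (evalAt x).comp (Omega V).subtype

theorem evalΩ_mulS_right {ι : Type} {V : ι → VBundle.{v} EX X} {x : X} {k : ℕ}
    {σ : RawForm (VBundle.line EX X) k} (hσ : SmoothForm σ) {η ζ : Omega V}
    (h : evalΩ x η = evalΩ x ζ) : evalΩ x (mulS σ hσ η) = evalΩ x (mulS σ hσ ζ) :=
  evalAt_scalarWedge_right (V := V) σ h

theorem evalΩ_mulS_one {ι : Type} {V : ι → VBundle.{v} EX X} {x : X}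
    {f : RawForm (VBundle.line EX X) 0} (hf : SmoothForm f) (h : sval f x ![] = 1) (η : Omega V) :
    evalΩ x (mulS f hf η) = evalΩ x η := evalAt_scalarWedge_one (V := V) h (η : RawForms V)

theorem map_map_add_smul {M N W : Type*} [AddCommGroup M] [Module ℝ M] [AddCommGroup N]
    [Module ℝ N] [AddCommGroup W] [Module ℝ W] (f : N →ₗ[ℝ] W) (g : M →ₗ[ℝ] N) (a b : M) (s : ℝ) :
    f (g (a + s • b)) = f (g a) + s • f (g b) := by
  rw [map_add, map_smul, map_add, map_smul]

theorem sub_of_eq_add {N W : Type*} [AddCommGroup N] [Module ℝ N] [AddCommGroup W] [Module ℝ W]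
    (f : N →ₗ[ℝ] W) (g : N →ₗ[ℝ] N) {a b c d : N} {w : W} {s : ℝ} (h : f a = w + s • f (g c))
    (h' : f b = w + s • f (g d)) : f (a - b) = s • f (g (c - d)) := by
  rw [map_sub, h, h', map_sub, map_sub, smul_sub]
  abel

theorem evalΩ_localD_mulS {x₀ : X} {p : P} (h : ∀ q ∈ E.support, (E.part q).bump x₀ (Q.proj p) = 1)
    {k : ℕ} {σ : RawForm (VBundle.line EP P) k} (hσ : SmoothForm σ)
    (η : Omega (E.pullback Q).part) : evalΩ p (localD Q D x₀ (mulS σ hσ η)) =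
      evalΩ p (mulS (extD σ) (smoothForm_extD hσ) η) +
        (-1 : ℝ) ^ k • evalΩ p (mulS σ hσ (localD Q D x₀ η)) := by
  have key := linear_eq_zero ((evalΩ p).comp ((localD Q D x₀).comp (mulS σ hσ)) -
    ((evalΩ p).comp (mulS (extD σ) (smoothForm_extD hσ)) +
      (-1 : ℝ) ^ k • (evalΩ p).comp ((mulS σ hσ).comp (localD Q D x₀)))) ?_ η
  · exact sub_eq_zero.1 key
  intro r q hq ζ hζ
  refine sub_eq_zero.2 ?_
  refine (congrArg (evalΩ p) (localD_mulS_inclΩ Q D x₀ hq hσ hζ)).trans ?_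
  refine ((evalΩ p).map_add _ _).trans ?_
  refine congrArg₂ (· + ·) ?_ ((evalΩ p).map_smul _ _)
  refine evalΩ_mulS_right _ ?_
  refine (congrArg (evalAt p) (sum_frame Q x₀ hζ)).symm.trans ?_
  refine evalAt_scalarWedge_one (V := (E.pullback Q).part) ?_ _
  change (E.part q).bump x₀ (Q.proj p) * (E.part q).bump x₀ (Q.proj p) = 1
  rw [h q hq, one_mul]

/-- The local frames around `x₀` are frames near `x`. -/
def FrameAt (E : GradedBundle.{v} EX X) (x₀ x : X) : Prop :=
  ∀ q ∈ E.support, ∀ᶠ y in nhds x, (E.part q).bump x₀ y = 1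

theorem eventually_frameAt (E : GradedBundle.{v} EX X) (x₀ : X) :
    ∀ᶠ x in nhds x₀, FrameAt E x₀ x :=
  (Filter.eventually_all_finset _).2 fun q _ =>
    ((E.part q).bump x₀).eventuallyEq_one.eventually_nhds

theorem FrameAt.eq_one {x₀ x : X} (h : FrameAt E x₀ x) : ∀ q ∈ E.support, (E.part q).bump x₀ x = 1 :=
  fun q hq => (h q hq).self_of_nhds

theorem frameCoef_frame (x₀ : X) {q : ℤ} (i j : Fin (Module.finrank ℝ (E.part q).F)) {p : P}
    (h : (E.part q).bump x₀ (Q.proj p) = 1) :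
    frameCoef Q x₀ j (secForm (A := (E.part q).pullback Q) fun p => (E.part q).toPullback Q p
      ((E.part q).sec x₀ (Module.finBasis ℝ (E.part q).F i) (Q.proj p))) p =
    fnForm (EX := EP) (fun _ => if i = j then 1 else 0) p := by
  refine ContinuousAlternatingMap.ext fun v => ?_
  change (E.part q).bump x₀ (Q.proj p) * (Module.finBasis ℝ (E.part q).F).coord j
    ((E.part q).tr x₀ (Q.proj p) ((E.part q).bump x₀ (Q.proj p) • (E.part q).trs x₀ (Q.proj p)
      (Module.finBasis ℝ (E.part q).F i))) = if i = j then 1 else 0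
  have hx : Q.proj p ∈ (E.part q).nb x₀ := by
    by_contra h'
    rw [(E.part q).bump_eq_zero h'] at h
    exact zero_ne_one h
  rw [h, one_smul, one_mul, (E.part q).tr_trs hx, Module.Basis.coord_apply,
    Module.Basis.repr_self, Finsupp.single_apply]

theorem evalΩ_localD_frameForm {x₀ : X} {p : P} (h : FrameAt E x₀ (Q.proj p)) {q : ℤ}
    (hq : q ∈ E.support) (i : Fin (Module.finrank ℝ (E.part q).F)) :
    evalΩ p (localD Q D x₀ (pullbackΩ Q (frameForm x₀ q i))) =
      evalΩ p (pullbackΩ Q (D (frameForm x₀ q i))) := by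
  set s : RawForm ((E.pullback Q).part q) 0 := secForm (A := (E.part q).pullback Q) fun p =>
    (E.part q).toPullback Q p ((E.part q).sec x₀ (Module.finBasis ℝ (E.part q).F i) (Q.proj p))
    with hs
  have h1 : (pullbackΩ Q (frameForm x₀ q i) : RawForms (E.pullback Q).part) = incl 0 q s :=
    pullbackΩ_inclΩ Q q _
  have hs' : SmoothForm s := by
    have := (pullbackΩ Q (frameForm (E := E) x₀ q i)).2 0 q
    rw [h1, incl_same] at this
    exact this
  have h2 : pullbackΩ Q (frameForm x₀ q i) = inclΩ 0 q s hs' := Subtype.ext h1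
  have hev : ∀ j, ∀ᶠ p' in nhds p, frameCoef Q x₀ j s p' =
      fnForm (EX := EP) (fun _ => if i = j then 1 else 0) p' := fun j =>
    (Q.proj.contMDiff.continuous.continuousAt.eventually (h q hq)).mono fun p' h' =>
      frameCoef_frame Q x₀ i j h'
  have hc : ∀ j, evalΩ p (localTerm Q D x₀ q j 0 (inclΩ 0 q s hs')) =
      evalAt p (scalarWedge (fnForm (EX := EP) (fun _ => if i = j then 1 else 0))
        (pullbackΩ Q (D (frameForm x₀ q j)) : RawForms (E.pullback Q).part)) := by
    intro j
    have h0 : extD (frameCoef Q x₀ j s) p = (0 : RawForm (VBundle.line EP P) 1) p := by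
      rw [extD_congr (hev j)]
      split_ifs
      · rw [extD_one]
      · rw [show fnForm (EX := EP) (X := P) (fun _ => 0) = 0 from rfl, extD_zero]
    have hA : ∀ h', evalΩ p (mulS (extD (frameCoef Q x₀ j s)) h'
        (pullbackΩ Q (frameForm x₀ q j))) = 0 := fun h' => by
      refine (evalAt_scalarWedge_congr (V := (E.pullback Q).part) h0 _).trans ?_
      rw [scalarWedge_zero_left, map_zero]
    rw [localTerm_inclΩ, pow_zero, one_smul, map_add, hA, zero_add]
    exact evalAt_scalarWedge_congr (V := (E.pullback Q).part) (hev j).self_of_nhds _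
  rw [h2, localD_inclΩ Q D x₀ hq, map_sum, Finset.sum_congr rfl fun j _ => hc j,
    Finset.sum_eq_single i]
  · exact evalAt_scalarWedge_one (V := (E.pullback Q).part)
      (f := fnForm (EX := EP) (fun _ => if i = i then 1 else 0)) (if_pos rfl) _
  · intro j _ hj
    rw [show fnForm (EX := EP) (X := P) (fun _ => if i = j then 1 else 0) = 0 by
      rw [if_neg (Ne.symm hj)]; rfl, scalarWedge_zero_left, map_zero]
  · exact fun h => absurd (Finset.mem_univ i) h

theorem evalΩ_localD_pullbackΩ (hD : IsSuperconnection E D) {x₀ : X} {p : P}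
    (h : FrameAt E x₀ (Q.proj p)) (ζ : Omega E.part) :
    evalΩ p (localD Q D x₀ (pullbackΩ Q ζ)) = evalΩ p (pullbackΩ Q (D ζ)) := by
  set Z : Omega E.part →ₗ[ℝ] Omega (E.pullback Q).part :=
    (localD Q D x₀).comp (pullbackΩ Q) - (pullbackΩ Q).comp D with hZ
  have key : ∀ (k : ℕ) (σ : RawForm (VBundle.line EX X) k) (hσ : SmoothForm σ) (η : Omega E.part),
      evalΩ p (Z (mulS σ hσ η)) = (-1 : ℝ) ^ k • evalΩ p (mulS (pullS EP Q.proj σ)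
        (smoothForm_pullS_proj Q hσ) (Z η)) := by
    intro k σ hσ η
    have e1 : evalΩ p (localD Q D x₀ (pullbackΩ Q (mulS σ hσ η))) =
        evalΩ p (mulS (pullS EP Q.proj (extD σ)) (smoothForm_pullS_proj Q (smoothForm_extD hσ))
          (pullbackΩ Q η)) + (-1 : ℝ) ^ k • evalΩ p (mulS (pullS EP Q.proj σ)
            (smoothForm_pullS_proj Q hσ) (localD Q D x₀ (pullbackΩ Q η))) := by
      rw [pullbackΩ_mulS, evalΩ_localD_mulS Q h.eq_one]
      refine congrArg₂ (· + ·) (congrArg (evalΩ p) (Subtype.ext ?_)) rfl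
      exact congrArg (fun τ => scalarWedge τ (pullbackΩ Q η : RawForms (E.pullback Q).part))
        (extD_pullS_proj Q hσ)
    have e2 : evalΩ p (pullbackΩ Q (D (mulS σ hσ η))) =
        evalΩ p (mulS (pullS EP Q.proj (extD σ)) (smoothForm_pullS_proj Q (smoothForm_extD hσ))
          (pullbackΩ Q η)) + (-1 : ℝ) ^ k • evalΩ p (mulS (pullS EP Q.proj σ)
            (smoothForm_pullS_proj Q hσ) (pullbackΩ Q (D η))) := by
      rw [hD.mulS, ← pullbackΩ_mulS, ← pullbackΩ_mulS]
      exact map_map_add_smul (evalΩ p) (pullbackΩ Q) _ _ _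
    rw [hZ, LinearMap.sub_apply, LinearMap.sub_apply]
    change evalΩ p (localD Q D x₀ (pullbackΩ Q (mulS σ hσ η)) - pullbackΩ Q (D (mulS σ hσ η))) =
      (-1 : ℝ) ^ k • evalΩ p (mulS (pullS EP Q.proj σ) (smoothForm_pullS_proj Q hσ)
        (localD Q D x₀ (pullbackΩ Q η) - pullbackΩ Q (D η)))
    exact sub_of_eq_add (evalΩ p) (mulS _ _) e1 e2
  have hr : ∀ q ∈ E.support, Generates (E.part q) (Q.proj p) (Set.range fun j =>
      secForm ((E.part q).sec x₀ (Module.finBasis ℝ (E.part q).F j))) := fun q hq =>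
    generates_sec x₀ (f := id) (fun m => ContinuousLinearEquiv.refl ℝ ((E.part q).fib m))
      contMDiff_id (fun m₀ => ⟨ContinuousLinearEquiv.refl ℝ (E.part q).F,
        Filter.Eventually.of_forall fun m a => rfl⟩) (h.eq_one q hq)
  have := eq_zero_of_generates (Q.proj p) _ hr
    (by rintro q _ ⟨j, rfl⟩; exact smoothForm_sec _ _ _) ((evalΩ p).comp Z)
    (fun k σ hσ η h0 => ?_) (fun f hf η h1 h0 => ?_) ?_ ζ
  · exact sub_eq_zero.1 ((map_sub (evalΩ p) _ _).symm.trans this)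
  · refine (key k σ hσ η).trans ?_
    rw [evalΩ_mulS_right (smoothForm_pullS_proj Q hσ) (ζ := 0) (h0.trans (map_zero _).symm),
      map_zero, map_zero, smul_zero]
  · have h2 := key 0 f hf η
    rw [pow_zero, one_smul, evalΩ_mulS_one] at h2
    · exact h2.symm.trans h0
    · refine Eq.trans ?_ h1
      change sval f (Q.proj p) _ = _
      exact congrArg _ (Subsingleton.elim _ _)
  · rintro q hq _ ⟨j, rfl⟩
    refine (map_sub (evalΩ p) _ _).trans (sub_eq_zero.2 ?_)
    exact evalΩ_localD_frameForm Q h hq j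

theorem evalΩ_localD_congr (hD : IsSuperconnection E D) {x₀ x₁ : X} {p : P}
    (h₀ : FrameAt E x₀ (Q.proj p)) (h₁ : FrameAt E x₁ (Q.proj p))
    (η : Omega (E.pullback Q).part) :
    evalΩ p (localD Q D x₀ η) = evalΩ p (localD Q D x₁ η) := by
  have key : ∀ (k : ℕ) (σ : RawForm (VBundle.line EP P) k) (hσ : SmoothForm σ)
      (η : Omega (E.pullback Q).part), evalΩ p ((localD Q D x₀ - localD Q D x₁) (mulS σ hσ η)) =
        (-1 : ℝ) ^ k • evalΩ p (mulS σ hσ ((localD Q D x₀ - localD Q D x₁) η)) := by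
    intro k σ hσ η
    exact sub_of_eq_add (evalΩ p) (mulS σ hσ) (evalΩ_localD_mulS Q h₀.eq_one hσ η)
      (evalΩ_localD_mulS Q h₁.eq_one hσ η)
  have := eq_zero_of_pullback Q p ((evalΩ p).comp (localD Q D x₀ - localD Q D x₁))
    (fun k σ hσ η h0 => ?_) (fun f hf η h1 h0 => ?_) (fun ζ => ?_) η
  · exact sub_eq_zero.1 ((map_sub (evalΩ p) _ _).symm.trans this)
  · refine (key k σ hσ η).trans ?_
    rw [evalΩ_mulS_right hσ (ζ := 0) (h0.trans (map_zero _).symm), map_zero, map_zero, smul_zero]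
  · have h2 := key 0 f hf η
    rw [pow_zero, one_smul, evalΩ_mulS_one hf h1] at h2
    exact h2.symm.trans h0
  · refine (map_sub (evalΩ p) _ _).trans (sub_eq_zero.2 ?_)
    rw [evalΩ_localD_pullbackΩ Q hD h₀, evalΩ_localD_pullbackΩ Q hD h₁]

end LocalOperator

section Pullback

theorem PrincipalBundle.mfderiv_proj_act (g : G) (p : P) (v : EP) :
    (mfderiv 𝓘(ℝ, EP) 𝓘(ℝ, EX) Q.proj (Q.act p g)
      (mfderiv 𝓘(ℝ, EP) 𝓘(ℝ, EP) (fun q => Q.act q g) p v : EP) : EX) =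
      mfderiv 𝓘(ℝ, EP) 𝓘(ℝ, EX) Q.proj p v := by
  have h1 := mfderiv_comp p (Q.mdifferentiable_proj (Q.act p g))
    ((Q.contMDiff_act_right g p).mdifferentiableAt (by simp))
  have h2 : (Q.proj : P → X) ∘ (fun q => Q.act q g) = Q.proj := funext fun q => Q.proj_act q g
  have h3 := congrArg (fun L : EP →L[ℝ] EX => L v) h1
  refine h3.symm.trans ?_
  have key : ∀ f : P → X, f = Q.proj → (mfderiv 𝓘(ℝ, EP) 𝓘(ℝ, EX) f p v : EX) =
    mfderiv 𝓘(ℝ, EP) 𝓘(ℝ, EX) Q.proj p v := by rintro _ rfl; rfl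
  exact key _ h2

theorem PrincipalBundle.mfderiv_proj_fundamental (x : GroupLieAlgebra 𝓘(ℝ, EG) G) (p : P) :
    (mfderiv 𝓘(ℝ, EP) 𝓘(ℝ, EX) Q.proj p (show EP from Q.fundamental x p) : EX) = 0 := by
  have key : ∀ p', Q.act p 1 = p' → (mfderiv 𝓘(ℝ, EP) 𝓘(ℝ, EX) Q.proj p'
      (show EP from Q.fundamental x p) : EX) = mfderiv 𝓘(ℝ, EG) 𝓘(ℝ, EX)
        ((Q.proj : P → X) ∘ fun g => Q.act p g) 1 x := by
    rintro _ rfl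
    have h1 := mfderiv_comp (1 : G) (Q.mdifferentiable_proj (Q.act p 1))
      ((Q.contMDiff_act_left p 1).mdifferentiableAt (by simp))
    exact (congrArg (fun L : EG →L[ℝ] EX => L x) h1).symm
  rw [key p (Q.act_one p)]
  have h2 : (Q.proj : P → X) ∘ (fun g => Q.act p g) = fun _ => Q.proj p :=
    funext fun g => Q.proj_act p g
  have h3 : ∀ f : G → X, f = (fun _ => Q.proj p) → (mfderiv 𝓘(ℝ, EG) 𝓘(ℝ, EX) f 1 x : EX) = 0 := by
    rintro _ rfl; rw [mfderiv_const]; rfl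
  exact h3 _ h2

section

variable {A : VBundle.{v} EX X} {A' : VBundle.{v} EP P} (c : ∀ p, A.fib (Q.proj p) ≃L[ℝ] A'.fib p)

theorem PrincipalBundle.contrF_pull (x : GroupLieAlgebra 𝓘(ℝ, EG) G) {r : ℕ}
    (α : RawForm A (r + 1)) : Q.contrF x (Q.pull c α) = 0 := by
  funext p
  refine ContinuousAlternatingMap.ext fun v => ?_
  change c p (α (Q.proj p) fun i => mfderiv 𝓘(ℝ, EP) 𝓘(ℝ, EX) Q.proj p
    (Matrix.vecCons (Q.fundamental x p) v i)) = 0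
  rw [(α (Q.proj p)).map_coord_zero 0, map_zero]
  exact Q.mfderiv_proj_fundamental x p

theorem PrincipalBundle.actF_pull {ρ : Q.FibreAction A'} (hc : ∀ g p a, ρ g p (c p a) =
    c (Q.act p g) (A.congrFib (Q.proj_act p g).symm a)) {r : ℕ} (g : G) (α : RawForm A r) :
    Q.actF ρ g (Q.pull c α) = Q.pull c α := by
  funext p
  refine ContinuousAlternatingMap.ext fun v => ?_
  change (ρ g p).symm (c (Q.act p g) (α (Q.proj (Q.act p g)) fun i =>
    mfderiv 𝓘(ℝ, EP) 𝓘(ℝ, EX) Q.proj (Q.act p g) (mfderiv 𝓘(ℝ, EP) 𝓘(ℝ, EP)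
      (fun q => Q.act q g) p (v i) : EP))) =
    c p (α (Q.proj p) fun i => mfderiv 𝓘(ℝ, EP) 𝓘(ℝ, EX) Q.proj p (v i))
  rw [ContinuousLinearEquiv.symm_apply_eq, hc]
  have key : ∀ y (h : Q.proj p = y) (w w' : Fin r → EX), w' = w →
      α y w' = A.congrFib h (α (Q.proj p) w) := by
    rintro _ rfl w _ rfl; rfl
  exact congrArg _ (key _ (Q.proj_act p g).symm _ _ (funext fun i => Q.mfderiv_proj_act g p (v i)))

end

theorem isAction_pullbackAction (A : VBundle.{v} EX X) : Q.IsAction (pullbackAction Q A) := by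
  have key : ∀ {p p' : P} {a : A.fib (Q.proj p)} {a' : A.fib (Q.proj p')}, p = p' →
      (⟨Q.proj p, a⟩ : TotalSpace A.F A.fib) = ⟨Q.proj p', a'⟩ →
      (⟨p, a⟩ : TotalSpace (A.pullback Q).F (A.pullback Q).fib) = ⟨p', a'⟩ := by
    rintro p _ a a' rfl h
    rw [VBundle.eq_of_total h]
  refine ⟨fun p a => key (Q.act_one p) (A.congrFib_total _ _), fun g h p a =>
    key (Q.act_mul p g h) ((A.congrFib_total _ _).trans
      ((A.congrFib_total _ _).trans (A.congrFib_total _ _)).symm), fun m₀ => ?_⟩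
  set p₀ := m₀.1.1 with hp₀
  set q₀ := Q.act m₀.1.1 m₀.2 with hq₀
  have hpr : ContMDiff ((𝓘(ℝ, EP).prod 𝓘(ℝ, (A.pullback Q).F)).prod 𝓘(ℝ, EG)) 𝓘(ℝ, EP) ∞
      (fun m : TotalSpace (A.pullback Q).F (A.pullback Q).fib × G => m.1.1) :=
    (Bundle.contMDiff_proj (A.pullback Q).fib).comp contMDiff_fst
  have hact : ContMDiff ((𝓘(ℝ, EP).prod 𝓘(ℝ, (A.pullback Q).F)).prod 𝓘(ℝ, EG)) 𝓘(ℝ, EP) ∞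
      (fun m : TotalSpace (A.pullback Q).F (A.pullback Q).fib × G => Q.act m.1.1 m.2) :=
    Q.smooth_act.comp (hpr.prodMk contMDiff_snd)
  have h3 : ContMDiffAt ((𝓘(ℝ, EP).prod 𝓘(ℝ, (A.pullback Q).F)).prod 𝓘(ℝ, EG))
      𝓘(ℝ, (A.pullback Q).F) ∞ (fun m : TotalSpace (A.pullback Q).F (A.pullback Q).fib × G =>
        (trivializationAt (A.pullback Q).F (A.pullback Q).fib p₀ m.1).2) m₀ := (((trivializationAt (A.pullback Q).F (A.pullback Q).fib p₀).contMDiffAt_iff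
    (f := fun m : TotalSpace (A.pullback Q).F (A.pullback Q).fib × G => m.1) (x₀ := m₀)
    (by exact (Trivialization.mem_source _).2 ((A.pullback Q).mem_nb p₀))).1 contMDiffAt_fst).2
  refine ((trivializationAt (A.pullback Q).F (A.pullback Q).fib q₀).contMDiffAt_iff
    (by exact (Trivialization.mem_source _).2 ((A.pullback Q).mem_nb q₀))).2 ⟨hact m₀, ?_⟩
  refine h3.congr_of_eventuallyEq ?_
  filter_upwards [(hpr m₀).continuousAt.preimage_mem_nhds
      (((A.pullback Q).isOpen_nb _).mem_nhds ((A.pullback Q).mem_nb p₀)),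
    (hact m₀).continuousAt.preimage_mem_nhds
      (((A.pullback Q).isOpen_nb _).mem_nhds ((A.pullback Q).mem_nb q₀))] with m hA hA'
  refine ((A.pullback Q).tr_eq hA' _).symm.trans (Eq.trans ?_ ((A.pullback Q).tr_eq hA _))
  exact A.tr_congrFib (Q.proj_act p₀ m₀.2).symm (Q.proj_act m.1.1 m.2).symm m.1.2

theorem actForms_pullbackForms {E : GradedBundle.{v} EX X} (g : G) (η : RawForms E.part) :
    Q.actForms (V := (E.pullback Q).part) (fun k => pullbackAction Q (E.part k)) g
      (pullbackForms Q η) = pullbackForms Q η :=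
  funext fun r => funext fun i => Q.actF_pull ((E.part i).toPullback Q)
    (ρ := pullbackAction Q (E.part i)) (fun _ _ _ => rfl) g (η r i)

theorem contraction_pullbackForms {E : GradedBundle.{v} EX X} (x : GroupLieAlgebra 𝓘(ℝ, EG) G)
    (η : RawForms E.part) : Q.contraction x (pullbackForms Q η) = 0 :=
  funext fun r => funext fun i => Q.contrF_pull ((E.part i).toPullback Q) x (η (r + 1) i)

theorem lieDerivative_pullbackForms {E : GradedBundle.{v} EX X} (x : GroupLieAlgebra 𝓘(ℝ, EG) G)
    (η : RawForms E.part) :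
    Q.lieDerivative (V := (E.pullback Q).part) (fun k => pullbackAction Q (E.part k)) x
      (pullbackForms Q η) = 0 :=
  funext fun r => funext fun i => (Q.lieDerivative_eq (V := (E.pullback Q).part) _ _ _ _ _).trans <|
    Q.lieF_eq_zero_of_invariant fun g =>
      congrFun (congrFun (actForms_pullbackForms Q g η) r) i

section

variable [T2Space X] [T2Space P] {E : GradedBundle.{v} EX X} {D : Omega E.part →ₗ[ℝ] Omega E.part}

/-- The operator which is given by `T p` at the point `p`. -/
def pointwiseΩ {ι : Type} {V : ι → VBundle.{v} EP P} (T : P → Omega V →ₗ[ℝ] Omega V)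
    (hs : ∀ (η : Omega V) (n : ℕ) (i : ι), SmoothForm fun p => (T p η : RawForms V) n i p) :
    Omega V →ₗ[ℝ] Omega V where
  toFun η := ⟨fun n i p => (T p η : RawForms V) n i p, fun n i => hs η n i⟩
  map_add' η ζ := Subtype.ext <| by
    funext n i p
    change (T p (η + ζ) : RawForms V) n i p = (T p η : RawForms V) n i p + (T p ζ : RawForms V) n i p
    rw [map_add]
    rfl
  map_smul' c η := Subtype.ext <| by
    funext n i p
    change (T p (c • η) : RawForms V) n i p = c • (T p η : RawForms V) n i p
    rw [map_smul]
    rfl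

/-- The pullback superconnection. -/
def pullbackD (hD : IsSuperconnection E D) :
    Omega (E.pullback Q).part →ₗ[ℝ] Omega (E.pullback Q).part :=
  pointwiseΩ (fun p => localD Q D (Q.proj p)) fun η n i => smoothForm_of_at fun p₀ => by
    refine (((localD Q D (Q.proj p₀) η).2 n i).at p₀).congr ?_
    filter_upwards [Q.proj.contMDiff.continuous.continuousAt.eventually
      (eventually_frameAt E (Q.proj p₀))] with p hp
    exact congrFun (congrFun (evalΩ_localD_congr Q hD
      (eventually_frameAt E (Q.proj p)).self_of_nhds hp η) n) i

theorem evalΩ_ext {ι : Type} {V : ι → VBundle.{v} EX X} {η ζ : Omega V}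
    (h : ∀ x, evalΩ x η = evalΩ x ζ) : η = ζ :=
  Subtype.ext <| funext fun n => funext fun i => funext fun x => congrFun (congrFun (h x) n) i

theorem isHomogeneous_pullbackForms {n : ℤ} {η : RawForms E.part} (h : IsHomogeneous id n η) :
    IsHomogeneous id n (pullbackForms Q η) := fun p i hp => by
  funext m
  refine ContinuousAlternatingMap.ext fun v => ?_
  change η p i (Q.proj m) _ = 0
  rw [h p i hp]
  rfl

theorem isHomogeneous_localD (hD : IsSuperconnection E D) (x₀ : X) {n : ℤ}
    {η : Omega (E.pullback Q).part}
    (h : IsHomogeneous id n (η : RawForms (E.pullback Q).part)) :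
    IsHomogeneous id (n + 1) (localD Q D x₀ η : RawForms (E.pullback Q).part) := by
  intro s i hs
  have : ∀ r q j, (localTerm Q D x₀ q j r η : RawForms (E.pullback Q).part) s i = 0 := by
    intro r q j
    by_cases hr : (r : ℤ) + q = n
    · have hq : (q : ℤ) = (0 : ℕ) + q := by simp
      have h1 : IsHomogeneous id q (frameForm (E := E) x₀ q j : RawForms E.part) := by
        have := isHomogeneous_incl (E := E) 0 q
          (secForm ((E.part q).sec x₀ (Module.finBasis ℝ (E.part q).F j)))
        rw [Nat.cast_zero, zero_add] at this
        exact this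
      have h2 := isHomogeneous_pullbackForms Q h1
      have h3 := isHomogeneous_pullbackForms Q (hD.degree q _ h1)
      have h4 := isHomogeneous_scalarWedge (E := E.pullback Q)
        (extD (frameCoef Q x₀ j ((η : RawForms (E.pullback Q).part) r q))) h2
      have h5 := isHomogeneous_scalarWedge (E := E.pullback Q)
        (frameCoef Q x₀ j ((η : RawForms (E.pullback Q).part) r q)) h3
      rw [show q + ((r + 1 : ℕ) : ℤ) = n + 1 by push_cast; omega] at h4
      rw [show q + 1 + (r : ℤ) = n + 1 by omega] at h5
      exact isHomogeneous_add h4 (isHomogeneous_smul ((-1 : ℝ) ^ r) h5) s i hs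
    · rw [localTerm_eq_zero Q D x₀ j (h r q hr)]
      rfl
  have h0 : ∀ {ι : Type} (t : Finset ι) (f : ι → Omega (E.pullback Q).part),
      (∀ a ∈ t, (f a : RawForms (E.pullback Q).part) s i = 0) →
      ((∑ a ∈ t, f a : Omega (E.pullback Q).part) : RawForms (E.pullback Q).part) s i = 0 := by
    intro ι t f hf
    rw [AddSubmonoidClass.coe_finsetSum, Finset.sum_apply, Finset.sum_apply]
    exact Finset.sum_eq_zero hf
  rw [localD]
  simp only [LinearMap.sum_apply]
  exact h0 _ _ fun r _ => h0 _ _ fun q _ => h0 _ _ fun j _ => this r q j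

theorem pullbackD_pullbackΩ (hD : IsSuperconnection E D) (ζ : Omega E.part) :
    pullbackD Q hD (pullbackΩ Q ζ) = pullbackΩ Q (D ζ) :=
  evalΩ_ext fun p => evalΩ_localD_pullbackΩ Q hD
    (eventually_frameAt E (Q.proj p)).self_of_nhds ζ

theorem isSuperconnection_pullbackD (hD : IsSuperconnection E D) :
    IsSuperconnection (E.pullback Q) (pullbackD Q hD) where
  degree n η h s i hs := funext fun p => congrFun (isHomogeneous_localD Q hD (Q.proj p) h s i hs) p
  leibniz k σ hσ η := by
    refine ⟨omega_scalarWedge hσ η.2, ?_⟩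
    have h : pullbackD Q hD (mulS σ hσ η) = mulS (extD σ) (smoothForm_extD hσ) η +
        (-1 : ℝ) ^ k • mulS σ hσ (pullbackD Q hD η) := evalΩ_ext fun p => by
      refine (evalΩ_localD_mulS Q (D := D)
        (eventually_frameAt E (Q.proj p)).self_of_nhds.eq_one hσ η).trans ?_
      refine Eq.trans (congrArg₂ (· + ·) rfl (congrArg _ (evalΩ_mulS_right hσ ?_)))
        (((evalΩ p).map_add _ _).trans (congrArg₂ (· + ·) rfl ((evalΩ p).map_smul _ _))).symm
      rfl
    exact congrArg Subtype.val h

end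

end Pullback

section Pullback

theorem IsSuperconnection.coe_mulS {E : GradedBundle.{v} EX X} {D : Omega E.part →ₗ[ℝ] Omega E.part}
    (hD : IsSuperconnection E D) {k : ℕ} {σ : RawForm (VBundle.line EX X) k} (hσ : SmoothForm σ)
    (η : Omega E.part) : (D (ChernWeil.mulS σ hσ η) : RawForms E.part) =
      scalarWedge (extD σ) (η : RawForms E.part) +
        (-1 : ℝ) ^ k • scalarWedge σ (D η : RawForms E.part) :=
  congrArg Subtype.val (hD.mulS hσ η)

theorem IsSuperconnection.sq_mulS {E : GradedBundle.{v} EX X}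
    {D : Omega E.part →ₗ[ℝ] Omega E.part} (hD : IsSuperconnection E D) {k : ℕ}
    {σ : RawForm (VBundle.line EX X) k} (hσ : SmoothForm σ) (η : Omega E.part) :
    (D (D (ChernWeil.mulS σ hσ η)) : RawForms E.part) =
      scalarWedge σ (D (D η) : RawForms E.part) := by
  have h := map_map_add_smul (LinearMap.id (R := ℝ) (M := Omega E.part)) D
    (ChernWeil.mulS (extD σ) (smoothForm_extD hσ) η) (ChernWeil.mulS σ hσ (D η)) ((-1 : ℝ) ^ k)
  rw [hD.mulS hσ]
  refine (congrArg Subtype.val h).trans ?_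
  change (D (ChernWeil.mulS (extD σ) (smoothForm_extD hσ) η) : RawForms E.part) + (-1 : ℝ) ^ k •
    (D (ChernWeil.mulS σ hσ (D η)) : RawForms E.part) = _
  rw [hD.coe_mulS, hD.coe_mulS, extD_extD hσ, scalarWedge_zero_left, smul_add, smul_smul, ← pow_add,
    ← two_mul, pow_mul, neg_one_sq, one_pow, one_smul, pow_succ, mul_neg_one, neg_smul]
  abel

theorem PrincipalBundle.smoothForm_pullS_act (g : G) {k : ℕ} {σ : RawForm (VBundle.line EP P) k}
    (hσ : SmoothForm σ) : SmoothForm (pullS EP (fun p => Q.act p g) σ) := smoothForm_of_at fun p =>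
  SmoothFormAt.pullS (Q.contMDiff_act_right g p) (hσ.at _)

theorem PrincipalBundle.actΩ_mulS {ι : Type} {V : ι → VBundle.{v} EP P}
    {ρ : ∀ i, Q.FibreAction (V i)} (hρ : ∀ i, Q.IsAction (ρ i)) (g : G) {k : ℕ}
    {σ : RawForm (VBundle.line EP P) k} (hσ : SmoothForm σ) (η : Omega V) :
    Q.actΩ hρ g (mulS σ hσ η) = mulS (pullS EP (fun p => Q.act p g) σ)
      (Q.smoothForm_pullS_act g hσ) (Q.actΩ hρ g η) :=
  Subtype.ext (Q.actForms_scalarWedge ρ g σ (η : RawForms V))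

theorem PrincipalBundle.commutator_actΩ_mulS {E : GradedBundle.{v} EP P}
    {ρ : ∀ k, Q.FibreAction (E.part k)} (hρ : ∀ k, Q.IsAction (ρ k))
    {D : Omega E.part →ₗ[ℝ] Omega E.part} (hD : IsSuperconnection E D) (g : G) {k : ℕ}
    {σ : RawForm (VBundle.line EP P) k} (hσ : SmoothForm σ) (η : Omega E.part) :
    (D.comp (Q.actΩ hρ g) - (Q.actΩ hρ g).comp D) (mulS σ hσ η) =
      (-1 : ℝ) ^ k • mulS (pullS EP (fun p => Q.act p g) σ) (Q.smoothForm_pullS_act g hσ)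
        ((D.comp (Q.actΩ hρ g) - (Q.actΩ hρ g).comp D) η) := by
  refine sub_of_eq_add LinearMap.id (mulS _ (Q.smoothForm_pullS_act g hσ)) (c := D (Q.actΩ hρ g η))
    (d := Q.actΩ hρ g (D η)) (w := mulS (pullS EP (fun p => Q.act p g) (extD σ))
      (Q.smoothForm_pullS_act g (smoothForm_extD hσ)) (Q.actΩ hρ g η)) ?_ ?_
  · refine (congrArg D (Q.actΩ_mulS hρ g hσ η)).trans ((hD.mulS _ _).trans ?_)
    refine congrArg₂ (· + ·) (Subtype.ext ?_) rfl
    exact congrArg (fun τ => scalarWedge τ (Q.actΩ hρ g η : RawForms E.part))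
      (funext fun p => extD_pullS (Q.contMDiff_act_right g p) (hσ.at _))
  · change Q.actΩ hρ g (D (mulS σ hσ η)) = _
    rw [hD.mulS, ← Q.actΩ_mulS, ← Q.actΩ_mulS]
    exact map_map_add_smul LinearMap.id (Q.actΩ hρ g) _ _ _

/-- The infinitesimal action on smooth forms, as a linear map. -/
def PrincipalBundle.lieL {ι : Type} {V : ι → VBundle.{v} EP P} {ρ : ∀ i, Q.FibreAction (V i)}
    (hρ : ∀ i, Q.IsAction (ρ i)) (x : GroupLieAlgebra 𝓘(ℝ, EG) G) : Omega V →ₗ[ℝ] RawForms V where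
  toFun η := Q.lieDerivative ρ x η
  map_add' η ζ := by
    funext r i
    rw [Pi.add_apply, Pi.add_apply, Q.lieDerivative_eq, Q.lieDerivative_eq, Q.lieDerivative_eq]
    exact (hρ i).lieF_add Q x (η.2 r i) (ζ.2 r i)
  map_smul' c η := by
    funext r i
    rw [Pi.smul_apply, Pi.smul_apply, Q.lieDerivative_eq, Q.lieDerivative_eq]
    exact (hρ i).lieF_smul Q x c (η.2 r i)

theorem PrincipalBundle.cartan_mulS {E : GradedBundle.{v} EP P} {ρ : ∀ k, Q.FibreAction (E.part k)}
    (hρ : ∀ k, Q.IsAction (ρ k)) {D : Omega E.part →ₗ[ℝ] Omega E.part} (hD : IsSuperconnection E D)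
    (x : GroupLieAlgebra 𝓘(ℝ, EG) G) {k : ℕ} {σ : RawForm (VBundle.line EP P) k}
    (hσ : SmoothForm σ) (η : Omega E.part) :
    (D (Q.contrΩ x (mulS σ hσ η)) : RawForms E.part) +
        Q.contraction x (D (mulS σ hσ η) : RawForms E.part) -
        Q.lieDerivative ρ x (scalarWedge σ (η : RawForms E.part)) =
      scalarWedge σ ((D (Q.contrΩ x η) : RawForms E.part) +
        Q.contraction x (D η : RawForms E.part) - Q.lieDerivative ρ x (η : RawForms E.part)) := by
  rw [Q.lieDerivative_scalarWedge hρ x hσ η.2, hD.coe_mulS, Q.contraction_add,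
    Q.contraction_smul, scalarWedge_sub, scalarWedge_add]
  cases k with
  | zero =>
    have e1 : Q.contrΩ x (mulS σ hσ η) = mulS σ hσ (Q.contrΩ x η) :=
      Subtype.ext (Q.contraction_scalarWedge_zero x σ (η : RawForms E.part))
    rw [e1, hD.coe_mulS, Q.contraction_scalarWedge_zero,
      Q.contraction_scalarWedge_succ, pow_zero, one_smul, one_smul, one_smul]
    change scalarWedge (extD σ) (Q.contraction x (η : RawForms E.part)) + _ +
      (scalarWedge (Q.contrF x (extD σ)) (η : RawForms E.part) - _ + _) -
      (scalarWedge (Q.contrF x (extD σ)) (η : RawForms E.part) + _) = _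
    abel
  | succ k =>
    have hσ' := Q.smoothForm_contrF x hσ
    have e1 : Q.contrΩ x (mulS σ hσ η) = mulS (Q.contrF x σ) hσ' η +
        (-(-1 : ℝ) ^ k) • mulS σ hσ (Q.contrΩ x η) := Subtype.ext <|
      (Q.contraction_scalarWedge_succ x σ (η : RawForms E.part)).trans <| by
        rw [sub_eq_add_neg, ← neg_smul]; rfl
    have e2 : (D (Q.contrΩ x (mulS σ hσ η)) : RawForms E.part) =
        (D (mulS (Q.contrF x σ) hσ' η) : RawForms E.part) +
          (-(-1 : ℝ) ^ k) • (D (mulS σ hσ (Q.contrΩ x η)) : RawForms E.part) := by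
      rw [e1, map_add, map_smul]
      rfl
    rw [e2, hD.coe_mulS, hD.coe_mulS, Q.contraction_scalarWedge_succ,
      Q.contraction_scalarWedge_succ]
    change _ + _ - (scalarWedge (extD (Q.contrF x σ) + Q.contrF x (extD σ))
      (η : RawForms E.part) + _) = _
    rw [scalarWedge_add_left]
    change _ + -(-1 : ℝ) ^ k • (scalarWedge (extD σ) (Q.contraction x (η : RawForms E.part)) + _) +
      _ - _ = _
    generalize scalarWedge (extD (Q.contrF x σ)) (η : RawForms E.part) = a₁
    generalize scalarWedge (Q.contrF x (extD σ)) (η : RawForms E.part) = a₂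
    generalize scalarWedge (extD σ) (Q.contraction x (η : RawForms E.part)) = a₃
    generalize scalarWedge (Q.contrF x σ) (D η : RawForms E.part) = a₄
    generalize scalarWedge σ (D (Q.contrΩ x η) : RawForms E.part) = a₅
    generalize scalarWedge σ (Q.contraction x (D η : RawForms E.part)) = a₆
    generalize scalarWedge σ (Q.lieDerivative ρ x (η : RawForms E.part)) = a₇
    rcases neg_one_pow_eq_or ℝ k with hk | hk <;> rw [pow_succ, hk] <;> module

namespace IsPullbackSuperconnection

variable [T2Space X] [T2Space P] {A : LocalSystem.{v} EX X}
  {D' D'' : Omega (A.E.pullback Q).part →ₗ[ℝ] Omega (A.E.pullback Q).part}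

variable {Q} in
theorem apply_pullbackΩ (h : IsPullbackSuperconnection Q A D') (ζ : Omega A.E.part) :
    D' (pullbackΩ Q ζ) = pullbackΩ Q (A.D ζ) := Subtype.ext (h.pullback ζ).choose_spec

variable {Q} in
theorem unique (h : IsPullbackSuperconnection Q A D') (h' : IsPullbackSuperconnection Q A D'') :
    D' = D'' := LinearMap.ext fun η => Subtype.ext <| sub_eq_zero.1 <| by
  refine ext_pullback Q ((Omega (A.E.pullback Q).part).subtype.comp (D' - D'')) (fun k => (-1) ^ k)
    (pow_zero _) (fun k σ hσ η => ?_) (fun ζ => ?_) η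
  · change (D' (mulS σ hσ η) : RawForms (A.E.pullback Q).part) - (D'' (mulS σ hσ η)).1 =
      (-1 : ℝ) ^ k • scalarWedge σ ((D' η : RawForms (A.E.pullback Q).part) - (D'' η).1)
    rw [h.superconnection.coe_mulS, h'.superconnection.coe_mulS, scalarWedge_sub, smul_sub]
    abel
  · change (D' (pullbackΩ Q ζ) : RawForms (A.E.pullback Q).part) - (D'' (pullbackΩ Q ζ)).1 = 0
    rw [h.apply_pullbackΩ, h'.apply_pullbackΩ, sub_self]

variable {Q} in
theorem isFlat (h : IsPullbackSuperconnection Q A D') : IsFlat D' := fun η => Subtype.ext <| by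
  refine ext_pullback Q ((Omega (A.E.pullback Q).part).subtype.comp (D'.comp D')) (fun _ => 1) rfl
    (fun k σ hσ η => ?_) (fun ζ => ?_) η
  · rw [one_smul]
    exact h.superconnection.sq_mulS hσ η
  · change (D' (D' (pullbackΩ Q ζ)) : RawForms (A.E.pullback Q).part) = 0
    rw [h.apply_pullbackΩ, h.apply_pullbackΩ, A.flat, map_zero]
    rfl

theorem equivariant (h : IsPullbackSuperconnection Q A D') (g : G)
    (η : Omega (A.E.pullback Q).part) :
    D' (Q.actΩ (fun k => isAction_pullbackAction Q (A.E.part k)) g η) =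
      Q.actΩ (fun k => isAction_pullbackAction Q (A.E.part k)) g (D' η) := by
  have hρ : ∀ k, Q.IsAction (A := (A.E.pullback Q).part k) (pullbackAction Q (A.E.part k)) :=
    fun k => isAction_pullbackAction Q (A.E.part k)
  set L := Q.actΩ (V := (A.E.pullback Q).part) hρ g with hL
  have key := fun (k : ℕ) (σ : RawForm (VBundle.line EP P) k) (hσ : SmoothForm σ) =>
    Q.commutator_actΩ_mulS hρ h.superconnection g hσ
  refine evalΩ_ext fun p => ?_
  have := eq_zero_of_pullback Q (Q.act p g) ((evalΩ p).comp (D'.comp L - L.comp D'))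
    (fun k σ hσ η h0 => ?_) (fun f hf η h1 h0 => ?_) (fun ζ => ?_) η
  · exact sub_eq_zero.1 ((map_sub (evalΩ p) _ _).symm.trans this)
  · refine (congrArg (evalΩ p) (key k σ hσ η)).trans ?_
    rw [map_smul, evalΩ_mulS_right (Q.smoothForm_pullS_act g hσ) (ζ := 0) (h0.trans (map_zero _).symm), map_zero,
      map_zero, smul_zero]
  · have h2 := congrArg (evalΩ p) (key 0 f hf η)
    rw [pow_zero, one_smul, evalΩ_mulS_one] at h2
    · exact h2.symm.trans h0
    · refine Eq.trans ?_ h1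
      change sval f (Q.act p g) _ = _
      exact congrArg _ (Subsingleton.elim _ _)
  · have hp : ∀ ζ : Omega A.E.part, L (pullbackΩ Q ζ) = pullbackΩ Q ζ := fun ζ =>
      Subtype.ext (actForms_pullbackForms Q g (ζ : RawForms A.E.part))
    refine (map_sub (evalΩ p) _ _).trans (sub_eq_zero.2 ?_)
    change evalΩ p (D' (L (pullbackΩ Q ζ))) = evalΩ p (L (D' (pullbackΩ Q ζ)))
    rw [hp, h.apply_pullbackΩ, hp]

theorem cartan (h : IsPullbackSuperconnection Q A D') (x : GroupLieAlgebra 𝓘(ℝ, EG) G)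
    (η : Omega (A.E.pullback Q).part) :
    (D' (Q.contrΩ x η) : RawForms (A.E.pullback Q).part) +
      Q.contraction x (D' η : RawForms (A.E.pullback Q).part) -
      Q.lieDerivative (V := (A.E.pullback Q).part) (fun k => pullbackAction Q (A.E.part k)) x
        (η : RawForms (A.E.pullback Q).part) = 0 := by
  have hρ : ∀ k, Q.IsAction (A := (A.E.pullback Q).part k) (pullbackAction Q (A.E.part k)) :=
    fun k => isAction_pullbackAction Q (A.E.part k)
  refine ext_pullback Q ((Omega (A.E.pullback Q).part).subtype.comp
    (D'.comp (Q.contrΩ x) + (Q.contrΩ x).comp D') - Q.lieL (V := (A.E.pullback Q).part) hρ x) (fun _ => 1) rfl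
    (fun k σ hσ η => ?_) (fun ζ => ?_) η
  · rw [one_smul]
    exact Q.cartan_mulS hρ h.superconnection x hσ η
  · change (D' (Q.contrΩ x (pullbackΩ Q ζ)) : RawForms (A.E.pullback Q).part) +
      Q.contraction x (D' (pullbackΩ Q ζ) : RawForms (A.E.pullback Q).part) -
      Q.lieDerivative (V := (A.E.pullback Q).part) (fun k => pullbackAction Q (A.E.part k)) x
        (pullbackForms Q (ζ : RawForms A.E.part)) = 0
    have e1 : Q.contrΩ x (pullbackΩ Q ζ) = 0 :=
      Subtype.ext (contraction_pullbackForms Q x (ζ : RawForms A.E.part))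
    rw [lieDerivative_pullbackForms, e1, map_zero, h.apply_pullbackΩ, sub_zero]
    refine (zero_add _).trans ?_
    exact contraction_pullbackForms Q x (A.D ζ : RawForms A.E.part)

end IsPullbackSuperconnection

theorem hasPullbacks [T2Space X] [T2Space P] : HasPullbacks.{v} Q where
  isAction := isAction_pullbackAction Q
  existsUnique A := ⟨pullbackD Q A.superconnection,
    ⟨isSuperconnection_pullbackD Q A.superconnection, fun η =>
      ⟨smoothForm_pullbackForms Q η.2,
        congrArg Subtype.val (pullbackD_pullbackΩ Q A.superconnection η)⟩⟩,
    fun D'' h => h.unique ⟨isSuperconnection_pullbackD Q A.superconnection, fun η =>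
      ⟨smoothForm_pullbackForms Q η.2,
        congrArg Subtype.val (pullbackD_pullbackΩ Q A.superconnection η)⟩⟩⟩
  flat A D' h := h.isFlat
  basic A D' h :=
    { equivariant := fun g η => ⟨(Q.actΩ (V := (A.E.pullback Q).part)
          (fun k => isAction_pullbackAction Q (A.E.part k)) g η).2,
        congrArg Subtype.val (h.equivariant Q g η)⟩
      cartan := fun x η => ⟨(Q.contrΩ x η).2, by
        rw [eq_sub_iff_add_eq]
        exact sub_eq_zero.1 (h.cartan Q x η)⟩ }

end Pullback

section Functors

variable {C : DGData.{u, w}} {D : DGData.{u', w'}} {F : DGFunctorData C D}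

theorem DGFunctorData.quasiFullyFaithful_of_bijOn (hC : C.IsDGCategory) (hD : D.IsDGCategory)
    (hF : F.IsDGFunctor) (h : ∀ A B n, Set.BijOn (F.map (A := A) (B := B)) (C.Hom A B n)
      (D.Hom (F.obj A) (F.obj B) n)) : F.QuasiFullyFaithful := by
  intro A B n
  have h0 : F.map (0 : C.Amb A B) = 0 := by
    simpa using hF.map_smul A B n 0 0 (hC.zero_mem A B n)
  have hd0 : D.d (n - 1) (0 : D.Amb (F.obj A) (F.obj B)) = 0 := by
    simpa using hD.d_smul (F.obj A) (F.obj B) (n - 1) 0 0 (hD.zero_mem _ _ _)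
  refine ⟨fun f hf g hg ⟨k', hk', e⟩ => ?_, fun g hg => ?_⟩
  · obtain ⟨k, hk, rfl⟩ := (h A B (n - 1)).surjOn hk'
    have hg' := hC.smul_mem A B n (-1) g hg.1
    have hd := hC.d_mem A B (n - 1) k hk
    rw [sub_add_cancel] at hd
    refine ⟨k, hk, ?_⟩
    rw [sub_eq_add_neg, ← neg_one_smul ℝ g]
    refine (h A B n).injOn (hC.add_mem A B n f hf.1 _ hg') hd ?_
    rw [hF.map_add A B n f hf.1 _ hg', hF.map_smul A B n (-1) g hg.1, hF.map_d A B (n - 1) k hk, ← e,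
      neg_one_smul, ← sub_eq_add_neg]
  · obtain ⟨f, hf, rfl⟩ := (h A B n).surjOn hg.1
    refine ⟨f, ⟨hf, ?_⟩, 0, hD.zero_mem _ _ _, by rw [hd0, sub_self]⟩
    refine (h A B (n + 1)).injOn (hC.d_mem A B n f hf) (hC.zero_mem _ _ _) ?_
    rw [hF.map_d A B n f hf, hg.2, h0]

theorem DGData.Iso.homotopyIso (hC : C.IsDGCategory) {A B : C.Obj} (h : C.Iso A B) :
    C.HomotopyIso A B := by
  obtain ⟨f, hf, g, hg, h1, h2⟩ := h
  have h0 : ∀ A : C.Obj, C.d (0 - 1) (0 : C.Amb A A) = 0 := fun A => by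
    simpa using hC.d_smul A A (0 - 1) 0 0 (hC.zero_mem _ _ _)
  exact ⟨f, hf, g, hg, ⟨0, hC.zero_mem _ _ _, by rw [h1, h0, sub_self]⟩,
    ⟨0, hC.zero_mem _ _ _, by rw [h2, h0, sub_self]⟩⟩

end Functors

section Defect

variable {E E' : GradedBundle.{v} EX X} {D : Omega E.part →ₗ[ℝ] Omega E.part}
  {D' : Omega E'.part →ₗ[ℝ] Omega E'.part} {n : ℤ} {α β : RawForms (E.hom E')}

/-- The failure of `β` to be the differential of `α`. -/
def defect (D : Omega E.part →ₗ[ℝ] Omega E.part) (D' : Omega E'.part →ₗ[ℝ] Omega E'.part) (n : ℤ)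
    (hα : α ∈ Omega (E.hom E')) (hβ : β ∈ Omega (E.hom E')) : Omega E.part →ₗ[ℝ] RawForms E'.part :=
  (Omega E'.part).subtype.comp (D'.comp (mulH α hα) - (-1 : ℝ) ^ n • (mulH α hα).comp D - mulH β hβ)

theorem isDifferential_of_defect (hα : α ∈ Omega (E.hom E')) (hβ : β ∈ Omega (E.hom E'))
    (h : ∀ η, defect D D' n hα hβ η = 0) : IsDifferential D D' n α β :=
  (isDifferential_iff hα hβ).2 fun η =>
    sub_eq_iff_eq_add.1 (sub_eq_zero.1 (Subtype.ext (h η) :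
      (D' (mulH α hα η) - (-1 : ℝ) ^ n • mulH α hα (D η)) - mulH β hβ η = 0))

theorem defect_mulS (hD : IsSuperconnection E D) (hD' : IsSuperconnection E' D')
    (hα : α ∈ homForms E E' n) (hβ : β ∈ homForms E E' (n + 1)) {k : ℕ}
    {σ : RawForm (VBundle.line EX X) k} (hσ : SmoothForm σ) (η : Omega E.part) :
    defect D D' n hα.1 hβ.1 (mulS σ hσ η) =
      (-1 : ℝ) ^ ((n + 1) * (k : ℤ)) • scalarWedge σ (defect D D' n hα.1 hβ.1 η) := by
  have h1 := congrArg₂ (· - ·) ((isTensorial_differential hD hD' hα.1 hα.2).mul k σ hσ η)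
    (mulH_mulS hβ.1 hβ.2 hσ η)
  refine (congrArg Subtype.val h1).trans ?_
  exact (smul_sub _ _ _).symm.trans (congrArg _ (scalarWedge_sub σ _ _).symm)

end Defect

section PullbackHom

theorem PrincipalBundle.pull_zero {A : VBundle.{v} EX X} {A' : VBundle.{v} EP P}
    (c : ∀ p, A.fib (Q.proj p) ≃L[ℝ] A'.fib p) {r : ℕ} : Q.pull c (0 : RawForm A r) = 0 :=
  funext fun p => ContinuousAlternatingMap.ext fun _ => map_zero (c p)

/-- The identity `Hom(A, B)_{π p} = Hom(π* A, π* B)_p`. -/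
def VBundle.toPullbackHom (A B : VBundle.{v} EX X) (p : P) :
    (A.hom B).fib (Q.proj p) ≃L[ℝ] ((A.pullback Q).hom (B.pullback Q)).fib p :=
  ContinuousLinearEquiv.refl ℝ ((A.hom B).fib (Q.proj p))

theorem VBundle.tr_toPullbackHom (A B : VBundle.{v} EX X) (p₀ : P) : ∀ᶠ p in nhds p₀, ∀ f,
    ((A.pullback Q).hom (B.pullback Q)).tr p₀ p (A.toPullbackHom Q B p f) =
      (A.hom B).tr (Q.proj p₀) (Q.proj p) f := by
  filter_upwards [((A.pullback Q).isOpen_nb p₀).mem_nhds ((A.pullback Q).mem_nb p₀),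
    ((B.pullback Q).isOpen_nb p₀).mem_nhds ((B.pullback Q).mem_nb p₀)] with p hA hB f
  refine ((A.pullback Q).hom_tr (B.pullback Q) hA hB _).trans
    (Eq.trans ?_ (A.hom_tr B (x₀ := Q.proj p₀) (x := Q.proj p) hA hB f).symm)
  refine ContinuousLinearMap.ext fun a => congrArg (fun b =>
    B.tr (Q.proj p₀) (Q.proj p) (homVal A B (Q.proj p) f b)) ?_
  exact A.tr_injective hA (((A.pullback Q).tr_trs hA a).trans
    (A.tr_trs (x₀ := Q.proj p₀) (x := Q.proj p) hA a).symm)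

theorem homAct_pullbackAction (A B : VBundle.{v} EX X) (g : G) (p : P) (f : (A.hom B).fib (Q.proj p)) :
    Q.homAct (pullbackAction Q A) (pullbackAction Q B) g p (A.toPullbackHom Q B p f) =
      A.toPullbackHom Q B (Q.act p g) ((A.hom B).congrFib (Q.proj_act p g).symm f) := by
  have key : ∀ {x y : X} (h : x = y) (f : A.fib x →L[ℝ] B.fib x),
      (A.congrFib h).arrowCongr (B.congrFib h) f = (A.hom B).congrFib h f := by
    rintro x _ rfl f; rfl
  exact key _ f

variable {E E' E'' : GradedBundle.{v} EX X}

theorem pullbackHom_injective : Function.Injective (pullbackHom Q (E := E) (E' := E')) :=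
  fun _ _ h => funext fun n => funext fun i =>
    Q.pull_injective ((E.part i.1).toPullbackHom Q (E'.part i.2)) (congrFun (congrFun h n) i)

theorem pullbackHom_mem {n : ℤ} {α : RawForms (E.hom E')} (hα : α ∈ homForms E E' n) :
    pullbackHom Q α ∈ homForms (E.pullback Q) (E'.pullback Q) n :=
  ⟨fun p i => Q.smoothForm_pull ((E.part i.1).toPullbackHom Q (E'.part i.2)) (fun p₀ =>
    ⟨fun _ => ContinuousLinearMap.id ℝ _, contMDiffAt_const,
      (E.part i.1).tr_toPullbackHom Q (E'.part i.2) p₀⟩) (hα.1 p i),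
  fun p i hp => (congrArg (Q.pull ((E.part i.1).toPullbackHom Q (E'.part i.2))) (hα.2 p i hp)).trans
    (Q.pull_zero _)⟩

theorem homWedge_pullbackHom (α : RawForms (E.hom E')) (η : RawForms E.part) :
    homWedge (pullbackHom Q α) (pullbackForms Q η) = pullbackForms Q (homWedge α η) :=
  funext fun n => funext fun q' => funext fun p => homWedge_natural
    (mfderiv 𝓘(ℝ, EP) 𝓘(ℝ, EX) Q.proj p) (fun q => (E.part q).toPullback Q p)
    (fun q => (E'.part q).toPullback Q p) (F := E.pullback Q) (F' := E'.pullback Q) rfl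
    (α := α) (α' := pullbackHom Q α) (η := η) (η' := pullbackForms Q η)
    (fun _ _ _ => rfl) (fun _ _ => rfl) n q'

theorem homComp_pullbackHom (ψ : RawForms (E'.hom E'')) (α : RawForms (E.hom E')) :
    pullbackHom Q (homComp ψ α) = homComp (pullbackHom Q ψ) (pullbackHom Q α) :=
  funext fun n => funext fun i => funext fun p => (homComp_natural
    (mfderiv 𝓘(ℝ, EP) 𝓘(ℝ, EX) Q.proj p) (fun q => (E.part q).toPullback Q p)
    (fun q => (E'.part q).toPullback Q p) (fun q => (E''.part q).toPullback Q p)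
    (F := E.pullback Q) (F' := E'.pullback Q) (F'' := E''.pullback Q) rfl
    (ψ := ψ) (ψ' := pullbackHom Q ψ) (α := α) (α' := pullbackHom Q α)
    (fun _ _ _ => rfl) (fun _ _ _ => rfl) n i.1 i.2).symm

theorem homOne_pullbackHom : pullbackHom Q (homOne E) = homOne (E.pullback Q) :=
  funext fun n => funext fun i => funext fun p => (homOne_natural
    (mfderiv 𝓘(ℝ, EP) 𝓘(ℝ, EX) Q.proj p) (fun q => (E.part q).toPullback Q p)
    (F := E.pullback Q) n i.1 i.2).symm

variable [T2Space X] [T2Space P]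

theorem isDifferential_of_pullback {F : GradedBundle.{v} EP P}
    {D : Omega (E.pullback Q).part →ₗ[ℝ] Omega (E.pullback Q).part}
    {D' : Omega F.part →ₗ[ℝ] Omega F.part} (hD : IsSuperconnection (E.pullback Q) D)
    (hD' : IsSuperconnection F D') {n : ℤ} {α β : RawForms ((E.pullback Q).hom F)}
    (hα : α ∈ homForms (E.pullback Q) F n) (hβ : β ∈ homForms (E.pullback Q) F (n + 1))
    (h : ∀ ζ : Omega E.part, D' (mulH α hα.1 (pullbackΩ Q ζ)) =
      mulH β hβ.1 (pullbackΩ Q ζ) + (-1 : ℝ) ^ n • mulH α hα.1 (D (pullbackΩ Q ζ))) :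
    IsDifferential D D' n α β :=
  isDifferential_of_defect hα.1 hβ.1 fun η => ext_pullback Q (defect D D' n hα.1 hβ.1)
    (fun k => (-1 : ℝ) ^ ((n + 1) * (k : ℤ))) (by simp)
    (fun _ _ hσ η => defect_mulS hD hD' hα hβ hσ η)
    (fun ζ => congrArg Subtype.val (sub_eq_zero.2 (sub_eq_iff_eq_add.2 (h ζ)))) η

theorem isDifferential_pullbackHom {A B : LocalSystem.{v} EX X}
    {D : Omega (A.E.pullback Q).part →ₗ[ℝ] Omega (A.E.pullback Q).part}
    {D' : Omega (B.E.pullback Q).part →ₗ[ℝ] Omega (B.E.pullback Q).part}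
    (hD : IsPullbackSuperconnection Q A D) (hD' : IsPullbackSuperconnection Q B D') {n : ℤ}
    {α β : RawForms (A.E.hom B.E)} (hα : α ∈ homForms A.E B.E n)
    (hβ : β ∈ homForms A.E B.E (n + 1)) (h : IsDifferential A.D B.D n α β) :
    IsDifferential D D' n (pullbackHom Q α) (pullbackHom Q β) := by
  have hα' := pullbackHom_mem Q hα
  have hβ' := pullbackHom_mem Q hβ
  refine isDifferential_of_pullback Q hD.superconnection hD'.superconnection hα' hβ' fun ζ => ?_
  have hα2 : ∀ ζ : Omega A.E.part, mulH (pullbackHom Q α) hα'.1 (pullbackΩ Q ζ) =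
      pullbackΩ Q (mulH α hα.1 ζ) :=
    fun ζ => Subtype.ext (homWedge_pullbackHom Q α (ζ : RawForms A.E.part))
  have hβ2 : mulH (pullbackHom Q β) hβ'.1 (pullbackΩ Q ζ) = pullbackΩ Q (mulH β hβ.1 ζ) :=
    Subtype.ext (homWedge_pullbackHom Q β (ζ : RawForms A.E.part))
  rw [hα2, hβ2, hD.apply_pullbackΩ, hD'.apply_pullbackΩ, hα2, (isDifferential_iff hα.1 hβ.1).1 h ζ]
  exact map_map_add_smul LinearMap.id (pullbackΩ Q) _ _ _

variable [PreconnectedSpace G]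

theorem pullbackHom_mem_basicForms (h : HasPullbacks.{v} Q) {A B : LocalSystem.{v} EX X} {n : ℤ}
    {α : RawForms (A.E.hom B.E)} (hα : α ∈ homForms A.E B.E n) :
    pullbackHom Q α ∈ basicForms Q (pullbackSystem Q h A) (pullbackSystem Q h B) n :=
  Q.mem_basicForms_iff.2 ⟨pullbackHom_mem Q hα, fun x => funext fun r => funext fun i =>
    Q.contrF_pull ((A.E.part i.1).toPullbackHom Q (B.E.part i.2)) x (α (r + 1) i),
    fun g => funext fun r => funext fun i =>
      Q.actF_pull ((A.E.part i.1).toPullbackHom Q (B.E.part i.2))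
        (homAct_pullbackAction Q (A.E.part i.1) (B.E.part i.2)) g (α r i)⟩

theorem exists_pullbackHom_eq (h : HasPullbacks.{v} Q) {A B : LocalSystem.{v} EX X} {n : ℤ}
    {φ : RawForms ((A.E.pullback Q).hom (B.E.pullback Q))}
    (hφ : φ ∈ basicForms Q (pullbackSystem Q h A) (pullbackSystem Q h B) n) :
    ∃ α ∈ homForms A.E B.E n, pullbackHom Q α = φ := by
  obtain ⟨hφ, hi, hinv⟩ := Q.mem_basicForms_iff.1 hφ
  have key : ∀ (r : ℕ) (i : ℤ × ℤ), Q.pull ((A.E.part i.1).toPullbackHom Q (B.E.part i.2))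
      (Q.desc (A' := ((A.E.part i.1).pullback Q).hom ((B.E.part i.2).pullback Q))
        ((A.E.part i.1).toPullbackHom Q (B.E.part i.2)) (φ r i)) = φ r i := fun r i =>
    Q.pull_desc ((A.E.part i.1).toPullbackHom Q (B.E.part i.2))
      (homAct_pullbackAction Q (A.E.part i.1) (B.E.part i.2))
      (fun x p => by
        cases r with
        | zero => rfl
        | succ r => exact congrFun (congrFun (congrFun (hi x) r) i) p)
      (fun g => congrFun (congrFun (hinv g) r) i)
  refine ⟨fun r i => Q.desc (A := (A.E.part i.1).hom (B.E.part i.2))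
      (A' := ((A.E.part i.1).pullback Q).hom ((B.E.part i.2).pullback Q))
      ((A.E.part i.1).toPullbackHom Q (B.E.part i.2)) (φ r i),
    ⟨fun r i => Q.smoothForm_desc _ (fun p₀ => ⟨fun _ => ContinuousLinearMap.id ℝ _,
      contMDiffAt_const, ?_⟩) (hφ.1 r i) (key r i), fun r i hr => ?_⟩,
    funext fun r => funext fun i => key r i⟩
  · filter_upwards [(A.E.part i.1).tr_toPullbackHom Q (B.E.part i.2) p₀] with p hp f
    exact (hp _).symm
  · refine Q.pull_injective ((A.E.part i.1).toPullbackHom Q (B.E.part i.2)) ?_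
    refine (key r i).trans ((hφ.2 r i hr).trans ?_)
    exact (Q.pull_zero ((A.E.part i.1).toPullbackHom Q (B.E.part i.2))).symm

variable (hX : LocHasDifferentials.{v} EX X) (hP : BasHasDifferentials.{v} Q)
  (h : HasPullbacks.{v} Q)

theorem isDGFunctor_pullbackFunctor : (pullbackFunctor Q hX hP h).IsDGFunctor where
  map_mem A B n f hf := pullbackHom_mem_basicForms Q h hf
  map_add _ _ _ _ _ _ _ := rfl
  map_smul _ _ _ _ _ _ := rfl
  map_d A B n f hf := by
    have hd := dgOf_d_mem hX (A := A) (B := B) hf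
    refine (dgOf_d_eq hP (A := pullbackSystem Q h A) (B := pullbackSystem Q h B)
      (pullbackHom_mem_basicForms Q h hf) ?_).symm
    exact isDifferential_pullbackHom Q (h.existsUnique A).choose_spec.1
      (h.existsUnique B).choose_spec.1 hf hd.1 hd.2
  map_one A := homOne_pullbackHom Q
  map_comp _ _ _ _ _ ψ _ α _ := homComp_pullbackHom Q ψ α

theorem bijOn_pullbackFunctor (A B : LocalSystem.{v} EX X) (n : ℤ) :
    Set.BijOn (pullbackHom Q) (homForms A.E B.E n)
      (basicForms Q (pullbackSystem Q h A) (pullbackSystem Q h B) n) :=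
  ⟨fun _ => pullbackHom_mem_basicForms Q h, (pullbackHom_injective Q).injOn,
    fun _ hφ => exists_pullbackHom_eq Q h hφ⟩

end PullbackHom

variable {Q}

section DescendBundle

theorem VBundle.trs_tr_total (A : VBundle.{v} EX X) {x₀ y : X}
    (hy : y ∈ A.nb x₀) (e : TotalSpace A.F A.fib) (h : e.1 = y) :
    (⟨y, A.trs x₀ y (A.tr x₀ e.1 e.2)⟩ : TotalSpace A.F A.fib) = e := by
  subst h
  rw [A.trs_tr hy]

theorem PrincipalBundle.LocalSection.fac_s (τ : Q.LocalSection) {x : X} (hx : x ∈ τ.dom) :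
    τ.fac (τ.s x) = 1 := by
  have hx' : Q.proj (τ.s x) ∈ τ.dom := by rwa [τ.proj_s x hx]
  have h1 := τ.act_fac _ hx'
  rw [τ.proj_s x hx] at h1
  have h2 := τ.fac_act (τ.s x) (τ.fac (τ.s x)) hx'
  rw [h1] at h2
  exact (mul_eq_left (a := τ.fac (τ.s x))).1 h2.symm

theorem PrincipalBundle.LocalSection.fac_mul_fac (τ τ' : Q.LocalSection) {p : P}
    (h : Q.proj p ∈ τ.dom) (h' : Q.proj p ∈ τ'.dom) :
    τ.fac (τ'.s (Q.proj p)) * τ'.fac p = τ.fac p := by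
  rw [← τ.fac_act _ _ (by rwa [τ'.proj_s _ h']), τ'.act_fac p h']

theorem PrincipalBundle.LocalSection.act_fac_s (τ τ' : Q.LocalSection) {x : X} (h : x ∈ τ.dom)
    (h' : x ∈ τ'.dom) : Q.act (τ.s x) (τ.fac (τ'.s x)) = τ'.s x := by
  have := τ.act_fac (τ'.s x) (by rwa [τ'.proj_s x h'])
  rwa [τ'.proj_s x h'] at this

variable {A : VBundle.{v} EP P} {ρ : Q.FibreAction A}

/-- The action on the total space. -/
def PrincipalBundle.actTotal (ρ : Q.FibreAction A) (g : G) (e : TotalSpace A.F A.fib) :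
    TotalSpace A.F A.fib := ⟨Q.act e.1 g, ρ g e.1 e.2⟩

theorem PrincipalBundle.IsAction.actTotal_mul (hρ : Q.IsAction ρ) (g h : G)
    (e : TotalSpace A.F A.fib) :
    actTotal ρ (g * h) e = actTotal ρ h (actTotal ρ g e) := hρ.mul g h e.1 e.2

/-- The set on which the descended bundle is trivialized with the section at `i`. -/
def PrincipalBundle.descSet (Q : PrincipalBundle EG G EP P EX X) (A : VBundle.{v} EP P) (i : X) :
    Set X := {x ∈ (Q.sec i).dom | (Q.sec i).s x ∈ A.nb ((Q.sec i).s i)}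

/-- The vector of `A` over the section at `i` with given coordinates. -/
def PrincipalBundle.descLift (Q : PrincipalBundle EG G EP P EX X) (A : VBundle.{v} EP P) (i x : X)
    (a : A.F) : TotalSpace A.F A.fib :=
  ⟨(Q.sec i).s x, A.trs ((Q.sec i).s i) ((Q.sec i).s x) a⟩

theorem PrincipalBundle.descLift_injective {i x : X} (hx : x ∈ Q.descSet A i) :
    Function.Injective (Q.descLift A i x) := fun a b h => by
  rw [← A.tr_trs hx.2 a, VBundle.eq_of_total h, A.tr_trs hx.2]

/-- The changes of coordinates of the descended bundle. -/
def PrincipalBundle.descChange (ρ : Q.FibreAction A) (i j x : X) : A.F →L[ℝ] A.F :=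
  (A.tr ((Q.sec j).s j) (Q.act ((Q.sec i).s x) ((Q.sec i).fac ((Q.sec j).s x)))).comp
    ((ρ ((Q.sec i).fac ((Q.sec j).s x)) ((Q.sec i).s x) : A.fib _ →L[ℝ] A.fib _).comp
      (A.trs ((Q.sec i).s i) ((Q.sec i).s x)))

theorem PrincipalBundle.descLift_descChange {i j x : X} (hi : x ∈ Q.descSet A i)
    (hj : x ∈ Q.descSet A j) (a : A.F) : Q.descLift A j x (descChange ρ i j x a) =
      actTotal ρ ((Q.sec i).fac ((Q.sec j).s x)) (Q.descLift A i x a) :=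
  A.trs_tr_total hj.2 (actTotal ρ ((Q.sec i).fac ((Q.sec j).s x)) (Q.descLift A i x a))
    ((Q.sec i).act_fac_s (Q.sec j) hi.1 hj.1)

theorem PrincipalBundle.isOpen_descSet (A : VBundle.{v} EP P) (i : X) : IsOpen (Q.descSet A i) :=
  ContinuousOn.isOpen_inter_preimage
    (fun y hy => ((Q.sec i).smooth_s y hy).continuousAt.continuousWithinAt) (Q.sec i).isOpen_dom
    (A.isOpen_nb _)

theorem PrincipalBundle.mem_descSet (A : VBundle.{v} EP P) (i : X) : i ∈ Q.descSet A i :=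
  ⟨Q.mem_sec i, A.mem_nb _⟩

theorem PrincipalBundle.IsAction.contMDiffOn_descChange (hρ : Q.IsAction ρ) (i j : X) :
    ContMDiffOn 𝓘(ℝ, EX) 𝓘(ℝ, A.F →L[ℝ] A.F) ∞ (descChange ρ i j)
      (Q.descSet A i ∩ Q.descSet A j) := fun x hx => by
  have hj : Q.proj ((Q.sec j).s x) ∈ (Q.sec i).dom := by
    rw [(Q.sec j).proj_s x hx.2.1]; exact hx.1.1
  refine ContMDiffAt.contMDiffWithinAt ?_
  refine hρ.contMDiffAt_act Q (a := (Q.sec i).s) (γ := fun x => (Q.sec i).fac ((Q.sec j).s x))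
    ((Q.sec i).smooth_s x hx.1.1)
    (((Q.sec i).smooth_fac _ hj).comp x ((Q.sec j).smooth_s x hx.2.1)) hx.1.2 ?_
  rw [(Q.sec i).act_fac_s (Q.sec j) hx.1.1 hx.2.1]
  exact hx.2.2

/-- The vector bundle core of the descended bundle. -/
def PrincipalBundle.IsAction.core (hρ : Q.IsAction ρ) : VectorBundleCore ℝ X A.F X where
  baseSet := Q.descSet A
  isOpen_baseSet := isOpen_descSet A
  indexAt x := x
  mem_baseSet_at := mem_descSet A
  coordChange := descChange ρ
  coordChange_self i x hx a := descLift_injective hx <| by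
    rw [descLift_descChange hx hx, (Q.sec i).fac_s hx.1]
    exact hρ.one _ _
  continuousOn_coordChange i j := (hρ.contMDiffOn_descChange i j).continuousOn
  coordChange_comp i j k x hx a := descLift_injective hx.2 <| by
    rw [descLift_descChange hx.1.2 hx.2, descLift_descChange hx.1.1 hx.1.2,
      descLift_descChange hx.1.1 hx.2, ← hρ.actTotal_mul]
    have hk := (Q.sec k).proj_s x hx.2.1
    have := (Q.sec i).fac_mul_fac (Q.sec j) (p := (Q.sec k).s x) (by rw [hk]; exact hx.1.1.1)
      (by rw [hk]; exact hx.1.2.1)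
    rw [hk] at this
    rw [this]

instance (hρ : Q.IsAction ρ) : hρ.core.IsContMDiff 𝓘(ℝ, EX) ∞ := ⟨hρ.contMDiffOn_descChange⟩

/-- The bundle on `X` obtained from a `G`-equivariant bundle on `P`. -/
def PrincipalBundle.IsAction.bundle (hρ : Q.IsAction ρ) : VBundle.{v} EX X where
  F := A.F
  fib := hρ.core.Fiber
  topAddFib _ := inferInstanceAs (IsTopologicalAddGroup A.F)
  topSMulFib _ := inferInstanceAs (ContinuousSMul ℝ A.F)

theorem PrincipalBundle.IsAction.bundle_tr (hρ : Q.IsAction ρ) {x₀ x : X}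
    (hx : x ∈ Q.descSet A x₀) (a : hρ.bundle.fib x) :
    hρ.bundle.tr x₀ x a = descChange ρ x x₀ x a :=
  hρ.bundle.tr_eq hx a

/-- The identification of the descended bundle with `A`. -/
def PrincipalBundle.IsAction.iso (hρ : Q.IsAction ρ) (p : P) :
    hρ.bundle.fib (Q.proj p) ≃L[ℝ] A.fib p :=
  ((((trivializationAt A.F A.fib ((Q.sec (Q.proj p)).s (Q.proj p))).continuousLinearEquivAt ℝ
    ((Q.sec (Q.proj p)).s (Q.proj p)) (A.mem_nb _)).symm.trans
      (ρ ((Q.sec (Q.proj p)).fac p) ((Q.sec (Q.proj p)).s (Q.proj p)))).trans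
        (A.congrFib ((Q.sec (Q.proj p)).act_fac p (Q.mem_sec _))) :)

theorem PrincipalBundle.IsAction.iso_total (hρ : Q.IsAction ρ) {j : X} {p : P}
    (hj : Q.proj p ∈ Q.descSet A j) (a : hρ.bundle.fib (Q.proj p)) :
    (⟨p, hρ.iso p a⟩ : TotalSpace A.F A.fib) = actTotal ρ ((Q.sec j).fac p)
      (Q.descLift A j (Q.proj p) (hρ.bundle.tr j (Q.proj p) a)) := by
  have key := congrArg (actTotal ρ ((Q.sec j).fac p))
    ((congrArg (Q.descLift A j (Q.proj p)) (hρ.bundle_tr hj a)).trans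
      (descLift_descChange (mem_descSet A _) hj a))
  rw [← hρ.actTotal_mul, (Q.sec (Q.proj p)).fac_mul_fac (Q.sec j) (Q.mem_sec _) hj.1] at key
  refine Eq.trans ?_ key.symm
  refine (A.congrFib_total ((Q.sec (Q.proj p)).act_fac p (Q.mem_sec _)) _).trans ?_
  refine congrArg (fun b => actTotal ρ ((Q.sec (Q.proj p)).fac p)
    (⟨(Q.sec (Q.proj p)).s (Q.proj p), b⟩ : TotalSpace A.F A.fib)) ?_
  refine (ContinuousLinearEquiv.symm_apply_eq _).2 ?_
  exact (A.tr_trs (A.mem_nb _) a).symm.trans (A.tr_eq (A.mem_nb _) _)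

theorem PrincipalBundle.IsAction.act_iso (hρ : Q.IsAction ρ) (g : G) (p : P)
    (a : hρ.bundle.fib (Q.proj p)) : ρ g p (hρ.iso p a) =
      hρ.iso (Q.act p g) (hρ.bundle.congrFib (Q.proj_act p g).symm a) := by
  have hj : Q.proj (Q.act p g) ∈ Q.descSet A (Q.proj p) := by
    rw [Q.proj_act]; exact mem_descSet A _
  apply VBundle.eq_of_total
  rw [hρ.iso_total hj, (Q.sec (Q.proj p)).fac_act p g (Q.mem_sec _), hρ.actTotal_mul,
    hρ.bundle.tr_congrFib rfl, Q.proj_act]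
  exact congrArg (actTotal ρ g) (hρ.iso_total (mem_descSet A (Q.proj p)) a)

/-- `hρ.iso` in coordinates. -/
def PrincipalBundle.IsAction.isoCoord (_ : Q.IsAction ρ) (p₀ p : P) : A.F →L[ℝ] A.F :=
  let τ := Q.sec (Q.proj p₀)
  (A.tr p₀ (Q.act (τ.s (Q.proj p)) (τ.fac p))).comp
    ((ρ (τ.fac p) (τ.s (Q.proj p)) : A.fib _ →L[ℝ] A.fib _).comp
      (A.trs (τ.s (Q.proj p₀)) (τ.s (Q.proj p))))

theorem PrincipalBundle.IsAction.tr_iso (hρ : Q.IsAction ρ) {p₀ p : P}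
    (hj : Q.proj p ∈ Q.descSet A (Q.proj p₀)) (a : hρ.bundle.fib (Q.proj p)) :
    A.tr p₀ p (hρ.iso p a) = hρ.isoCoord p₀ p (hρ.bundle.tr (Q.proj p₀) (Q.proj p) a) :=
  congrArg (fun e : TotalSpace A.F A.fib => A.tr p₀ e.1 e.2) (hρ.iso_total hj a)

theorem PrincipalBundle.eventually_descSet (p₀ : P) :
    ∀ᶠ p in nhds p₀, Q.proj p ∈ Q.descSet A (Q.proj p₀) :=
  Q.proj.contMDiff.continuous.continuousAt.preimage_mem_nhds
    ((isOpen_descSet A _).mem_nhds (mem_descSet A _))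

theorem PrincipalBundle.IsAction.exists_tr_iso (hρ : Q.IsAction ρ) (p₀ : P) :
    ∃ K : P → hρ.bundle.F →L[ℝ] A.F, ContMDiffAt 𝓘(ℝ, EP) 𝓘(ℝ, hρ.bundle.F →L[ℝ] A.F) ∞ K p₀ ∧
      ∀ᶠ p in nhds p₀, ∀ a, A.tr p₀ p (hρ.iso p a) =
        K p (hρ.bundle.tr (Q.proj p₀) (Q.proj p) a) := by
  refine ⟨hρ.isoCoord p₀, ?_, Q.eventually_descSet p₀ |>.mono fun p hp => hρ.tr_iso hp⟩
  have h₀ := Q.mem_sec (Q.proj p₀)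
  refine hρ.contMDiffAt_act Q (a := fun p => (Q.sec (Q.proj p₀)).s (Q.proj p))
    (((Q.sec (Q.proj p₀)).smooth_s _ h₀).comp p₀ Q.proj.contMDiff.contMDiffAt)
    ((Q.sec (Q.proj p₀)).smooth_fac p₀ h₀) (A.mem_nb _) ?_
  rw [(Q.sec (Q.proj p₀)).act_fac p₀ h₀]
  exact A.mem_nb p₀

theorem PrincipalBundle.IsAction.exists_tr_iso_symm (hρ : Q.IsAction ρ)
    (p₀ : P) : ∃ K : P → A.F →L[ℝ] hρ.bundle.F,
      ContMDiffAt 𝓘(ℝ, EP) 𝓘(ℝ, A.F →L[ℝ] hρ.bundle.F) ∞ K p₀ ∧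
      ∀ᶠ p in nhds p₀, ∀ b, hρ.bundle.tr (Q.proj p₀) (Q.proj p) ((hρ.iso p).symm b) =
        K p (A.tr p₀ p b) := by
  have h₀ := Q.mem_sec (Q.proj p₀)
  have h₁ := (Q.sec (Q.proj p₀)).act_fac p₀ h₀
  refine ⟨_, hρ.contMDiffAt_symm Q (a := fun p => (Q.sec (Q.proj p₀)).s (Q.proj p))
    (((Q.sec (Q.proj p₀)).smooth_s _ h₀).comp p₀ Q.proj.contMDiff.contMDiffAt)
    ((Q.sec (Q.proj p₀)).smooth_fac p₀ h₀) (A.mem_nb ((Q.sec (Q.proj p₀)).s (Q.proj p₀)))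
    (p₂ := p₀) (by rw [h₁]; exact A.mem_nb p₀), ?_⟩
  filter_upwards [Q.eventually_descSet p₀, (A.isOpen_nb p₀).mem_nhds (A.mem_nb p₀)] with p hp hp' b
  obtain ⟨a, rfl⟩ := (hρ.iso p).surjective b
  rw [ContinuousLinearEquiv.symm_apply_apply, hρ.tr_iso hp]
  set w := hρ.bundle.tr (Q.proj p₀) (Q.proj p) a
  have h₂ := (Q.sec (Q.proj p₀)).act_fac p hp.1
  refine (A.tr_trs hp.2 w).symm.trans (congrArg (A.tr _ _) ?_)
  refine (ContinuousLinearEquiv.eq_symm_apply _).2 ?_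
  exact (A.trs_tr (by rw [h₂]; exact hp') _).symm

end DescendBundle

section IsoForms

/-- The family `c` of linear maps between the fibres is smooth. -/
def SmoothFamily {A B : VBundle.{v} EX X} (c : ∀ x, A.fib x →L[ℝ] B.fib x) : Prop :=
  ∀ x₀, ∃ K : X → A.F →L[ℝ] B.F, ContMDiffAt 𝓘(ℝ, EX) 𝓘(ℝ, A.F →L[ℝ] B.F) ∞ K x₀ ∧
    ∀ᶠ x in nhds x₀, ∀ a, B.tr x₀ x (c x a) = K x (A.tr x₀ x a)

variable {E E' : GradedBundle.{v} EX X} {c : ∀ k x, (E.part k).fib x ≃L[ℝ] (E'.part k).fib x}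
  (hc : ∀ k, SmoothFamily fun x => (c k x : (E.part k).fib x →L[ℝ] (E'.part k).fib x))

/-- The operator on smooth forms which applies `c` to the values. -/
def mapΩ : Omega E.part →ₗ[ℝ] Omega E'.part where
  toFun η := ⟨fun n k => mapVal (fun x => (c k x : (E.part k).fib x →L[ℝ] (E'.part k).fib x))
    ((η : RawForms E.part) n k), fun n k => smoothForm_of_at fun x₀ => by
      obtain ⟨K, hK, h⟩ := hc k x₀
      exact ((η.2 n k).at x₀).mapVal hK h⟩
  map_add' _ _ := Subtype.ext <| funext fun _ => funext fun k => funext fun x =>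
    ContinuousAlternatingMap.ext fun _ => map_add (c k x) _ _
  map_smul' _ _ := Subtype.ext <| funext fun _ => funext fun k => funext fun x =>
    ContinuousAlternatingMap.ext fun _ => map_smul (c k x) _ _

theorem isTensorial_mapΩ : IsTensorial 0 (mapΩ hc) where
  degree n η hη p i h := by
    rw [add_zero] at h
    refine (congrArg (mapVal fun x => (c i x : (E.part i).fib x →L[ℝ] (E'.part i).fib x))
      (hη p i h)).trans ?_
    exact funext fun x => ContinuousAlternatingMap.ext fun _ => map_zero (c i x)
  mul k σ hσ η := by
    rw [zero_mul, zpow_zero, one_smul]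
    exact Subtype.ext <| funext fun n => funext fun i => funext fun x =>
      (scalarWedge_natural (ContinuousLinearMap.id ℝ (TangentSpace 𝓘(ℝ, EX) x)) (fun i => c i x)
        (V := E.part) (V' := E'.part) (σ := σ) (σ' := σ) (η := η) (η' := mapΩ hc η)
        rfl (fun _ _ => rfl) n i).symm

variable [T2Space X]

/-- The form `c`, of partial degree `0`. -/
def isoForm : RawForms (E.hom E') := repr (mapΩ hc)

theorem isoForm_mem : isoForm hc ∈ homForms E E' 0 :=
  ⟨smooth_repr (isTensorial_mapΩ hc), isHomogeneous_repr (isTensorial_mapΩ hc)⟩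

theorem homWedge_isoForm (η : Omega E.part) :
    homWedge (isoForm hc) (η : RawForms E.part) = (mapΩ hc η : RawForms E'.part) :=
  homWedge_repr (isTensorial_mapΩ hc) η

theorem mulH_isoForm (η : Omega E.part) : mulH (isoForm hc) (isoForm_mem hc).1 η = mapΩ hc η :=
  Subtype.ext (homWedge_isoForm hc η)

theorem homComp_eq_one {f : RawForms (E.hom E')} {g : RawForms (E'.hom E)}
    (h : ∀ η ∈ Omega E.part, homWedge g (homWedge f η) = η) : homComp g f = homOne E :=
  homForms_ext fun η hη => by rw [homWedge_homComp, h η hη, homWedge_homOne]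

theorem IsDifferential.inv {D : Omega E.part →ₗ[ℝ] Omega E.part}
    {D' : Omega E'.part →ₗ[ℝ] Omega E'.part} {f : RawForms (E.hom E')} {g : RawForms (E'.hom E)}
    (hf : f ∈ Omega (E.hom E')) (hg : g ∈ Omega (E'.hom E))
    (h₁ : ∀ η, mulH g hg (mulH f hf η) = η) (h₂ : ∀ η, mulH f hf (mulH g hg η) = η)
    (h : IsDifferential D D' 0 f 0) : IsDifferential D' D 0 g 0 := by
  have h' := (isDifferential_iff hf (Omega (E.hom E')).zero_mem).1 h
  refine (isDifferential_iff hg (Omega (E'.hom E)).zero_mem).2 fun η => ?_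
  have key := congrArg (mulH g hg) (h' (mulH g hg η))
  rw [mulH_zero, zero_add, zpow_zero, one_smul, h₁, h₂] at key
  rw [mulH_zero, zero_add, zpow_zero, one_smul, key]

end IsoForms

section Descend

section

variable {F F' : GradedBundle.{v} EP P} {c : ∀ k p, (F.part k).fib p ≃L[ℝ] (F'.part k).fib p}
  (hc : ∀ k, SmoothFamily fun p => (c k p : (F.part k).fib p →L[ℝ] (F'.part k).fib p))
  {ρ : ∀ k, Q.FibreAction (F.part k)} {ρ' : ∀ k, Q.FibreAction (F'.part k)} [T2Space P]

theorem isoForm_mem_basic (hρ : ∀ k, Q.IsAction (ρ k))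
    (h : ∀ k g p a, ρ' k g p (c k p a) = c k (Q.act p g) (ρ k g p a)) :
    (∀ x, Q.contraction x (isoForm hc) = 0) ∧
      ∀ g, Q.actForms (Q.homAction ρ ρ') g (isoForm hc) = isoForm hc := by
  refine ⟨fun x => homForms_ext fun η hη => ?_, fun g => homForms_ext fun η hη => ?_⟩
  · have h1 := Q.contraction_homWedge x (isoForm_mem hc).2 η
    rw [zpow_zero, one_smul, homWedge_isoForm hc ⟨η, hη⟩] at h1
    rw [homWedge_zero_left]
    exact right_eq_add.1 ((homWedge_isoForm hc (Q.contrΩ x ⟨η, hη⟩)).trans h1)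
  · set ζ := Q.actΩ hρ g⁻¹ ⟨η, hη⟩ with hζ
    have h1 : Q.actForms ρ g (ζ : RawForms F.part) = η := Q.actForms_inv hρ g η
    have h2 := Q.actForms_homWedge ρ ρ' g (isoForm hc) ζ
    rw [h1, homWedge_isoForm] at h2
    refine h2.symm.trans (Eq.trans ?_ (homWedge_isoForm hc ⟨η, hη⟩).symm)
    funext r k p
    refine ContinuousAlternatingMap.ext fun v => ?_
    refine (ContinuousLinearEquiv.symm_apply_eq _).2 ?_
    refine Eq.trans ?_ (h k g p _).symm
    refine congrArg (c k (Q.act p g)) ?_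
    have h3 := congrArg (fun ξ : RawForms F.part => ξ r k p v) h1
    exact (ContinuousLinearEquiv.symm_apply_eq _).1 h3

end

variable {E : GradedBundle.{v} EP P} {ρ : ∀ k, Q.FibreAction (E.part k)}
  (hρ : ∀ k, Q.IsAction (ρ k))

/-- The graded bundle on `X` obtained from a `G`-equivariant graded bundle on `P`. -/
def descBundle : GradedBundle.{v} EX X where
  part k := (hρ k).bundle
  finite_support := E.finite_support

/-- The pullback of forms with values in the descended bundle. -/
def pullIso : Omega (descBundle hρ).part →ₗ[ℝ] Omega E.part where
  toFun η := ⟨fun n k => Q.pull (hρ k).iso ((η : RawForms (descBundle hρ).part) n k), fun n k =>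
    Q.smoothForm_pull (hρ k).iso (hρ k).exists_tr_iso (η.2 n k)⟩
  map_add' _ _ := Subtype.ext <| funext fun _ => funext fun k => Q.pull_add (hρ k).iso _ _
  map_smul' _ _ := Subtype.ext <| funext fun _ => funext fun k => Q.pull_smul (hρ k).iso _ _

theorem pullIso_injective : Function.Injective (pullIso hρ) := fun _ _ h =>
  Subtype.ext <| funext fun n => funext fun k => Q.pull_injective (hρ k).iso
    (congrFun (congrFun (congrArg Subtype.val h) n) k)

theorem contraction_pullIso (x : GroupLieAlgebra 𝓘(ℝ, EG) G) (η : Omega (descBundle hρ).part) :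
    Q.contraction x (pullIso hρ η : RawForms E.part) = 0 :=
  funext fun r => funext fun k => Q.contrF_pull (hρ k).iso x
    ((η : RawForms (descBundle hρ).part) (r + 1) k)

theorem actForms_pullIso (g : G) (η : Omega (descBundle hρ).part) :
    Q.actForms ρ g (pullIso hρ η : RawForms E.part) = pullIso hρ η :=
  funext fun r => funext fun k => Q.actF_pull (hρ k).iso (hρ k).act_iso g
    ((η : RawForms (descBundle hρ).part) r k)

theorem exists_pullIso_eq (φ : Omega E.part)
    (hi : ∀ x, Q.contraction x (φ : RawForms E.part) = 0)
    (hg : ∀ g, Q.actForms ρ g (φ : RawForms E.part) = φ) : ∃ ζ, pullIso hρ ζ = φ := by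
  have key : ∀ (r : ℕ) (k : ℤ), Q.pull (hρ k).iso
      (Q.desc (hρ k).iso ((φ : RawForms E.part) r k)) = (φ : RawForms E.part) r k := fun r k =>
    Q.pull_desc (hρ k).iso (hρ k).act_iso
      (fun x p => by
        cases r with
        | zero => rfl
        | succ r => exact congrFun (congrFun (congrFun (hi x) r) k) p)
      (fun g => congrFun (congrFun (hg g) r) k)
  exact ⟨⟨fun r k => Q.desc (hρ k).iso ((φ : RawForms E.part) r k), fun r k =>
    Q.smoothForm_desc (hρ k).iso (hρ k).exists_tr_iso_symm (φ.2 r k) (key r k)⟩,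
    Subtype.ext <| funext fun r => funext fun k => key r k⟩

theorem pullIso_mulS {k : ℕ} {σ : RawForm (VBundle.line EX X) k} (hσ : SmoothForm σ)
    (η : Omega (descBundle hρ).part) : pullIso hρ (mulS σ hσ η) =
      mulS (pullS EP Q.proj σ) (smoothForm_pullS_proj Q hσ) (pullIso hρ η) :=
  Subtype.ext <| funext fun n => funext fun i => funext fun p =>
    (scalarWedge_natural (mfderiv 𝓘(ℝ, EP) 𝓘(ℝ, EX) Q.proj p) (fun i => (hρ i).iso p)
      (V := (descBundle hρ).part) (V' := E.part) (σ := σ) (σ' := pullS EP Q.proj σ)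
      (η := η) (η' := pullIso hρ η) rfl (fun _ _ => rfl) n i).symm

theorem LinearMap.exists_factor {V W : Type*} [AddCommGroup V] [Module ℝ V] [AddCommGroup W]
    [Module ℝ W] {f : V →ₗ[ℝ] W} (hf : Function.Injective f) (T : V →ₗ[ℝ] W)
    (h : ∀ a, ∃ b, f b = T a) : ∃ S : V →ₗ[ℝ] V, ∀ a, f (S a) = T a := by
  choose S hS using h
  exact ⟨{ toFun := S
           map_add' := fun a b => hf (by rw [map_add, hS, hS, hS, map_add])
           map_smul' := fun c a => hf (by rw [RingHom.id_apply, map_smul, hS, hS, map_smul]) }, hS⟩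

variable {D : Omega E.part →ₗ[ℝ] Omega E.part}
  {D' : Omega (descBundle hρ).part →ₗ[ℝ] Omega (descBundle hρ).part}

theorem exists_descend [T2Space P] [PreconnectedSpace G] (hD : Q.IsBasicSuperconnection ρ D) :
    ∃ D' : Omega (descBundle hρ).part →ₗ[ℝ] Omega (descBundle hρ).part,
      ∀ ζ, pullIso hρ (D' ζ) = D (pullIso hρ ζ) := by
  refine LinearMap.exists_factor (pullIso_injective hρ) (D.comp (pullIso hρ)) fun ζ =>
    exists_pullIso_eq hρ _ (fun x => ?_) fun g => ?_
  · have h1 := hD.contrΩ Q x (pullIso hρ ζ)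
    rw [show Q.contrΩ x (pullIso hρ ζ) = 0 from Subtype.ext (contraction_pullIso hρ x ζ), map_zero,
      (((Q.isBasicForm_iff hρ (pullIso hρ ζ).2).2
        ⟨fun x => contraction_pullIso hρ x ζ, fun g => actForms_pullIso hρ g ζ⟩) x).2] at h1
    exact neg_eq_zero.1 ((zero_sub _).symm.trans h1.symm)
  · have h1 := hD.actΩ Q hρ g (pullIso hρ ζ)
    rw [show Q.actΩ hρ g (pullIso hρ ζ) = pullIso hρ ζ from
      Subtype.ext (actForms_pullIso hρ g ζ)] at h1
    exact (congrArg Subtype.val h1).symm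

theorem isFlat_descend (hD : IsFlat D) (h : ∀ ζ, pullIso hρ (D' ζ) = D (pullIso hρ ζ)) :
    IsFlat D' := fun ζ =>
  pullIso_injective hρ (by rw [h, h, hD, map_zero])

theorem isSuperconnection_descend (hD : IsSuperconnection E D)
    (h : ∀ ζ, pullIso hρ (D' ζ) = D (pullIso hρ ζ)) : IsSuperconnection (descBundle hρ) D' where
  degree n η hη p i hi := by
    refine Q.pull_injective (hρ i).iso (Eq.trans ?_ (Q.pull_zero (hρ i).iso).symm)
    refine (congrArg (fun φ : Omega E.part => (φ : RawForms E.part) p i) (h η)).trans ?_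
    refine hD.degree n _ (fun p i hi => ?_) p i hi
    exact (congrArg (Q.pull (hρ i).iso) (hη p i hi)).trans (Q.pull_zero (hρ i).iso)
  leibniz k σ hσ η := by
    refine ⟨(mulS σ hσ η).2, ?_⟩
    have key : D' (mulS σ hσ η) = mulS (extD σ) (smoothForm_extD hσ) η +
        (-1 : ℝ) ^ k • mulS σ hσ (D' η) := by
      refine pullIso_injective hρ ?_
      rw [map_add, map_smul, pullIso_mulS, pullIso_mulS, h, h, pullIso_mulS, hD.mulS]
      refine congrArg (· + _) (Subtype.ext ?_)
      exact congrArg (fun τ => scalarWedge τ (pullIso hρ η : RawForms E.part)) (extD_pullS_proj Q hσ)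
    exact congrArg Subtype.val key

end Descend

section EssentialSurjectivity

variable [T2Space P] [PreconnectedSpace G]

theorem isoForm_closed (hP : BasHasDifferentials.{v} Q) {A B : BasicLocalSystem.{v} Q}
    {c : ∀ k p, (A.E.part k).fib p ≃L[ℝ] (B.E.part k).fib p}
    (hc : ∀ k, SmoothFamily fun p => (c k p : (A.E.part k).fib p →L[ℝ] (B.E.part k).fib p))
    (h : ∀ k g p a, B.act k g p (c k p a) = c k (Q.act p g) (A.act k g p a))
    (hd : IsDifferential A.D B.D 0 (isoForm hc) 0) :
    isoForm hc ∈ (LocBas Q hP).Closed A B 0 :=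
  have hm : isoForm hc ∈ basicForms Q A B 0 :=
    Q.mem_basicForms_iff.2 ⟨isoForm_mem hc, isoForm_mem_basic hc A.isAction h⟩
  ⟨hm, dgOf_d_eq hP hm hd⟩

theorem iso_of_family (hP : BasHasDifferentials.{v} Q) {A B : BasicLocalSystem.{v} Q}
    {c : ∀ k p, (A.E.part k).fib p ≃L[ℝ] (B.E.part k).fib p}
    (hc : ∀ k, SmoothFamily fun p => (c k p : (A.E.part k).fib p →L[ℝ] (B.E.part k).fib p))
    (hc' : ∀ k, SmoothFamily fun p => ((c k p).symm : (B.E.part k).fib p →L[ℝ] (A.E.part k).fib p))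
    (h : ∀ k g p a, B.act k g p (c k p a) = c k (Q.act p g) (A.act k g p a))
    (hd : IsDifferential A.D B.D 0 (isoForm hc) 0) : (LocBas Q hP).Iso A B := by
  have h1 : ∀ η, mapΩ (c := fun k p => (c k p).symm) hc' (mapΩ hc η) = η := fun η =>
    Subtype.ext <| funext fun n => funext fun k => funext fun p =>
      ContinuousAlternatingMap.ext fun _ => (c k p).symm_apply_apply _
  have h2 : ∀ η, mapΩ hc (mapΩ (c := fun k p => (c k p).symm) hc' η) = η := fun η =>
    Subtype.ext <| funext fun n => funext fun k => funext fun p =>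
      ContinuousAlternatingMap.ext fun _ => (c k p).apply_symm_apply _
  refine ⟨isoForm hc, isoForm_closed hP hc h hd, isoForm (c := fun k p => (c k p).symm) hc',
    isoForm_closed hP hc' (fun k g p b => ?_) (hd.inv (isoForm_mem hc).1 (isoForm_mem hc').1
      (fun η => ?_) fun η => ?_), homComp_eq_one fun η hη => ?_, homComp_eq_one fun η hη => ?_⟩
  · obtain ⟨a, rfl⟩ := (c k p).surjective b
    rw [ContinuousLinearEquiv.eq_symm_apply, ← h, ContinuousLinearEquiv.symm_apply_apply]
  · rw [mulH_isoForm, mulH_isoForm, h1]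
  · rw [mulH_isoForm, mulH_isoForm, h2]
  · rw [homWedge_isoForm hc ⟨η, hη⟩, homWedge_isoForm, h1]
  · rw [homWedge_isoForm hc' ⟨η, hη⟩, homWedge_isoForm, h2]

theorem isDifferential_zero_of_pullback [T2Space X] {E : GradedBundle.{v} EX X}
    {F : GradedBundle.{v} EP P} {D : Omega (E.pullback Q).part →ₗ[ℝ] Omega (E.pullback Q).part}
    {D' : Omega F.part →ₗ[ℝ] Omega F.part} (hD : IsSuperconnection (E.pullback Q) D)
    (hD' : IsSuperconnection F D') {α : RawForms ((E.pullback Q).hom F)}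
    (hα : α ∈ homForms (E.pullback Q) F 0) (h : ∀ ζ : Omega E.part,
      D' (mulH α hα.1 (pullbackΩ Q ζ)) = mulH α hα.1 (D (pullbackΩ Q ζ))) :
    IsDifferential D D' 0 α 0 :=
  isDifferential_of_pullback Q hD hD' hα (homForms_zero_mem _ _ _) fun ζ => by
    rw [mulH_zero, zero_add, zpow_zero, one_smul, h]

theorem exists_pullbackSystem_iso [T2Space X] (hP : BasHasDifferentials.{v} Q)
    (h : HasPullbacks.{v} Q) (B : BasicLocalSystem.{v} Q) :
    ∃ A : LocalSystem.{v} EX X, (LocBas Q hP).Iso (pullbackSystem Q h A) B := by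
  obtain ⟨D', hD'⟩ := exists_descend B.isAction B.basic
  let A : LocalSystem.{v} EX X := ⟨descBundle B.isAction, D',
    isSuperconnection_descend B.isAction B.superconnection hD', isFlat_descend B.isAction B.flat hD'⟩
  have hA := (h.existsUnique A).choose_spec.1
  have hc : ∀ k, SmoothFamily (A := (A.E.pullback Q).part k) (B := B.E.part k)
      fun p => ((B.isAction k).iso p : (B.isAction k).bundle.fib (Q.proj p) →L[ℝ] (B.E.part k).fib p) :=
    fun k => (B.isAction k).exists_tr_iso
  have hc' : ∀ k, SmoothFamily (A := B.E.part k) (B := (A.E.pullback Q).part k) fun p =>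
      (((B.isAction k).iso p).symm : (B.E.part k).fib p →L[ℝ] (B.isAction k).bundle.fib (Q.proj p)) :=
    fun k => (B.isAction k).exists_tr_iso_symm
  refine ⟨A, iso_of_family hP (A := pullbackSystem Q h A) (c := fun k p => (B.isAction k).iso p) hc hc'
    (fun k => (B.isAction k).act_iso) ?_⟩
  have hm := isoForm_mem (E := A.E.pullback Q) (c := fun k p => (B.isAction k).iso p) hc
  refine isDifferential_zero_of_pullback hA.superconnection B.superconnection hm fun ζ => ?_
  have h1 : ∀ ζ : Omega A.E.part, mulH _ hm.1 (pullbackΩ Q ζ) = pullIso B.isAction ζ := fun ζ =>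
    mulH_isoForm hc (pullbackΩ Q ζ)
  have h2 := hA.apply_pullbackΩ ζ
  exact (congrArg B.D (h1 ζ)).trans <| (hD' ζ).symm.trans ((h1 (D' ζ)).symm.trans (congrArg (mulH _ hm.1) h2.symm))

end EssentialSurjectivity

end Pullbacks

end ChernWeil

end

theorem proposition3p4
    {EG : Type*} [NormedAddCommGroup EG] [NormedSpace ℝ EG] [FiniteDimensional ℝ EG]
    {G : Type*} [TopologicalSpace G] [ChartedSpace EG G] [Group G] [LieGroup 𝓘(ℝ, EG) ∞ G]
    [T2Space G] [SecondCountableTopology G] [ConnectedSpace G]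
    {EP : Type*} [NormedAddCommGroup EP] [NormedSpace ℝ EP] [FiniteDimensional ℝ EP]
    {P : Type*} [TopologicalSpace P] [ChartedSpace EP P] [IsManifold 𝓘(ℝ, EP) ∞ P]
    [T2Space P] [SecondCountableTopology P]
    {EX : Type*} [NormedAddCommGroup EX] [NormedSpace ℝ EX] [FiniteDimensional ℝ EX]
    {X : Type*} [TopologicalSpace X] [ChartedSpace EX X] [IsManifold 𝓘(ℝ, EX) ∞ X]
    [T2Space X] [SecondCountableTopology X]
    (Q : ChernWeil.PrincipalBundle EG G EP P EX X) :
    -- the differentials and the pullback functor are well defined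
    ∃ (hX : ChernWeil.LocHasDifferentials.{v} EX X) (hP : ChernWeil.BasHasDifferentials.{v} Q)
      (h : ChernWeil.HasPullbacks.{v} Q),
      (ChernWeil.Loc EX X hX).IsDGCategory ∧ (ChernWeil.LocBas Q hP).IsDGCategory ∧
      (ChernWeil.pullbackFunctor Q hX hP h).IsDGFunctor ∧
      -- the pullback functor is a quasi-equivalence
      (ChernWeil.pullbackFunctor Q hX hP h).IsQuasiEquivalence ∧
      -- it is an isomorphism on the complexes of morphisms
      (∀ (A B : (ChernWeil.Loc EX X hX).Obj) (n : ℤ),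
        Set.BijOn (ChernWeil.pullbackFunctor Q hX hP h).map
          ((ChernWeil.Loc EX X hX).Hom A B n)
          ((ChernWeil.LocBas Q hP).Hom ((ChernWeil.pullbackFunctor Q hX hP h).obj A)
            ((ChernWeil.pullbackFunctor Q hX hP h).obj B) n)) ∧
      -- it is essentially surjective up to closed isomorphisms of degree zero
      ∀ B : (ChernWeil.LocBas Q hP).Obj, ∃ A : (ChernWeil.Loc EX X hX).Obj,
        (ChernWeil.LocBas Q hP).Iso ((ChernWeil.pullbackFunctor Q hX hP h).obj A) B := by
  have hX : ChernWeil.LocHasDifferentials.{v} EX X := ChernWeil.locHasDifferentials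
  have hP : ChernWeil.BasHasDifferentials.{v} Q := Q.basHasDifferentials
  have h := ChernWeil.hasPullbacks.{v} Q
  have hF := ChernWeil.isDGFunctor_pullbackFunctor Q hX hP h
  have hL := ChernWeil.isDGCategory_loc hX
  have hB := Q.isDGCategory_locBas hP
  have hbij := ChernWeil.bijOn_pullbackFunctor Q h
  have hiso := ChernWeil.exists_pullbackSystem_iso hP h
  refine ⟨hX, hP, h, hL, hB, hF, ⟨?_, fun B => ?_⟩, hbij, hiso⟩
  · exact ChernWeil.DGFunctorData.quasiFullyFaithful_of_bijOn hL hB hF hbij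
  · obtain ⟨A, hA⟩ := hiso B
    exact ⟨A, ChernWeil.DGData.Iso.homotopyIso hB hA⟩
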